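/- **Setting.** Let $U\in C^1(\mathbb R)$ with $U'$ Lipschitz. Let $V:\mathbb R\setminus\{0\}\to\mathbb R$ be even, convex on $(0,\infty)$, with $V\in W^{3,1}_{\rm loc}(0,\infty)$, $V''\in L^\infty(1,\infty)$, and $V'\le 0$, $V''\ge 0$, $V'''\le 0$ on $(0,\infty)$. Assume $xV''(x)\to\infty$ as $x\downarrow 0$, and $|V'(x)|\le Cx^{-1-a}$ on $(0,1)$ for some $a>-1$, $C>0$. Assume moreover that one of the following holds: - ($m=1$) $V\in C^3((0,\infty))$ and $x\mapsto x^3\sup_{y\in(x,1)}|V'''(y)|$ is in $L^1(0,1)$; - ($m=2$) $V\in C^3((0,\infty))\cap W^{3,1}(1,\infty)$, $x\mapsto x^3\sup_{y>x}|V'''(y)|$ is in $L^1(0,\infty)$, and $x^4V'''(x)\to0$ as $x\downarrow0$; - ($m=3$) $V\in C^4((0,\infty))\cap W^{3,1}(1,\infty)$, $x\mapsto x^2V''(x)$ is in $L^1(0,1)$, $x\mapsto x^3\sup_{y>x}|V'''(y)|$ is in $L^1(1,\infty)$, and $\sup_{x>1}x^{k+1}|V^{(k)}(x)|<\infty$ for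 $k=3,4$. Let $n\ge2$, $\varepsilon=\frac1n$, $\alpha>0$, $V_\alpha(x)=\alpha V(\alpha x)$. Let $\mathcal Z_n$ be the set of $(\mathbf x,\mathbf b)\in\mathbb R^n\times\{-1,0,1\}^n$ with $x_i<x_j$ whenever $i<j$ and $b_ib_j\ne0$. Let $(\mathbf x^\circ,\mathbf b^\circ)\in\mathcal Z_n$ and $u_n^\circ(x)=\frac1n\sum_i b_i^\circ H(x-x_i^\circ)$, with $H$ the Heaviside function. Let $Q=(0,\infty)\times\mathbb R$, and let $u^*,u_*$ be the upper and lower semicontinuous envelopes of $u$ in all variables (extended to $t=0$ when $u$ is defined on $Q$). **The equation.** $(HJ_\varepsilon)$ is $v_t=(\mathcal M_\varepsilon[v]+U')|v_x|$ on $Q$, with $\mathcal M_\varepsilon[v](x)=\mathrm{pv}\int_{\mathbb R}E_\varepsilon[v(x+z)-v(x)]V_\alpha''(z)\,dz$ and $E_\varepsilon[\gamma]=\varepsilon(\lfloor\gamma/\varepsilon\rfloor+\frac12)$. For $\rho>0$, a bounded upper semicontinuous $u:Q\to\mathbb R$ is a $\rho$-subsolution if, whenever $\phi\in C^2(Q)$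 and $u-\phi$ has a global maximum at $(\bar t,\bar x)$: if $\phi_x(\bar t,\bar x)\neq0$, then at $(\bar t,\bar x)$ $$\phi_t\le\Big(\mathrm{pv}\!\int_{|z|<\rho}\!E_\varepsilon^*[\phi(\bar t,\bar x+z)-\phi(\bar t,\bar x)]V_\alpha''(z)dz+\int_{|z|\ge\rho}\!E_\varepsilon^*[u(\bar t,\bar x+z)-u(\bar t,\bar x)]V_\alpha''(z)dz+U'(\bar x)\Big)|\phi_x|;$$ and if $\phi(t,x)=\theta|x-\bar x|^4+g(t)$ for some $\theta\in\mathbb R$, $g\in C^2((0,\infty))$, then $\phi_t(\bar t,\bar x)\le0$ (no condition for other $\phi$ with $\phi_x(\bar t,\bar x)=0$). $\rho$-supersolutions are defined symmetrically (bounded lower semicontinuous functions, minima, reversed inequalities, $E_{\varepsilon,*}$). A function $v:Q\to\mathbb R$ is a $\rho$-solution if $v^*$ is a $\rho$-subsolution and $v_*$ is a $\rho$-supersolution. **The particle system.** $(\mathbf x,\mathbf b):[0,\infty)\to\mathcal Z_n$ is a particle solution with initial datum $(\mathbf x^\circ,\mathbf b^\circ)$ if for each $T>0$ there is a finite $S\subset(0,T]$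 such that: $\mathbf x\in C([0,T])\cap C^1((0,T)\setminus S)$ and the $b_i$ are right-continuous on $[0,T]$; $(\mathbf x,\mathbf b)(0)=(\mathbf x^\circ,\mathbf b^\circ)$; each $b_i$ jumps at most once on $[0,T]$, only at a time in $S$, and from $\pm1$ to $0$; $\sum_{i:x_i(t)=y}b_i(t)=\sum_{i:x_i(t)=y}b_i(t-)$ for all $t\in(0,T]$, $y\in\mathbb R$; and on $(0,T)\setminus S$, for all $i$, $\dot x_i=-\frac1n\sum_{j\ne i}b_ib_jV_\alpha'(x_i-x_j)-b_iU'(x_i)$. Put $u_n(t,x)=\frac1n\sum_ib_i(t)H(x-x_i(t))$. **Proposition 5.5.** There is a function $v:Q\to\mathbb R$ which is a $\rho$-solution of $(HJ_\varepsilon)$ for every $\rho>0$ and satisfies $v^*(0,\cdot)=(u_n^\circ)^*$, $v_*(0,\cdot)=(u_n^\circ)_*$. It is unique up to semicontinuous envelopes: for any $\rho>0$, every $\rho$-solution $w$ with $w^*(0,\cdot)=(u_n^\circ)^*$ and $w_*(0,\cdot)=(u_n^\circ)_*$ satisfies $w^*=v^*$ and $w_*=v_*$ on $Q$. Furthermore,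 the particle system has a solution with initial datum $(\mathbf x^\circ,\mathbf b^\circ)$, and if $V'(x)\to0$ as $x\to\infty$ (which is automatic for $m=2,3$), then for every such particle solution, $u_n$ is a $\rho$-solution of $(HJ_\varepsilon)$ for every $\rho>0$ with these initial envelopes, and $u_n^*=v^*$ and $(u_n)_*=v_*$ on $Q$. -/

import Mathlib

open Filter Set Topology MeasureTheory
open scoped ENNReal

noncomputable section

namespace ParticleHJ

/-! ### Assumptions on the potentials -/

/-- The rescaled potential `V_α(x) = α V(α x)`. -/
def scaledPotential (V : ℝ → ℝ) (α : ℝ) (x : ℝ) : ℝ := α * V (α * x)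

/-- The assumptions for the well-posedness of the particle system, for an interaction potential `V`
(whose value at `0` is never used) and an external potential `U`.
Every one of the three regimes below requires `V ∈ C³((0,∞))`. This is recorded here once; it
contains the assumptions `V ∈ W^{2,1}_loc(0,∞)` and `V ∈ W^{3,1}_loc(0,∞)`, and makes all
derivatives of `V` on `(0,∞)` classical. -/
structure WellPosednessAssumption (V U : ℝ → ℝ) : Prop where
  even : ∀ x, V (-x) = V x
  convex : ConvexOn ℝ (Ioi 0) V
  regular : ContDiffOn ℝ 3 V (Ioi 0)
  second_deriv_bounded : ∃ C : ℝ, ∀ x > 1, |iteratedDeriv 2 V x| ≤ C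
  external_C1 : ContDiff ℝ 1 U
  external_lipschitz : ∃ L, LipschitzWith L (deriv U)
  deriv_nonpos : ∀ x > 0, deriv V x ≤ 0
  second_deriv_nonneg : ∀ x > 0, 0 ≤ iteratedDeriv 2 V x
  third_deriv_nonpos : ∀ x > 0, iteratedDeriv 3 V x ≤ 0
  singularity_lower : Tendsto (fun x => x * iteratedDeriv 2 V x) (𝓝[>] 0) atTop
  singularity_upper : ∃ a > (-1 : ℝ), ∃ C > 0, ∀ x ∈ Ioo (0 : ℝ) 1, |deriv V x| ≤ C / x ^ (1 + a)

/-- `sup_{y ∈ s, y > x} |V⁽ᵏ⁾(y)|`, with values in `[0,∞]`. -/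
def derivSup (V : ℝ → ℝ) (k : ℕ) (s : Set ℝ) (x : ℝ) : ℝ≥0∞ :=
  ⨆ y ∈ s ∩ Ioi x, ENNReal.ofReal |iteratedDeriv k V y|

/-- Regime `m = 1`: `V ∈ C³((0,∞))` and `x ↦ x³ sup_{y ∈ (x,1)} |V'''(y)|` is in `L¹(0,1)`. -/
def Regime1 (V : ℝ → ℝ) : Prop :=
  ContDiffOn ℝ 3 V (Ioi 0) ∧
  ∫⁻ x in Ioo (0 : ℝ) 1, ENNReal.ofReal (x ^ 3) * derivSup V 3 (Iio 1) x < ∞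

/-- Regime `m = 2`: `V ∈ C³((0,∞)) ∩ W^{3,1}(1,∞)`, `x ↦ x³ sup_{y > x} |V'''(y)|` is in
`L¹(0,∞)`, and `x⁴ V'''(x) → 0` as `x → 0`. -/
def Regime2 (V : ℝ → ℝ) : Prop :=
  ContDiffOn ℝ 3 V (Ioi 0) ∧
  (∀ k ≤ 3, IntegrableOn (iteratedDeriv k V) (Ioi 1)) ∧
  ∫⁻ x in Ioi (0 : ℝ), ENNReal.ofReal (x ^ 3) * derivSup V 3 univ x < ∞ ∧
  Tendsto (fun x => x ^ 4 * iteratedDeriv 3 V x) (𝓝[>] 0) (𝓝 0)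

/-- Regime `m = 3`: `V ∈ C⁴((0,∞)) ∩ W^{3,1}(1,∞)`, `x ↦ x² V''(x)` is in `L¹(0,1)`,
`x ↦ x³ sup_{y > x} |V'''(y)|` is in `L¹(1,∞)`, and `x^{k+1} V⁽ᵏ⁾(x)` is bounded on `(1,∞)` for
`k = 3, 4`. -/
def Regime3 (V : ℝ → ℝ) : Prop :=
  ContDiffOn ℝ 4 V (Ioi 0) ∧
  (∀ k ≤ 3, IntegrableOn (iteratedDeriv k V) (Ioi 1)) ∧
  IntegrableOn (fun x => x ^ 2 * iteratedDeriv 2 V x) (Ioo 0 1) ∧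
  ∫⁻ x in Ioi (1 : ℝ), ENNReal.ofReal (x ^ 3) * derivSup V 3 univ x < ∞ ∧
  ∀ k : ℕ, k = 3 ∨ k = 4 → ∃ C : ℝ, ∀ x > 1, x ^ (k + 1) * |iteratedDeriv k V x| ≤ C

/-! ### The particle system -/

/-- The state space `Z_n`: positions and charges in `{-1,0,1}` such that the charged particles
are strictly ordered from left to right. -/
def stateSpace (n : ℕ) : Set ((Fin n → ℝ) × (Fin n → ℤ)) :=
  {z | (∀ i, z.2 i = -1 ∨ z.2 i = 0 ∨ z.2 i = 1) ∧
    ∀ i j, i < j → z.2 i * z.2 j ≠ 0 → z.1 i < z.1 j}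

/-- `(x,b)` solves on `[0,T]` the particle system with interaction potential `W` (in the
application `W = V_α`), external potential `U`, annihilation upon collision, and initial datum
`(x₀,b₀)`. The finite set `S` contains the collision times. The field `jump` says that each `b_i`
is right-continuous and jumps at most once, and that a jump happens at a time in `S` and is from
`±1` to `0`. -/
structure IsParticleSolutionOn {n : ℕ} (W U : ℝ → ℝ) (x₀ : Fin n → ℝ) (b₀ : Fin n → ℤ)
    (x : ℝ → Fin n → ℝ) (b : ℝ → Fin n → ℤ) (T : ℝ) (S : Set ℝ) : Prop where
  finite : S.Finite
  subset : S ⊆ Ioc 0 T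
  mem : ∀ t ∈ Icc 0 T, (x t, b t) ∈ stateSpace n
  initial_x : x 0 = x₀
  initial_b : b 0 = b₀
  continuous : ContinuousOn x (Icc 0 T)
  C1 : ContDiffOn ℝ 1 x (Ioo 0 T \ S)
  jump : ∀ i, (∀ t ∈ Icc 0 T, b t i = b 0 i) ∨
    (b 0 i ≠ 0 ∧ ∃ τ ∈ S, (∀ t ∈ Ico 0 τ, b t i = b 0 i) ∧ ∀ t ∈ Icc τ T, b t i = 0)
  annihilation : ∀ t ∈ Ioc 0 T, ∀ y : ℝ,
    ∑ i with x t i = y, b t i = ∑ i with x t i = y, Function.leftLim (fun s => b s i) t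
  ode : ∀ t ∈ Ioo 0 T \ S, ∀ i,
    HasDerivAt (fun s => x s i)
      (-(1 / (n : ℝ)) * ∑ j with j ≠ i, (b t i : ℝ) * (b t j : ℝ) * deriv W (x t i - x t j)
        - (b t i : ℝ) * deriv U (x t i)) t

/-- `(x,b)` is a solution of the particle system on `[0,∞)`, i.e. on every interval `[0,T]`. -/
def IsParticleSolution {n : ℕ} (W U : ℝ → ℝ) (x₀ : Fin n → ℝ) (b₀ : Fin n → ℤ)
    (x : ℝ → Fin n → ℝ) (b : ℝ → Fin n → ℤ) : Prop :=
  ∀ T > 0, ∃ S : Set ℝ, IsParticleSolutionOn W U x₀ b₀ x b T S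

/-- The Heaviside function. -/
def heaviside (y : ℝ) : ℝ := if 0 ≤ y then 1 else 0

/-- The step function `y ↦ (1/n) ∑ b_i H(y - x_i)` of a particle configuration. -/
def stepFunction {n : ℕ} (x : Fin n → ℝ) (b : Fin n → ℤ) (y : ℝ) : ℝ :=
  (1 / (n : ℝ)) * ∑ i, (b i : ℝ) * heaviside (y - x i)

/-- The space-time step function `u_n(t,y)` of a particle trajectory. -/
def stepEvolution {n : ℕ} (x : ℝ → Fin n → ℝ) (b : ℝ → Fin n → ℤ) (p : ℝ × ℝ) : ℝ :=
  stepFunction (x p.1) (b p.1) p.2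

/-! ### Viscosity solutions -/

/-- The space-time domain `Q = (0,∞) × ℝ`. -/
def Q : Set (ℝ × ℝ) := {p | 0 < p.1}

/-- The upper semicontinuous envelope, at a point of the closure of `s`, of a function that is
locally bounded on `s`. Since `𝓝[s] p` is not punctured, a point `p ∈ s` itself is taken into
account. -/
def upperEnvelope {X : Type*} [TopologicalSpace X] (s : Set X) (f : X → ℝ) (p : X) : ℝ :=
  limsup f (𝓝[s] p)

/-- The lower semicontinuous envelope. -/
def lowerEnvelope {X : Type*} [TopologicalSpace X] (s : Set X) (f : X → ℝ) (p : X) : ℝ :=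
  liminf f (𝓝[s] p)

/-- The staircase function `E_ε[γ] = ε (⌊γ/ε⌋ + 1/2)`. -/
def staircase (ε γ : ℝ) : ℝ := ε * ((⌊γ / ε⌋ : ℝ) + 1 / 2)

/-- The principal value integral over `B_ρ = (-ρ,ρ)` with singularity at `0`. -/
def pvIntegral (ρ : ℝ) (g : ℝ → ℝ) : ℝ :=
  limUnder (𝓝[>] (0 : ℝ)) fun δ => ∫ z in {z : ℝ | δ ≤ |z| ∧ |z| < ρ}, g z

/-- The nonlocal operator in which `F` is either of the envelopes of the staircase function:
`pv ∫_{B_ρ} F(ψ(x+z)-ψ(x)) W''(z) dz + ∫_{B_ρᶜ} F(v(x+z)-v(x)) W''(z) dz`. -/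
def nonlocal (F W : ℝ → ℝ) (ρ : ℝ) (ψ v : ℝ → ℝ) (x : ℝ) : ℝ :=
  pvIntegral ρ (fun z => F (ψ (x + z) - ψ x) * iteratedDeriv 2 W z) +
    ∫ z in {z : ℝ | ρ ≤ |z|}, F (v (x + z) - v x) * iteratedDeriv 2 W z

/-- The partial derivative in time. -/
def dt (φ : ℝ × ℝ → ℝ) (p : ℝ × ℝ) : ℝ := deriv (fun s => φ (s, p.2)) p.1

/-- The partial derivative in space. -/
def dx (φ : ℝ × ℝ → ℝ) (p : ℝ × ℝ) : ℝ := deriv (fun y => φ (p.1, y)) p.2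

/-- The Hamiltonian `(M[φ(t,·),u(t,·)](x) + U'(x)) |φ_x(t,x)|` built with `F`. -/
def hamiltonian (F W U : ℝ → ℝ) (ρ : ℝ) (φ u : ℝ × ℝ → ℝ) (p : ℝ × ℝ) : ℝ :=
  (nonlocal F W ρ (fun y => φ (p.1, y)) (fun y => u (p.1, y)) p.2 + deriv U p.2) * |dx φ p|

/-- `φ(t,x) = θ |x - x̄|⁴ + g(t)` on `Q` for some `θ ∈ ℝ` and `g ∈ C²((0,∞))`. -/
def IsQuarticAt (φ : ℝ × ℝ → ℝ) (xbar : ℝ) : Prop :=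
  ∃ (θ : ℝ) (g : ℝ → ℝ), ContDiffOn ℝ 2 g (Ioi 0) ∧
    ∀ p ∈ Q, φ p = θ * |p.2 - xbar| ^ 4 + g p.1

/-- `ρ`-subsolutions of `u_t = (M_ε[u] + U') |u_x|` in `Q`, where
`M_ε[u](x) = pv ∫ E_ε[u(x+z)-u(x)] W''(z) dz`. At a contact point with `φ_x = 0` only quartic
test functions give a condition. -/
structure IsSubsolution (W U : ℝ → ℝ) (ε ρ : ℝ) (u : ℝ × ℝ → ℝ) : Prop where
  usc : UpperSemicontinuousOn u Q
  bounded : ∃ C : ℝ, ∀ p ∈ Q, |u p| ≤ C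
  test : ∀ φ : ℝ × ℝ → ℝ, ContDiffOn ℝ 2 φ Q → ∀ p ∈ Q, IsMaxOn (fun q => u q - φ q) Q p →
    (dx φ p ≠ 0 → dt φ p ≤ hamiltonian (upperEnvelope univ (staircase ε)) W U ρ φ u p) ∧
    (IsQuarticAt φ p.2 → dt φ p ≤ 0)

/-- `ρ`-supersolutions. -/
structure IsSupersolution (W U : ℝ → ℝ) (ε ρ : ℝ) (v : ℝ × ℝ → ℝ) : Prop where
  lsc : LowerSemicontinuousOn v Q
  bounded : ∃ C : ℝ, ∀ p ∈ Q, |v p| ≤ C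
  test : ∀ ψ : ℝ × ℝ → ℝ, ContDiffOn ℝ 2 ψ Q → ∀ p ∈ Q, IsMinOn (fun q => v q - ψ q) Q p →
    (dx ψ p ≠ 0 → hamiltonian (lowerEnvelope univ (staircase ε)) W U ρ ψ v p ≤ dt ψ p) ∧
    (IsQuarticAt ψ p.2 → 0 ≤ dt ψ p)

/-- `ρ`-solutions: the envelopes are a sub- and a supersolution. That the envelopes of `v` are
bounded means that `v` is; this is required first, so that the real-valued envelopes are the
actual ones. -/
structure IsViscositySolution (W U : ℝ → ℝ) (ε ρ : ℝ) (v : ℝ × ℝ → ℝ) : Prop where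
  bounded : ∃ C : ℝ, ∀ p ∈ Q, |v p| ≤ C
  sub : IsSubsolution W U ε ρ (upperEnvelope Q v)
  super : IsSupersolution W U ε ρ (lowerEnvelope Q v)

/-- The envelopes of `v` at time `0` are those of `u₀`. -/
def HasInitialEnvelopes (v : ℝ × ℝ → ℝ) (u₀ : ℝ → ℝ) : Prop :=
  ∀ x : ℝ, upperEnvelope Q v (0, x) = upperEnvelope univ u₀ x ∧
    lowerEnvelope Q v (0, x) = lowerEnvelope univ u₀ x

/-- Two functions on `Q` have the same upper and lower semicontinuous envelopes on `Q`. -/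
def SameEnvelopes (v w : ℝ × ℝ → ℝ) : Prop :=
  ∀ p ∈ Q, upperEnvelope Q v p = upperEnvelope Q w p ∧
    lowerEnvelope Q v p = lowerEnvelope Q w p

end ParticleHJ

end

open ParticleHJ

/-! Put W = V_α and f = -W' on (0,∞). Each of the three regimes makes f nonnegative, decreasing,
convex, C¹, infinite at 0+ and O(x⁻²) there (`WellPosednessAssumption.isKernel`); apart from the
behaviour of f at infinity and the Lipschitz drift U', nothing else is needed.

Particles. The forces on a charge are sums of a monotone kernel over a sequence of signs. Where
signs alternate, such sums cancel; only repeated signs cost something. Convexity makes the cost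
telescope, so the smallest gap between neighbours of equal sign is never closed by the interaction
(`Consec.velocity_sub_same`) and only opposite charges collide. Since f = O(x⁻²), the cube of the
gap between consecutive charges decreases at most at a bounded rate, so positions have limits at a
collision and reach it at rate (t-s)^{1/3}. A colliding cluster alternates in sign, hence its total
charge is 0 or the charge of its first particle; keeping that particle or none lowers the number of
charges, and induction on this number gives global solutions (`exists_isGlobalSolution`).

Particles solve the equation (`Traj.isSubsolution`). If φ_x ≠ 0, the integrand of the principal
value is odd near 0, and a jump at distance d integrates to the force f(d) when f vanishes at
infinity: the nonlocal operator of the step function is the force. At a collision the contact is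
tested along the curve of the first or last particle of the cluster, on which the upper envelope
keeps its maximal value just before the collision. If φ_x = 0, the rate (t-s)^{1/3} makes the fourth
power in the test function o(t-s). Supersolutions follow by changing the signs of charges and of U.

Uniqueness compares an arbitrary subsolution directly with the particle solution. Sharp steps are
replaced by smooth layers of width δ. Because the staircase sees increments only up to integer
multiples of 1/n, a superposition of layers, cut at any common parameter s, is a supersolution as
soon as the point charges at the cut points obey a strict form of the particle system
(`IsSubsolution.le_layered`). Shifting the particles slightly against their charges provides this
strictness. The spikes which annihilated pairs leave in the upper envelope are covered by narrow
dipoles, whose mutual attraction exceeds all other forces and which uncover the spike point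
immediately as δ → 0 (`Traj.exists_forward`). Finite speed of propagation, itself proved with
layers, controls infinity and carries the inequality over to the closure in time
(`Traj.le_at_of_lt`), so the comparison holds for all times. Applied to w and, after negation, to
the lower envelope, it fixes both envelopes, because the step function is locally constant away from
the particles.

The kernel f may tend to some ℓ > 0 at infinity. The equation contains only W'', which is unchanged
off 0 when ℓ|x| is added to W; the function v is therefore the step function of the particle system
with kernel f - ℓ, and this is the original system when V' → 0. -/

namespace ParticleHJ

/-! ### Alternating sums -/

section AlternatingSums

variable {ι : Type*} [Fintype ι] [LinearOrder ι]

/-- The entries of `b` are charges `-1`, `0` or `1`. -/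
def IsCharge (b : ι → ℝ) : Prop := ∀ i, b i = -1 ∨ b i = 0 ∨ b i = 1

/-- `i < j` are charged, and no index between them is. -/
def Consec (b : ι → ℝ) (i j : ι) : Prop :=
  i < j ∧ b i ≠ 0 ∧ b j ≠ 0 ∧ ∀ k, i < k → k < j → b k = 0

omit [Fintype ι] [LinearOrder ι] in
theorem IsCharge.mul_self {b : ι → ℝ} (hb : IsCharge b) {i : ι} (hi : b i ≠ 0) : b i * b i = 1 := by
  rcases hb i with h | h | h
  · rw [h]; norm_num
  · exact absurd h hi
  · rw [h]; norm_num

omit [Fintype ι] [LinearOrder ι] in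
theorem IsCharge.eq_or_eq_neg {b : ι → ℝ} (hb : IsCharge b) {i j : ι} (hi : b i ≠ 0)
    (hj : b j ≠ 0) : b i = b j ∨ b i = -b j := by
  rcases hb i with h | h | h <;> rcases hb j with h' | h' | h' <;> simp_all

omit [Fintype ι] [LinearOrder ι] in
theorem IsCharge.abs_le {b : ι → ℝ} (hb : IsCharge b) (i : ι) : |b i| ≤ 1 := by
  rcases hb i with h | h | h <;> rw [h] <;> norm_num

theorem exists_consec {b : ι → ℝ} {i : ι} (hi : b i ≠ 0) (h : ∃ j, i < j ∧ b j ≠ 0) :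
    ∃ j, Consec b i j := by
  obtain ⟨j, hj⟩ := h
  have hne : (Finset.univ.filter fun j => i < j ∧ b j ≠ 0).Nonempty := ⟨j, by simpa using hj⟩
  have hm := Finset.min'_mem _ hne
  set m := (Finset.univ.filter fun j => i < j ∧ b j ≠ 0).min' hne
  simp only [Finset.mem_filter, Finset.mem_univ, true_and] at hm
  refine ⟨m, hm.1, hi, hm.2, fun k hik hkm => ?_⟩
  by_contra hk
  exact absurd (Finset.min'_le _ k (by simp [hik, hk])) (not_le.2 hkm)

theorem Consec.sum_gt {b : ι → ℝ} {i j : ι} (h : Consec b i j) (g : ι → ℝ) :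
    ∑ k with i < k, b k * g k = b j * g j + ∑ k with j < k, b k * g k := by
  have h1 : (Finset.univ.filter fun k => i < k) =
      (Finset.univ.filter fun k => i < k ∧ k < j) ∪ ({j} ∪ Finset.univ.filter fun k => j < k) := by
    ext k
    simp only [Finset.mem_filter, Finset.mem_univ, true_and, Finset.mem_union,
      Finset.mem_singleton]
    constructor
    · intro hk
      rcases lt_trichotomy k j with h' | h' | h'
      · exact Or.inl ⟨hk, h'⟩
      · exact Or.inr (Or.inl h')
      · exact Or.inr (Or.inr h')
    · rintro (h' | h' | h')
      · exact h'.1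
      · exact h' ▸ h.1
      · exact h.1.trans h'
  rw [h1, Finset.sum_union, Finset.sum_union, Finset.sum_singleton, Finset.sum_eq_zero, zero_add]
  · intro k hk
    simp only [Finset.mem_filter, Finset.mem_univ, true_and] at hk
    rw [h.2.2.2 k hk.1 hk.2, zero_mul]
  · simp
  · rw [Finset.disjoint_left]
    intro k hk hk'
    simp only [Finset.mem_filter, Finset.mem_univ, true_and, Finset.mem_union,
      Finset.mem_singleton] at hk hk'
    rcases hk' with rfl | hk'
    · exact lt_irrefl _ hk.2
    · exact lt_asymm hk.2 hk'

theorem sum_gt_eq_zero {b : ι → ℝ} {i : ι} (h : ¬ ∃ j, i < j ∧ b j ≠ 0) (g : ι → ℝ) :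
    ∑ k with i < k, b k * g k = 0 := by
  refine Finset.sum_eq_zero fun k hk => ?_
  simp only [Finset.mem_filter, Finset.mem_univ, true_and] at hk
  by_contra hk'
  exact h ⟨k, hk, fun h0 => hk' (by rw [h0, zero_mul])⟩

/-- Induction from the right end. `G` is a budget: a next charge of opposite sign cancels by
monotonicity of `g`, while a next charge of equal sign adds its term `g j`, which `hs` takes out of
the budget. The two bounds are carried together because a change of sign exchanges them. -/
theorem tail_sum_bound {b g G : ι → ℝ} (hb : IsCharge b) (i₀ : ι)
    (hg : ∀ i, i₀ < i → b i ≠ 0 → 0 ≤ g i) (hG : ∀ i, i₀ < i → b i ≠ 0 → 0 ≤ G i)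
    (hs : ∀ i j, i₀ < i → Consec b i j → b i = b j → g j + G j ≤ G i)
    (ho : ∀ i j, i₀ < i → Consec b i j → b i = -b j → G j ≤ G i ∧ g j ≤ g i) :
    ∀ i, i₀ < i → b i ≠ 0 → b i * ∑ k with i < k, b k * g k ≤ G i ∧
      -(b i * ∑ k with i < k, b k * g k) ≤ g i + G i := by
  intro i
  induction i using WellFoundedGT.induction with
  | ind i ih =>
    intro hi hbi
    by_cases h : ∃ j, i < j ∧ b j ≠ 0
    · obtain ⟨j, hj⟩ := exists_consec hbi h
      obtain ⟨ih1, ih2⟩ := ih j hj.1 (hi.trans hj.1) hj.2.2.1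
      have hsq := hb.mul_self hj.2.2.1
      have h0 := hg i hi hbi
      have h0j := hg j (hi.trans hj.1) hj.2.2.1
      rw [hj.sum_gt]
      set σ := ∑ k with j < k, b k * g k
      rcases hb.eq_or_eq_neg hbi hj.2.2.1 with h1 | h1
      · have h2 := hs i j hi hj h1
        rw [h1]
        have : b j * (b j * g j + σ) = g j + b j * σ := by linear_combination g j * hsq
        rw [this]
        constructor <;> linarith
      · have h2 := ho i j hi hj h1
        rw [h1]
        have : -b j * (b j * g j + σ) = -g j - b j * σ := by linear_combination -g j * hsq
        rw [this]
        constructor <;> linarith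
    · rw [sum_gt_eq_zero h]
      have h0 := hg i hi hbi
      have h0j := hG i hi hbi
      constructor <;> simp <;> linarith

/-- The first step is separated because nothing is assumed on `g i₀`: in the applications `g` is a
function of the distance to particle `i₀` and singular there. Only the upper bound survives, as the
other one involves `g i₀`. -/
theorem tail_sum_bound_start {b g G : ι → ℝ} (hb : IsCharge b) {i₀ : ι} (hi₀ : b i₀ ≠ 0) {G₀ : ℝ}
    (hG₀ : 0 ≤ G₀) (hs₀ : ∀ j, Consec b i₀ j → b i₀ = b j → g j + G j ≤ G₀)
    (ho₀ : ∀ j, Consec b i₀ j → b i₀ = -b j → G j ≤ G₀)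
    (hg : ∀ i, i₀ < i → b i ≠ 0 → 0 ≤ g i) (hG : ∀ i, i₀ < i → b i ≠ 0 → 0 ≤ G i)
    (hs : ∀ i j, i₀ < i → Consec b i j → b i = b j → g j + G j ≤ G i)
    (ho : ∀ i j, i₀ < i → Consec b i j → b i = -b j → G j ≤ G i ∧ g j ≤ g i) :
    b i₀ * ∑ k with i₀ < k, b k * g k ≤ G₀ := by
  by_cases h : ∃ j, i₀ < j ∧ b j ≠ 0
  · obtain ⟨j, hj⟩ := exists_consec hi₀ h
    obtain ⟨h1, h2⟩ := tail_sum_bound hb i₀ hg hG hs ho j hj.1 hj.2.2.1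
    have hsq := hb.mul_self hj.2.2.1
    rw [hj.sum_gt]
    set σ := ∑ k with j < k, b k * g k
    rcases hb.eq_or_eq_neg hi₀ hj.2.2.1 with h3 | h3
    · have := hs₀ j hj h3
      rw [h3]
      linear_combination h1 + this + g j * hsq
    · have := ho₀ j hj h3
      rw [h3]
      linear_combination h2 + this - g j * hsq
  · rw [sum_gt_eq_zero h]
    simpa using hG₀

/-- The tail of an alternating sum has a sign and is dominated by its first term. -/
theorem alternating_tail {b g : ι → ℝ} (hb : IsCharge b)
    (hs : ∀ i j, Consec b i j → b i ≠ b j) {i₀ : ι} (hi₀ : b i₀ ≠ 0)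
    (hg : ∀ i, i₀ < i → b i ≠ 0 → 0 ≤ g i)
    (hm : ∀ i j, i₀ < i → Consec b i j → g j ≤ g i) :
    b i₀ * ∑ k with i₀ < k, b k * g k ≤ 0 :=
  tail_sum_bound_start (G := 0) hb hi₀ le_rfl (fun _ hj h => absurd h (hs _ _ hj))
    (fun _ _ _ => le_rfl) hg (fun _ _ _ => le_rfl) (fun _ _ _ hj h => absurd h (hs _ _ hj))
    fun i j hi hj _ => ⟨le_rfl, hm i j hi hj⟩

/-- If the positive gaps between consecutive charges are at most `δ`, then the diameter is at most
`δ` times the number of indices. -/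
theorem diam_le_of_consec {b x : ι → ℝ} {δ : ℝ} (hδ : 0 ≤ δ)
    (h : ∀ i j, Consec b i j → x j - x i ≤ δ) :
    ∀ i, b i ≠ 0 → ∀ z, b z ≠ 0 → i ≤ z →
      x z - x i ≤ (Finset.univ.filter fun k => i < k).card * δ := by
  intro i
  induction i using WellFoundedGT.induction with
  | ind i ih =>
    intro hi z hz hiz
    rcases hiz.eq_or_lt with rfl | hlt
    · simp only [sub_self]; positivity
    · obtain ⟨j, hj⟩ := exists_consec hi ⟨z, hlt, hz⟩
      have hjz : j ≤ z := by
        by_contra hzj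
        exact hz (hj.2.2.2 z hlt (not_le.1 hzj))
      have h1 := ih j hj.1 hj.2.2.1 z hz hjz
      have h2 := h i j hj
      have h3 : (Finset.univ.filter fun k => j < k).card + 1 ≤
          (Finset.univ.filter fun k => i < k).card := by
        rw [← Finset.card_insert_of_notMem (a := j) (by simp)]
        apply Finset.card_le_card
        intro k hk
        simp only [Finset.mem_insert, Finset.mem_filter, Finset.mem_univ, true_and] at hk ⊢
        rcases hk with rfl | hk
        · exact hj.1
        · exact hj.1.trans hk
      have h4 : ((Finset.univ.filter fun k => j < k).card : ℝ) + 1 ≤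
          (Finset.univ.filter fun k => i < k).card := by exact_mod_cast h3
      nlinarith

end AlternatingSums

/-! ### Repulsive kernels -/

/-- The properties of `f = -W'` on `(0,∞)` on which the dynamics depends. -/
structure IsKernel (f : ℝ → ℝ) : Prop where
  nonneg : ∀ x > 0, 0 ≤ f x
  anti : AntitoneOn f (Ioi 0)
  convex : ConvexOn ℝ (Ioi 0) f
  regular : ContDiffOn ℝ 1 f (Ioi 0)
  singular : Tendsto f (𝓝[>] 0) atTop
  bound : ∃ C > 0, ∀ x ∈ Ioo (0 : ℝ) 1, f x ≤ C / x ^ 2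

/-- The odd extension of `f` from `(0,∞)` to `ℝ`. -/
noncomputable def oddKer (f : ℝ → ℝ) (s : ℝ) : ℝ := if 0 < s then f s else if s < 0 then -f (-s) else 0

theorem oddKer_pos {f : ℝ → ℝ} {s : ℝ} (h : 0 < s) : oddKer f s = f s := by simp [oddKer, h]

theorem oddKer_neg {f : ℝ → ℝ} {s : ℝ} (h : s < 0) : oddKer f s = -f (-s) := by
  simp [oddKer, h, h.not_gt]

theorem oddKer_zero {f : ℝ → ℝ} : oddKer f 0 = 0 := by simp [oddKer]

theorem oddKer_odd {f : ℝ → ℝ} (s : ℝ) : oddKer f (-s) = -oddKer f s := by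
  rcases lt_trichotomy s 0 with h | rfl | h
  · rw [oddKer_neg h, oddKer_pos (by linarith), neg_neg]
  · simp [oddKer_zero]
  · rw [oddKer_pos h, oddKer_neg (by linarith), neg_neg]

namespace IsKernel

variable {f : ℝ → ℝ} (hf : IsKernel f)

include hf

theorem hasDerivAt {x : ℝ} (hx : 0 < x) : HasDerivAt f (deriv f x) x :=
  ((hf.regular.differentiableOn (by norm_num)).differentiableAt (Ioi_mem_nhds hx)).hasDerivAt

theorem continuousAt {x : ℝ} (hx : 0 < x) : ContinuousAt f x := (hf.hasDerivAt hx).continuousAt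

theorem deriv_nonpos {x : ℝ} (hx : 0 < x) : deriv f x ≤ 0 := by
  rw [← derivWithin_of_isOpen isOpen_Ioi hx]
  exact hf.anti.derivWithin_nonpos

theorem deriv_mono : MonotoneOn (deriv f) (Ioi 0) :=
  hf.convex.monotoneOn_deriv fun _ hx => (hf.hasDerivAt hx).differentiableAt

/-- Increments of `f` decrease in absolute value. -/
theorem sub_le_sub {s t D : ℝ} (hs : 0 < s) (hst : s ≤ t) (hD : 0 ≤ D) :
    f t - f (t + D) ≤ f s - f (s + D) := by
  have hm : MonotoneOn (fun x => f (x + D) - f x) (Ioi 0) := by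
    have hd : ∀ x ∈ Ioi (0 : ℝ), HasDerivAt (fun x => f (x + D) - f x)
        (deriv f (x + D) - deriv f x) x := fun x hx => by
      have hx' : (0 : ℝ) < x := hx
      exact ((hf.hasDerivAt (by linarith : 0 < x + D)).comp_add_const x D).sub (hf.hasDerivAt hx')
    refine monotoneOn_of_deriv_nonneg (convex_Ioi 0)
      (fun x hx => (hd x hx).continuousAt.continuousWithinAt) ?_ ?_
    · rw [interior_Ioi]
      exact fun x hx => (hd x hx).differentiableAt.differentiableWithinAt
    · rw [interior_Ioi]
      intro x hx
      have hx' : (0 : ℝ) < x := hx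
      rw [(hd x hx).deriv]
      have := hf.deriv_mono hx (show x + D ∈ Ioi 0 by simp; linarith) (by linarith)
      linarith
  have := hm hs (show t ∈ Ioi 0 from hs.trans_le hst) hst
  simp only at this
  linarith

theorem lipschitz {l : ℝ} (hl : 0 < l) : ∃ L : NNReal, LipschitzOnWith L f (Ici l) := by
  refine ⟨(-deriv f l).toNNReal, ?_⟩
  refine (convex_Ici l).lipschitzOnWith_of_nnnorm_deriv_le (fun _ hx => ?_) (fun x hx => ?_)
  · exact (hf.hasDerivAt (hl.trans_le hx)).differentiableAt
  · rw [← NNReal.coe_le_coe, coe_nnnorm, Real.norm_eq_abs,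
      Real.coe_toNNReal _ (by linarith [hf.deriv_nonpos hl]), abs_of_nonpos (hf.deriv_nonpos (hl.trans_le hx))]
    have := hf.deriv_mono (show l ∈ Ioi 0 from hl) (show x ∈ Ioi 0 from hl.trans_le hx) hx
    linarith

theorem continuousAt_oddKer {s : ℝ} (hs : s ≠ 0) : ContinuousAt (oddKer f) s := by
  rcases hs.lt_or_gt with h | h
  · have : oddKer f =ᶠ[𝓝 s] fun s => -f (-s) := by
      filter_upwards [Iio_mem_nhds h] with y hy using oddKer_neg hy
    refine ContinuousAt.congr ?_ this.symm
    exact (ContinuousAt.comp (f := fun s : ℝ => -s) (g := f) (hf.continuousAt (by linarith))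
      continuous_neg.continuousAt).neg
  · have : oddKer f =ᶠ[𝓝 s] f := by
      filter_upwards [Ioi_mem_nhds h] with y hy using oddKer_pos hy
    exact ContinuousAt.congr (hf.continuousAt h) this.symm

theorem abs_oddKer_le {l s : ℝ} (hl : 0 < l) (hs : l ≤ |s|) : |oddKer f s| ≤ f l := by
  rcases le_or_gt 0 s with h | h
  · rw [abs_of_nonneg h] at hs
    rw [oddKer_pos (hl.trans_le hs), abs_of_nonneg (hf.nonneg _ (hl.trans_le hs))]
    exact hf.anti hl (show s ∈ Ioi 0 from hl.trans_le hs) hs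
  · rw [abs_of_neg h] at hs
    rw [oddKer_neg h, abs_neg, abs_of_nonneg (hf.nonneg _ (hl.trans_le hs))]
    exact hf.anti hl (show -s ∈ Ioi 0 from hl.trans_le hs) hs

end IsKernel

/-! ### The velocity field -/

section Velocity

/-- The charged entries of `x` are strictly increasing. -/
def Ordered {ι : Type*} [LinearOrder ι] (b x : ι → ℝ) : Prop :=
  ∀ i j, i < j → b i ≠ 0 → b j ≠ 0 → x i < x j

/-- The velocity of particle `i` in the configuration `(x,b)`. -/
noncomputable def velocity {ι : Type*} [Fintype ι] (c : ℝ) (f dU : ℝ → ℝ) (b x : ι → ℝ) (i : ι) : ℝ :=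
  c * (b i * ∑ k, b k * oddKer f (x i - x k)) - b i * dU (x i)

/-- Consecutive charges of equal sign are at distance at least `d`. -/
def SameGap {ι : Type*} [LinearOrder ι] (b x : ι → ℝ) (d : ℝ) : Prop :=
  ∀ i j, Consec b i j → b i = b j → d ≤ x j - x i

variable {ι : Type*} [Fintype ι] [LinearOrder ι] {c d : ℝ} {f dU : ℝ → ℝ} {b x : ι → ℝ} {i j : ι}

theorem sum_trichotomy (F : ι → ℝ) (i : ι) :
    ∑ k, F k = ∑ k with k < i, F k + F i + ∑ k with i < k, F k := by
  rw [← Finset.sum_filter_add_sum_filter_not Finset.univ (fun k => k < i), add_assoc]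
  congr 1
  have : (Finset.univ.filter fun k => ¬ k < i) = insert i (Finset.univ.filter fun k => i < k) := by
    ext k
    simp [le_iff_eq_or_lt, eq_comm]
  rw [this, Finset.sum_insert (by simp)]

omit [Fintype ι] in
theorem Consec.dual (h : Consec b i j) :
    Consec (ι := ιᵒᵈ) (fun k => b (OrderDual.ofDual k)) (OrderDual.toDual j) (OrderDual.toDual i) :=
  ⟨h.1, h.2.2.1, h.2.1, fun k h1 h2 => h.2.2.2 (OrderDual.ofDual k) h2 h1⟩

omit [Fintype ι] in
theorem Consec.of_dual {k l : ιᵒᵈ} (h : Consec (fun k : ιᵒᵈ => b (OrderDual.ofDual k)) k l) :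
    Consec b (OrderDual.ofDual l) (OrderDual.ofDual k) :=
  ⟨h.1, h.2.2.1, h.2.1, fun m h1 h2 => h.2.2.2 (OrderDual.toDual m) h2 h1⟩

omit [Fintype ι] in
theorem Ordered.dual (h : Ordered b x) :
    Ordered (ι := ιᵒᵈ) (fun k => b (OrderDual.ofDual k)) (fun k => -x (OrderDual.ofDual k)) :=
  fun _ _ hkl hk hl => neg_lt_neg (h _ _ hkl hl hk)

omit [Fintype ι] in
theorem SameGap.dual (h : SameGap b x d) :
    SameGap (ι := ιᵒᵈ) (fun k => b (OrderDual.ofDual k)) (fun k => -x (OrderDual.ofDual k)) d :=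
  fun _ _ hkl hs => by have := h _ _ hkl.of_dual hs.symm; linarith

omit [Fintype ι] in
omit [Fintype ι] [LinearOrder ι] in
theorem IsCharge.dual (h : IsCharge b) : IsCharge (ι := ιᵒᵈ) (fun k => b (OrderDual.ofDual k)) :=
  fun _ => h _

/-- By convexity the increments of `f` over a step `d` decrease with the distance. The budget at `k`
is `f (x k - x j + d)`: an equal neighbour `l` of `k` lies at least `d` further away, and there
increment plus budget is `f (x l - x j)`. The sum telescopes to `f d` with constant one, and this
exact constant is what the smallest gap requires. -/
theorem right_sum_same (hf : IsKernel f) (hb : IsCharge b) (hx : Ordered b x) (hd : 0 < d)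
    (hgap : SameGap b x d) (hj : b j ≠ 0) :
    b j * ∑ k with j < k, b k * (f (x k - x j) - f (x k - x j + d)) ≤ f d := by
  have hpos : ∀ k, j < k → b k ≠ 0 → 0 < x k - x j := fun k hk hbk => by
    linarith [hx j k hk hj hbk]
  refine tail_sum_bound_start (g := fun k => f (x k - x j) - f (x k - x j + d))
    (G := fun k => f (x k - x j + d)) hb hj (hf.nonneg _ hd) ?_ ?_ ?_ ?_ ?_ ?_
  · intro k hk hs
    have := hgap j k hk hs
    simp only [sub_add_cancel]
    exact hf.anti hd (show x k - x j ∈ Ioi 0 from hd.trans_le this) this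
  · intro k hk _
    have := hpos k hk.1 hk.2.2.1
    exact hf.anti hd (show x k - x j + d ∈ Ioi 0 by simp; linarith) (by linarith)
  · intro k hk hbk
    have := hpos k hk hbk
    have := hf.anti (show x k - x j ∈ Ioi 0 from this)
      (show x k - x j + d ∈ Ioi 0 by simp; linarith) (by linarith)
    linarith
  · intro k hk hbk
    have := hpos k hk hbk
    exact hf.nonneg _ (by linarith)
  · intro k l hk hkl hs
    have h1 := hpos k hk hkl.2.1
    have := hgap k l hkl hs
    simp only [sub_add_cancel]
    exact hf.anti (show x k - x j + d ∈ Ioi 0 by simp; linarith)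
      (show x l - x j ∈ Ioi 0 by simp; linarith) (by linarith)
  · intro k l hk hkl _
    have h1 := hpos k hk hkl.2.1
    have h2 := hx k l hkl.1 hkl.2.1 hkl.2.2.1
    refine ⟨?_, ?_⟩
    · exact hf.anti (show x k - x j + d ∈ Ioi 0 by simp; linarith)
        (show x l - x j + d ∈ Ioi 0 by simp; linarith) (by linarith)
    · exact hf.sub_le_sub h1 (by linarith) hd.le

/-- Only repetitions of a sign cost anything, and each costs at most `h d`, because the second of
two equal neighbours is at distance at least `d` from particle `j`. The budget at `k` is `h d` times
the number of indices beyond `k`. -/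
theorem right_sum_crude {h : ℝ → ℝ} (hanti : AntitoneOn h (Ioi 0)) (hnn : ∀ s > 0, 0 ≤ h s)
    (hb : IsCharge b) (hx : Ordered b x) (hd : 0 < d) (hgap : SameGap b x d) (hj : b j ≠ 0) :
    b j * ∑ k with j < k, b k * h (x k - x j) ≤ Fintype.card ι * h d := by
  have hpos : ∀ k, j < k → b k ≠ 0 → 0 < x k - x j := fun k hk hbk => by
    linarith [hx j k hk hj hbk]
  have hhd := hnn d hd
  have hcard : ∀ k l : ι, k < l → ((Finset.univ.filter fun m => l < m).card : ℝ) + 1 ≤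
      (Finset.univ.filter fun m => k < m).card := by
    intro k l hkl
    have : (Finset.univ.filter fun m => l < m).card + 1 ≤
        (Finset.univ.filter fun m => k < m).card := by
      rw [← Finset.card_insert_of_notMem (a := l) (by simp)]
      apply Finset.card_le_card
      intro m hm
      simp only [Finset.mem_insert, Finset.mem_filter, Finset.mem_univ, true_and] at hm ⊢
      rcases hm with rfl | hm
      · exact hkl
      · exact hkl.trans hm
    exact_mod_cast this
  have hsame : ∀ k l, j ≤ k → Consec b k l → b k = b l → h (x l - x j) ≤ h d := by
    intro k l hjk hkl hs
    have h1 := hgap k l hkl hs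
    have h2 : x j ≤ x k := by
      rcases hjk.eq_or_lt with rfl | h'
      · exact le_rfl
      · linarith [hpos k h' hkl.2.1]
    exact hanti hd (show x l - x j ∈ Ioi 0 by simp; linarith) (by linarith)
  have hmain : b j * ∑ k with j < k, b k * h (x k - x j) ≤
      (Finset.univ.filter fun m => j < m).card * h d := by
    refine tail_sum_bound_start (g := fun k => h (x k - x j))
      (G := fun k => (Finset.univ.filter fun m => k < m).card * h d) hb hj (by positivity)
      ?_ ?_ ?_ ?_ ?_ ?_
    · intro k hk hs
      have h1 := hsame j k le_rfl hk hs
      have h2 := hcard j k hk.1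
      nlinarith
    · intro k hk _
      have h2 := hcard j k hk.1
      nlinarith
    · intro k hk hbk
      exact hnn _ (hpos k hk hbk)
    · intro k hk hbk
      positivity
    · intro k l hk hkl hs
      have h1 := hsame k l hk.le hkl hs
      have h2 := hcard k l hkl.1
      nlinarith
    · intro k l hk hkl _
      have h1 := hpos k hk hkl.2.1
      have h2 := hx k l hkl.1 hkl.2.1 hkl.2.2.1
      have h3 := hcard k l hkl.1
      refine ⟨by nlinarith, hanti h1 (show x l - x j ∈ Ioi 0 by simp; linarith) (by linarith)⟩
  refine hmain.trans (mul_le_mul_of_nonneg_right ?_ hhd)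
  exact_mod_cast Finset.card_le_univ _

/-- A left sum is a right sum of the configuration reflected at the origin and indexed by the dual
order. -/
theorem left_sum_same (hf : IsKernel f) (hb : IsCharge b) (hx : Ordered b x) (hd : 0 < d)
    (hgap : SameGap b x d) (hj : b j ≠ 0) :
    b j * ∑ k with k < j, b k * (f (x j - x k) - f (x j - x k + d)) ≤ f d := by
  have := right_sum_same (ι := ιᵒᵈ) hf hb.dual hx.dual hd hgap.dual (j := OrderDual.toDual j) hj
  simp only [OrderDual.ofDual_toDual, neg_sub_neg] at this
  exact this

theorem left_sum_crude {h : ℝ → ℝ} (hanti : AntitoneOn h (Ioi 0)) (hnn : ∀ s > 0, 0 ≤ h s)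
    (hb : IsCharge b) (hx : Ordered b x) (hd : 0 < d) (hgap : SameGap b x d) (hj : b j ≠ 0) :
    b j * ∑ k with k < j, b k * h (x j - x k) ≤ Fintype.card ι * h d := by
  have := right_sum_crude (ι := ιᵒᵈ) hanti hnn hb.dual hx.dual hd hgap.dual
    (j := OrderDual.toDual j) hj
  simp only [OrderDual.ofDual_toDual, neg_sub_neg, Fintype.card_orderDual] at this
  exact this

/-- The interaction force, split into contributions from the left and from the right. -/
theorem sum_oddKer_split (hx : Ordered b x) (hi : b i ≠ 0) :
    ∑ k, b k * oddKer f (x i - x k) =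
      ∑ k with k < i, b k * f (x i - x k) - ∑ k with i < k, b k * f (x k - x i) := by
  rw [sum_trichotomy _ i, sub_self, oddKer_zero, mul_zero, add_zero, sub_eq_add_neg,
    ← Finset.sum_neg_distrib]
  congr 1
  · refine Finset.sum_congr rfl fun k hk => ?_
    simp only [Finset.mem_filter, Finset.mem_univ, true_and] at hk
    by_cases h : b k = 0
    · simp [h]
    · rw [oddKer_pos (by linarith [hx k i hk h hi])]
  · refine Finset.sum_congr rfl fun k hk => ?_
    simp only [Finset.mem_filter, Finset.mem_univ, true_and] at hk
    by_cases h : b k = 0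
    · simp [h]
    · rw [oddKer_neg (by linarith [hx i k hk hi h]), neg_sub]; ring

omit [Fintype ι] in
theorem Consec.sum_lt [Fintype ι] (h : Consec b i j) (g : ι → ℝ) :
    ∑ k with k < j, b k * g k = ∑ k with k < i, b k * g k + b i * g i := by
  have := h.dual.sum_gt (ι := ιᵒᵈ) (fun k => g (OrderDual.ofDual k))
  simp only [OrderDual.ofDual_toDual] at this
  rw [add_comm]
  exact this

theorem Consec.velocity_sub (h : Consec b i j) (hx : Ordered b x) :
    velocity c f dU b x j - velocity c f dU b x i =
      c * (b j * (∑ k with k < i, b k * f (x j - x k) + b i * f (x j - x i)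
        - ∑ k with j < k, b k * f (x k - x j)) -
        b i * (∑ k with k < i, b k * f (x i - x k) - (b j * f (x j - x i)
        + ∑ k with j < k, b k * f (x k - x i)))) - (b j * dU (x j) - b i * dU (x i)) := by
  unfold velocity
  rw [sum_oddKer_split hx h.2.1, sum_oddKer_split hx h.2.2.1, h.sum_lt, h.sum_gt]
  ring

/-- The smallest gap between consecutive charges of equal sign is not closed by the interaction. -/
theorem Consec.velocity_sub_same (hf : IsKernel f) (hc : 0 ≤ c) (hb : IsCharge b)
    (hx : Ordered b x) (h : Consec b i j) (hs : b i = b j) (hgap : SameGap b x (x j - x i)) :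
    -(b j * (dU (x j) - dU (x i))) ≤ velocity c f dU b x j - velocity c f dU b x i := by
  have hd : 0 < x j - x i := by linarith [hx i j h.1 h.2.1 h.2.2.1]
  have h1 := right_sum_same hf hb hx hd hgap h.2.2.1
  have h2 := left_sum_same hf hb hx hd hgap h.2.1
  have e1 : ∀ k, x k - x j + (x j - x i) = x k - x i := fun k => by ring
  have e2 : ∀ k, x i - x k + (x j - x i) = x j - x k := fun k => by ring
  simp only [e1, e2, mul_sub, Finset.sum_sub_distrib] at h1 h2
  have hsq := hb.mul_self h.2.2.1
  rw [h.velocity_sub hx]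
  rw [hs] at h2 ⊢
  -- With D = `x j - x i`, the charges on the right and on the left each close the gap with strength
  -- at most `f D`; the mutual repulsion of the pair opens it with strength `2 * f D`.
  have key : 0 ≤ (b j * (∑ k with k < i, b k * f (x j - x k) + b j * f (x j - x i)
        - ∑ k with j < k, b k * f (x k - x j)) -
        b j * (∑ k with k < i, b k * f (x i - x k) - (b j * f (x j - x i)
        + ∑ k with j < k, b k * f (x k - x i)))) := by
    linear_combination h1 + h2 - 2 * f (x j - x i) * hsq
  have := mul_nonneg hc key
  linarith

/-- With D the gap, the pair feels the other charges through the kernel `f s - f (s + D)` if its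
signs agree and `f s + f (s + D)` if they are opposite. Both kernels are nonnegative and decreasing,
so the crude bounds apply on either side. The singular term `2 * c * f D` accounts for the
attraction of an opposite pair. -/
theorem Consec.velocity_sub_ge (hf : IsKernel f) (hc : 0 ≤ c) (hb : IsCharge b)
    (hx : Ordered b x) (h : Consec b i j) (hd : 0 < d) (hgap : SameGap b x d) :
    -(2 * c * f (x j - x i)) - 4 * c * Fintype.card ι * f d - |dU (x i)| - |dU (x j)| ≤
      velocity c f dU b x j - velocity c f dU b x i := by
  have hD : 0 < x j - x i := by linarith [hx i j h.1 h.2.1 h.2.2.1]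
  have hfd := hf.nonneg d hd
  have hfD := hf.nonneg _ hD
  have hsq := hb.mul_self h.2.2.1
  have hU : ∀ k, |b k * dU (x k)| ≤ |dU (x k)| := fun k => by
    rw [abs_mul]; exact mul_le_of_le_one_left (abs_nonneg _) (hb.abs_le k)
  have hUi := abs_le.1 (hU i)
  have hUj := abs_le.1 (hU j)
  have e1 : ∀ k, x k - x j + (x j - x i) = x k - x i := fun k => by ring
  have e2 : ∀ k, x i - x k + (x j - x i) = x j - x k := fun k => by ring
  have hn : (0 : ℝ) ≤ Fintype.card ι := by positivity
  rw [h.velocity_sub hx]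
  rcases hb.eq_or_eq_neg h.2.1 h.2.2.1 with hs | hs
  · have hanti : AntitoneOn (fun s => f s - f (s + (x j - x i))) (Ioi 0) :=
      fun s hs t _ hst => hf.sub_le_sub hs hst hD.le
    have hnn : ∀ s > 0, 0 ≤ f s - f (s + (x j - x i)) := fun s hs => by
      have := hf.anti (show s ∈ Ioi 0 from hs) (show s + (x j - x i) ∈ Ioi 0 by simp; linarith)
        (by linarith)
      linarith
    have h1 := right_sum_crude hanti hnn hb hx hd hgap h.2.2.1
    have h2 := left_sum_crude hanti hnn hb hx hd hgap h.2.1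
    have h3 := hf.nonneg (d + (x j - x i)) (by linarith)
    simp only [e1, e2, mul_sub, Finset.sum_sub_distrib] at h1 h2
    rw [hs] at h2 ⊢
    have key : -(2 * (Fintype.card ι * f d)) ≤
        (b j * (∑ k with k < i, b k * f (x j - x k) + b j * f (x j - x i)
        - ∑ k with j < k, b k * f (x k - x j)) -
        b j * (∑ k with k < i, b k * f (x i - x k) - (b j * f (x j - x i)
        + ∑ k with j < k, b k * f (x k - x i)))) := by
      have h4 := mul_nonneg hn h3
      linear_combination h1 + h2 - 2 * f (x j - x i) * hsq + 2 * h4 + 2 * hfD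
    have := mul_le_mul_of_nonneg_left key hc
    have h5 : 0 ≤ c * (Fintype.card ι * f d) := by positivity
    have h6 : 0 ≤ c * f (x j - x i) := by positivity
    rw [hs] at hUi
    have hUi' : b j * dU (x i) ≤ |dU (x i)| ∧ -|dU (x i)| ≤ b j * dU (x i) := ⟨hUi.2, hUi.1⟩
    nlinarith
  · have hanti : AntitoneOn (fun s => f s + f (s + (x j - x i))) (Ioi 0) := by
      intro s hs t ht hst
      have hs' : (0 : ℝ) < s := hs
      have ht' : (0 : ℝ) < t := ht
      have := hf.anti hs ht hst
      have := hf.anti (show s + (x j - x i) ∈ Ioi 0 by simp; linarith)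
        (show t + (x j - x i) ∈ Ioi 0 by simp; linarith) (by linarith)
      simp only; linarith
    have hnn : ∀ s > 0, 0 ≤ f s + f (s + (x j - x i)) := fun s hs =>
      add_nonneg (hf.nonneg s hs) (hf.nonneg _ (by linarith))
    have h1 := right_sum_crude hanti hnn hb hx hd hgap h.2.2.1
    have h2 := left_sum_crude hanti hnn hb hx hd hgap h.2.1
    have h3 := hf.anti (show d ∈ Ioi 0 from hd) (show d + (x j - x i) ∈ Ioi 0 by simp; linarith)
      (by linarith)
    simp only [e1, e2, mul_add, Finset.sum_add_distrib] at h1 h2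
    rw [hs] at h2 ⊢
    have key : -(2 * f (x j - x i)) - 4 * (Fintype.card ι * f d) ≤
        (b j * (∑ k with k < i, b k * f (x j - x k) + -b j * f (x j - x i)
        - ∑ k with j < k, b k * f (x k - x j)) -
        -b j * (∑ k with k < i, b k * f (x i - x k) - (b j * f (x j - x i)
        + ∑ k with j < k, b k * f (x k - x i)))) := by
      have h4 := mul_le_mul_of_nonneg_left h3 hn
      linear_combination h1 + h2 + 2 * f (x j - x i) * hsq + 2 * h4
    have := mul_le_mul_of_nonneg_left key hc
    rw [hs] at hUi
    nlinarith

/-- The attraction of a nearby opposite charge pulls the leftmost charge to the right and does not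
harm a lower bound; only equal charges push it left, and the crude estimate covers them without a
singular term. -/
theorem velocity_first_ge (hf : IsKernel f) (hc : 0 ≤ c) (hb : IsCharge b)
    (hx : Ordered b x) (hi : b i ≠ 0) (hfirst : ∀ k, k < i → b k = 0) (hd : 0 < d)
    (hgap : SameGap b x d) :
    -(c * Fintype.card ι * f d) - |dU (x i)| ≤ velocity c f dU b x i := by
  have h1 := right_sum_crude hf.anti hf.nonneg hb hx hd hgap hi
  have h2 : ∑ k with k < i, b k * f (x i - x k) = 0 := Finset.sum_eq_zero fun k hk => by
    rw [hfirst k (by simpa using hk), zero_mul]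
  have hU : b i * dU (x i) ≤ |dU (x i)| := by
    refine (le_abs_self _).trans ?_
    rw [abs_mul]; exact mul_le_of_le_one_left (abs_nonneg _) (hb.abs_le i)
  unfold velocity
  rw [sum_oddKer_split hx hi, h2]
  have := mul_le_mul_of_nonneg_left h1 hc
  linarith

omit [LinearOrder ι] in
theorem velocity_dual (c : ℝ) (f dU : ℝ → ℝ) (b x : ι → ℝ) (i : ι) :
    velocity (ι := ιᵒᵈ) c f (fun s => -dU (-s)) (fun k => b (OrderDual.ofDual k))
      (fun k => -x (OrderDual.ofDual k)) (OrderDual.toDual i) = -velocity c f dU b x i := by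
  unfold velocity
  simp only [OrderDual.ofDual_toDual, neg_neg]
  have : ∑ k : ιᵒᵈ, b (OrderDual.ofDual k) * oddKer f (-x i - -x (OrderDual.ofDual k)) =
      -∑ k, b k * oddKer f (x i - x k) := by
    rw [← Finset.sum_neg_distrib]
    refine Fintype.sum_equiv OrderDual.ofDual _ _ fun k => ?_
    rw [show -x i - -x (OrderDual.ofDual k) = -(x i - x (OrderDual.ofDual k)) by ring, oddKer_odd]
    ring
  rw [this]
  ring

theorem velocity_last_le (hf : IsKernel f) (hc : 0 ≤ c) (hb : IsCharge b)
    (hx : Ordered b x) (hi : b i ≠ 0) (hlast : ∀ k, i < k → b k = 0) (hd : 0 < d)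
    (hgap : SameGap b x d) :
    velocity c f dU b x i ≤ c * Fintype.card ι * f d + |dU (x i)| := by
  have := velocity_first_ge (ι := ιᵒᵈ) (dU := fun s => -dU (-s)) hf hc hb.dual hx.dual
    (i := OrderDual.toDual i) hi (fun k hk => hlast _ hk) hd hgap.dual
  rw [velocity_dual] at this
  simp only [OrderDual.ofDual_toDual, neg_neg, abs_neg, Fintype.card_orderDual] at this
  linarith

end Velocity

/-! ### Flows between collisions -/

/-- A finite family of functions that are increasing wherever one of them vanishes while the others
are nonnegative stays positive. -/
theorem pos_of_deriv_pos_at_zero {κ : Type*} [Finite κ] {u : κ → ℝ → ℝ} {t₀ t₁ : ℝ}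
    (hcont : ∀ p, ContinuousOn (u p) (Icc t₀ t₁)) (h0 : ∀ p, 0 < u p t₀)
    (hd : ∀ p, ∀ t ∈ Ioc t₀ t₁, u p t = 0 → (∀ q, 0 ≤ u q t) → ∃ u' > 0, HasDerivAt (u p) u' t) :
    ∀ t ∈ Icc t₀ t₁, ∀ p, 0 < u p t := by
  by_contra hcon
  push Not at hcon
  obtain ⟨t, ht, p, hp⟩ := hcon
  set Z : Set ℝ := ⋃ p, {t ∈ Icc t₀ t₁ | u p t ≤ 0} with hZ
  have hZc : IsCompact Z := by
    refine isCompact_iUnion fun p => ?_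
    refine isCompact_Icc.of_isClosed_subset ?_ (fun t ht => ht.1)
    exact (hcont p).preimage_isClosed_of_isClosed isClosed_Icc isClosed_Iic
  obtain ⟨s, hs, hmin⟩ := hZc.exists_isLeast ⟨t, mem_iUnion.2 ⟨p, ht, hp⟩⟩
  obtain ⟨q, hsI, hq⟩ := mem_iUnion.1 hs
  have hs0 : t₀ < s := by
    rcases hsI.1.eq_or_lt with h | h
    · rw [← h] at hq; exact absurd hq (not_le.2 (h0 q))
    · exact h
  have hpos : ∀ r, ∀ t ∈ Ico t₀ s, 0 < u r t := by
    intro r t ht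
    by_contra h
    have := hmin (mem_iUnion.2 ⟨r, ⟨ht.1, (ht.2.trans_le hsI.2).le⟩, not_lt.1 h⟩)
    exact absurd ht.2 (not_lt.2 this)
  have hnn : ∀ r, 0 ≤ u r s := by
    intro r
    have h1 : ContinuousWithinAt (u r) (Ico t₀ s) s :=
      ((hcont r) s hsI).mono (fun t ht => ⟨ht.1, (ht.2.trans_le hsI.2).le⟩)
    have h2 : (𝓝[Ico t₀ s] s).NeBot := by
      rw [← mem_closure_iff_nhdsWithin_neBot, closure_Ico hs0.ne]
      exact right_mem_Icc.2 hs0.le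
    exact ge_of_tendsto h1 (by filter_upwards [self_mem_nhdsWithin] with t ht using (hpos r t ht).le)
  obtain ⟨u', hu', hder⟩ := hd q s ⟨hs0, hsI.2⟩ (le_antisymm hq (hnn q)) hnn
  have hsl := hasDerivAt_iff_tendsto_slope.1 hder
  have hsl' : Tendsto (slope (u q) s) (𝓝[<] s) (𝓝 u') :=
    hsl.mono_left (nhdsWithin_mono _ fun t (ht : t < s) => ht.ne)
  have : u' ≤ 0 := by
    refine le_of_tendsto hsl' ?_
    filter_upwards [Ioo_mem_nhdsLT hs0] with t ht
    rw [slope_def_field, le_antisymm hq (hnn q)]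
    exact div_nonpos_of_nonneg_of_nonpos (by linarith [hpos q t ⟨ht.1.le, ht.2⟩])
      (by linarith [ht.2])
  linarith

/-- Functions with `u' ≥ -K (1 + |u|)` are bounded below on bounded intervals. -/
theorem bddBelow_of_deriv_ge {u u' : ℝ → ℝ} {t₀ e K : ℝ} (hK : 0 ≤ K)
    (hd : ∀ t ∈ Ico t₀ e, HasDerivAt u (u' t) t) (hb : ∀ t ∈ Ico t₀ e, -(K * (1 + |u t|)) ≤ u' t) :
    ∃ m, ∀ t ∈ Ico t₀ e, m ≤ u t := by
  -- The barrier is minus E with E = A exp((2K+1)(t-t₀)). It starts below `u t₀`, and E ≥ 1 gives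
  -- K(1+E) ≤ 2KE < (2K+1)E at a contact.
  set A := 2 + |u t₀|
  have hA : 1 ≤ A := by have := abs_nonneg (u t₀); linarith
  refine ⟨-(A * Real.exp ((2 * K + 1) * (e - t₀))), fun t ht => ?_⟩
  have hder : ∀ s, HasDerivAt (fun s => A * Real.exp ((2 * K + 1) * (s - t₀)))
      (A * (Real.exp ((2 * K + 1) * (s - t₀)) * (2 * K + 1))) s := by
    intro s
    have h1 : HasDerivAt (fun s => (2 * K + 1) * (s - t₀)) (2 * K + 1) s := by
      simpa using ((hasDerivAt_id s).sub_const t₀).const_mul (2 * K + 1)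
    exact (h1.exp).const_mul A
  have key := pos_of_deriv_pos_at_zero (κ := Unit) (t₀ := t₀) (t₁ := t)
    (u := fun _ s => u s + A * Real.exp ((2 * K + 1) * (s - t₀))) ?_ ?_ ?_ t ⟨ht.1, le_rfl⟩ ()
  · have h1 : Real.exp ((2 * K + 1) * (t - t₀)) ≤ Real.exp ((2 * K + 1) * (e - t₀)) := by
      apply Real.exp_le_exp.2
      have := ht.2
      nlinarith
    have := mul_le_mul_of_nonneg_left h1 (by linarith : (0 : ℝ) ≤ A)
    linarith
  · intro _ s hs
    exact ((hd s ⟨hs.1, hs.2.trans_lt ht.2⟩).add (hder s)).continuousAt.continuousWithinAt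
  · intro _
    simp only [sub_self, mul_zero, Real.exp_zero, mul_one]
    linarith [neg_abs_le (u t₀), show A = 2 + |u t₀| from rfl]
  · intro _ s hs h0 _
    have hs' : s ∈ Ico t₀ e := ⟨hs.1.le, hs.2.trans_lt ht.2⟩
    refine ⟨_, ?_, (hd s hs').add (hder s)⟩
    have hE : 1 ≤ Real.exp ((2 * K + 1) * (s - t₀)) := by
      apply Real.one_le_exp
      have := hs.1
      exact mul_nonneg (by linarith) (by linarith)
    set E := A * Real.exp ((2 * K + 1) * (s - t₀)) with hEdef
    have hE1 : 1 ≤ E := by nlinarith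
    have hu : u s = -E := by linarith
    have h1 := hb s hs'
    have h2 : |u s| = E := by rw [hu, abs_neg, abs_of_nonneg (by linarith)]
    rw [h2] at h1
    have h3 : A * (Real.exp ((2 * K + 1) * (s - t₀)) * (2 * K + 1)) = (2 * K + 1) * E := by
      rw [hEdef]; ring
    rw [h3]
    nlinarith

/-- A solution of the particle system with constant charges on the time set `I`. -/
structure Flow {ι : Type*} [Fintype ι] [LinearOrder ι] (c : ℝ) (f dU : ℝ → ℝ) (b : ι → ℝ)
    (x : ℝ → ι → ℝ) (I : Set ℝ) : Prop where
  order : ∀ t ∈ I, Ordered b (x t)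
  ode : ∀ t ∈ I, ∀ i, HasDerivAt (fun s => x s i) (velocity c f dU b (x t) i) t

namespace Flow

variable {ι : Type*} [Fintype ι] [LinearOrder ι] {c : ℝ} {f dU : ℝ → ℝ} {b : ι → ℝ}
  {x : ℝ → ι → ℝ} {t₀ e : ℝ}

theorem mono {I J : Set ℝ} (h : Flow c f dU b x I) (hJ : J ⊆ I) : Flow c f dU b x J :=
  ⟨fun t ht => h.order t (hJ ht), fun t ht => h.ode t (hJ ht)⟩

theorem continuousAt {I : Set ℝ} (h : Flow c f dU b x I) {t : ℝ} (ht : t ∈ I) (i : ι) :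
    ContinuousAt (fun s => x s i) t := (h.ode t ht i).continuousAt

/-- Gaps are compared with an exponentially decaying barrier. A pair touching it while no other
equal pair is below has the smallest gap of all, so `Consec.velocity_sub_same` applies: the
interaction does not close the gap, and the drift closes it at most at rate `L`, slower than the
decay rate `L + 1` of the barrier. -/
theorem exists_sameGap (h : Flow c f dU b x (Ico t₀ e)) (hf : IsKernel f) (hc : 0 ≤ c)
    (hb : IsCharge b) {L : NNReal} (hL : LipschitzWith L dU) :
    ∃ d > 0, ∀ t ∈ Ico t₀ e, SameGap b (x t) d := by
  rcases le_or_gt e t₀ with he | he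
  · exact ⟨1, one_pos, fun t ht => by simp [he] at ht⟩
  set κ := {p : ι × ι // Consec b p.1 p.2 ∧ b p.1 = b p.2}
  have hpos0 : ∀ p : κ, 0 < x t₀ p.1.2 - x t₀ p.1.1 := fun p => by
    have := h.order t₀ ⟨le_rfl, he⟩ _ _ p.2.1.1 p.2.1.2.1 p.2.1.2.2.1
    linarith
  obtain ⟨m, hm, hmle⟩ : ∃ m > 0, ∀ p : κ, m < x t₀ p.1.2 - x t₀ p.1.1 := by
    rcases isEmpty_or_nonempty κ with hκ | hκ
    · exact ⟨1, one_pos, fun p => (hκ.false p).elim⟩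
    · obtain ⟨p, hp⟩ := Finite.exists_min fun p : κ => x t₀ p.1.2 - x t₀ p.1.1
      exact ⟨(x t₀ p.1.2 - x t₀ p.1.1) / 2, by linarith [hpos0 p],
        fun q => by linarith [hp q, hpos0 p]⟩
  set B : ℝ → ℝ := fun s => m * Real.exp (-((L : ℝ) + 1) * (s - t₀)) with hB
  have hBd : ∀ s, HasDerivAt B (-((L : ℝ) + 1) * B s) s := by
    intro s
    have h1 : HasDerivAt (fun s => -((L : ℝ) + 1) * (s - t₀)) (-((L : ℝ) + 1)) s := by
      simpa using ((hasDerivAt_id s).sub_const t₀).const_mul (-((L : ℝ) + 1))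
    refine HasDerivAt.congr_deriv (f := B) ((h1.exp).const_mul m) ?_
    simp only [hB]; ring
  refine ⟨m * Real.exp (-((L : ℝ) + 1) * (e - t₀)), by positivity, fun t ht i j hij hs => ?_⟩
  have key := pos_of_deriv_pos_at_zero (κ := κ) (t₀ := t₀) (t₁ := t)
    (u := fun p s => x s p.1.2 - x s p.1.1 - B s) ?_ ?_ ?_ t ⟨ht.1, le_rfl⟩ ⟨(i, j), hij, hs⟩
  · simp only at key
    have h1 : Real.exp (-((L : ℝ) + 1) * (e - t₀)) ≤ Real.exp (-((L : ℝ) + 1) * (t - t₀)) := by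
      apply Real.exp_le_exp.2
      have h2 := ht.2
      have h3 := L.2
      simp only [NNReal.val_eq_coe] at h3
      nlinarith
    have := mul_le_mul_of_nonneg_left h1 hm.le
    simp only [hB] at key
    linarith
  · intro p s hs
    have hs' : s ∈ Ico t₀ e := ⟨hs.1, hs.2.trans_lt ht.2⟩
    exact (((h.continuousAt hs' _).sub (h.continuousAt hs' _)).sub
      (hBd s).continuousAt).continuousWithinAt
  · intro p
    simp only [hB, sub_self, mul_zero, Real.exp_zero, mul_one]
    linarith [hmle p]
  · intro p s hs h0 hq
    have hs' : s ∈ Ico t₀ e := ⟨hs.1.le, hs.2.trans_lt ht.2⟩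
    refine ⟨_, ?_, ((h.ode s hs' _).sub (h.ode s hs' _)).sub (hBd s)⟩
    have hBpos : 0 < B s := by simp only [hB]; positivity
    have h1 := p.2.1.velocity_sub_same (dU := dU) hf hc hb (h.order s hs') p.2.2 (fun k l hkl hsm => by
      have := hq ⟨(k, l), hkl, hsm⟩
      simp only at this h0
      linarith)
    have h2 : |b p.1.2 * (dU (x s p.1.2) - dU (x s p.1.1))| ≤ L * (x s p.1.2 - x s p.1.1) := by
      rw [abs_mul]
      have h3 := hL.dist_le_mul (x s p.1.2) (x s p.1.1)
      rw [Real.dist_eq, Real.dist_eq] at h3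
      have h4 : |x s p.1.2 - x s p.1.1| = x s p.1.2 - x s p.1.1 := by
        rw [abs_of_nonneg]
        have h5 := h0
        linarith
      rw [h4] at h3
      exact (mul_le_of_le_one_left (abs_nonneg _) (hb.abs_le _)).trans h3
    have h3 := (abs_le.1 h2).2
    have h4 : x s p.1.2 - x s p.1.1 = B s := by linarith
    rw [h4] at h3
    linarith

/-- Uncharged particles rest and charged ones lie between the two extreme charges. For each extreme
charge the velocity has an outward bound that grows linearly in its position, which is enough for a
one-sided Grönwall argument. -/
theorem exists_bound (h : Flow c f dU b x (Ico t₀ e)) (hf : IsKernel f) (hc : 0 ≤ c)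
    (hb : IsCharge b) {L : NNReal} (hL : LipschitzWith L dU) :
    ∃ R, ∀ t ∈ Ico t₀ e, ∀ i, |x t i| ≤ R := by
  obtain ⟨d, hd, hgap⟩ := h.exists_sameGap hf hc hb hL
  rcases le_or_gt e t₀ with he | he
  · exact ⟨1, fun t ht => by simp [he] at ht⟩
  have hfd := hf.nonneg d hd
  set K := c * Fintype.card ι * f d + |dU 0| + L with hK
  have hK0 : 0 ≤ K := by positivity
  have hdU : ∀ y, c * Fintype.card ι * f d + |dU y| ≤ K * (1 + |y|) := by
    intro y
    have h3 := hL.dist_le_mul y 0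
    rw [Real.dist_eq, Real.dist_eq, sub_zero] at h3
    have h4 := abs_sub_abs_le_abs_sub (dU y) (dU 0)
    have h5 : 0 ≤ c * Fintype.card ι * f d := by positivity
    have h6 := abs_nonneg (dU 0)
    have h7 := abs_nonneg y
    have h8 : (L : ℝ) ≤ K := by rw [hK]; linarith
    nlinarith
  have hconst : ∀ i, b i = 0 → ∀ t ∈ Ico t₀ e, x t i = x t₀ i := by
    intro i hi t ht
    refine constant_of_has_deriv_right_zero (a := t₀) (b := t) (f := fun s => x s i) ?_ ?_ t
      ⟨ht.1, le_rfl⟩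
    · exact fun s hs => (h.continuousAt ⟨hs.1, hs.2.trans_lt ht.2⟩ i).continuousWithinAt
    · intro s hs
      have := h.ode s ⟨hs.1, hs.2.trans ht.2⟩ i
      simp only [velocity, hi, zero_mul, mul_zero, sub_zero] at this
      exact this.hasDerivWithinAt
  have hlow : ∀ i, b i ≠ 0 → ∃ m, ∀ t ∈ Ico t₀ e, m ≤ x t i := by
    intro i hi
    have hne : (Finset.univ.filter fun j => b j ≠ 0).Nonempty := ⟨i, by simpa using hi⟩
    set a := (Finset.univ.filter fun j => b j ≠ 0).min' hne
    have ha : b a ≠ 0 := by simpa using Finset.min'_mem _ hne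
    have hmin : ∀ k, b k ≠ 0 → a ≤ k := fun k hk => Finset.min'_le _ k (by simpa using hk)
    obtain ⟨m, hm⟩ := bddBelow_of_deriv_ge hK0 (fun t ht => h.ode t ht a) fun t ht => by
      have h1 := velocity_first_ge (dU := dU) hf hc hb (h.order t ht) ha (fun k hk => by
        by_contra hk'
        exact absurd (hmin k hk') (not_le.2 hk)) hd (hgap t ht)
      have := hdU (x t a)
      linarith
    refine ⟨m, fun t ht => (hm t ht).trans ?_⟩
    rcases (hmin i hi).eq_or_lt with h' | h'
    · rw [h']
    · exact (h.order t ht a i h' ha hi).le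
  have hupp : ∀ i, b i ≠ 0 → ∃ m, ∀ t ∈ Ico t₀ e, m ≤ -x t i := by
    intro i hi
    have hne : (Finset.univ.filter fun j => b j ≠ 0).Nonempty := ⟨i, by simpa using hi⟩
    set a := (Finset.univ.filter fun j => b j ≠ 0).max' hne
    have ha : b a ≠ 0 := by simpa using Finset.max'_mem _ hne
    have hmax : ∀ k, b k ≠ 0 → k ≤ a := fun k hk => Finset.le_max' _ k (by simpa using hk)
    obtain ⟨m, hm⟩ := bddBelow_of_deriv_ge hK0 (fun t ht => (h.ode t ht a).neg) fun t ht => by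
      have h1 := velocity_last_le (dU := dU) hf hc hb (h.order t ht) ha (fun k hk => by
        by_contra hk'
        exact absurd (hmax k hk') (not_le.2 hk)) hd (hgap t ht)
      have := hdU (x t a)
      simp only [Pi.neg_apply, abs_neg]
      linarith
    refine ⟨m, fun t ht => (hm t ht).trans ?_⟩
    simp only [Pi.neg_apply]
    rcases (hmax i hi).eq_or_lt with h' | h'
    · rw [h']
    · exact neg_le_neg (h.order t ht i a h' hi ha).le
  have hall : ∀ i, ∃ R, ∀ t ∈ Ico t₀ e, |x t i| ≤ R := by
    intro i
    by_cases hi : b i = 0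
    · exact ⟨|x t₀ i|, fun t ht => by rw [hconst i hi t ht]⟩
    · obtain ⟨m, hm⟩ := hlow i hi
      obtain ⟨m', hm'⟩ := hupp i hi
      refine ⟨max (-m) (-m'), fun t ht => abs_le.2 ⟨?_, ?_⟩⟩
      · linarith [hm t ht, le_max_left (-m) (-m')]
      · linarith [hm' t ht, le_max_right (-m) (-m')]
  choose R hR using hall
  refine ⟨∑ i, |R i|, fun t ht i => (hR i t ht).trans ((le_abs_self _).trans ?_)⟩
  exact Finset.single_le_sum (f := fun i => |R i|) (fun j _ => abs_nonneg _) (Finset.mem_univ i)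

/-- The cube of the gap between consecutive charges decreases at most at a bounded rate. -/
theorem exists_gap_cube (h : Flow c f dU b x (Ico t₀ e)) (hf : IsKernel f) (hc : 0 ≤ c)
    (hb : IsCharge b) {L : NNReal} (hL : LipschitzWith L dU) :
    ∃ C ≥ 0, ∀ i j, Consec b i j →
      MonotoneOn (fun t => (x t j - x t i) ^ 3 + C * t) (Ico t₀ e) := by
  obtain ⟨d, hd, hgap⟩ := h.exists_sameGap hf hc hb hL
  obtain ⟨R, hR⟩ := h.exists_bound hf hc hb hL
  obtain ⟨C₁, hC₁, hfb⟩ := hf.bound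
  have hfd := hf.nonneg d hd
  have hf1 := hf.nonneg 1 one_pos
  rcases le_or_gt e t₀ with he | he
  · exact ⟨0, le_rfl, fun i j _ => by rw [Ico_eq_empty (not_lt.2 he)]; exact fun _ h => h.elim⟩
  obtain hι | hι := isEmpty_or_nonempty ι
  · exact ⟨0, le_rfl, fun i => hι.elim i⟩
  have hR0 : 0 ≤ R := (abs_nonneg _).trans (hR t₀ ⟨le_rfl, he⟩ (Classical.arbitrary ι))
  set M := |dU 0| + L * R with hM
  have hM0 : 0 ≤ M := by positivity
  have hdU : ∀ t ∈ Ico t₀ e, ∀ i, |dU (x t i)| ≤ M := by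
    intro t ht i
    have h3 := hL.dist_le_mul (x t i) 0
    rw [Real.dist_eq, Real.dist_eq, sub_zero] at h3
    have h4 := abs_sub_abs_le_abs_sub (dU (x t i)) (dU 0)
    have h5 := mul_le_mul_of_nonneg_left (hR t ht i) L.2
    simp only [NNReal.val_eq_coe] at h5
    rw [hM]; linarith
  -- The bound f = O(x⁻²) enters here: in the derivative of the cube of the gap, the attraction is
  -- multiplied by the square of the gap.
  have hfD : ∀ D, 0 < D → D ≤ 2 * R → D ^ 2 * f D ≤ C₁ + 4 * R ^ 2 * f 1 := by
    intro D hD hDR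
    rcases lt_or_ge D 1 with h1 | h1
    · have := hfb D ⟨hD, h1⟩
      rw [le_div_iff₀ (by positivity)] at this
      have : 0 ≤ 4 * R ^ 2 * f 1 := by positivity
      linarith
    · have h2 := hf.anti (show (1 : ℝ) ∈ Ioi 0 by simp) (show D ∈ Ioi 0 from hD) h1
      have h3 : D ^ 2 ≤ 4 * R ^ 2 := by nlinarith
      have h4 : D ^ 2 * f D ≤ 4 * R ^ 2 * f 1 :=
        mul_le_mul h3 h2 (hf.nonneg D hD) (by positivity)
      linarith
  set N := 4 * c * Fintype.card ι * f d + 2 * M with hN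
  have hN0 : 0 ≤ N := by positivity
  set C := 6 * c * (C₁ + 4 * R ^ 2 * f 1) + 12 * R ^ 2 * N with hC
  refine ⟨C, by positivity, fun i j hij => ?_⟩
  refine monotoneOn_of_hasDerivWithinAt_nonneg (convex_Ico _ _)
    (f' := fun t => 3 * (x t j - x t i) ^ 2 *
      (velocity c f dU b (x t) j - velocity c f dU b (x t) i) + C) ?_ ?_ ?_
  · intro t ht
    exact ((((h.continuousAt ht j).sub (h.continuousAt ht i)).pow 3).add
      (continuousAt_const.mul continuousAt_id)).continuousWithinAt
  · intro t ht
    have ht' := interior_subset ht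
    have h1 := (((h.ode t ht' j).sub (h.ode t ht' i)).pow 3).add ((hasDerivAt_id t).const_mul C)
    refine HasDerivAt.hasDerivWithinAt ?_
    refine HasDerivAt.congr_deriv (f := fun t => (x t j - x t i) ^ 3 + C * t) h1 ?_
    simp
  · intro t ht
    have ht' := interior_subset ht
    have h1 := hij.velocity_sub_ge (dU := dU) hf hc hb (h.order t ht') hd (hgap t ht')
    have h2 := hdU t ht' i
    have h3 := hdU t ht' j
    have hD : 0 < x t j - x t i := by linarith [h.order t ht' i j hij.1 hij.2.1 hij.2.2.1]
    have hDR : x t j - x t i ≤ 2 * R := by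
      have := abs_le.1 (hR t ht' i)
      have := abs_le.1 (hR t ht' j)
      linarith
    have h4 := hfD _ hD hDR
    set D := x t j - x t i
    set v := velocity c f dU b (x t) j - velocity c f dU b (x t) i
    have h5 : -(2 * c * f D) - N ≤ v := by rw [hN]; linarith
    have h6 : D ^ 2 ≤ 4 * R ^ 2 := by nlinarith
    have h7 : 3 * D ^ 2 * (-(2 * c * f D) - N) ≤ 3 * D ^ 2 * v :=
      mul_le_mul_of_nonneg_left h5 (by positivity)
    have h8 := mul_le_mul_of_nonneg_left h4 (by positivity : 0 ≤ 6 * c)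
    have h9 := mul_le_mul_of_nonneg_right h6 hN0
    simp only [hC]
    nlinarith

/-- The positions of a flow on a bounded time interval converge at the end of it. -/
theorem exists_limit (h : Flow c f dU b x (Ico t₀ e)) (hf : IsKernel f) (hc : 0 ≤ c)
    (hb : IsCharge b) {L : NNReal} (hL : LipschitzWith L dU) (he : t₀ < e) :
    ∃ X : ι → ℝ, ∀ i, Tendsto (fun t => x t i) (𝓝[<] e) (𝓝 (X i)) := by
  obtain ⟨d, hd, hgap⟩ := h.exists_sameGap hf hc hb hL
  obtain ⟨R, hR⟩ := h.exists_bound hf hc hb hL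
  obtain ⟨C, hC, hcube⟩ := h.exists_gap_cube hf hc hb hL
  have hfd := hf.nonneg d hd
  have mono_lim : ∀ {g : ℝ → ℝ} {B : ℝ}, MonotoneOn g (Ico t₀ e) → (∀ t ∈ Ico t₀ e, g t ≤ B) →
      ∃ l, Tendsto g (𝓝[<] e) (𝓝 l) := fun {g B} hg hB =>
    ⟨_, MonotoneOn.tendsto_nhdsWithin_Ioo_left (nonempty_Ioo.2 he) (hg.mono Ioo_subset_Ico_self)
      ⟨B, by rintro _ ⟨t, ht, rfl⟩; exact hB t (Ioo_subset_Ico_self ht)⟩⟩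
  have hid : ∀ K : ℝ, Tendsto (fun t : ℝ => K * t) (𝓝[<] e) (𝓝 (K * e)) := fun K =>
    ((continuous_const.mul continuous_id).tendsto e).mono_left nhdsWithin_le_nhds
  have hgaps : ∀ i j, Consec b i j → ∃ l, Tendsto (fun t => x t j - x t i) (𝓝[<] e) (𝓝 l) := by
    intro i j hij
    -- The cube of the gap plus `C * t` is monotone and bounded, hence converges; the gap itself is
    -- recovered by a cube root.
    obtain ⟨l, hl⟩ := mono_lim (B := (2 * R) ^ 3 + C * e) (hcube i j hij) fun t ht => by
      have h1 := abs_le.1 (hR t ht i)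
      have h2 := abs_le.1 (hR t ht j)
      have h3 := h.order t ht i j hij.1 hij.2.1 hij.2.2.1
      have h4 : (x t j - x t i) ^ 3 ≤ (2 * R) ^ 3 :=
        pow_le_pow_left₀ (by linarith) (by linarith) 3
      have h5 := mul_le_mul_of_nonneg_left ht.2.le hC
      linarith
    have h1 := hl.sub (hid C)
    have h2 := ((Real.continuous_rpow_const (q := ((3 : ℕ) : ℝ)⁻¹) (by positivity)).tendsto _).comp h1
    refine ⟨_, h2.congr' ?_⟩
    filter_upwards [Ioo_mem_nhdsLT he] with t ht
    have h3 := h.order t (Ioo_subset_Ico_self ht) i j hij.1 hij.2.1 hij.2.2.1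
    simp only [Function.comp, add_sub_cancel_right]
    exact Real.pow_rpow_inv_natCast (by linarith) (by norm_num)
  have hall : ∀ i, ∃ l, Tendsto (fun t => x t i) (𝓝[<] e) (𝓝 l) := by
    intro i
    -- From left to right: uncharged particles rest, a charge with a charged predecessor is that
    -- predecessor plus a convergent gap, and the first charge becomes monotone after adding a
    -- linear function of time.
    induction i using WellFoundedLT.induction with
    | ind i ih =>
      by_cases hi : b i = 0
      · obtain ⟨l, hl⟩ := mono_lim (g := fun t => x t i) (B := R) (by
          refine monotoneOn_of_hasDerivWithinAt_nonneg (convex_Ico _ _) (f' := fun _ => 0)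
            (fun t ht => (h.continuousAt ht i).continuousWithinAt) (fun t ht => ?_)
            (fun _ _ => le_rfl)
          have := h.ode t (interior_subset ht) i
          simp only [velocity, hi, zero_mul, mul_zero, sub_zero] at this
          exact this.hasDerivWithinAt) fun t ht => (abs_le.1 (hR t ht i)).2
        exact ⟨l, hl⟩
      · by_cases hp : ∃ k, k < i ∧ b k ≠ 0
        · obtain ⟨k, hk⟩ := exists_consec (ι := ιᵒᵈ) (b := fun k => b (OrderDual.ofDual k))
            (i := OrderDual.toDual i) hi (by
              obtain ⟨k, hk⟩ := hp
              exact ⟨OrderDual.toDual k, hk⟩)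
          have hk' := hk.of_dual
          obtain ⟨l, hl⟩ := ih (OrderDual.ofDual k) hk'.1
          obtain ⟨l', hl'⟩ := hgaps _ _ hk'
          exact ⟨_, (hl.add hl').congr fun t => by simp⟩
        · set M := |dU 0| + L * R with hM
          set K := c * Fintype.card ι * f d + M with hK
          obtain ⟨l, hl⟩ := mono_lim (g := fun t => x t i + |K| * t) (B := R + |K| * e) (by
            refine monotoneOn_of_hasDerivWithinAt_nonneg (convex_Ico _ _)
              (f' := fun t => velocity c f dU b (x t) i + |K|) ?_ ?_ ?_
            · exact fun t ht => ((h.continuousAt ht i).add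
                (continuousAt_const.mul continuousAt_id)).continuousWithinAt
            · intro t ht
              exact (HasDerivAt.congr_deriv (f := fun t => x t i + |K| * t)
                ((h.ode t (interior_subset ht) i).add ((hasDerivAt_id t).const_mul |K|))
                (by simp)).hasDerivWithinAt
            · intro t ht
              have ht' := interior_subset ht
              have h1 := velocity_first_ge (dU := dU) hf hc hb (h.order t ht') hi (fun k hk => by
                by_contra hk'
                exact hp ⟨k, hk, hk'⟩) hd (hgap t ht')
              have h3 := hL.dist_le_mul (x t i) 0
              rw [Real.dist_eq, Real.dist_eq, sub_zero] at h3
              have h4 := abs_sub_abs_le_abs_sub (dU (x t i)) (dU 0)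
              have h5 := mul_le_mul_of_nonneg_left (hR t ht' i) L.2
              simp only [NNReal.val_eq_coe] at h5
              have h6 := le_abs_self K
              beta_reduce at h1 ⊢
              rw [hK, hM] at h6
              linarith) fun t ht => by
                have h1 := (abs_le.1 (hR t ht i)).2
                have h2 := mul_le_mul_of_nonneg_left ht.2.le (abs_nonneg K)
                linarith
          exact ⟨_, (hl.sub (hid |K|)).congr fun t => by simp⟩
  choose X hX using hall
  exact ⟨X, hX⟩

end Flow

/-! ### Clusters of colliding particles -/

section Clusters

variable {ι : Type*} [Fintype ι] [LinearOrder ι] {b X : ι → ℝ} {y : ℝ} {a : ι}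

/-- Beyond the first term of the tail, the remainder has the favourable sign by `alternating_tail`
and may be dropped. -/
theorem neg_alternating_tail_le {g : ι → ℝ} {B : ℝ} (hb : IsCharge b)
    (hs : ∀ i j, Consec b i j → b i ≠ b j) {i₀ : ι} (hi₀ : b i₀ ≠ 0) (hB : 0 ≤ B)
    (hB' : ∀ j, Consec b i₀ j → g j ≤ B)
    (hg : ∀ i, i₀ < i → b i ≠ 0 → 0 ≤ g i)
    (hm : ∀ i j, i₀ < i → Consec b i j → g j ≤ g i) :
    -(b i₀ * ∑ k with i₀ < k, b k * g k) ≤ B := by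
  by_cases h : ∃ j, i₀ < j ∧ b j ≠ 0
  · obtain ⟨j, hj⟩ := exists_consec hi₀ h
    have h1 := alternating_tail hb hs hj.2.2.1 (g := g) (fun i hi => hg i (hj.1.trans hi))
      fun i k hi => hm i k (hj.1.trans hi)
    have h2 := hB' j hj
    have hsq := hb.mul_self hj.2.2.1
    rw [hj.sum_gt, (hb.eq_or_eq_neg hi₀ hj.2.2.1).resolve_left (hs _ _ hj)]
    linear_combination h1 + h2 + g j * hsq
  · rw [sum_gt_eq_zero h]
    simpa using hB

omit [Fintype ι] [LinearOrder ι] in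
theorem IsCharge.exists_int_sum (hb : IsCharge b) (s : Finset ι) : ∃ m : ℤ, ∑ i ∈ s, b i = m := by
  classical
  induction s using Finset.induction_on with
  | empty => exact ⟨0, by simp⟩
  | insert i s hi ih =>
    obtain ⟨m, hm⟩ := ih
    rw [Finset.sum_insert hi, hm]
    rcases hb i with h | h | h <;> rw [h]
    · exact ⟨-1 + m, by push_cast; ring⟩
    · exact ⟨m, by ring⟩
    · exact ⟨1 + m, by push_cast; ring⟩

/-- Initial partial sums of an alternating sequence of charges are `0` or the first charge. -/
theorem alternating_partial_sum (hb : IsCharge b) (hs : ∀ i j, Consec b i j → b i ≠ b j)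
    (ha : b a ≠ 0) (hfirst : ∀ k, k < a → b k = 0) (p : ι → Prop) [DecidablePred p] (hpa : p a)
    (hp : ∀ i j, Consec b i j → p j → p i) :
    ∑ i with p i, b i = 0 ∨ ∑ i with p i, b i = b a := by
  obtain ⟨m, hm⟩ := hb.exists_int_sum (Finset.univ.filter p)
  set g : ι → ℝ := fun i => if p i then 1 else 0 with hg
  have hsum : ∑ i with p i, b i = b a + ∑ k with a < k, b k * g k := by
    have h1 : ∑ i with p i, b i = ∑ i, b i * g i := by
      rw [Finset.sum_filter]
      exact Finset.sum_congr rfl fun i _ => by simp [hg]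
    rw [h1, sum_trichotomy _ a, Finset.sum_eq_zero, zero_add]
    · simp [hg, hpa]
    · intro k hk
      rw [hfirst k (by simpa using hk), zero_mul]
  have hnn : ∀ i, 0 ≤ g i := fun i => by simp only [hg]; split_ifs <;> norm_num
  have hle : ∀ i, g i ≤ 1 := fun i => by simp only [hg]; split_ifs <;> norm_num
  have hmono : ∀ i j, a < i → Consec b i j → g j ≤ g i := by
    intro i j _ hij
    by_cases h : p j
    · simp [hg, h, hp i j hij h]
    · simp only [hg, h, if_false]; split_ifs <;> norm_num
  -- The two bounds place the partial sum between 0 and `b a`; being an integer, it is one of them.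
  have h1 := alternating_tail hb hs ha (g := g) (fun i _ _ => hnn i) hmono
  have h2 := neg_alternating_tail_le hb hs ha zero_le_one (g := g) (fun j _ => hle j)
    (fun i _ _ => hnn i) hmono
  have hsq := hb.mul_self ha
  rw [hsum] at hm ⊢
  set σ := ∑ k with a < k, b k * g k
  rcases hb a with h | h | h
  · rw [h] at h1 h2 hm ⊢
    have h3 : (m : ℝ) ≤ 0 := by linarith
    have h4 : (-1 : ℝ) ≤ m := by linarith
    have h5 : m = 0 ∨ m = -1 := by
      have : m ≤ 0 := by exact_mod_cast h3
      have : -1 ≤ m := by exact_mod_cast h4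
      lia
    rcases h5 with h5 | h5 <;> rw [h5] at hm <;> push_cast at hm
    · exact Or.inl hm
    · exact Or.inr hm
  · exact absurd h ha
  · rw [h] at h1 h2 hm ⊢
    have h3 : (m : ℝ) ≤ 1 := by linarith
    have h4 : (0 : ℝ) ≤ m := by linarith
    have h5 : m = 0 ∨ m = 1 := by
      have : m ≤ 1 := by exact_mod_cast h3
      have : 0 ≤ m := by exact_mod_cast h4
      lia
    rcases h5 with h5 | h5 <;> rw [h5] at hm <;> push_cast at hm
    · exact Or.inl hm
    · exact Or.inr hm

open Classical in
/-- The charges of the particles at position `y`; the others are discarded. -/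
noncomputable def clusterCharge (b X : ι → ℝ) (y : ℝ) (i : ι) : ℝ := if X i = y then b i else 0

omit [Fintype ι] [LinearOrder ι] in
theorem IsCharge.cluster (hb : IsCharge b) (X : ι → ℝ) (y : ℝ) :
    IsCharge (clusterCharge b X y) := fun i => by
  unfold clusterCharge
  split_ifs
  · exact hb i
  · exact Or.inr (Or.inl rfl)

omit [Fintype ι] [LinearOrder ι] in
theorem clusterCharge_ne_zero {i : ι} : clusterCharge b X y i ≠ 0 ↔ b i ≠ 0 ∧ X i = y := by
  unfold clusterCharge
  split_ifs with h <;> simp [h]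

omit [Fintype ι] [LinearOrder ι] in
theorem clusterCharge_of_eq {i : ι} (h : X i = y) : clusterCharge b X y i = b i := by
  simp [clusterCharge, h]

omit [Fintype ι] in
-- A charge between two members of the cluster is squeezed to the position `y` by monotonicity,
-- hence belongs to the cluster itself.
theorem consec_of_cluster {i j : ι} (hmono : ∀ i j, i < j → b i ≠ 0 → b j ≠ 0 → X i ≤ X j)
    (h : Consec (clusterCharge b X y) i j) : Consec b i j := by
  have hi := clusterCharge_ne_zero.1 h.2.1
  have hj := clusterCharge_ne_zero.1 h.2.2.1
  refine ⟨h.1, hi.1, hj.1, fun k hik hkj => ?_⟩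
  by_contra hk
  have h1 := hmono i k hik hi.1 hk
  have h2 := hmono k j hkj hk hj.1
  rw [hi.2] at h1
  rw [hj.2] at h2
  have h3 := h.2.2.2 k hik hkj
  rw [clusterCharge_of_eq (le_antisymm h2 h1)] at h3
  exact hk h3

omit [Fintype ι] in
-- Consecutive charges of equal sign keep the distance `d > 0` and cannot share a position.
theorem cluster_alternating {d : ℝ} (hd : 0 < d)
    (hmono : ∀ i j, i < j → b i ≠ 0 → b j ≠ 0 → X i ≤ X j) (hgap : SameGap b X d) (y : ℝ) :
    ∀ i j, Consec (clusterCharge b X y) i j → clusterCharge b X y i ≠ clusterCharge b X y j := by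
  intro i j h hs
  have hi := clusterCharge_ne_zero.1 h.2.1
  have hj := clusterCharge_ne_zero.1 h.2.2.1
  rw [clusterCharge_of_eq hi.2, clusterCharge_of_eq hj.2] at hs
  have := hgap i j (consec_of_cluster hmono h) hs
  rw [hi.2, hj.2] at this
  linarith

open Classical in
omit [LinearOrder ι] in
theorem sum_cluster (b X : ι → ℝ) (y : ℝ) : ∑ i, clusterCharge b X y i = ∑ i with X i = y, b i := by
  rw [Finset.sum_filter]; rfl

/-- The total charge of a cluster is `0` or the charge of its first particle. -/
theorem cluster_sum {d : ℝ} (hb : IsCharge b) (hd : 0 < d)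
    (hmono : ∀ i j, i < j → b i ≠ 0 → b j ≠ 0 → X i ≤ X j) (hgap : SameGap b X d)
    (ha : b a ≠ 0) (hfirst : ∀ k, k < a → b k ≠ 0 → X k ≠ X a) :
    ∑ i, clusterCharge b X (X a) i = 0 ∨ ∑ i, clusterCharge b X (X a) i = b a := by
  have := alternating_partial_sum (hb.cluster X (X a)) (cluster_alternating hd hmono hgap (X a))
    (a := a) (clusterCharge_ne_zero.2 ⟨ha, rfl⟩) (fun k hk => by
      by_contra h
      have h1 := clusterCharge_ne_zero.1 h
      exact hfirst k hk h1.1 h1.2) (fun _ => True) trivial (fun _ _ _ _ => trivial)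
  simpa [clusterCharge_of_eq] using this

end Clusters

/-! ### Existence of flows -/

section Existence

variable {ι : Type*} [Fintype ι] [LinearOrder ι]

/-- The velocity field of ordered configurations, with distances truncated from below at `l` and
positions truncated at `±R`. -/
noncomputable def truncVelocity (c : ℝ) (f dU : ℝ → ℝ) (b : ι → ℝ) (l R : ℝ) (x : ι → ℝ) (i : ι) :
    ℝ :=
  c * (b i * ∑ k, b k * (if k < i then f (max (x i - x k) l) else
    if i < k then -f (max (x k - x i) l) else 0)) - b i * dU (max (min (x i) R) (-R))

variable {c : ℝ} {f dU : ℝ → ℝ} {b : ι → ℝ}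

theorem truncVelocity_eq {l R : ℝ} {x : ι → ℝ} (hl : 0 < l)
    (hx : ∀ i j, i < j → b i ≠ 0 → b j ≠ 0 → l ≤ x j - x i) (hR : ∀ i, |x i| ≤ R) :
    truncVelocity c f dU b l R x = velocity c f dU b x := by
  funext i
  unfold truncVelocity velocity
  have h1 : max (min (x i) R) (-R) = x i := by
    have := abs_le.1 (hR i)
    rw [min_eq_left this.2, max_eq_left this.1]
  rw [h1]
  by_cases hi : b i = 0
  · simp [hi]
  congr 3
  refine Finset.sum_congr rfl fun k _ => ?_
  by_cases hk : b k = 0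
  · simp [hk]
  congr 1
  rcases lt_trichotomy k i with h | h | h
  · have := hx k i h hk hi
    rw [if_pos h, max_eq_left this, oddKer_pos (by linarith)]
  · subst h; simp [oddKer_zero]
  · have := hx i k h hi hk
    rw [if_neg h.not_gt, if_pos h, max_eq_left this, oddKer_neg (by linarith), neg_sub]

theorem exists_lipschitz_truncVelocity (hf : IsKernel f) {L : NNReal} (hL : LipschitzWith L dU)
    {l : ℝ} (hl : 0 < l) (R : ℝ) :
    ∃ K, LipschitzWith K (truncVelocity c f dU b l R) := by
  have hev : ∀ i : ι, LipschitzWith 1 fun x : ι → ℝ => x i := fun i => LipschitzWith.eval i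
  obtain ⟨M, hM⟩ := hf.lipschitz hl
  have hfl : LipschitzWith M fun s => f (max s l) := by
    have h1 : LipschitzWith 1 fun s : ℝ => max s l := LipschitzWith.id.max_const l
    have h2 := hM.comp (h1.lipschitzOnWith (s := univ)) (fun s _ => le_max_right s l)
    rw [mul_one] at h2
    exact lipschitzOnWith_univ.1 h2
  have hmul : ∀ (r : ℝ) {g : (ι → ℝ) → ℝ}, (∃ K, LipschitzWith K g) →
      ∃ K, LipschitzWith K fun x => r * g x := fun r g ⟨K, hK⟩ =>
    ⟨_, (lipschitzWith_smul r).comp hK⟩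
  have hsum : ∀ (s : Finset ι) {g : ι → (ι → ℝ) → ℝ}, (∀ k, ∃ K, LipschitzWith K (g k)) →
      ∃ K, LipschitzWith K fun x => ∑ k ∈ s, g k x := by
    intro s g hg
    induction s using Finset.induction_on with
    | empty => exact ⟨0, by simp⟩
    | insert k s hk ih =>
      obtain ⟨K₁, h₁⟩ := hg k
      obtain ⟨K₂, h₂⟩ := ih
      exact ⟨_, by simpa [Finset.sum_insert hk] using h₁.add h₂⟩
  have hcomp : ∀ i, ∃ K, LipschitzWith K fun x => truncVelocity c f dU b l R x i := by
    intro i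
    have h1 : ∃ K, LipschitzWith K fun x : ι → ℝ => c * (b i * ∑ k, b k *
        (if k < i then f (max (x i - x k) l) else
        if i < k then -f (max (x k - x i) l) else 0)) := by
      refine hmul c (hmul (b i) (hsum _ fun k => hmul (b k) ?_))
      split_ifs
      · exact ⟨_, hfl.comp ((hev i).sub (hev k))⟩
      · exact ⟨_, (hfl.comp ((hev k).sub (hev i))).neg⟩
      · exact ⟨0, LipschitzWith.const' 0⟩
    have h2 : ∃ K, LipschitzWith K fun x : ι → ℝ => b i * dU (max (min (x i) R) (-R)) :=
      hmul (b i) ⟨_, hL.comp (((hev i).min_const R).max_const (-R))⟩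
    obtain ⟨K₁, h₁⟩ := h1
    obtain ⟨K₂, h₂⟩ := h2
    exact ⟨_, h₁.sub h₂⟩
  choose K hK using hcomp
  refine ⟨∑ i, K i, ?_⟩
  refine LipschitzWith.of_dist_le_mul fun x y => ?_
  rw [dist_pi_le_iff (by positivity)]
  exact fun i => ((hK i).weaken (Finset.single_le_sum (f := K) (fun j _ => zero_le)
    (Finset.mem_univ i))).dist_le_mul x y

theorem exists_bound_truncVelocity (hf : IsKernel f) (hU : Continuous dU) (hb : IsCharge b)
    {l : ℝ} (hl : 0 < l) {R : ℝ} (hR : 0 ≤ R) :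
    ∃ M : NNReal, ∀ x, ‖truncVelocity c f dU b l R x‖ ≤ M := by
  obtain ⟨B, hB⟩ := (isCompact_Icc (a := -R) (b := R)).exists_bound_of_continuousOn hU.continuousOn
  have hB0 : 0 ≤ B := (norm_nonneg _).trans (hB 0 ⟨by linarith, hR⟩)
  have hfl := hf.nonneg l hl
  refine ⟨⟨|c| * (Fintype.card ι * f l) + B, by positivity⟩, fun x => ?_⟩
  change _ ≤ |c| * (Fintype.card ι * f l) + B
  rw [pi_norm_le_iff_of_nonneg (by positivity)]
  intro i
  unfold truncVelocity
  refine (norm_sub_le _ _).trans (add_le_add ?_ ?_)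
  · rw [norm_mul, Real.norm_eq_abs]
    refine mul_le_mul_of_nonneg_left ?_ (abs_nonneg c)
    rw [norm_mul, Real.norm_eq_abs]
    refine (mul_le_of_le_one_left (norm_nonneg _) (hb.abs_le i)).trans ?_
    refine (norm_sum_le _ _).trans ?_
    have : ∀ s, |f (max s l)| ≤ f l := fun s => by
      have h1 : l ≤ max s l := le_max_right _ _
      rw [abs_of_nonneg (hf.nonneg _ (hl.trans_le h1))]
      exact hf.anti hl (show max s l ∈ Ioi 0 from hl.trans_le h1) h1
    refine (Finset.sum_le_card_nsmul _ _ (f l) fun k _ => ?_).trans (by simp)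
    rw [norm_mul, Real.norm_eq_abs]
    refine (mul_le_of_le_one_left (norm_nonneg _) (hb.abs_le k)).trans ?_
    rw [Real.norm_eq_abs]
    split_ifs
    · exact this _
    · rw [abs_neg]; exact this _
    · simpa using hfl
  · rw [norm_mul, Real.norm_eq_abs]
    refine (mul_le_of_le_one_left (norm_nonneg _) (hb.abs_le i)).trans (hB _ ⟨le_max_right _ _, ?_⟩)
    exact max_le (min_le_right _ _) (by linarith)

/-- A bounded Lipschitz vector field has solutions on `[0,T]` for every `T`. -/
theorem exists_solution_of_bounded {E : Type*} [NormedAddCommGroup E] [NormedSpace ℝ E]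
    [CompleteSpace E] {F : E → E} {K M : NNReal} (hK : LipschitzWith K F) (hM : ∀ x, ‖F x‖ ≤ M)
    (x₀ : E) {T : ℝ} (hT : 0 ≤ T) :
    ∃ α : ℝ → E, α 0 = x₀ ∧ ∀ t ∈ Icc 0 T, HasDerivWithinAt α (F (α t)) (Icc 0 T) t := by
  -- A field bounded by `M` cannot leave the ball of radius `M * T` before time `T`, so no smallness
  -- of `T` is needed.
  have : IsPicardLindelof (fun _ => F) (⟨0, le_rfl, hT⟩ : Icc 0 T) x₀ (M * ⟨T, hT⟩) 0 M K := by
    refine ⟨fun t _ => hK.lipschitzOnWith, fun x _ => continuousOn_const, fun t _ x _ => hM x, ?_⟩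
    simp only [sub_zero, sub_self, NNReal.coe_zero, max_eq_left hT]
    exact le_rfl
  exact this.exists_eq_forall_mem_Icc_hasDerivWithinAt (Metric.mem_closedBall_self le_rfl)

end Existence

/-! ### Maximal flows up to the first collision -/

section MaximalFlow

variable {ι : Type*} [Fintype ι] [LinearOrder ι] {c : ℝ} {f dU : ℝ → ℝ} {b : ι → ℝ}

/-- The configurations that are not affected by the truncation at level `N`. -/
def Inside (b : ι → ℝ) (N : ℕ) (x : ι → ℝ) : Prop :=
  (∀ i j, i < j → b i ≠ 0 → b j ≠ 0 → 1 / ((N : ℝ) + 1) < x j - x i) ∧ ∀ i, |x i| < N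

omit [Fintype ι] in
theorem Inside.mono {N M : ℕ} (h : N ≤ M) {x : ι → ℝ} (hx : Inside b N x) : Inside b M x := by
  have h' : (N : ℝ) ≤ M := by exact_mod_cast h
  refine ⟨fun i j hij hi hj => lt_of_le_of_lt ?_ (hx.1 i j hij hi hj),
    fun i => (hx.2 i).trans_le h'⟩
  exact one_div_le_one_div_of_le (by positivity) (by linarith)

theorem isOpen_inside (b : ι → ℝ) (N : ℕ) : IsOpen {x | Inside b N x} := by
  have : {x | Inside b N x} = (⋂ i, ⋂ j, {x : ι → ℝ | i < j → b i ≠ 0 → b j ≠ 0 →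
      1 / ((N : ℝ) + 1) < x j - x i}) ∩ ⋂ i, {x : ι → ℝ | |x i| < N} := by
    ext x
    simp [Inside]
  rw [this]
  refine IsOpen.inter (isOpen_iInter_of_finite fun i => isOpen_iInter_of_finite fun j => ?_)
    (isOpen_iInter_of_finite fun i => ?_)
  · by_cases h : i < j ∧ b i ≠ 0 ∧ b j ≠ 0
    · simp only [h.1, h.2.1, h.2.2, not_false_eq_true, true_imp_iff, ne_eq]
      exact isOpen_lt continuous_const ((continuous_apply j).sub (continuous_apply i))
    · convert isOpen_univ
      ext x
      simp only [mem_ofPred_eq, mem_univ, iff_true]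
      exact fun h1 h2 h3 => absurd ⟨h1, h2, h3⟩ h
  · exact isOpen_lt ((continuous_apply i).abs) continuous_const

theorem Ordered.exists_inside {x : ι → ℝ} (hx : Ordered b x) : ∃ N, Inside b N x := by
  have h1 : ∀ p : ι × ι, ∃ N : ℕ, p.1 < p.2 → b p.1 ≠ 0 → b p.2 ≠ 0 →
      1 / ((N : ℝ) + 1) < x p.2 - x p.1 := by
    intro p
    by_cases h : p.1 < p.2 ∧ b p.1 ≠ 0 ∧ b p.2 ≠ 0
    · obtain ⟨N, hN⟩ := exists_nat_one_div_lt (sub_pos.2 (hx p.1 p.2 h.1 h.2.1 h.2.2))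
      exact ⟨N, fun _ _ _ => hN⟩
    · exact ⟨0, fun h1 h2 h3 => absurd ⟨h1, h2, h3⟩ h⟩
  have h2 : ∀ i, ∃ N : ℕ, |x i| < N := fun i => exists_nat_gt _
  choose N hN using h1
  choose M hM using h2
  refine ⟨∑ p, N p + ∑ i, M i, fun i j hij hi hj => ?_, fun i => ?_⟩
  · refine lt_of_le_of_lt ?_ (hN (i, j) hij hi hj)
    apply one_div_le_one_div_of_le (by positivity)
    have := Finset.single_le_sum (f := N) (fun _ _ => Nat.zero_le _) (Finset.mem_univ (i, j))
    have : N (i, j) ≤ ∑ p, N p + ∑ i, M i := by lia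
    have : (N (i, j) : ℝ) ≤ ((∑ p, N p + ∑ i, M i : ℕ) : ℝ) := by exact_mod_cast this
    linarith
  · refine (hM i).trans_le ?_
    have := Finset.single_le_sum (f := M) (fun _ _ => Nat.zero_le _) (Finset.mem_univ i)
    have : M i ≤ ∑ p, N p + ∑ i, M i := by lia
    exact_mod_cast this

/-- The flow from an ordered configuration exists globally or until particles collide. -/
theorem exists_maximal_flow (hf : IsKernel f) (hc : 0 ≤ c) (hb : IsCharge b) {L : NNReal}
    (hL : LipschitzWith L dU) {x₀ : ι → ℝ} (hx₀ : Ordered b x₀) :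
    (∃ y : ℝ → ι → ℝ, y 0 = x₀ ∧ ContinuousOn y (Ici 0) ∧ Flow c f dU b y (Ioi 0)) ∨
    ∃ (y : ℝ → ι → ℝ) (T : ℝ), 0 < T ∧ y 0 = x₀ ∧ ContinuousOn y (Icc 0 T) ∧
      Flow c f dU b y (Ioo 0 T) ∧ ¬ Ordered b (y T) := by
  classical
  have hl : ∀ N : ℕ, (0 : ℝ) < 1 / ((N : ℝ) + 1) := fun N => by positivity
  have hLip := fun N : ℕ => exists_lipschitz_truncVelocity (c := c) (b := b) hf hL (hl N) (N : ℝ)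
  choose K hK using hLip
  have hsol : ∀ N : ℕ, ∃ α : ℝ → ι → ℝ, α 0 = x₀ ∧ ∀ t ∈ Icc (0 : ℝ) N, HasDerivWithinAt α
      (truncVelocity c f dU b (1 / ((N : ℝ) + 1)) N (α t)) (Icc (0 : ℝ) N) t := fun N => by
    obtain ⟨M, hM⟩ := exists_bound_truncVelocity (c := c) hf hL.continuous hb (hl N)
      (Nat.cast_nonneg N)
    exact exists_solution_of_bounded (hK N) hM x₀ (Nat.cast_nonneg N)
  choose Y hY0 hYd using hsol
  have hYc : ∀ N, ContinuousOn (Y N) (Icc (0 : ℝ) N) := fun N t ht =>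
    (hYd N t ht).continuousWithinAt
  have htr : ∀ {N M : ℕ} {x : ι → ℝ}, N ≤ M → Inside b N x →
      truncVelocity c f dU b (1 / ((M : ℝ) + 1)) M x = velocity c f dU b x := fun h hx =>
    truncVelocity_eq (hl _) (fun i j hij hi hj => ((hx.mono h).1 i j hij hi hj).le)
      fun i => ((hx.mono h).2 i).le
  have huniq : ∀ (M : ℕ) {α β : ℝ → ι → ℝ} {t : ℝ}, ContinuousOn α (Icc 0 t) →
      (∀ s ∈ Ico 0 t, HasDerivWithinAt α (truncVelocity c f dU b (1 / ((M : ℝ) + 1)) M (α s))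
        (Ici s) s) → ContinuousOn β (Icc 0 t) →
      (∀ s ∈ Ico 0 t, HasDerivWithinAt β (truncVelocity c f dU b (1 / ((M : ℝ) + 1)) M (β s))
        (Ici s) s) → α 0 = β 0 → EqOn α β (Icc 0 t) := fun M α β t h1 h2 h3 h4 h5 =>
    ODE_solution_unique_of_mem_Icc_right (v := fun _ =>
      truncVelocity c f dU b (1 / ((M : ℝ) + 1)) M) (s := fun _ => univ) (K := K M)
      (fun _ _ => (hK M).lipschitzOnWith) h1 h2 (fun _ _ => mem_univ _) h3 h4
      (fun _ _ => mem_univ _) h5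
  have hYr : ∀ N : ℕ, ∀ s ∈ Ico (0 : ℝ) N, HasDerivWithinAt (Y N)
      (truncVelocity c f dU b (1 / ((N : ℝ) + 1)) N (Y N s)) (Ici s) s := fun N s hs =>
    (hYd N s ⟨hs.1, hs.2.le⟩).mono_of_mem_nhdsWithin (Icc_mem_nhdsGE_of_mem hs)
  -- As long as the solution of level `N` stays inside level `N` the truncation is inactive: it is a
  -- genuine flow, and it agrees with the solutions of other levels that are good up to the same
  -- time.
  set Good : ℕ → ℝ → Prop := fun N t => 0 ≤ t ∧ t < N ∧ ∀ s ∈ Icc 0 t, Inside b N (Y N s)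
    with hGood
  have hmono : ∀ {N s t}, Good N t → 0 ≤ s → s ≤ t → Good N s := fun h h0 hst =>
    ⟨h0, hst.trans_lt h.2.1, fun r hr => h.2.2 r ⟨hr.1, hr.2.trans hst⟩⟩
  have hagree' : ∀ {N M s}, N ≤ M → Good N s → Good M s → EqOn (Y N) (Y M) (Icc 0 s) := by
    intro N M s hNM hN hM
    have hNM' : (N : ℝ) ≤ M := by exact_mod_cast hNM
    refine huniq M ((hYc N).mono (Icc_subset_Icc_right hN.2.1.le)) (fun r hr => ?_)
      ((hYc M).mono (Icc_subset_Icc_right hM.2.1.le))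
      (fun r hr => hYr M r ⟨hr.1, hr.2.trans hM.2.1⟩) ((hY0 N).trans (hY0 M).symm)
    have h1 := hYr N r ⟨hr.1, hr.2.trans hN.2.1⟩
    have h2 := hN.2.2 r ⟨hr.1, hr.2.le⟩
    rw [htr le_rfl h2] at h1
    rwa [htr hNM h2]
  have hagree : ∀ {N M s}, Good N s → Good M s → EqOn (Y N) (Y M) (Icc 0 s) := by
    intro N M s hN hM
    rcases le_total N M with h | h
    · exact hagree' h hN hM
    · exact (hagree' h hM hN).symm
  have hext : ∀ {N t}, Good N t → ∃ t' > t, Good N t' := by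
    intro N t h
    have h1 : ∀ᶠ s in 𝓝[Icc (0 : ℝ) N] t, Inside b N (Y N s) :=
      (hYc N t ⟨h.1, h.2.1.le⟩).eventually ((isOpen_inside b N).mem_nhds (h.2.2 t ⟨h.1, le_rfl⟩))
    have h2 : ∀ᶠ s in 𝓝[≥] t, Inside b N (Y N s) :=
      h1.filter_mono (nhdsWithin_le_iff.2 (Icc_mem_nhdsGE_of_mem ⟨h.1, h.2.1⟩))
    obtain ⟨u, hu, hu'⟩ := mem_nhdsGE_iff_exists_Ico_subset.1 h2
    have hu : t < u := hu
    refine ⟨min ((t + u) / 2) ((t + N) / 2), lt_min (by linarith) (by linarith [h.2.1]),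
      le_min (by linarith [h.1]) (by linarith [h.1, h.2.1]),
      (min_le_right _ _).trans_lt (by linarith [h.2.1]), fun s hs => ?_⟩
    rcases le_or_gt s t with hst | hst
    · exact h.2.2 s ⟨hs.1, hst⟩
    · exact hu' ⟨hst.le, (hs.2.trans (min_le_left _ _)).trans_lt (by linarith)⟩
  set G : Set ℝ := {t | ∃ N, Good N t} with hG
  have hG0 : (0 : ℝ) ∈ G := by
    obtain ⟨N, hN⟩ := hx₀.exists_inside
    refine ⟨N + 1, le_rfl, by push_cast; positivity, fun s hs => ?_⟩
    have : s = 0 := le_antisymm hs.2 hs.1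
    rw [this, hY0]
    exact hN.mono (Nat.le_succ N)
  set y₀ : ℝ → ι → ℝ := fun t => if h : ∃ N, Good N t then Y h.choose t else 0 with hy₀
  have hyY : ∀ {N t}, Good N t → ∀ s ∈ Icc 0 t, y₀ s = Y N s := by
    intro N t h s hs
    have hs' := hmono h hs.1 hs.2
    have hex : ∃ N, Good N s := ⟨N, hs'⟩
    simp only [hy₀, dif_pos hex]
    exact hagree hex.choose_spec hs' ⟨hs.1, le_rfl⟩
  have hyd : ∀ t ∈ G, 0 < t → HasDerivAt y₀ (velocity c f dU b (y₀ t)) t := by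
    rintro t ⟨N, hN⟩ h0
    obtain ⟨t', htt', hN'⟩ := hext hN
    have h1 : y₀ =ᶠ[𝓝 t] Y N := by
      filter_upwards [Icc_mem_nhds h0 htt'] with s hs using hyY hN' s hs
    have h2 := (hYd N t ⟨h0.le, hN.2.1.le⟩).hasDerivAt (Icc_mem_nhds h0 hN.2.1)
    rw [htr le_rfl (hN.2.2 t ⟨h0.le, le_rfl⟩), ← h1.eq_of_nhds] at h2
    exact h2.congr_of_eventuallyEq h1
  have hyr0 : HasDerivWithinAt y₀ (velocity c f dU b (y₀ 0)) (Ici 0) 0 := by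
    obtain ⟨N, hN⟩ := hG0
    obtain ⟨t', htt', hN'⟩ := hext hN
    have h1 : y₀ =ᶠ[𝓝[≥] 0] Y N := by
      filter_upwards [Icc_mem_nhdsGE htt'] with s hs using hyY hN' s hs
    have h2 := hYr N 0 ⟨le_rfl, hN.2.1⟩
    rw [htr le_rfl (hN.2.2 0 ⟨le_rfl, le_rfl⟩), ← hyY hN 0 ⟨le_rfl, le_rfl⟩] at h2
    exact h2.congr_of_eventuallyEq h1 (hyY hN 0 ⟨le_rfl, le_rfl⟩)
  have hyr : ∀ t ∈ G, HasDerivWithinAt y₀ (velocity c f dU b (y₀ t)) (Ici t) t := by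
    intro t ht
    have h0 : 0 ≤ t := ht.choose_spec.1
    rcases h0.eq_or_lt with h | h
    · rw [← h]; exact hyr0
    · exact (hyd t ht h).hasDerivWithinAt
  have hyc : ∀ t ∈ G, ContinuousWithinAt y₀ (Ici 0) t := by
    intro t ht
    have h0 : 0 ≤ t := ht.choose_spec.1
    rcases h0.eq_or_lt with h | h
    · rw [← h]; exact hyr0.continuousWithinAt
    · exact (hyd t ht h).continuousAt.continuousWithinAt
  have hyin : ∀ {N t}, Good N t → Inside b N (y₀ t) := fun {N t} h => by
    rw [hyY h t ⟨h.1, le_rfl⟩]; exact h.2.2 t ⟨h.1, le_rfl⟩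
  have hyo : ∀ t ∈ G, Ordered b (y₀ t) := by
    rintro t ⟨N, hN⟩ i j hij hi hj
    have := (hyin hN).1 i j hij hi hj
    linarith [hl N]
  have hy00 : y₀ 0 = x₀ := by
    obtain ⟨N, hN⟩ := hG0
    rw [hyY hN 0 ⟨le_rfl, le_rfl⟩, hY0]
  have hflow : Flow c f dU b y₀ (G ∩ Ioi 0) :=
    ⟨fun t ht => hyo t ht.1, fun t ht i => (hasDerivAt_pi.1 (hyd t ht.1 ht.2)) i⟩
  by_cases hbdd : BddAbove G
  · right
    set T := sSup G with hT
    have hTG : T ∉ G := by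
      rintro ⟨N, hN⟩
      obtain ⟨t', htt', hN'⟩ := hext hN
      exact absurd (le_csSup hbdd ⟨N, hN'⟩) (not_le.2 htt')
    have hT0 : 0 < T := by
      rcases (le_csSup hbdd hG0).eq_or_lt with h | h
      · rw [← hT] at h; rw [h] at hG0; exact absurd hG0 hTG
      · exact h
    have hlt : ∀ t ∈ Ico 0 T, t ∈ G := by
      intro t ht
      obtain ⟨s, hs, hts⟩ := exists_lt_of_lt_csSup ⟨0, hG0⟩ ht.2
      obtain ⟨N, hN⟩ := hs
      exact ⟨N, hmono hN ht.1 hts.le⟩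
    -- The interval starts at `T / 2` because `Flow` on a half-open interval requires a two-sided
    -- derivative at its left end, which is not available at time 0.
    obtain ⟨X, hX⟩ := (hflow.mono (J := Ico (T / 2) T) fun t ht =>
      ⟨hlt t ⟨by linarith [ht.1], ht.2⟩, by simp only [mem_Ioi]; linarith [ht.1]⟩).exists_limit hf hc hb hL
      (by linarith)
    set y : ℝ → ι → ℝ := fun t => if t < T then y₀ t else X with hy
    have hyy : ∀ t, t < T → y t = y₀ t := fun t ht => by simp [hy, ht]
    have hyT : y T = X := by simp [hy]
    have hev : ∀ t, t < T → y =ᶠ[𝓝 t] y₀ := fun t ht => by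
      filter_upwards [Iio_mem_nhds ht] with s hs using hyy s hs
    have hycont : ContinuousOn y (Icc 0 T) := by
      intro t ht
      rcases ht.2.lt_or_eq with h | h
      · have h1 := (hyc t (hlt t ⟨ht.1, h⟩)).mono (fun s (hs : s ∈ Icc 0 T) => hs.1)
        exact h1.congr_of_eventuallyEq ((hev t h).filter_mono nhdsWithin_le_nhds) (hyy t h)
      · rw [h]
        have h1 : Tendsto y (𝓝[<] T) (𝓝 X) := by
          refine Tendsto.congr' (f₁ := y₀) ?_ (tendsto_pi_nhds.2 hX)
          filter_upwards [self_mem_nhdsWithin] with s hs using (hyy s hs).symm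
        have h2 : ContinuousWithinAt y (Iio T) T := by
          unfold ContinuousWithinAt; rw [hyT]; exact h1
        have h3 := h2.insert
        rw [Iio_insert] at h3
        exact h3.mono fun s hs => hs.2
    have hyr' : ∀ s ∈ Ico 0 T, HasDerivWithinAt y (velocity c f dU b (y s)) (Ici s) s := by
      intro s hs
      rw [hyy s hs.2]
      exact (hyr s (hlt s hs)).congr_of_eventuallyEq
        ((hev s hs.2).filter_mono nhdsWithin_le_nhds) (hyy s hs.2)
    have hy0 : y 0 = x₀ := by rw [hyy 0 hT0, hy00]
    refine ⟨y, T, hT0, hy0, hycont, ⟨fun t ht => ?_, fun t ht i => ?_⟩, ?_⟩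
    · rw [hyy t ht.2]; exact hyo t (hlt t ⟨ht.1.le, ht.2⟩)
    · have h1 := (hyd t (hlt t ⟨ht.1.le, ht.2⟩) ht.1).congr_of_eventuallyEq (hev t ht.2)
      rw [← hyy t ht.2] at h1
      exact (hasDerivAt_pi.1 h1) i
    -- If the limit were ordered, compactness would put the whole trajectory inside one level.
    -- Uniqueness then identifies it with the truncated solution of a level larger than `T`, which
    -- makes `T` itself good, against maximality.
    · intro hord
      have hcover : Icc 0 T ⊆ ⋃ N : ℕ, (y ⁻¹' {x | Inside b N x}) := by
        intro t ht
        have : Ordered b (y t) := by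
          rcases ht.2.lt_or_eq with h | h
          · rw [hyy t h]; exact hyo t (hlt t ⟨ht.1, h⟩)
          · rw [h]; exact hord
        obtain ⟨N, hN⟩ := this.exists_inside
        exact mem_iUnion.2 ⟨N, hN⟩
      have hopen : ∀ N : ℕ, ∃ O : Set ℝ, IsOpen O ∧
          y ⁻¹' {x | Inside b N x} ∩ Icc 0 T = O ∩ Icc 0 T := fun N =>
        (continuousOn_iff'.1 hycont) _ (isOpen_inside b N)
      choose O hO hOy using hopen
      obtain ⟨N, hN⟩ : ∃ N : ℕ, ∀ t ∈ Icc 0 T, Inside b N (y t) := by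
        obtain ⟨S, hS⟩ := (isCompact_Icc (a := (0 : ℝ)) (b := T)).elim_finite_subcover O hO
          (fun t ht => by
            obtain ⟨N, hN⟩ := mem_iUnion.1 (hcover ht)
            exact mem_iUnion.2 ⟨N, ((hOy N).subset ⟨hN, ht⟩).1⟩)
        refine ⟨∑ N ∈ S, N, fun t ht => ?_⟩
        obtain ⟨N, hNS, hN⟩ := mem_iUnion₂.1 (hS ht)
        have h1 : Inside b N (y t) := ((hOy N).symm.subset ⟨hN, ht⟩).1
        exact h1.mono (Finset.single_le_sum (f := fun N : ℕ => N) (fun _ _ => Nat.zero_le _) hNS)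
      obtain ⟨M₀, hM₀⟩ := exists_nat_gt T
      set M := max N M₀
      have hTM : T < (M : ℝ) := hM₀.trans_le (by exact_mod_cast le_max_right _ _)
      have heq := huniq M hycont (fun s hs => by
        rw [htr (le_max_left N M₀) (hN s ⟨hs.1, hs.2.le⟩)]
        exact hyr' s hs) ((hYc M).mono (Icc_subset_Icc_right hTM.le))
        (fun s hs => hYr M s ⟨hs.1, hs.2.trans hTM⟩) (hy0.trans (hY0 M).symm)
      exact hTG ⟨M, hT0.le, hTM, fun s hs => by
        rw [← heq hs]; exact (hN s hs).mono (le_max_left _ _)⟩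
  · left
    have hall : ∀ t, 0 ≤ t → t ∈ G := by
      intro t ht
      by_contra h
      refine hbdd ⟨t, fun s ⟨N, hs⟩ => ?_⟩
      by_contra hst
      exact h ⟨N, hmono hs ht (not_le.1 hst).le⟩
    exact ⟨y₀, hy00, fun t ht => hyc t (hall t ht), hflow.mono fun t ht => ⟨hall t (le_of_lt ht), ht⟩⟩

end MaximalFlow

/-! ### Existence of particle solutions -/

section GlobalSolution

variable {n : ℕ} {c : ℝ} {f dU : ℝ → ℝ}

/-- A solution of the particle system on `[0,∞)` with collision times in the finite set `S`. -/
structure IsGlobalSolution (c : ℝ) (f dU : ℝ → ℝ) (x₀ : Fin n → ℝ) (b₀ : Fin n → ℤ)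
    (x : ℝ → Fin n → ℝ) (b : ℝ → Fin n → ℤ) (S : Set ℝ) : Prop where
  finite : S.Finite
  pos : S ⊆ Ioi 0
  mem : ∀ t ≥ 0, (x t, b t) ∈ stateSpace n
  initial_x : x 0 = x₀
  initial_b : b 0 = b₀
  continuous : ContinuousOn x (Ici 0)
  jump : ∀ i, (∀ t ≥ 0, b t i = b₀ i) ∨
    (b₀ i ≠ 0 ∧ ∃ τ ∈ S, (∀ t ∈ Ico 0 τ, b t i = b₀ i) ∧ ∀ t ≥ τ, b t i = 0)
  annihilation : ∀ t > 0, ∃ β : Fin n → ℤ, (∀ᶠ s in 𝓝[<] t, b s = β) ∧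
    ∀ y : ℝ, ∑ i with x t i = y, b t i = ∑ i with x t i = y, β i
  ode : ∀ t > 0, t ∉ S → ∀ i,
    HasDerivAt (fun s => x s i) (velocity c f dU (fun k => (b t k : ℝ)) (x t) i) t

theorem isCharge_cast {b : Fin n → ℤ} (h : ∀ i, b i = -1 ∨ b i = 0 ∨ b i = 1) :
    IsCharge fun i => (b i : ℝ) := fun i => by
  rcases h i with h | h | h <;> simp [h]

theorem ordered_of_mem {x : Fin n → ℝ} {b : Fin n → ℤ} (h : (x, b) ∈ stateSpace n) :
    Ordered (fun i => (b i : ℝ)) x := fun i j hij hi hj =>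
  h.2 i j hij (mul_ne_zero (Int.cast_ne_zero.1 hi) (Int.cast_ne_zero.1 hj))

/-- Induction on the number of charged particles: the flow runs until a collision, at least one
charge is removed there, and the solution provided by the induction hypothesis is attached after a
shift in time. Hence there are only finitely many collision times. -/
theorem exists_isGlobalSolution (hf : IsKernel f) (hc : 0 ≤ c) {L : NNReal}
    (hL : LipschitzWith L dU) :
    ∀ (m : ℕ) (x₀ : Fin n → ℝ) (b₀ : Fin n → ℤ), (x₀, b₀) ∈ stateSpace n →
      (Finset.univ.filter fun i => b₀ i ≠ 0).card ≤ m →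
      ∃ x b S, IsGlobalSolution c f dU x₀ b₀ x b S := by
  intro m
  induction m with
  | zero =>
    intro x₀ b₀ h₀ hm
    have hz : ∀ i, b₀ i = 0 := by
      intro i
      have := Finset.card_eq_zero.1 (Nat.le_zero.1 hm)
      by_contra h
      have h1 : i ∈ (Finset.univ.filter fun i => b₀ i ≠ 0) := by simp [h]
      rw [this] at h1
      simp at h1
    refine ⟨fun _ => x₀, fun _ => b₀, ∅, finite_empty, empty_subset _, fun _ _ => h₀, rfl, rfl,
      continuousOn_const, fun i => Or.inl fun _ _ => rfl,
      fun t _ => ⟨b₀, Eventually.of_forall fun _ => rfl, fun _ => rfl⟩, fun t _ _ i => ?_⟩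
    have : velocity c f dU (fun k => (b₀ k : ℝ)) x₀ i = 0 := by simp [velocity, hz]
    rw [this]
    exact hasDerivAt_const t _
  | succ m ih =>
    intro x₀ b₀ h₀ hm
    have hb := isCharge_cast h₀.1
    have hint : ∀ i, (b₀ i : ℝ) ≠ 0 ↔ b₀ i ≠ 0 := fun i => Int.cast_ne_zero
    rcases exists_maximal_flow hf hc hb hL (ordered_of_mem h₀) with
      ⟨y, hy0, hyc, hy⟩ | ⟨y, T, hT, hy0, hyc, hy, hno⟩
    · refine ⟨y, fun _ => b₀, ∅, finite_empty, empty_subset _, fun t ht => ⟨h₀.1, ?_⟩, hy0, rfl,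
        hyc, fun i => Or.inl fun _ _ => rfl,
        fun t _ => ⟨b₀, Eventually.of_forall fun _ => rfl, fun _ => rfl⟩,
        fun t ht _ i => hy.ode t ht i⟩
      intro i j hij hij'
      have hi : (b₀ i : ℝ) ≠ 0 := (hint i).2 (left_ne_zero_of_mul hij')
      have hj : (b₀ j : ℝ) ≠ 0 := (hint j).2 (right_ne_zero_of_mul hij')
      rcases (show 0 ≤ t from ht).eq_or_lt with h | h
      · rw [← h, hy0]; exact h₀.2 i j hij hij'
      · exact hy.order t h i j hij hi hj
    · have hyIco := hy.mono (J := Ico (T / 2) T) fun t ht => ⟨by linarith [ht.1], ht.2⟩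
      obtain ⟨d, hd, hgap⟩ := hyIco.exists_sameGap hf hc hb hL
      have hlim : ∀ i, Tendsto (fun t => y t i) (𝓝[<] T) (𝓝 (y T i)) := by
        intro i
        have h1 : ContinuousWithinAt y (Icc 0 T) T := hyc T ⟨hT.le, le_rfl⟩
        have h2 := (tendsto_pi_nhds.1 h1.tendsto) i
        exact h2.mono_left (nhdsWithin_le_iff.2 (mem_of_superset (Ioo_mem_nhdsLT hT)
          Ioo_subset_Icc_self))
      have hnear : ∀ᶠ t in 𝓝[<] T, t ∈ Ico (T / 2) T := by
        filter_upwards [Ioo_mem_nhdsLT (show T / 2 < T by linarith)] with t ht using ⟨ht.1.le, ht.2⟩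
      set X := y T with hX
      have hmono : ∀ i j, i < j → (b₀ i : ℝ) ≠ 0 → (b₀ j : ℝ) ≠ 0 → X i ≤ X j :=
        fun i j hij hi hj => le_of_tendsto_of_tendsto (hlim i) (hlim j) (by
          filter_upwards [hnear] with t ht using (hyIco.order t ht i j hij hi hj).le)
      have hgapX : SameGap (fun i => (b₀ i : ℝ)) X d := fun i j hij hs =>
        ge_of_tendsto ((hlim j).sub (hlim i)) (by
          filter_upwards [hnear] with t ht using hgap t ht i j hij hs)
      -- In a cluster of nonzero total charge only the first charge survives, and by `cluster_sum`
      -- it equals the total charge; neutral clusters disappear altogether.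
      set keep : Fin n → Prop := fun i => b₀ i ≠ 0 ∧ (∀ j < i, b₀ j ≠ 0 → X j ≠ X i) ∧
        ∑ j with X j = X i, b₀ j ≠ 0 with hkeep
      classical
      set b₁ : Fin n → ℤ := fun i => if keep i then b₀ i else 0 with hb₁
      have hb₁keep : ∀ i, b₁ i ≠ 0 → keep i := fun i h => by
        by_contra h'
        exact h (by simp only [hb₁, if_neg h'])
      have hmem₁ : (X, b₁) ∈ stateSpace n := by
        refine ⟨fun i => ?_, fun i j hij hij' => ?_⟩
        · simp only [hb₁]
          split_ifs
          · exact h₀.1 i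
          · simp
        · have hi := hb₁keep i (left_ne_zero_of_mul hij')
          have hj := hb₁keep j (right_ne_zero_of_mul hij')
          exact lt_of_le_of_ne (hmono i j hij ((hint i).2 hi.1) ((hint j).2 hj.1))
            (hj.2.1 i hij hi.1)
      have hcard : (Finset.univ.filter fun i => b₁ i ≠ 0).card ≤ m := by
        -- The flow stopped because two charges met. The right one is not the first charge at its
        -- position and is removed, so the number of charges drops.
        simp only [Ordered, not_forall] at hno
        obtain ⟨i, j, hij, hi, hj, hXij⟩ := hno
        have heq : X i = X j := le_antisymm (hmono i j hij hi hj) (not_lt.1 hXij)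
        have hj₁ : b₁ j = 0 := by
          by_contra h
          exact (hb₁keep j h).2.1 i hij ((hint i).1 hi) heq
        have h1 : (Finset.univ.filter fun i => b₁ i ≠ 0) ⊂ (Finset.univ.filter fun i => b₀ i ≠ 0) := by
          rw [Finset.ssubset_iff_of_subset]
          · exact ⟨j, by simpa using (hint j).1 hj, by simp [hj₁]⟩
          · intro k hk
            simp only [Finset.mem_filter, Finset.mem_univ, true_and] at hk ⊢
            exact (hb₁keep k hk).1
        have := Finset.card_lt_card h1
        lia
      have hsum₁ : ∀ z : ℝ, ∑ i with X i = z, b₁ i = ∑ i with X i = z, b₀ i := by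
        intro z
        by_cases hz : ∑ i with X i = z, b₀ i = 0
        · rw [hz]
          refine Finset.sum_eq_zero fun i hi => ?_
          simp only [Finset.mem_filter, Finset.mem_univ, true_and] at hi
          by_contra h
          have := (hb₁keep i h).2.2
          rw [hi] at this
          exact this hz
        · have hne : (Finset.univ.filter fun i => X i = z ∧ b₀ i ≠ 0).Nonempty := by
            by_contra h
            rw [Finset.not_nonempty_iff_eq_empty, Finset.filter_eq_empty_iff] at h
            refine hz (Finset.sum_eq_zero fun i hi => ?_)
            simp only [Finset.mem_filter, Finset.mem_univ, true_and] at hi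
            by_contra h'
            exact h (Finset.mem_univ i) ⟨hi, h'⟩
          set a := (Finset.univ.filter fun i => X i = z ∧ b₀ i ≠ 0).min' hne
          have ha : X a = z ∧ b₀ a ≠ 0 := by simpa using Finset.min'_mem _ hne
          have hmin : ∀ k, X k = z → b₀ k ≠ 0 → a ≤ k := fun k h1 h2 =>
            Finset.min'_le _ k (by simp [h1, h2])
          have hcs := cluster_sum hb hd hmono hgapX ((hint a).2 ha.2) (fun k hk hbk hXk =>
            absurd (hmin k (hXk.trans ha.1) ((hint k).1 hbk)) (not_le.2 hk))
          rw [sum_cluster, ha.1] at hcs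
          have hcs' : ∑ i with X i = z, b₀ i = b₀ a := by
            have h1 : ((∑ i with X i = z, b₀ i : ℤ) : ℝ) = ∑ i with X i = z, (b₀ i : ℝ) := by
              push_cast; rfl
            have h2 : ∑ i with X i = z, (b₀ i : ℝ) = (b₀ a : ℝ) := by
              rcases hcs with h | h
              · rw [← h1] at h
                exact absurd (by exact_mod_cast h) hz
              · exact h
            rw [← h1] at h2
            exact_mod_cast h2
          rw [hcs', Finset.sum_eq_single a]
          · simp only [hb₁]
            rw [if_pos]
            refine ⟨ha.2, fun j hj hbj hXj => ?_, ?_⟩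
            · exact absurd (hmin j (hXj.trans ha.1) hbj) (not_le.2 hj)
            · rw [ha.1]; exact hz
          · intro k hk hka
            simp only [Finset.mem_filter, Finset.mem_univ, true_and] at hk
            by_contra h
            have hkk := hb₁keep k h
            have hlt : a < k := lt_of_le_of_ne (hmin k hk hkk.1) (Ne.symm hka)
            exact hkk.2.1 a hlt ha.2 (ha.1.trans hk.symm)
          · intro h
            exact absurd (by simp [ha.1]) h
      obtain ⟨x₁, c₁, S₁, h₁⟩ := ih X b₁ hmem₁ hcard
      have hne : ∀ s, s < T → ∀ᶠ r in 𝓝 s, r < T := fun s hs => Iio_mem_nhds hs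
      -- At time `T` itself the continuation is used, which makes the charges right-continuous.
      refine ⟨fun t => if t < T then y t else x₁ (t - T),
        fun t => if t < T then b₀ else c₁ (t - T), insert T ((fun s => s + T) '' S₁),
        (h₁.finite.image _).insert _, ?_, ?_, ?_, ?_, ?_, ?_, ?_, ?_⟩
      · rintro s (rfl | ⟨r, hr, rfl⟩)
        · exact hT
        · have : (0 : ℝ) < r := h₁.pos hr
          simp only [mem_Ioi]; linarith
      · intro t ht
        by_cases h : t < T
        · simp only [if_pos h]
          refine ⟨h₀.1, fun i j hij hij' => ?_⟩
          have hi : (b₀ i : ℝ) ≠ 0 := (hint i).2 (left_ne_zero_of_mul hij')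
          have hj : (b₀ j : ℝ) ≠ 0 := (hint j).2 (right_ne_zero_of_mul hij')
          rcases (show 0 ≤ t from ht).eq_or_lt with h' | h'
          · rw [← h', hy0]; exact h₀.2 i j hij hij'
          · exact hy.order t ⟨h', h⟩ i j hij hi hj
        · simp only [if_neg h]
          exact h₁.mem _ (by linarith [not_lt.1 h])
      · simp only [if_pos hT]; exact hy0
      · simp only [if_pos hT]
      · intro t ht
        rcases lt_trichotomy t T with h | h | h
        · have h1 : ContinuousWithinAt y (Ici 0) t :=
            (hyc t ⟨ht, h.le⟩).mono_of_mem_nhdsWithin (by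
              filter_upwards [self_mem_nhdsWithin, nhdsWithin_le_nhds (hne t h)] with s hs hs'
                using ⟨hs, le_of_lt hs'⟩)
          refine h1.congr_of_eventuallyEq ?_ (by simp only [if_pos h])
          filter_upwards [nhdsWithin_le_nhds (hne t h)] with s hs
          simp only [if_pos hs]
        · subst h
          have hL1 : ContinuousWithinAt (fun s => if s < t then y s else x₁ (s - t))
              (Ici 0 ∩ Iio t) t := by
            have h1 : ContinuousWithinAt y (Ici 0 ∩ Iio t) t :=
              (hyc t ⟨ht, le_rfl⟩).mono fun s hs => ⟨hs.1, le_of_lt hs.2⟩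
            refine h1.congr (fun s hs => by simp only [if_pos (show s < t from hs.2)]) ?_
            simp only [lt_irrefl, if_false, sub_self, h₁.initial_x]
            rfl
          have hR1 : ContinuousWithinAt (fun s => if s < t then y s else x₁ (s - t))
              (Ici 0 ∩ Ici t) t := by
            have h1 : ContinuousWithinAt (fun s => x₁ (s - t)) (Ici 0 ∩ Ici t) t := by
              refine ContinuousWithinAt.comp (t := Ici 0) (g := x₁) ?_
                (continuous_id.sub continuous_const).continuousWithinAt
                (fun s hs => by simpa using hs.2)
              simp only [sub_self]
              exact h₁.continuous 0 (mem_Ici.2 le_rfl)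
            exact h1.congr (fun s hs => by simp only [if_neg (not_lt.2 (show t ≤ s from hs.2))])
              (by simp only [lt_irrefl, if_false])
          have := hL1.union hR1
          refine this.mono fun s hs => ?_
          rcases lt_or_ge s t with h | h
          · exact Or.inl ⟨hs, h⟩
          · exact Or.inr ⟨hs, h⟩
        · have h1 : ContinuousAt (fun s => x₁ (s - T)) t := by
            refine ContinuousAt.comp (g := x₁) ?_ (continuous_id.sub continuous_const).continuousAt
            exact (h₁.continuous (t - T) (by simp only [mem_Ici]; linarith)).continuousAt
              (Ici_mem_nhds (by linarith))
          refine (h1.congr ?_).continuousWithinAt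
          filter_upwards [Ioi_mem_nhds h] with s hs
          simp only [if_neg (not_lt.2 (show T < s from hs).le)]
      · intro i
        have hb₁i : b₁ i = b₀ i ∨ b₁ i = 0 := by
          simp only [hb₁]; split_ifs <;> simp
        by_cases hbi : b₀ i = 0
        · left
          intro t ht
          by_cases h : t < T
          · simp only [if_pos h]
          · simp only [if_neg h]
            have h0 : b₁ i = 0 := by rcases hb₁i with h | h <;> simp [h, hbi]
            rcases h₁.jump i with h' | h'
            · rw [h' _ (by linarith [not_lt.1 h]), h0, hbi]
            · exact absurd h0 h'.1
        · rcases hb₁i with hb₁i | hb₁i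
          · rcases h₁.jump i with h' | ⟨_, τ, hτ, h1, h2⟩
            · left
              intro t ht
              by_cases h : t < T
              · simp only [if_pos h]
              · simp only [if_neg h]
                rw [h' _ (by linarith [not_lt.1 h]), hb₁i]
            · right
              refine ⟨hbi, τ + T, Or.inr ⟨τ, hτ, rfl⟩, fun t ht => ?_, fun t ht => ?_⟩
              · by_cases h : t < T
                · simp only [if_pos h]
                · simp only [if_neg h]
                  rw [h1 _ ⟨by linarith [not_lt.1 h], by linarith [ht.2]⟩, hb₁i]
              · have hτ0 : (0 : ℝ) < τ := h₁.pos hτ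
                have h : ¬ t < T := by linarith
                simp only [if_neg h]
                exact h2 _ (by linarith)
          · right
            refine ⟨hbi, T, Or.inl rfl, fun t ht => by simp only [if_pos ht.2], fun t ht => ?_⟩
            simp only [if_neg (not_lt.2 ht)]
            rcases h₁.jump i with h' | h'
            · rw [h' _ (by linarith), hb₁i]
            · exact absurd hb₁i h'.1
      · intro t ht
        rcases lt_trichotomy t T with h | h | h
        · refine ⟨b₀, ?_, fun z => by simp only [if_pos h]⟩
          filter_upwards [nhdsWithin_le_nhds (hne t h)] with s hs
          simp only [if_pos hs]
        · subst h
          refine ⟨b₀, ?_, fun z => ?_⟩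
          · filter_upwards [self_mem_nhdsWithin] with s hs
            simp only [if_pos (show s < t from hs)]
          · simp only [lt_irrefl, if_false, sub_self, h₁.initial_x, h₁.initial_b]
            exact hsum₁ z
        · obtain ⟨β, hβ, hβ'⟩ := h₁.annihilation (t - T) (by linarith)
          refine ⟨β, ?_, fun z => ?_⟩
          · have h1 : Tendsto (fun s => s - T) (𝓝[<] t) (𝓝[<] (t - T)) :=
              tendsto_nhdsWithin_iff.2 ⟨((continuous_id.sub continuous_const).tendsto t).mono_left
                nhdsWithin_le_nhds, by
                  filter_upwards [self_mem_nhdsWithin] with s hs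
                  have : s < t := hs
                  simp only [mem_Iio]; linarith⟩
            filter_upwards [h1.eventually hβ, Ioo_mem_nhdsLT h] with s hs hs'
            simp only [if_neg (not_lt.2 hs'.1.le)]
            exact hs
          · simp only [if_neg (not_lt.2 h.le)]
            exact hβ' z
      · intro t ht htS i
        rcases lt_trichotomy t T with h | h | h
        · simp only [if_pos h]
          refine (hy.ode t ⟨ht, h⟩ i).congr_of_eventuallyEq ?_
          filter_upwards [hne t h] with s hs
          simp only [if_pos hs]
        · exact absurd (Or.inl h) htS
        · simp only [if_neg (not_lt.2 h.le)]
          have h1 := h₁.ode (t - T) (by linarith) (fun h' => htS (Or.inr ⟨t - T, h', by simp⟩)) i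
          have h2 := h1.comp_sub_const t T
          refine h2.congr_of_eventuallyEq ?_
          filter_upwards [Ioi_mem_nhds h] with s hs
          simp only [if_neg (not_lt.2 (show T < s from hs).le)]

end GlobalSolution

/-! ### Particle solutions -/

theorem Ordered.ne {ι : Type*} [LinearOrder ι] {b x : ι → ℝ} (h : Ordered b x) {i j : ι}
    (hij : i ≠ j) (hi : b i ≠ 0) (hj : b j ≠ 0) : x i ≠ x j := by
  rcases hij.lt_or_gt with h' | h'
  · exact (h i j h' hi hj).ne
  · exact (h j i h' hj hi).ne'

theorem Ordered.continuousAt_velocity {ι : Type*} [Fintype ι] [LinearOrder ι] {c : ℝ}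
    {f dU : ℝ → ℝ} {b X : ι → ℝ} (hf : IsKernel f) (hU : Continuous dU) (h : Ordered b X) (i : ι) :
    ContinuousAt (fun x => velocity c f dU b x i) X := by
  by_cases hi : b i = 0
  · simp only [velocity, hi, zero_mul, mul_zero, sub_zero]
    exact continuousAt_const
  · unfold velocity
    refine (continuousAt_const.mul (continuousAt_const.mul ?_)).sub
      (continuousAt_const.mul (hU.comp (continuous_apply i)).continuousAt)
    refine tendsto_finsetSum _ fun k _ => ?_
    by_cases hk : b k = 0
    · simp only [hk, zero_mul]
      exact tendsto_const_nhds
    · by_cases hki : i = k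
      · subst hki
        simp only [sub_self]
        exact tendsto_const_nhds
      · refine tendsto_const_nhds.mul ?_
        exact ContinuousAt.comp (g := oddKer f) (f := fun x : ι → ℝ => x i - x k)
          (hf.continuousAt_oddKer (sub_ne_zero.2 (h.ne hki hi hk)))
          ((continuous_apply i).sub (continuous_apply k)).continuousAt

section Solutions

variable {n : ℕ} {f W U : ℝ → ℝ} {x₀ : Fin n → ℝ} {b₀ : Fin n → ℤ}
  {x : ℝ → Fin n → ℝ} {b : ℝ → Fin n → ℤ}

/-- Terms with an uncharged particle vanish on both sides, and distinct charges have distinct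
positions, so `deriv W` is compared only away from 0. The self-interaction in `velocity` vanishes
because the odd extension is 0 at 0. -/
theorem velocity_eq_of_deriv (hW : ∀ s ≠ 0, deriv W s = -oddKer f s) {X : Fin n → ℝ}
    {β : Fin n → ℤ} (h : Ordered (fun k => (β k : ℝ)) X) (i : Fin n) :
    -(1 / (n : ℝ)) * ∑ j with j ≠ i, (β i : ℝ) * (β j : ℝ) * deriv W (X i - X j)
        - (β i : ℝ) * deriv U (X i) =
      velocity (1 / (n : ℝ)) f (deriv U) (fun k => (β k : ℝ)) X i := by
  unfold velocity
  congr 1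
  rw [neg_mul, ← mul_neg]
  congr 1
  rw [Finset.sum_filter, Finset.mul_sum, neg_eq_iff_eq_neg, ← Finset.sum_neg_distrib]
  refine Finset.sum_congr rfl fun j _ => ?_
  split_ifs with hji
  · by_cases hi : (β i : ℝ) = 0
    · simp [hi]
    by_cases hj : (β j : ℝ) = 0
    · simp [hj]
    rw [hW _ (sub_ne_zero.2 (h.ne hji hj hi).symm)]
    ring
  · rw [not_not.1 hji, sub_self, oddKer_zero]
    ring

/-- Local structure of a particle solution with kernel `f` in terms of flows. -/
structure Traj (f dU : ℝ → ℝ) (x : ℝ → Fin n → ℝ) (b : ℝ → Fin n → ℤ) : Prop where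
  continuous : ContinuousOn x (Ici 0)
  mem : ∀ t ≥ 0, (x t, b t) ∈ stateSpace n
  right : ∀ t ≥ 0, ∃ e > t, (∀ s ∈ Ico t e, b s = b t) ∧
    Flow (1 / (n : ℝ)) f dU (fun k => (b t k : ℝ)) x (Ioo t e)
  left : ∀ t > 0, ∃ e ∈ Ico 0 t, ∃ β : Fin n → ℤ, (∀ s ∈ Ioo e t, b s = β) ∧
    Flow (1 / (n : ℝ)) f dU (fun k => (β k : ℝ)) x (Ioo e t) ∧
    ∀ y, ∑ i with x t i = y, b t i = ∑ i with x t i = y, β i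

theorem eventually_notMem_of_finite {S : Set ℝ} (hS : S.Finite) (t : ℝ) :
    ∀ᶠ s in 𝓝 t, s ≠ t → s ∉ S := by
  have h := (hS.subset (sdiff_subset : S \ {t} ⊆ S)).isClosed.isOpen_compl.mem_nhds
    (show t ∈ (S \ {t})ᶜ from fun h => h.2 rfl)
  filter_upwards [h] with s hs hst hsS using hs ⟨hsS, hst⟩

/-- Each charge jumps at most once and the exceptional set is finite, so every time has one-sided
neighbourhoods with constant charges and without exceptional times. The left limits in the
annihilation rule are then the constant charges before the time in question. -/
theorem IsParticleSolution.traj (hW : ∀ s ≠ 0, deriv W s = -oddKer f s)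
    (h : IsParticleSolution W U x₀ b₀ x b) : Traj f (deriv U) x b := by
  refine ⟨fun t ht => ?_, fun t ht => ?_, fun t ht => ?_, fun t ht => ?_⟩
  · obtain ⟨S, hS⟩ := h (t + 1) (by linarith [mem_Ici.1 ht])
    refine (hS.continuous t ⟨ht, by linarith⟩).mono_of_mem_nhdsWithin ?_
    filter_upwards [self_mem_nhdsWithin, nhdsWithin_le_nhds (Iio_mem_nhds (show t < t + 1 by linarith))]
      with s hs hs' using ⟨hs, (mem_Iio.1 hs').le⟩
  · obtain ⟨S, hS⟩ := h (t + 1) (by linarith)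
    exact hS.mem t ⟨ht, by linarith⟩
  · obtain ⟨S, hS⟩ := h (t + 1) (by linarith)
    have h1 : ∀ᶠ s in 𝓝[>] t, (s ∉ S ∧ s < t + 1) ∧ b s = b t := by
      have hi : ∀ i, ∀ᶠ s in 𝓝[>] t, b s i = b t i := by
        intro i
        rcases hS.jump i with h' | ⟨-, τ, hτ, h1, h2⟩
        · filter_upwards [Ioo_mem_nhdsGT (show t < t + 1 by linarith)] with s hs
          rw [h' s ⟨by linarith [hs.1], hs.2.le⟩, h' t ⟨ht, by linarith⟩]
        · rcases lt_or_ge t τ with htτ | htτ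
          · filter_upwards [Ioo_mem_nhdsGT htτ] with s hs
            rw [h1 s ⟨by linarith [hs.1], hs.2⟩, h1 t ⟨ht, htτ⟩]
          · filter_upwards [Ioo_mem_nhdsGT (show t < t + 1 by linarith)] with s hs
            rw [h2 s ⟨by linarith [hs.1], hs.2.le⟩, h2 t ⟨htτ, by linarith⟩]
      filter_upwards [eventually_all.2 hi, Ioo_mem_nhdsGT (show t < t + 1 by linarith),
        nhdsWithin_le_nhds (eventually_notMem_of_finite hS.finite t)] with s hs hs' hs''
      exact ⟨⟨hs'' hs'.1.ne', hs'.2⟩, funext hs⟩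
    obtain ⟨e, he, hes⟩ := mem_nhdsGT_iff_exists_Ioo_subset.1 h1
    refine ⟨e, he, fun s hs => ?_, fun s hs => ?_, fun s hs i => ?_⟩
    · rcases hs.1.eq_or_lt with rfl | h'
      · rfl
      · exact (hes ⟨h', hs.2⟩).2
    · have h2 := hes hs
      rw [← h2.2]
      exact ordered_of_mem (hS.mem s ⟨by linarith [hs.1], h2.1.2.le⟩)
    · have h2 := hes hs
      rw [← h2.2, ← velocity_eq_of_deriv hW (ordered_of_mem (hS.mem s ⟨by linarith [hs.1],
        h2.1.2.le⟩))]
      exact hS.ode s ⟨⟨by linarith [hs.1], h2.1.2⟩, h2.1.1⟩ i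
  · obtain ⟨S, hS⟩ := h (t + 1) (by linarith)
    have hi : ∀ i, ∃ β, ∀ᶠ s in 𝓝[<] t, b s i = β := by
      intro i
      rcases hS.jump i with h' | ⟨-, τ, hτ, h1, h2⟩
      · refine ⟨b 0 i, ?_⟩
        filter_upwards [Ioo_mem_nhdsLT ht] with s hs
        exact h' s ⟨hs.1.le, by linarith [hs.2]⟩
      · rcases lt_or_ge τ t with htτ | htτ
        · refine ⟨0, ?_⟩
          filter_upwards [Ioo_mem_nhdsLT htτ] with s hs
          exact h2 s ⟨hs.1.le, by linarith [hs.2]⟩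
        · refine ⟨b 0 i, ?_⟩
          filter_upwards [Ioo_mem_nhdsLT ht] with s hs
          exact h1 s ⟨hs.1.le, by linarith [hs.2]⟩
    choose β hβ using hi
    have h1 : ∀ᶠ s in 𝓝[<] t, (s ∉ S ∧ 0 < s) ∧ b s = β := by
      filter_upwards [eventually_all.2 hβ, Ioo_mem_nhdsLT ht,
        nhdsWithin_le_nhds (eventually_notMem_of_finite hS.finite t)] with s hs hs' hs''
      exact ⟨⟨hs'' hs'.2.ne, hs'.1⟩, funext hs⟩
    obtain ⟨e, he, hes⟩ := mem_nhdsLT_iff_exists_Ioo_subset.1 h1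
    have hsub : Ioo (max e 0) t ⊆ Ioo e t := Ioo_subset_Ioo_left (le_max_left _ _)
    refine ⟨max e 0, ⟨le_max_right _ _, max_lt he ht⟩, β, fun s hs => (hes (hsub hs)).2,
      ⟨fun s hs => ?_, fun s hs i => ?_⟩, fun y => ?_⟩
    · have h2 := hes (hsub hs)
      rw [← h2.2]
      exact ordered_of_mem (hS.mem s ⟨h2.1.2.le, by linarith [hs.2]⟩)
    · have h2 := hes (hsub hs)
      rw [← h2.2, ← velocity_eq_of_deriv hW (ordered_of_mem (hS.mem s ⟨h2.1.2.le,
        by linarith [hs.2]⟩))]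
      exact hS.ode s ⟨⟨h2.1.2, by linarith [hs.2]⟩, h2.1.1⟩ i
    · rw [hS.annihilation t ⟨ht, by linarith⟩ y]
      refine Finset.sum_congr rfl fun i _ => ?_
      refine leftLim_eq_of_tendsto (tendsto_const_nhds.congr' ?_)
      filter_upwards [hβ i] with s hs using hs.symm

theorem IsParticleSolution.initial (h : IsParticleSolution W U x₀ b₀ x b) : x 0 = x₀ ∧ b 0 = b₀ :=
  let ⟨_, hS⟩ := h 1 one_pos
  ⟨hS.initial_x, hS.initial_b⟩

theorem IsGlobalSolution.isParticleSolution {S : Set ℝ} (hf : IsKernel f)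
    (hW : ∀ s ≠ 0, deriv W s = -oddKer f s) (hU : Continuous (deriv U))
    (h : IsGlobalSolution (1 / (n : ℝ)) f (deriv U) x₀ b₀ x b S) :
    IsParticleSolution W U x₀ b₀ x b := by
  intro T hT
  have hnot : ∀ t ∈ Ioo 0 T \ (S ∩ Ioc 0 T), t ∉ S := fun t ht hS =>
    ht.2 ⟨hS, ht.1.1, ht.1.2.le⟩
  refine ⟨S ∩ Ioc 0 T, h.finite.subset inter_subset_left, inter_subset_right,
    fun t ht => h.mem t ht.1, h.initial_x, h.initial_b, h.continuous.mono Icc_subset_Ici_self,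
    ?_, fun i => ?_, fun t ht y => ?_, fun t ht i => ?_⟩
  · have hopen : IsOpen (Ioo 0 T \ (S ∩ Ioc 0 T)) :=
      isOpen_Ioo.sdiff (h.finite.subset inter_subset_left).isClosed
    refine contDiffOn_pi.2 fun i => ?_
    rw [contDiffOn_one_iff_derivWithin hopen.uniqueDiffOn]
    have hd : ∀ t ∈ Ioo 0 T \ (S ∩ Ioc 0 T), HasDerivAt (fun s => x s i)
        (velocity (1 / (n : ℝ)) f (deriv U) (fun k => (b t k : ℝ)) (x t) i) t :=
      fun t ht => h.ode t ht.1.1 (hnot t ht) i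
    refine ⟨fun t ht => (hd t ht).differentiableAt.differentiableWithinAt, ?_⟩
    have hc : ContinuousOn (fun t => velocity (1 / (n : ℝ)) f (deriv U) (fun k => (b t k : ℝ))
        (x t) i) (Ioo 0 T \ (S ∩ Ioc 0 T)) := by
      intro t ht
      have hxc : ContinuousAt x t := (h.continuous t ht.1.1.le).continuousAt (Ici_mem_nhds ht.1.1)
      have hv := (ordered_of_mem (h.mem t ht.1.1.le)).continuousAt_velocity
        (c := 1 / (n : ℝ)) hf hU i
      have h1 : ContinuousAt (fun s => velocity (1 / (n : ℝ)) f (deriv U) (fun k => (b t k : ℝ))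
        (x s) i) t := ContinuousAt.comp (g := fun X => velocity (1 / (n : ℝ)) f (deriv U)
          (fun k => (b t k : ℝ)) X i) hv hxc
      refine (h1.congr ?_).continuousWithinAt
      have hb : ∀ k, ∀ᶠ s in 𝓝 t, b s k = b t k := by
        intro k
        rcases h.jump k with h' | ⟨-, τ, hτ, h2, h3⟩
        · filter_upwards [Ioi_mem_nhds ht.1.1] with s hs
          rw [h' s (show 0 < s from hs).le, h' t ht.1.1.le]
        · rcases lt_trichotomy t τ with h4 | h4 | h4
          · filter_upwards [Ioo_mem_nhds ht.1.1 h4] with s hs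
            rw [h2 s ⟨hs.1.le, hs.2⟩, h2 t ⟨ht.1.1.le, h4⟩]
          · exact absurd (h4 ▸ hτ) (hnot t ht)
          · filter_upwards [Ioi_mem_nhds h4] with s hs
            rw [h3 s (show τ < s from hs).le, h3 t h4.le]
      filter_upwards [eventually_all.2 hb] with s hs
      simp only [hs]
    refine hc.congr fun t ht => ?_
    rw [derivWithin_of_isOpen hopen ht]
    exact (hd t ht).deriv
  · rw [h.initial_b]
    rcases h.jump i with h' | ⟨h0, τ, hτ, h1, h2⟩
    · exact Or.inl fun t ht => h' t ht.1
    · rcases le_or_gt τ T with hτT | hτT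
      · exact Or.inr ⟨h0, τ, ⟨hτ, h.pos hτ, hτT⟩, h1, fun t ht => h2 t ht.1⟩
      · exact Or.inl fun t ht => h1 t ⟨ht.1, ht.2.trans_lt hτT⟩
  · obtain ⟨β, hβ, hβ'⟩ := h.annihilation t ht.1
    rw [hβ' y]
    refine Finset.sum_congr rfl fun i _ => (leftLim_eq_of_tendsto (tendsto_const_nhds.congr' ?_)).symm
    filter_upwards [hβ] with s hs
    rw [hs]
  · rw [velocity_eq_of_deriv hW (ordered_of_mem (h.mem t ht.1.1.le))]
    exact h.ode t ht.1.1 (hnot t ht) i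

end Solutions

/-! ### Semicontinuous envelopes -/

section Envelopes

variable {X : Type*} [TopologicalSpace X] {s : Set X} {f : X → ℝ} {p : X} {A : ℝ}

theorem isBoundedUnder_of_abs (hf : ∃ C : ℝ, ∀ q ∈ s, |f q| ≤ C) (p : X) :
    IsBoundedUnder (· ≤ ·) (𝓝[s] p) f := by
  obtain ⟨C, hC⟩ := hf
  refine ⟨C, ?_⟩
  rw [eventually_map]
  filter_upwards [self_mem_nhdsWithin] with q hq using (abs_le.1 (hC q hq)).2

theorem isBoundedUnder_ge_of_abs (hf : ∃ C : ℝ, ∀ q ∈ s, |f q| ≤ C) (p : X) :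
    IsBoundedUnder (· ≥ ·) (𝓝[s] p) f := by
  obtain ⟨C, hC⟩ := hf
  refine ⟨-C, ?_⟩
  rw [eventually_map]
  filter_upwards [self_mem_nhdsWithin] with q hq using (abs_le.1 (hC q hq)).1

theorem upperEnvelope_le [(𝓝[s] p).NeBot] (hf : ∃ C : ℝ, ∀ q ∈ s, |f q| ≤ C)
    (h : ∀ᶠ q in 𝓝[s] p, f q ≤ A) : upperEnvelope s f p ≤ A :=
  limsup_le_of_le (isBoundedUnder_ge_of_abs hf p).isCoboundedUnder_le h

theorem le_upperEnvelope_of_frequently (hf : ∃ C : ℝ, ∀ q ∈ s, |f q| ≤ C)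
    (h : ∃ᶠ q in 𝓝[s] p, A ≤ f q) : A ≤ upperEnvelope s f p :=
  le_limsup_of_frequently_le h (isBoundedUnder_of_abs hf p)

theorem eventually_lt_of_upperEnvelope_lt (hf : ∃ C : ℝ, ∀ q ∈ s, |f q| ≤ C)
    (h : upperEnvelope s f p < A) : ∀ᶠ q in 𝓝[s] p, f q < A :=
  eventually_lt_of_limsup_lt h (isBoundedUnder_of_abs hf p)

theorem le_upperEnvelope (hf : ∃ C : ℝ, ∀ q ∈ s, |f q| ≤ C) (hp : p ∈ s) :
    f p ≤ upperEnvelope s f p := by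
  refine le_upperEnvelope_of_frequently hf fun h => ?_
  exact (Eventually.self_of_nhdsWithin h hp) le_rfl

theorem neBot_nhdsWithin_of_mem (hp : p ∈ s) : (𝓝[s] p).NeBot :=
  mem_closure_iff_nhdsWithin_neBot.1 (subset_closure hp)

theorem eventually_upperEnvelope_lt (hf : ∃ C : ℝ, ∀ q ∈ s, |f q| ≤ C)
    (h : upperEnvelope s f p < A) : ∀ᶠ q in 𝓝[s] p, upperEnvelope s f q < A := by
  obtain ⟨B, hB, hBA⟩ := exists_between h
  have h1 := eventually_lt_of_upperEnvelope_lt hf hB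
  filter_upwards [eventually_eventually_nhdsWithin.2 h1, self_mem_nhdsWithin] with q hq hqs
  have := neBot_nhdsWithin_of_mem hqs
  exact (upperEnvelope_le hf (hq.mono fun _ h => h.le)).trans_lt hBA

theorem upperSemicontinuousOn_upperEnvelope (hf : ∃ C : ℝ, ∀ q ∈ s, |f q| ≤ C) :
    UpperSemicontinuousOn (upperEnvelope s f) s := fun _ _ _ h => eventually_upperEnvelope_lt hf h

theorem abs_upperEnvelope_le [(𝓝[s] p).NeBot] {C : ℝ} (hf : ∀ q ∈ s, |f q| ≤ C) :
    |upperEnvelope s f p| ≤ C := by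
  refine abs_le.2 ⟨le_upperEnvelope_of_frequently ⟨C, hf⟩ ?_, upperEnvelope_le ⟨C, hf⟩ ?_⟩
  · refine Eventually.frequently ?_
    filter_upwards [self_mem_nhdsWithin] with q hq using (abs_le.1 (hf q hq)).1
  · filter_upwards [self_mem_nhdsWithin] with q hq using (abs_le.1 (hf q hq)).2

theorem lowerEnvelope_eq_neg (s : Set X) (f : X → ℝ) (p : X) :
    lowerEnvelope s f p = -upperEnvelope s (fun q => -f q) p := by
  unfold lowerEnvelope upperEnvelope liminf limsup limsSup limsInf
  -- The infimum of a set of reals is defined as minus the supremum of the reflected set, so the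
  -- identity needs no boundedness; default values match as well.
  rw [Real.sInf_def, neg_neg]
  congr 1
  ext a
  simp only [Set.mem_neg, mem_ofPred_eq, eventually_map, neg_le_neg_iff]

theorem UpperSemicontinuousOn.upperEnvelope_eq (hf : ∃ C : ℝ, ∀ q ∈ s, |f q| ≤ C)
    (h : UpperSemicontinuousOn f s) (hp : p ∈ s) : upperEnvelope s f p = f p := by
  have := neBot_nhdsWithin_of_mem hp
  refine le_antisymm (le_of_forall_gt_imp_ge_of_dense fun A hA => ?_) (le_upperEnvelope hf hp)
  exact upperEnvelope_le hf ((h p hp A hA).mono fun _ h => h.le)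

end Envelopes

/-! ### The staircase -/

section Staircase

variable {ε : ℝ}

theorem staircase_mono (hε : 0 < ε) : Monotone (staircase ε) := fun x y h => by
  unfold staircase
  have : x / ε ≤ y / ε := by gcongr
  have h1 : (⌊x / ε⌋ : ℝ) ≤ ⌊y / ε⌋ := by exact_mod_cast Int.floor_le_floor this
  nlinarith

theorem abs_staircase_le (hε : 0 < ε) (γ : ℝ) : |staircase ε γ| ≤ |γ| + ε := by
  unfold staircase
  have h1 := Int.floor_le (γ / ε)
  have h2 := Int.lt_floor_add_one (γ / ε)
  have h3 : ε * (γ / ε) = γ := by field_simp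
  refine abs_le.2 ⟨?_, ?_⟩
  · have := neg_abs_le γ
    nlinarith
  · have := le_abs_self γ
    nlinarith

theorem measurable_staircase (hε : 0 < ε) : Measurable (staircase ε) :=
  (staircase_mono hε).measurable

theorem eventually_staircase_le (hε : 0 < ε) (γ : ℝ) :
    ∀ᶠ y in 𝓝 γ, staircase ε y ≤ staircase ε γ := by
  have h : Tendsto (fun y : ℝ => y / ε) (𝓝 γ) (𝓝 (γ / ε)) :=
    (continuous_id.div_const ε).tendsto γ
  filter_upwards [h.eventually (gt_mem_nhds (Int.lt_floor_add_one (γ / ε)))] with y hy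
  unfold staircase
  have h1 : ⌊y / ε⌋ < ⌊γ / ε⌋ + 1 := Int.floor_lt.2 (by push_cast; exact hy)
  have h2 : (⌊y / ε⌋ : ℝ) ≤ ⌊γ / ε⌋ := by exact_mod_cast Int.lt_add_one_iff.1 h1
  nlinarith

theorem isBoundedUnder_staircase (hε : 0 < ε) (γ : ℝ) :
    IsBoundedUnder (· ≤ ·) (𝓝[univ] γ) (staircase ε) ∧
      IsBoundedUnder (· ≥ ·) (𝓝[univ] γ) (staircase ε) := by
  rw [nhdsWithin_univ]
  refine ⟨⟨_, eventually_map.2 (eventually_staircase_le hε γ)⟩, ⟨-(|γ| + 1 + ε), ?_⟩⟩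
  rw [eventually_map]
  have h : ∀ᶠ y in 𝓝 γ, |y| < |γ| + 1 :=
    continuous_abs.continuousAt.eventually (gt_mem_nhds (by linarith))
  filter_upwards [h] with y hy
  have := (abs_le.1 (abs_staircase_le hε y)).1
  simp only [ge_iff_le]
  linarith

theorem upperEnvelope_staircase (hε : 0 < ε) :
    upperEnvelope univ (staircase ε) = staircase ε := by
  ext γ
  obtain ⟨h1, h2⟩ := isBoundedUnder_staircase hε γ
  have hne : (𝓝[univ] γ).NeBot := neBot_nhdsWithin_of_mem (mem_univ γ)
  refine le_antisymm (limsup_le_of_le h2.isCoboundedUnder_le ?_) (le_limsup_of_frequently_le ?_ h1)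
  · rw [nhdsWithin_univ]; exact eventually_staircase_le hε γ
  · rw [nhdsWithin_univ]
    exact fun h => h.self_of_nhds le_rfl

/-- Just to the left of γ the staircase has the value ε(⌈γ/ε⌉ - 1/2), and this is -E(-γ). This
relation exchanges the two envelopes, and with them sub- and supersolutions, under negation. -/
theorem lowerEnvelope_staircase (hε : 0 < ε) (γ : ℝ) :
    lowerEnvelope univ (staircase ε) γ = -staircase ε (-γ) := by
  obtain ⟨h1, h2⟩ := isBoundedUnder_staircase hε γ
  have hne : (𝓝[univ] γ).NeBot := neBot_nhdsWithin_of_mem (mem_univ γ)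
  refine le_antisymm (liminf_le_of_frequently_le ?_ h2) (le_liminf_of_le h1.isCoboundedUnder_ge ?_)
  · rw [nhdsWithin_univ]
    have h : ∃ᶠ y in 𝓝 γ, y < γ := by
      refine Frequently.filter_mono ?_ (nhdsWithin_le_nhds (s := Iio γ))
      exact Eventually.frequently self_mem_nhdsWithin
    refine h.mono fun y hy => ?_
    unfold staircase
    have h3 : ⌊y / ε⌋ < -⌊-γ / ε⌋ := by
      rw [Int.floor_lt]
      push_cast
      have h4 := Int.floor_le (-γ / ε)
      have h5 : y / ε < γ / ε := by gcongr
      rw [neg_div] at h4 ⊢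
      linarith
    have h6 : (⌊y / ε⌋ : ℝ) + 1 ≤ -⌊-γ / ε⌋ := by exact_mod_cast h3
    nlinarith
  · rw [nhdsWithin_univ]
    have h := (continuous_neg.tendsto γ).eventually (eventually_staircase_le hε (-γ))
    filter_upwards [h] with y hy
    refine (neg_le_neg hy).trans ?_
    unfold staircase
    have h3 := Int.lt_floor_add_one (y / ε)
    have h4 := Int.lt_floor_add_one (-y / ε)
    have h5 : -⌊-y / ε⌋ < ⌊y / ε⌋ + 1 + 1 := by
      have h6 : (-⌊-y / ε⌋ : ℝ) < ⌊y / ε⌋ + 1 + 1 := by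
        have h7 := Int.floor_le (-y / ε)
        have h8 : ((-⌊-y / ε⌋ - 1 : ℤ) : ℝ) < y / ε := by
          push_cast
          rw [neg_div] at h4 ⊢
          linarith
        have := h8.trans h3
        push_cast at this
        linarith
      exact_mod_cast h6
    have h6 : (-⌊-y / ε⌋ : ℝ) ≤ ⌊y / ε⌋ + 1 := by exact_mod_cast Int.lt_add_one_iff.1 h5
    nlinarith

end Staircase

/-! ### The nonlocal operator -/

section Nonlocal

theorem integral_eq_zero_of_odd {g : ℝ → ℝ} {s : Set ℝ} (hs : MeasurableSet s)
    (hsym : ∀ z, -z ∈ s ↔ z ∈ s) (hg : ∀ z ∈ s, g (-z) = -g z) : ∫ z in s, g z = 0 := by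
  rw [← integral_indicator hs]
  have h := integral_neg_eq_self (s.indicator g) volume
  have h2 : (fun z => s.indicator g (-z)) = fun z => -s.indicator g z := by
    ext z
    by_cases hz : z ∈ s
    · rw [indicator_of_mem hz, indicator_of_mem ((hsym z).2 hz), hg z hz]
    · rw [indicator_of_notMem hz, indicator_of_notMem (fun h => hz ((hsym z).1 h)), neg_zero]
  rw [h2, integral_neg] at h
  linarith

theorem measurableSet_le_abs (r : ℝ) : MeasurableSet {z : ℝ | r ≤ |z|} :=
  measurableSet_le measurable_const continuous_abs.measurable

theorem measurableSet_abs_lt (r : ℝ) : MeasurableSet {z : ℝ | |z| < r} :=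
  measurableSet_lt continuous_abs.measurable measurable_const

/-- On every shell δ ≤ |z| < r the odd integrand cancels, so the truncated integrals are constant
for δ < r: the principal value is attained, not merely approached. -/
theorem pvIntegral_eq {g : ℝ → ℝ} {r ρ : ℝ} (hr : 0 < r) (hrρ : r ≤ ρ)
    (hodd : ∀ z ≠ 0, |z| < r → g (-z) = -g z)
    (hint : ∀ δ > 0, IntegrableOn g {z : ℝ | δ ≤ |z| ∧ |z| < ρ}) :
    pvIntegral ρ g = ∫ z in {z : ℝ | r ≤ |z| ∧ |z| < ρ}, g z := by
  refine Tendsto.limUnder_eq (tendsto_const_nhds.congr' ?_)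
  filter_upwards [Ioo_mem_nhdsGT hr] with δ hδ
  have hsplit : {z : ℝ | δ ≤ |z| ∧ |z| < ρ} =
      {z : ℝ | δ ≤ |z| ∧ |z| < r} ∪ {z : ℝ | r ≤ |z| ∧ |z| < ρ} := by
    ext z
    simp only [mem_ofPred_eq, mem_union]
    constructor
    · intro h
      rcases lt_or_ge |z| r with h' | h'
      · exact Or.inl ⟨h.1, h'⟩
      · exact Or.inr ⟨h', h.2⟩
    · rintro (h | h)
      · exact ⟨h.1, h.2.trans_le hrρ⟩
      · exact ⟨hδ.2.le.trans h.1, h.2⟩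
  have hm : MeasurableSet {z : ℝ | δ ≤ |z| ∧ |z| < r} :=
    (measurableSet_le_abs δ).inter (measurableSet_abs_lt r)
  have hm' : MeasurableSet {z : ℝ | r ≤ |z| ∧ |z| < ρ} :=
    (measurableSet_le_abs r).inter (measurableSet_abs_lt ρ)
  have hi := hint δ hδ.1
  rw [hsplit] at hi ⊢
  rw [setIntegral_union _ hm' (hi.mono_set subset_union_left) (hi.mono_set subset_union_right),
    integral_eq_zero_of_odd hm (by simp), zero_add]
  · intro z hz
    exact hodd z (fun h => by
      have := hz.1
      rw [h, abs_zero] at this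
      linarith [hδ.1]) hz.2
  · rw [Set.disjoint_left]
    intro z hz hz'
    exact absurd hz'.1 (not_le.2 hz.2)

variable {f W : ℝ → ℝ}

theorem eqOn_Ioi_deriv (hW : ∀ z ≠ 0, iteratedDeriv 2 W z = -deriv f |z|) {d : ℝ} (hd : 0 ≤ d) :
    EqOn (iteratedDeriv 2 W) (fun z => -deriv f z) (Ioi d) := fun z hz => by
  have h : 0 < z := hd.trans_lt hz
  simp only [hW z h.ne', abs_of_pos h]

theorem iteratedDeriv_two_neg (hW : ∀ z ≠ 0, iteratedDeriv 2 W z = -deriv f |z|) (z : ℝ) :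
    iteratedDeriv 2 W (-z) = iteratedDeriv 2 W z := by
  rcases eq_or_ne z 0 with rfl | h
  · rw [neg_zero]
  · rw [hW z h, hW (-z) (neg_ne_zero.2 h), abs_neg]

theorem integrableOn_Ioi_iteratedDeriv (hf : IsKernel f) (hf0 : Tendsto f atTop (𝓝 0))
    (hW : ∀ z ≠ 0, iteratedDeriv 2 W z = -deriv f |z|) {d : ℝ} (hd : 0 < d) :
    IntegrableOn (iteratedDeriv 2 W) (Ioi d) := by
  rw [integrableOn_congr_fun (eqOn_Ioi_deriv hW hd.le) measurableSet_Ioi]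
  exact (integrableOn_Ioi_deriv_of_nonpos (hf.continuousAt hd).continuousWithinAt
    (fun x hx => hf.hasDerivAt (hd.trans hx)) (fun x hx => hf.deriv_nonpos (hd.trans hx)) hf0).neg

/-- The decay of `f` enters here; with a limit at infinity different from 0 the integral would be `f
d` minus that limit. -/
theorem integral_Ioi_iteratedDeriv (hf : IsKernel f) (hf0 : Tendsto f atTop (𝓝 0))
    (hW : ∀ z ≠ 0, iteratedDeriv 2 W z = -deriv f |z|) {d : ℝ} (hd : 0 < d) :
    ∫ z in Ioi d, iteratedDeriv 2 W z = f d := by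
  rw [setIntegral_congr_fun measurableSet_Ioi (eqOn_Ioi_deriv hW hd.le), integral_neg,
    integral_Ioi_of_hasDerivAt_of_nonpos (hf.continuousAt hd).continuousWithinAt
    (fun x hx => hf.hasDerivAt (hd.trans hx)) (fun x hx => hf.deriv_nonpos (hd.trans hx)) hf0]
  ring

theorem integrableOn_Iic_iteratedDeriv (hf : IsKernel f) (hf0 : Tendsto f atTop (𝓝 0))
    (hW : ∀ z ≠ 0, iteratedDeriv 2 W z = -deriv f |z|) {d : ℝ} (hd : d < 0) :
    IntegrableOn (iteratedDeriv 2 W) (Iic d) := by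
  rw [integrableOn_Iic_iff_integrableOn_Iio]
  have := (integrableOn_Ioi_iteratedDeriv hf hf0 hW (neg_pos.2 hd)).comp_neg_Iio
  simpa only [iteratedDeriv_two_neg hW] using this

theorem integral_Iic_iteratedDeriv (hf : IsKernel f) (hf0 : Tendsto f atTop (𝓝 0))
    (hW : ∀ z ≠ 0, iteratedDeriv 2 W z = -deriv f |z|) {d : ℝ} (hd : d < 0) :
    ∫ z in Iic d, iteratedDeriv 2 W z = f (-d) := by
  rw [← integral_Ioi_iteratedDeriv hf hf0 hW (neg_pos.2 hd), ← integral_comp_neg_Iic]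
  simp only [iteratedDeriv_two_neg hW]

theorem le_abs_eq (r : ℝ) : {z : ℝ | r ≤ |z|} = Iic (-r) ∪ Ici r := by
  ext z
  simp only [mem_ofPred_eq, le_abs, mem_union, mem_Iic, mem_Ici]
  rw [or_comm, le_neg]

theorem integrableOn_iteratedDeriv (hf : IsKernel f) (hf0 : Tendsto f atTop (𝓝 0))
    (hW : ∀ z ≠ 0, iteratedDeriv 2 W z = -deriv f |z|) {r : ℝ} (hr : 0 < r) :
    IntegrableOn (iteratedDeriv 2 W) {z | r ≤ |z|} := by
  rw [le_abs_eq]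
  refine (integrableOn_Iic_iteratedDeriv hf hf0 hW (by linarith)).union ?_
  rw [integrableOn_Ici_iff_integrableOn_Ioi]
  exact integrableOn_Ioi_iteratedDeriv hf hf0 hW hr

theorem iteratedDeriv_two_nonneg (hf : IsKernel f)
    (hW : ∀ z ≠ 0, iteratedDeriv 2 W z = -deriv f |z|) {z : ℝ} (hz : z ≠ 0) :
    0 ≤ iteratedDeriv 2 W z := by
  rw [hW z hz]
  linarith [hf.deriv_nonpos (abs_pos.2 hz)]

/-- The elementary jump function `1_{z>d} - 1_{0>d}`. -/
noncomputable def jumpAt (d z : ℝ) : ℝ := (if d < z then 1 else 0) - (if d < 0 then 1 else 0)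

theorem abs_jumpAt_le (d z : ℝ) : |jumpAt d z| ≤ 1 := by
  unfold jumpAt; split_ifs <;> norm_num

theorem measurable_jumpAt (d : ℝ) : Measurable (jumpAt d) :=
  (Measurable.ite measurableSet_Ioi measurable_const measurable_const).sub measurable_const

/-- A unit jump at distance `d`, integrated against W'', gives the force of a unit charge at that
distance. This turns the nonlocal operator on step functions into a sum of particle forces. -/
theorem integral_jumpAt (hf : IsKernel f) (hf0 : Tendsto f atTop (𝓝 0))
    (hW : ∀ z ≠ 0, iteratedDeriv 2 W z = -deriv f |z|) {r d : ℝ} (hr : 0 < r) (hd : r ≤ |d|) :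
    ∫ z in {z | r ≤ |z|}, jumpAt d z * iteratedDeriv 2 W z = oddKer f d := by
  rcases le_abs.1 hd with h | h
  · have hd0 : 0 < d := hr.trans_le h
    have h1 : ∀ z, jumpAt d z * iteratedDeriv 2 W z =
        (Ioi d).indicator (iteratedDeriv 2 W) z := fun z => by
      simp only [jumpAt, hd0.not_gt, if_false, sub_zero, indicator, mem_Ioi]
      split_ifs <;> simp
    simp only [h1]
    rw [setIntegral_indicator measurableSet_Ioi, inter_eq_self_of_subset_right,
      integral_Ioi_iteratedDeriv hf hf0 hW hd0, oddKer_pos hd0]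
    intro z hz
    exact h.trans ((le_of_lt hz).trans (le_abs_self z))
  · have hd0 : d < 0 := by linarith
    have h1 : ∀ z, jumpAt d z * iteratedDeriv 2 W z =
        (Iic d).indicator (fun z => -iteratedDeriv 2 W z) z := fun z => by
      simp only [jumpAt, hd0, if_true, indicator, mem_Iic, ← not_lt]
      split_ifs <;> simp
    simp only [h1]
    rw [setIntegral_indicator measurableSet_Iic, inter_eq_self_of_subset_right, integral_neg,
      integral_Iic_iteratedDeriv hf hf0 hW hd0, oddKer_neg hd0]
    intro z hz
    have : z ≤ d := hz
    exact (show r ≤ -z by linarith).trans (neg_le_abs z)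

/-- A step function with weight `σ` at `0` and weights `w j` at `d j`, relative to its value at
`0`. -/
noncomputable def relStep {ι : Type*} [Fintype ι] (σ : ℝ) (w d : ι → ℝ) (z : ℝ) : ℝ :=
  σ * ((if 0 < z then 1 else 0) - 1 / 2) + ∑ j, w j * jumpAt (d j) z

variable {ι : Type*} [Fintype ι]

/-- The half step at 0 is odd off the origin and contributes nothing: a charge exerts no force on
itself. -/
theorem integral_relStep (hf : IsKernel f) (hf0 : Tendsto f atTop (𝓝 0))
    (hW : ∀ z ≠ 0, iteratedDeriv 2 W z = -deriv f |z|) {r : ℝ} (hr : 0 < r) (σ : ℝ) {w d : ι → ℝ}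
    (hd : ∀ j, w j ≠ 0 → r ≤ |d j|) :
    IntegrableOn (fun z => relStep σ w d z * iteratedDeriv 2 W z) {z | r ≤ |z|} ∧
    ∫ z in {z | r ≤ |z|}, relStep σ w d z * iteratedDeriv 2 W z = ∑ j, w j * oddKer f (d j) := by
  have hi := integrableOn_iteratedDeriv hf hf0 hW hr
  have hi1 : ∀ j, IntegrableOn (fun z => w j * (jumpAt (d j) z * iteratedDeriv 2 W z))
      {z | r ≤ |z|} := fun j =>
    (hi.bdd_mul (c := 1) (measurable_jumpAt (d j)).aestronglyMeasurable
      (Eventually.of_forall fun z => abs_jumpAt_le (d j) z)).const_mul (w j)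
  have hm : Measurable fun z : ℝ => σ * ((if 0 < z then (1 : ℝ) else 0) - 1 / 2) :=
    ((Measurable.ite measurableSet_Ioi measurable_const measurable_const).sub
      measurable_const).const_mul σ
  have hi2 : IntegrableOn (fun z => σ * ((if 0 < z then (1 : ℝ) else 0) - 1 / 2) *
      iteratedDeriv 2 W z) {z | r ≤ |z|} :=
    hi.bdd_mul (c := |σ|) hm.aestronglyMeasurable (Eventually.of_forall fun z => by
      rw [Real.norm_eq_abs, abs_mul]
      refine mul_le_of_le_one_right (abs_nonneg σ) ?_
      split_ifs <;> norm_num [abs_le])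
  have heq : ∀ z, relStep σ w d z * iteratedDeriv 2 W z =
      σ * ((if 0 < z then (1 : ℝ) else 0) - 1 / 2) * iteratedDeriv 2 W z +
        ∑ j, w j * (jumpAt (d j) z * iteratedDeriv 2 W z) := fun z => by
    rw [relStep, add_mul, Finset.sum_mul]
    congr 1
    exact Finset.sum_congr rfl fun j _ => by ring
  simp only [heq]
  have hi3 := integrable_finsetSum Finset.univ fun j (_ : j ∈ Finset.univ) => hi1 j
  refine ⟨hi2.add hi3, ?_⟩
  rw [integral_add hi2 hi3, integral_finsetSum _ fun j _ => hi1 j,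
    integral_eq_zero_of_odd (measurableSet_le_abs r) (by simp), zero_add]
  · refine Finset.sum_congr rfl fun j _ => ?_
    rw [integral_const_mul]
    by_cases hj : w j = 0
    · simp [hj]
    · rw [integral_jumpAt hf hf0 hW hr (hd j hj)]
  · intro z hz
    have hz0 : z ≠ 0 := fun h => by
      have : r ≤ |z| := hz
      rw [h, abs_zero] at this
      linarith
    rw [iteratedDeriv_two_neg hW]
    rcases hz0.lt_or_gt with h | h
    · simp only [neg_pos, h, h.not_gt, if_true, if_false]; ring
    · simp only [neg_pos, h, h.not_gt, if_true, if_false]; ring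

/-- For small z ≠ 0 the increment of ψ has the sign of zψ' and modulus below ε, so the staircase
takes only the values ε/2 and -ε/2 there. -/
theorem staircase_eq_of_hasDerivAt {ε : ℝ} (hε : 0 < ε) {ψ : ℝ → ℝ} {ψ' x : ℝ}
    (h : HasDerivAt ψ ψ' x) (hψ' : ψ' ≠ 0) :
    ∃ r > 0, ∀ z ≠ 0, |z| < r →
      staircase ε (ψ (x + -z) - ψ x) = -staircase ε (ψ (x + z) - ψ x) := by
  have hslope := hasDerivAt_iff_tendsto_slope_zero.1 h
  have hcont : Tendsto (fun z => ψ (x + z) - ψ x) (𝓝 0) (𝓝 0) := by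
    have h1 : ContinuousAt (fun z => ψ (x + z) - ψ x) 0 := by
      refine ContinuousAt.sub ?_ continuousAt_const
      exact ContinuousAt.comp (g := ψ) (f := fun z => x + z) (by simpa using h.continuousAt)
        (continuous_const.add continuous_id).continuousAt
    simpa [ContinuousAt] using h1
  have hsmall : ∀ᶠ z in 𝓝[≠] (0 : ℝ), |ψ (x + z) - ψ x| < ε := by
    refine nhdsWithin_le_nhds (hcont.abs.eventually (gt_mem_nhds ?_))
    simpa using hε
  have hpos : ∀ a, 0 < a → a < ε → staircase ε a = ε / 2 := fun a h1 h2 => by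
    have : ⌊a / ε⌋ = 0 := Int.floor_eq_zero_iff.2 ⟨by positivity, by rwa [div_lt_one hε]⟩
    rw [staircase, this]; push_cast; ring
  have hneg : ∀ a, -ε < a → a < 0 → staircase ε a = -(ε / 2) := fun a h1 h2 => by
    have : ⌊a / ε⌋ = -1 := by
      rw [Int.floor_eq_iff]
      push_cast
      exact ⟨by rw [le_div_iff₀ hε]; linarith, by rw [div_lt_iff₀ hε]; linarith⟩
    rw [staircase, this]; push_cast; ring
  have hsign : ∀ᶠ z in 𝓝[≠] (0 : ℝ), 0 < (ψ (x + z) - ψ x) * (z * ψ') := by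
    have h1 : ∀ᶠ z in 𝓝[≠] (0 : ℝ), 0 < (z⁻¹ • (ψ (x + z) - ψ x)) * ψ' :=
      (hslope.mul_const ψ').eventually (lt_mem_nhds (mul_self_pos.2 hψ'))
    filter_upwards [h1, self_mem_nhdsWithin] with z hz hz0
    have hz0' : z ≠ 0 := hz0
    have h2 : (ψ (x + z) - ψ x) * (z * ψ') = (z⁻¹ • (ψ (x + z) - ψ x)) * ψ' * z ^ 2 := by
      rw [smul_eq_mul]; field_simp
    rw [h2]
    exact mul_pos hz (by positivity)
  obtain ⟨r, hr, hball⟩ := Metric.mem_nhdsWithin_iff.1 (hsmall.and hsign)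
  refine ⟨r, hr, fun z hz hzr => ?_⟩
  obtain ⟨h1, h2⟩ := hball ⟨by simpa using hzr, hz⟩
  obtain ⟨h3, h4⟩ := hball (a := -z) ⟨by simpa using hzr, by simpa using hz⟩
  rw [abs_lt] at h1 h3
  rcases lt_trichotomy (ψ (x + z) - ψ x) 0 with h | h | h
  · have h5 : 0 < ψ (x + -z) - ψ x := by
      by_contra hcon
      nlinarith [mul_nonneg_of_nonpos_of_nonpos h.le (not_lt.1 hcon)]
    rw [hpos _ h5 h3.2, hneg _ h1.1 h, neg_neg]
  · rw [h] at h2; simp at h2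
  · have h5 : ψ (x + -z) - ψ x < 0 := by
      by_contra hcon
      nlinarith [mul_nonneg h.le (not_lt.1 hcon)]
    rw [hneg _ h3.1 h5, hpos _ h h1.2]

theorem nonlocal_eq (hf : IsKernel f) (hf0 : Tendsto f atTop (𝓝 0))
    (hW : ∀ z ≠ 0, iteratedDeriv 2 W z = -deriv f |z|) {ε ρ : ℝ} (hε : 0 < ε) (hρ : 0 < ρ)
    {ψ v : ℝ → ℝ} (hψ : Continuous ψ) {ψ' x : ℝ} (hψd : HasDerivAt ψ ψ' x) (hψ' : ψ' ≠ 0) :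
    ∃ r₀ > 0, ∀ r ∈ Ioc 0 r₀, r ≤ ρ ∧
      (∀ z ≠ 0, |z| < r → staircase ε (ψ (x + -z) - ψ x) = -staircase ε (ψ (x + z) - ψ x)) ∧
      IntegrableOn (fun z => staircase ε (ψ (x + z) - ψ x) * iteratedDeriv 2 W z)
        {z : ℝ | r ≤ |z| ∧ |z| < ρ} ∧
      nonlocal (staircase ε) W ρ ψ v x =
        (∫ z in {z : ℝ | r ≤ |z| ∧ |z| < ρ}, staircase ε (ψ (x + z) - ψ x) * iteratedDeriv 2 W z) +
        ∫ z in {z : ℝ | ρ ≤ |z|}, staircase ε (v (x + z) - v x) * iteratedDeriv 2 W z := by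
  obtain ⟨r₁, hr₁, hodd⟩ := staircase_eq_of_hasDerivAt hε hψd hψ'
  have hint : ∀ δ > 0, IntegrableOn (fun z => staircase ε (ψ (x + z) - ψ x) * iteratedDeriv 2 W z)
      {z : ℝ | δ ≤ |z| ∧ |z| < ρ} := by
    intro δ hδ
    have hcψ : Continuous fun z => ψ (x + z) - ψ x :=
      (hψ.comp (continuous_const.add continuous_id)).sub continuous_const
    obtain ⟨C, hC⟩ := (isCompact_Icc (a := -ρ) (b := ρ)).exists_bound_of_continuousOn
      hcψ.continuousOn
    have hi : IntegrableOn (iteratedDeriv 2 W) {z : ℝ | δ ≤ |z| ∧ |z| < ρ} :=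
      (integrableOn_iteratedDeriv hf hf0 hW hδ).mono_set fun z hz => hz.1
    refine hi.bdd_mul (c := C + ε)
      ((measurable_staircase hε).comp hcψ.measurable).aestronglyMeasurable ?_
    filter_upwards [ae_restrict_mem ((measurableSet_le_abs δ).inter (measurableSet_abs_lt ρ))]
      with z hz
    refine (abs_staircase_le hε _).trans ?_
    have := hC z (abs_le.1 hz.2.le)
    rw [Real.norm_eq_abs] at this
    linarith
  refine ⟨min r₁ ρ, lt_min hr₁ hρ, fun r hr => ?_⟩
  have hrρ : r ≤ ρ := hr.2.trans (min_le_right _ _)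
  have hodd' : ∀ z ≠ 0, |z| < r →
      staircase ε (ψ (x + -z) - ψ x) = -staircase ε (ψ (x + z) - ψ x) := fun z hz hzr =>
    hodd z hz (hzr.trans_le (hr.2.trans (min_le_left _ _)))
  refine ⟨hrρ, hodd', hint r hr.1, ?_⟩
  rw [nonlocal, pvIntegral_eq hr.1 hrρ _ hint]
  intro z hz hzr
  rw [hodd' z hz hzr, iteratedDeriv_two_neg hW]
  ring

/-- Comparison of the nonlocal operator with the force exerted by a finite system of charges. -/
theorem nonlocal_bounds (hf : IsKernel f) (hf0 : Tendsto f atTop (𝓝 0))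
    (hW : ∀ z ≠ 0, iteratedDeriv 2 W z = -deriv f |z|) {ε ρ : ℝ} (hε : 0 < ε) (hρ : 0 < ρ)
    {ψ v : ℝ → ℝ} (hψ : Continuous ψ) {ψ' x : ℝ} (hψd : HasDerivAt ψ ψ' x) (hψ' : ψ' ≠ 0)
    (hv : Measurable v) (hvb : ∃ C : ℝ, ∀ y, |v y| ≤ C) :
    ∃ r₀ > 0, ∀ r ∈ Ioc 0 r₀, ∀ (σ : ℝ) (w d : ι → ℝ), (∀ j, w j ≠ 0 → r ≤ |d j|) →
      ((∀ z, r ≤ |z| → (∀ j, w j ≠ 0 → z ≠ d j) →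
          (if |z| < ρ then staircase ε (ψ (x + z) - ψ x) else staircase ε (v (x + z) - v x)) ≤
            ε * relStep σ w d z) →
        nonlocal (staircase ε) W ρ ψ v x ≤ ε * ∑ j, w j * oddKer f (d j)) ∧
      ((∀ z, r ≤ |z| → (∀ j, w j ≠ 0 → z ≠ d j) →
          ε * relStep σ w d z ≤
          (if |z| < ρ then staircase ε (ψ (x + z) - ψ x) else staircase ε (v (x + z) - v x))) →
        ε * ∑ j, w j * oddKer f (d j) ≤ nonlocal (staircase ε) W ρ ψ v x) := by
  obtain ⟨r₀, hr₀, h⟩ := nonlocal_eq (v := v) hf hf0 hW hε hρ hψ hψd hψ'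
  obtain ⟨C, hC⟩ := hvb
  refine ⟨r₀, hr₀, fun r hr σ w d hd => ?_⟩
  obtain ⟨hrρ, hodd, hint, heq⟩ := h r hr
  set g : ℝ → ℝ := fun z => (if |z| < ρ then staircase ε (ψ (x + z) - ψ x)
    else staircase ε (v (x + z) - v x)) * iteratedDeriv 2 W z with hg
  have hs1 : MeasurableSet {z : ℝ | r ≤ |z| ∧ |z| < ρ} :=
    (measurableSet_le_abs r).inter (measurableSet_abs_lt ρ)
  have hs2 := measurableSet_le_abs ρ
  have he1 : EqOn (fun z => staircase ε (ψ (x + z) - ψ x) * iteratedDeriv 2 W z) g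
      {z : ℝ | r ≤ |z| ∧ |z| < ρ} := fun z hz => by
    simp only [hg, if_pos hz.2]
  have he2 : EqOn (fun z => staircase ε (v (x + z) - v x) * iteratedDeriv 2 W z) g
      {z : ℝ | ρ ≤ |z|} := fun z hz => by
    simp only [hg, if_neg (not_lt.2 (show ρ ≤ |z| from hz))]
  have hi1 : IntegrableOn g {z : ℝ | r ≤ |z| ∧ |z| < ρ} := (integrableOn_congr_fun he1 hs1).1 hint
  have hi2 : IntegrableOn g {z : ℝ | ρ ≤ |z|} := by
    refine (integrableOn_congr_fun he2 hs2).1 ?_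
    refine (integrableOn_iteratedDeriv hf hf0 hW hρ).bdd_mul (c := 2 * C + ε)
      ((measurable_staircase hε).comp ((hv.comp (measurable_const.add measurable_id)).sub
        measurable_const)).aestronglyMeasurable (Eventually.of_forall fun z => ?_)
    refine (abs_staircase_le hε _).trans ?_
    have h1 := abs_sub (v (x + z)) (v x)
    have h2 := hC (x + z)
    have h3 := hC x
    linarith
  have hunion : {z : ℝ | r ≤ |z| ∧ |z| < ρ} ∪ {z : ℝ | ρ ≤ |z|} = {z : ℝ | r ≤ |z|} := by
    ext z
    simp only [mem_union, mem_ofPred_eq]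
    constructor
    · rintro (h | h)
      · exact h.1
      · exact hrρ.trans h
    · intro h
      rcases lt_or_ge |z| ρ with h' | h'
      · exact Or.inl ⟨h, h'⟩
      · exact Or.inr h'
  have hi : IntegrableOn g {z : ℝ | r ≤ |z|} := hunion ▸ hi1.union hi2
  have hnl : nonlocal (staircase ε) W ρ ψ v x = ∫ z in {z : ℝ | r ≤ |z|}, g z := by
    rw [heq, setIntegral_congr_fun hs1 he1, setIntegral_congr_fun hs2 he2, ← hunion,
      setIntegral_union _ hs2 hi1 hi2]
    rw [Set.disjoint_left]
    intro z hz hz'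
    exact absurd hz.2 (not_lt.2 hz')
  obtain ⟨hri, hrint⟩ := integral_relStep hf hf0 hW hr.1 σ hd
  have hri' : IntegrableOn (fun z => ε * (relStep σ w d z * iteratedDeriv 2 W z)) {z : ℝ | r ≤ |z|} :=
    hri.const_mul ε
  rw [hnl, ← hrint, ← integral_const_mul]
  have hfin : (range d).Finite := finite_range d
  -- The finitely many jump points form a null set, so the pointwise hypotheses may leave them out.
  have hae : ∀ᵐ z ∂(volume.restrict {z : ℝ | r ≤ |z|}), r ≤ |z| ∧ z ∉ range d := by
    filter_upwards [ae_restrict_mem (measurableSet_le_abs r),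
      ae_restrict_of_ae (hfin.measure_zero volume |> compl_mem_ae_iff.2)] with z h1 h2
      using ⟨h1, h2⟩
  have hpos : ∀ z, r ≤ |z| → 0 ≤ iteratedDeriv 2 W z := fun z hz =>
    iteratedDeriv_two_nonneg hf hW (abs_pos.1 (hr.1.trans_le hz))
  refine ⟨fun hG => integral_mono_ae hi hri' ?_, fun hG => integral_mono_ae hri' hi ?_⟩
  · filter_upwards [hae] with z hz
    have := mul_le_mul_of_nonneg_right (hG z hz.1 fun j _ hj => hz.2 ⟨j, hj.symm⟩) (hpos z hz.1)
    simp only [hg]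
    linarith
  · filter_upwards [hae] with z hz
    have := mul_le_mul_of_nonneg_right (hG z hz.1 fun j _ hj => hz.2 ⟨j, hj.symm⟩) (hpos z hz.1)
    simp only [hg]
    linarith

end Nonlocal

/-! ### The force inside an alternating cluster -/

section ClusterForce

variable {ι : Type*} [Fintype ι] [LinearOrder ι] {f : ℝ → ℝ} {γ x : ι → ℝ} {a z : ι}

/-- Subtracting the constant `f (x z - x a)` from the kernel keeps it nonnegative and decreasing
along the cluster, so the alternating tail still has a sign; the constant is multiplied by the sum
of the charges. In a neutral cluster the first particle is pulled inwards with a force that blows up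
as the cluster shrinks; otherwise the bound only says that the inner force does not push it
outwards. -/
theorem cluster_force_first (hf : IsKernel f) (hγ : IsCharge γ)
    (halt : ∀ i j, Consec γ i j → γ i ≠ γ j) (hx : Ordered γ x) (ha : γ a ≠ 0)
    (hfirst : ∀ k, k < a → γ k = 0) (hz : γ z ≠ 0) (hlast : ∀ k, z < k → γ k = 0) :
    (1 - γ a * ∑ k, γ k) * f (x z - x a) ≤ γ a * ∑ k, γ k * oddKer f (x a - x k) := by
  have haa := hγ.mul_self ha
  have hz' : ∀ k, γ k ≠ 0 → k ≤ z := fun k hk => not_lt.1 fun h => hk (hlast k h)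
  have hxle : ∀ i k, i ≤ k → γ i ≠ 0 → γ k ≠ 0 → x i ≤ x k := fun i k hik hi hk => by
    rcases hik.eq_or_lt with rfl | h
    · exact le_rfl
    · exact (hx i k h hi hk).le
  have h1 : γ a * ∑ k with a < k, γ k * (f (x k - x a) - f (x z - x a)) ≤ 0 := by
    refine alternating_tail hγ halt ha (fun i hi hbi => sub_nonneg.2 ?_) (fun i j hi hij => ?_)
    · exact hf.anti (sub_pos.2 (hx a i hi ha hbi))
        (sub_pos.2 (hx a z (hi.trans_le (hz' i hbi)) ha hz))
        (sub_le_sub_right (hxle i z (hz' i hbi) hbi hz) _)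
    · refine sub_le_sub_right ?_ _
      exact hf.anti (sub_pos.2 (hx a i hi ha hij.2.1)) (sub_pos.2 (hx a j (hi.trans hij.1) ha hij.2.2.1))
        (sub_le_sub_right (hx i j hij.1 hij.2.1 hij.2.2.1).le _)
  have h2 : ∑ k, γ k = γ a + ∑ k with a < k, γ k := by
    rw [sum_trichotomy γ a, Finset.sum_eq_zero (s := Finset.univ.filter fun k => k < a), zero_add]
    intro k hk
    exact hfirst k (by simpa using hk)
  have h3 : ∑ k with k < a, γ k * f (x a - x k) = 0 := Finset.sum_eq_zero fun k hk => by
    rw [hfirst k (by simpa using hk), zero_mul]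
  rw [sum_oddKer_split hx ha, h3, h2]
  simp only [mul_sub, Finset.sum_sub_distrib, ← Finset.sum_mul] at h1
  have h4 : γ a * (γ a + ∑ k with a < k, γ k) = 1 + γ a * ∑ k with a < k, γ k := by
    rw [mul_add, haa]
  rw [h4]
  linarith

theorem cluster_force_last (hf : IsKernel f) (hγ : IsCharge γ)
    (halt : ∀ i j, Consec γ i j → γ i ≠ γ j) (hx : Ordered γ x) (ha : γ a ≠ 0)
    (hfirst : ∀ k, k < a → γ k = 0) (hz : γ z ≠ 0) (hlast : ∀ k, z < k → γ k = 0) :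
    γ z * ∑ k, γ k * oddKer f (x z - x k) ≤ -((1 - γ z * ∑ k, γ k) * f (x z - x a)) := by
  have h := cluster_force_first (ι := ιᵒᵈ) (f := f) (a := OrderDual.toDual z)
    (z := OrderDual.toDual a) hf hγ.dual (fun i j hij => (halt _ _ hij.of_dual).symm) hx.dual hz
    (fun k hk => hlast _ hk) ha (fun k hk => hfirst _ hk)
  simp only [OrderDual.ofDual_toDual, neg_sub_neg] at h
  have h1 : ∑ k : ιᵒᵈ, γ (OrderDual.ofDual k) = ∑ k, γ k := OrderDual.ofDual.sum_comp γ
  have h2 : ∑ k : ιᵒᵈ, γ (OrderDual.ofDual k) * oddKer f (x (OrderDual.ofDual k) - x z) =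
      ∑ k, γ k * oddKer f (x k - x z) :=
    OrderDual.ofDual.sum_comp fun k => γ k * oddKer f (x k - x z)
  rw [h1, h2] at h
  have h3 : ∑ k, γ k * oddKer f (x k - x z) = -∑ k, γ k * oddKer f (x z - x k) := by
    rw [← Finset.sum_neg_distrib]
    refine Finset.sum_congr rfl fun k _ => ?_
    rw [← neg_sub (x z) (x k), oddKer_odd, mul_neg]
  rw [h3] at h
  linarith

end ClusterForce

/-! ### Test functions along curves -/

section Calculus

theorem hasDerivAt_dt {φ : ℝ × ℝ → ℝ} {p : ℝ × ℝ} (h : DifferentiableAt ℝ φ p) :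
    HasDerivAt (fun s => φ (s, p.2)) (dt φ p) p.1 := by
  have h1 : DifferentiableAt ℝ (fun s => φ (s, p.2)) p.1 :=
    DifferentiableAt.comp (g := φ) (f := fun s : ℝ => (s, p.2)) p.1 h
      (differentiableAt_id.prodMk (differentiableAt_const _))
  exact h1.hasDerivAt

theorem hasDerivAt_dx {φ : ℝ × ℝ → ℝ} {p : ℝ × ℝ} (h : DifferentiableAt ℝ φ p) :
    HasDerivAt (fun y => φ (p.1, y)) (dx φ p) p.2 := by
  have h1 : DifferentiableAt ℝ (fun y => φ (p.1, y)) p.2 :=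
    DifferentiableAt.comp (g := φ) (f := fun y : ℝ => (p.1, y)) p.2 h
      ((differentiableAt_const _).prodMk differentiableAt_id)
  exact h1.hasDerivAt

theorem fderiv_apply_eq {φ : ℝ × ℝ → ℝ} {p : ℝ × ℝ} (h : DifferentiableAt ℝ φ p) (v : ℝ × ℝ) :
    fderiv ℝ φ p v = dt φ p * v.1 + dx φ p * v.2 := by
  have h1 : HasDerivAt (fun s => φ (s, p.2)) (fderiv ℝ φ p (1, 0)) p.1 :=
    HasFDerivAt.comp_hasDerivAt (f := fun s : ℝ => (s, p.2)) p.1 h.hasFDerivAt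
      ((hasDerivAt_id p.1).prodMk (hasDerivAt_const p.1 p.2))
  have h2 : HasDerivAt (fun y => φ (p.1, y)) (fderiv ℝ φ p (0, 1)) p.2 :=
    HasFDerivAt.comp_hasDerivAt (f := fun y : ℝ => (p.1, y)) p.2 h.hasFDerivAt
      ((hasDerivAt_const p.2 p.1).prodMk (hasDerivAt_id p.2))
  rw [(hasDerivAt_dt h).unique h1, (hasDerivAt_dx h).unique h2]
  have hv : v = v.1 • ((1 : ℝ), (0 : ℝ)) + v.2 • ((0 : ℝ), (1 : ℝ)) := by
    ext <;> simp
  conv_lhs => rw [hv]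
  rw [map_add, map_smul, map_smul, smul_eq_mul, smul_eq_mul]
  ring

/-- If `φ` is not smaller than `φ p` along a curve ending at `p` with speed at least `v'` in the
direction of increase of `φ`, then `φ_t ≤ -v' |φ_x|`. -/
theorem dt_le_of_curve {φ : ℝ × ℝ → ℝ} {t y σ v' : ℝ} {X : ℝ → ℝ} (h : DifferentiableAt ℝ φ (t, y))
    (hσ : σ * σ = 1) (hdx : 0 < σ * dx φ (t, y)) (hX : Tendsto X (𝓝[<] t) (𝓝 y))
    (hφ : ∀ᶠ s in 𝓝[<] t, φ (t, y) ≤ φ (s, X s))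
    (hv : ∀ᶠ s in 𝓝[<] t, v' * (t - s) ≤ σ * (y - X s)) :
    dt φ (t, y) ≤ -v' * (σ * dx φ (t, y)) := by
  set A := σ * dx φ (t, y) with hA
  have hσA : dx φ (t, y) = σ * A := by rw [hA, ← mul_assoc, hσ, one_mul]
  have hσabs : |σ| = 1 := by
    have : |σ| * |σ| = 1 := by rw [← abs_mul, hσ, abs_one]
    nlinarith [abs_nonneg σ]
  refine le_of_forall_pos_lt_add fun η hη => ?_
  -- With `η' ≤ A` the coefficient of the displacement keeps its sign after the error of
  -- differentiation, so the lower bound on the displacement may be inserted; the second condition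
  -- makes the total loss smaller than `η`.
  obtain ⟨η', hη', hη'A, hη'η⟩ : ∃ η' > 0, η' ≤ A ∧ η' * (1 + |v'|) < η := by
    refine ⟨min A (η / (2 * (1 + |v'|))), lt_min hdx (by positivity), min_le_left _ _, ?_⟩
    have h1 : min A (η / (2 * (1 + |v'|))) * (1 + |v'|) ≤ η / (2 * (1 + |v'|)) * (1 + |v'|) :=
      mul_le_mul_of_nonneg_right (min_le_right _ _) (by positivity)
    have h2 : η / (2 * (1 + |v'|)) * (1 + |v'|) = η / 2 := by
      have : (1 + |v'|) ≠ 0 := by positivity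
      field_simp
    linarith
  have hlim : Tendsto (fun s => (s, X s)) (𝓝[<] t) (𝓝 (t, y)) :=
    (tendsto_id.mono_left nhdsWithin_le_nhds).prodMk_nhds hX
  have hlo := hlim.eventually (h.hasFDerivAt.isLittleO.def hη')
  obtain ⟨s, ⟨⟨h1, h2⟩, h3⟩, hs⟩ := ((hφ.and hv).and hlo |>.and self_mem_nhdsWithin).exists
  have hs' : 0 < t - s := sub_pos.2 hs
  rw [fderiv_apply_eq h, Real.norm_eq_abs] at h3
  have hnorm : ‖(s, X s) - (t, y)‖ ≤ (t - s) + |y - X s| := by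
    rw [Prod.norm_def, Prod.fst_sub, Prod.snd_sub, Real.norm_eq_abs, Real.norm_eq_abs,
      abs_sub_comm s t, abs_of_pos hs', abs_sub_comm (X s) y]
    exact max_le (by linarith [abs_nonneg (y - X s)]) (by linarith)
  have h4 := (le_abs_self _).trans (h3.trans (mul_le_mul_of_nonneg_left hnorm hη'.le))
  simp only [Prod.fst_sub, Prod.snd_sub] at h4
  set ξ := σ * (y - X s) with hξ
  have hξ' : dx φ (t, y) * (X s - y) = -(A * ξ) := by
    rw [hσA, hξ]; linear_combination (-A * (y - X s)) * hσ + A * (y - X s) * hσ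
  have hξabs : |y - X s| = |ξ| := by rw [hξ, abs_mul, hσabs, one_mul]
  rw [hξ', hξabs] at h4
  have h5 : -(A * ξ) + η' * |ξ| ≤ -(A * (v' * (t - s))) + η' * (|v'| * (t - s)) := by
    have h6 : v' * (t - s) ≤ |v'| * (t - s) := mul_le_mul_of_nonneg_right (le_abs_self _) hs'.le
    have h7 : -(v' * (t - s)) ≤ |v'| * (t - s) := by
      rw [← neg_mul]; exact mul_le_mul_of_nonneg_right (neg_le_abs _) hs'.le
    rcases le_or_gt 0 ξ with h | h
    · rw [abs_of_nonneg h]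
      nlinarith [mul_le_mul_of_nonneg_left h2 (sub_nonneg.2 hη'A), mul_le_mul_of_nonneg_left h6 hη'.le]
    · rw [abs_of_neg h]
      nlinarith [mul_le_mul_of_nonneg_left h2 (add_nonneg hη'.le (hη'.le.trans hη'A)),
        mul_le_mul_of_nonneg_left h7 hη'.le, mul_le_mul_of_nonneg_left h2 hη'.le,
        mul_le_mul_of_nonneg_left h2 (hη'.le.trans hη'A)]
  have h6 : 0 ≤ (t - s) * (-dt φ (t, y) - A * v' + η' * (1 + |v'|)) := by
    nlinarith
  have h7 := nonneg_of_mul_nonneg_right h6 hs'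
  linarith

/-- The cubic rate makes the fourth power of the displacement o(t-s), so the quartic term does not
contribute to the derivative in time. -/
theorem deriv_nonpos_of_quartic {g X : ℝ → ℝ} {t y θ C : ℝ} (hg : DifferentiableAt ℝ g t)
    (hX : Tendsto X (𝓝[<] t) (𝓝 y))
    (hφ : ∀ᶠ s in 𝓝[<] t, g t - g s ≤ θ * |X s - y| ^ 4)
    (hv : ∀ᶠ s in 𝓝[<] t, |X s - y| ^ 3 ≤ C * (t - s)) : deriv g t ≤ 0 := by
  have h1 : Tendsto (slope g t) (𝓝[<] t) (𝓝 (deriv g t)) :=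
    (hasDerivAt_iff_tendsto_slope.1 hg.hasDerivAt).mono_left
      (nhdsWithin_mono _ fun s hs => ne_of_lt hs)
  have h2 : Tendsto (fun s => |θ| * C * |X s - y|) (𝓝[<] t) (𝓝 (|θ| * C * |y - y|)) :=
    ((hX.sub_const y).abs).const_mul _
  rw [sub_self, abs_zero, mul_zero] at h2
  refine le_of_tendsto_of_tendsto h1 h2 ?_
  filter_upwards [hφ, hv, self_mem_nhdsWithin] with s h3 h4 hs
  have hs' : 0 < t - s := sub_pos.2 hs
  rw [slope_comm, slope_def_field, div_le_iff₀ hs']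
  refine h3.trans ?_
  have h5 : |X s - y| ^ 4 ≤ C * (t - s) * |X s - y| := by
    calc |X s - y| ^ 4 = |X s - y| ^ 3 * |X s - y| := by ring
      _ ≤ _ := mul_le_mul_of_nonneg_right h4 (abs_nonneg _)
  calc θ * |X s - y| ^ 4 ≤ |θ| * |X s - y| ^ 4 :=
        mul_le_mul_of_nonneg_right (le_abs_self _) (by positivity)
    _ ≤ |θ| * (C * (t - s) * |X s - y|) := mul_le_mul_of_nonneg_left h5 (abs_nonneg _)
    _ = _ := by ring

end Calculus

/-! ### Local structure of particle solutions -/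

/-- Integration of a one-sided velocity bound up to a time at which `X` is only known to be
continuous from the left, such as a collision time. -/
theorem eventually_displacement_ge {X X' : ℝ → ℝ} {t v' : ℝ}
    (hd : ∀ᶠ s in 𝓝[<] t, HasDerivAt X (X' s) s) (hc : Tendsto X (𝓝[<] t) (𝓝 (X t)))
    (hv : ∀ᶠ s in 𝓝[<] t, v' ≤ X' s) : ∀ᶠ s in 𝓝[<] t, v' * (t - s) ≤ X t - X s := by
  obtain ⟨e, he, h⟩ := mem_nhdsLT_iff_exists_Ioo_subset.1 (hd.and hv)
  have hd' : ∀ s ∈ Ioo e t, HasDerivAt (fun s => X s - v' * s) (X' s - v' * 1) s := fun s hs =>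
    (h hs).1.sub ((hasDerivAt_id s).const_mul v')
  have hm : MonotoneOn (fun s => X s - v' * s) (Ioo e t) := by
    refine monotoneOn_of_deriv_nonneg (convex_Ioo e t)
      (fun s hs => (hd' s hs).continuousAt.continuousWithinAt) ?_ ?_
    · rw [interior_Ioo]
      exact fun s hs => (hd' s hs).differentiableAt.differentiableWithinAt
    · rw [interior_Ioo]
      intro s hs
      rw [(hd' s hs).deriv]
      linarith [(h hs).2]
  have hlim : Tendsto (fun s => X s - v' * s) (𝓝[<] t) (𝓝 (X t - v' * t)) :=
    hc.sub ((tendsto_id.mono_left nhdsWithin_le_nhds).const_mul v')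
  filter_upwards [Ioo_mem_nhdsLT he] with s hs
  have : X s - v' * s ≤ X t - v' * t := by
    refine ge_of_tendsto hlim ?_
    filter_upwards [Ioo_mem_nhdsLT hs.2] with r hr
    exact hm hs ⟨hs.1.trans hr.1, hr.2⟩ hr.1.le
  linarith

/-- Annihilation preserves the total charge at every point, hence all sums of charges against a
function of position. Values of the step function and outer forces are therefore the same with the
charges before and after a collision. -/
theorem sum_mul_eq_of_sum_fiber_eq {ι : Type*} [Fintype ι] {b β X : ι → ℝ}
    (h : ∀ y, ∑ i with X i = y, b i = ∑ i with X i = y, β i) (g : ℝ → ℝ) :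
    ∑ i, b i * g (X i) = ∑ i, β i * g (X i) := by
  classical
  have key : ∀ a : ι → ℝ, ∑ i, a i * g (X i) =
      ∑ y ∈ Finset.univ.image X, (∑ i with X i = y, a i) * g y := by
    intro a
    rw [← Finset.sum_fiberwise_of_maps_to (s := Finset.univ) (t := Finset.univ.image X) (g := X)
      (fun i _ => Finset.mem_image_of_mem _ (Finset.mem_univ i))]
    refine Finset.sum_congr rfl fun y _ => ?_
    rw [Finset.sum_mul]
    refine Finset.sum_congr rfl fun i hi => ?_
    rw [(Finset.mem_filter.1 hi).2]
  rw [key b, key β]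
  exact Finset.sum_congr rfl fun y _ => by rw [h y]

theorem heaviside_of_nonneg {y : ℝ} (h : 0 ≤ y) : heaviside y = 1 := if_pos h

theorem heaviside_of_neg {y : ℝ} (h : y < 0) : heaviside y = 0 := if_neg (not_le.2 h)

theorem sum_mul_heaviside {ι : Type*} [Fintype ι] (γ x : ι → ℝ) (y : ℝ) :
    ∑ i, γ i * heaviside (y - x i) = ∑ i with x i ≤ y, γ i := by
  rw [Finset.sum_filter]
  refine Finset.sum_congr rfl fun i _ => ?_
  split_ifs with h
  · rw [heaviside_of_nonneg (sub_nonneg.2 h), mul_one]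
  · rw [heaviside_of_neg (sub_neg.2 (not_le.1 h)), mul_zero]

/-- Near `y`, a step function is the sum of its value to the left of `y` and the contribution of
the charges that sit at `y` in the limit. -/
theorem eventually_sum_heaviside {ι α : Type*} [Fintype ι] (β X : ι → ℝ) (y : ℝ) {l : Filter α}
    {F : α → ι → ℝ} (h : ∀ i, Tendsto (fun q => F q i) l (𝓝 (y - X i))) :
    ∀ᶠ q in l, ∑ i, β i * heaviside (F q i) =
      ∑ i, β i * (if X i < y then 1 else 0) + ∑ i, clusterCharge β X y i * heaviside (F q i) := by
  have hi : ∀ i, ∀ᶠ q in l, β i * heaviside (F q i) =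
      β i * (if X i < y then 1 else 0) + clusterCharge β X y i * heaviside (F q i) := by
    intro i
    rcases lt_trichotomy (X i) y with h' | h' | h'
    · filter_upwards [(h i).eventually (lt_mem_nhds (sub_pos.2 h'))] with q hq
      rw [heaviside_of_nonneg hq.le, if_pos h', clusterCharge, if_neg h'.ne]
      ring
    · filter_upwards with q
      rw [if_neg h'.not_lt, clusterCharge_of_eq h']
      ring
    · filter_upwards [(h i).eventually (gt_mem_nhds (sub_neg.2 h'))] with q hq
      rw [heaviside_of_neg hq, if_neg h'.not_gt]
      ring
  filter_upwards [eventually_all.2 hi] with q hq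
  rw [← Finset.sum_add_distrib]
  exact Finset.sum_congr rfl fun i _ => hq i

theorem tendsto_fst_nhdsLT (t y : ℝ) : Tendsto (fun q : ℝ × ℝ => q.1) (𝓝[{q | q.1 < t}] (t, y)) (𝓝[<] t) :=
  tendsto_nhdsWithin_iff.2 ⟨(continuous_fst.tendsto (t, y)).mono_left nhdsWithin_le_nhds,
    self_mem_nhdsWithin⟩

section Local

variable {n : ℕ} {f dU : ℝ → ℝ} {x : ℝ → Fin n → ℝ} {b : ℝ → Fin n → ℤ}

/-- The value of the step function of `x t` to the left of `y`. -/
noncomputable def leftValue (x : ℝ → Fin n → ℝ) (b : ℝ → Fin n → ℤ) (t y : ℝ) : ℝ :=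
  (1 / (n : ℝ)) * ∑ i, (b t i : ℝ) * (if x t i < y then 1 else 0)

/-- The total charge at `y`. -/
noncomputable def netCharge (x : ℝ → Fin n → ℝ) (b : ℝ → Fin n → ℤ) (t y : ℝ) : ℝ :=
  ∑ i with x t i = y, (b t i : ℝ)

/-- The behaviour of a particle solution just before time `t`. -/
structure LeftEnd (f dU : ℝ → ℝ) (x : ℝ → Fin n → ℝ) (b : ℝ → Fin n → ℤ) (t e : ℝ)
    (β : Fin n → ℝ) (d C : ℝ) : Prop where
  nonneg : 0 ≤ e
  lt : e < t
  charge : IsCharge β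
  b_eq : ∀ s ∈ Ioo e t, ∀ i, (b s i : ℝ) = β i
  flow : Flow (1 / (n : ℝ)) f dU β x (Ioo e t)
  sum_eq : ∀ y, ∑ i with x t i = y, (b t i : ℝ) = ∑ i with x t i = y, β i
  cont : ∀ i, Tendsto (fun s => x s i) (𝓝[<] t) (𝓝 (x t i))
  mono : ∀ i j, i < j → β i ≠ 0 → β j ≠ 0 → x t i ≤ x t j
  gap_pos : 0 < d
  gap : SameGap β (x t) d
  cube_nonneg : 0 ≤ C
  cube : ∀ i j, Consec β i j → x t i = x t j → ∀ s ∈ Ioo e t, (x s j - x s i) ^ 3 ≤ C * (t - s)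

theorem Traj.exists_leftEnd (h : Traj f dU x b) (hf : IsKernel f) {L : NNReal}
    (hL : LipschitzWith L dU) {t : ℝ} (ht : 0 < t) : ∃ e β d C, LeftEnd f dU x b t e β d C := by
  obtain ⟨e, he, β, hb, hflow, hsum⟩ := h.left t ht
  have hc : 0 ≤ 1 / (n : ℝ) := by positivity
  have hmid : ((e + t) / 2) ∈ Ioo e t := ⟨by linarith [he.2], by linarith [he.2]⟩
  have hch : IsCharge fun i => (β i : ℝ) := by
    rw [← hb _ hmid]
    exact isCharge_cast (h.mem _ (he.1.trans hmid.1.le)).1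
  have hflow' : Flow (1 / (n : ℝ)) f dU (fun i => (β i : ℝ)) x (Ico ((e + t) / 2) t) :=
    hflow.mono fun s hs => ⟨hmid.1.trans_le hs.1, hs.2⟩
  obtain ⟨d, hd, hgap⟩ := hflow'.exists_sameGap hf hc hch hL
  obtain ⟨C, hC, hcube⟩ := hflow'.exists_gap_cube hf hc hch hL
  have hcont : ∀ i, Tendsto (fun s => x s i) (𝓝[<] t) (𝓝 (x t i)) := fun i => by
    have h1 : ContinuousAt x t := (h.continuous t ht.le).continuousAt (Ici_mem_nhds ht)
    exact ((tendsto_pi_nhds.1 h1.tendsto) i).mono_left nhdsWithin_le_nhds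
  have hnear : ∀ᶠ s in 𝓝[<] t, s ∈ Ico ((e + t) / 2) t := by
    filter_upwards [Ioo_mem_nhdsLT hmid.2] with s hs using ⟨hs.1.le, hs.2⟩
  refine ⟨(e + t) / 2, fun i => (β i : ℝ), d, C, ⟨he.1.trans hmid.1.le, hmid.2, hch,
    fun s hs i => ?_, hflow'.mono Ioo_subset_Ico_self, fun y => by exact_mod_cast hsum y, hcont,
    fun i j hij hi hj => ?_, hd, fun i j hij hs => ?_, hC, fun i j hij hX s hs => ?_⟩⟩
  · rw [hb s ⟨hmid.1.trans hs.1, hs.2⟩]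
  · exact le_of_tendsto_of_tendsto (hcont i) (hcont j)
      (hnear.mono fun s hs => (hflow'.order s hs i j hij hi hj).le)
  · exact ge_of_tendsto ((hcont j).sub (hcont i)) (hnear.mono fun r hr => hgap r hr i j hij hs)
  · have hlim : Tendsto (fun s => (x s j - x s i) ^ 3 + C * s) (𝓝[<] t)
        (𝓝 ((x t j - x t i) ^ 3 + C * t)) :=
      (((hcont j).sub (hcont i)).pow 3).add ((tendsto_id.mono_left nhdsWithin_le_nhds).const_mul C)
    have h1 : (x s j - x s i) ^ 3 + C * s ≤ (x t j - x t i) ^ 3 + C * t := by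
      refine ge_of_tendsto hlim ?_
      filter_upwards [Ioo_mem_nhdsLT hs.2] with r hr
      exact hcube i j hij ⟨hs.1.le, hs.2⟩ ⟨hs.1.le.trans hr.1.le, hr.2⟩ hr.1.le
    rw [hX, sub_self] at h1
    nlinarith

/-- `a` and `z` are the first and the last particle of the cluster at `y`. -/
structure IsCluster (β X : Fin n → ℝ) (y : ℝ) (a z : Fin n) : Prop where
  first_ne : clusterCharge β X y a ≠ 0
  first : ∀ k, k < a → clusterCharge β X y k = 0
  last_ne : clusterCharge β X y z ≠ 0
  last : ∀ k, z < k → clusterCharge β X y k = 0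

theorem exists_isCluster (β X : Fin n → ℝ) (y : ℝ) :
    (∀ i, clusterCharge β X y i = 0) ∨ ∃ a z, IsCluster β X y a z := by
  by_cases h : ∀ i, clusterCharge β X y i = 0
  · exact Or.inl h
  · right
    push Not at h
    have hne : (Finset.univ.filter fun i => clusterCharge β X y i ≠ 0).Nonempty :=
      h.imp fun i hi => by simpa using hi
    refine ⟨_, _, by simpa using Finset.min'_mem _ hne, fun k hk => ?_,
      by simpa using Finset.max'_mem _ hne, fun k hk => ?_⟩
    · by_contra h'
      exact absurd (Finset.min'_le _ k (by simpa using h')) (not_le.2 hk)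
    · by_contra h'
      exact absurd (Finset.le_max' _ k (by simpa using h')) (not_le.2 hk)

namespace LeftEnd

variable {t e d C y : ℝ} {β : Fin n → ℝ} (h : LeftEnd f dU x b t e β d C)
include h

theorem alternating (y : ℝ) : ∀ i j, Consec (clusterCharge β (x t) y) i j →
    clusterCharge β (x t) y i ≠ clusterCharge β (x t) y j :=
  cluster_alternating h.gap_pos h.mono h.gap y

theorem ordered_cluster {s : ℝ} (hs : s ∈ Ioo e t) (y : ℝ) :
    Ordered (clusterCharge β (x t) y) (x s) := fun i j hij hi hj =>
  h.flow.order s hs i j hij (clusterCharge_ne_zero.1 hi).1 (clusterCharge_ne_zero.1 hj).1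

theorem sum_cluster_eq (y : ℝ) : ∑ i, clusterCharge β (x t) y i = netCharge x b t y := by
  rw [sum_cluster, netCharge, h.sum_eq]

theorem sum_mul_eq (g : ℝ → ℝ) : ∑ i, (b t i : ℝ) * g (x t i) = ∑ i, β i * g (x t i) :=
  sum_mul_eq_of_sum_fiber_eq h.sum_eq g

theorem eventually_mem : ∀ᶠ s in 𝓝[<] t, s ∈ Ioo e t := Ioo_mem_nhdsLT h.lt

theorem eventually_value (y : ℝ) : ∀ᶠ q in 𝓝[{q : ℝ × ℝ | q.1 < t}] (t, y), q.1 ∈ Ioo e t ∧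
    stepEvolution x b q = leftValue x b t y +
      (1 / (n : ℝ)) * ∑ i with x q.1 i ≤ q.2, clusterCharge β (x t) y i := by
  have h1 : ∀ i, Tendsto (fun q : ℝ × ℝ => q.2 - x q.1 i) (𝓝[{q | q.1 < t}] (t, y))
      (𝓝 (y - x t i)) := fun i =>
    ((continuous_snd.tendsto (t, y)).mono_left nhdsWithin_le_nhds).sub
      ((h.cont i).comp (tendsto_fst_nhdsLT t y))
  filter_upwards [eventually_sum_heaviside β (x t) y h1, (tendsto_fst_nhdsLT t y).eventually h.eventually_mem]
    with q hq hq'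
  refine ⟨hq', ?_⟩
  rw [stepEvolution, stepFunction, leftValue, ← mul_add, ← sum_mul_heaviside,
    h.sum_mul_eq fun s => if s < y then 1 else 0, ← hq]
  congr 1
  exact Finset.sum_congr rfl fun i _ => by rw [h.b_eq _ hq' i]

variable {a z : Fin n} (hc : IsCluster β (x t) y a z)

include hc in
theorem partial_sum (p : Fin n → Prop) [DecidablePred p]
    (hp : ∀ i j, i < j → clusterCharge β (x t) y i ≠ 0 → clusterCharge β (x t) y j ≠ 0 → p j → p i) :
    ∑ i with p i, clusterCharge β (x t) y i = 0 ∨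
      ∑ i with p i, clusterCharge β (x t) y i = clusterCharge β (x t) y a := by
  by_cases ha : p a
  · exact alternating_partial_sum (h.charge.cluster _ _) (h.alternating y) hc.first_ne hc.first p ha
      fun i j hij => hp i j hij.1 hij.2.1 hij.2.2.1
  · left
    refine Finset.sum_eq_zero fun i hi => ?_
    by_contra h'
    have hai : a ≤ i := not_lt.1 fun hlt => h' (hc.first i hlt)
    rcases hai.eq_or_lt with rfl | hlt
    · exact ha (by simpa using hi)
    · exact ha (hp a i hlt hc.first_ne h' (by simpa using hi))

include hc in
theorem net_eq_first : netCharge x b t y = 0 ∨ netCharge x b t y = clusterCharge β (x t) y a := by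
  have := h.partial_sum hc (fun _ => True) fun _ _ _ _ _ _ => trivial
  simpa [h.sum_cluster_eq] using this

include hc in
/-- The partial sums up to and strictly before a particle of the cluster. -/
theorem partial_sums {i : Fin n} (hi : clusterCharge β (x t) y i ≠ 0) {s : ℝ} (hs : s ∈ Ioo e t) :
    (∑ k with x s k ≤ x s i, clusterCharge β (x t) y k =
      ∑ k with x s k < x s i, clusterCharge β (x t) y k + clusterCharge β (x t) y i) ∧
    (∑ k with x s k < x s i, clusterCharge β (x t) y k = 0 ∧
      ∑ k with x s k ≤ x s i, clusterCharge β (x t) y k = clusterCharge β (x t) y a ∨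
     ∑ k with x s k < x s i, clusterCharge β (x t) y k = clusterCharge β (x t) y a ∧
      ∑ k with x s k ≤ x s i, clusterCharge β (x t) y k = 0) := by
  have hord := h.ordered_cluster hs y
  have h1 : ∑ k with x s k ≤ x s i, clusterCharge β (x t) y k =
      ∑ k with x s k < x s i, clusterCharge β (x t) y k + clusterCharge β (x t) y i := by
    rw [Finset.sum_filter, Finset.sum_filter, ← Fintype.sum_ite_eq' i (clusterCharge β (x t) y),
      ← Finset.sum_add_distrib]
    refine Finset.sum_congr rfl fun k _ => ?_
    by_cases hk : clusterCharge β (x t) y k = 0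
    · simp [hk]
    · by_cases hki : k = i
      · subst hki; simp
      · have hne := hord.ne hki hk hi
        by_cases hlt : x s k < x s i
        · simp [hlt, hlt.le, hki]
        · have : ¬ x s k ≤ x s i := fun h' => hlt (lt_of_le_of_ne h' hne)
          simp [hlt, this, hki]
  refine ⟨h1, ?_⟩
  rcases h.partial_sum hc (fun k => x s k < x s i) (fun k l hkl hk hl hp =>
    (hord k l hkl hk hl).trans hp) with h2 | h2 <;>
  rcases h.partial_sum hc (fun k => x s k ≤ x s i) (fun k l hkl hk hl hp =>
    (hord k l hkl hk hl).le.trans hp) with h3 | h3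
  · rw [h2, h3, zero_add] at h1
    exact absurd h1.symm hi
  · exact Or.inl ⟨h2, h3⟩
  · exact Or.inr ⟨h2, h3⟩
  · rw [h2, h3] at h1
    exact absurd (by linarith) hi

include hc in
-- At the last particle the partial sum is the net charge and the previous one is the other of the
-- two possible values; their difference is the last charge.
theorem net_eq_last : netCharge x b t y = 0 ∧ clusterCharge β (x t) y z = -clusterCharge β (x t) y a ∨
    netCharge x b t y = clusterCharge β (x t) y a ∧
      clusterCharge β (x t) y z = clusterCharge β (x t) y a := by
  have hs : (e + t) / 2 ∈ Ioo e t := ⟨by linarith [h.lt], by linarith [h.lt]⟩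
  have hord := h.ordered_cluster hs y
  have h1 : ∑ k with x ((e + t) / 2) k ≤ x ((e + t) / 2) z, clusterCharge β (x t) y k =
      netCharge x b t y := by
    rw [← h.sum_cluster_eq, Finset.sum_filter]
    refine Finset.sum_congr rfl fun k _ => ?_
    by_cases hk : clusterCharge β (x t) y k = 0
    · simp [hk]
    · have hkz : k ≤ z := not_lt.1 fun hlt => hk (hc.last k hlt)
      rw [if_pos]
      rcases hkz.eq_or_lt with rfl | hlt
      · exact le_rfl
      · exact (hord k z hlt hk hc.last_ne).le
  obtain ⟨h2, h3⟩ := h.partial_sums hc hc.last_ne hs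
  rw [h1] at h2 h3
  rcases h3 with ⟨h3, h4⟩ | ⟨h3, h4⟩
  · exact Or.inr ⟨h4, by linarith⟩
  · exact Or.inl ⟨h4, by linarith⟩

/-- The force at `y` exerted by the particles outside the cluster. -/
theorem tendsto_outer (hf : IsKernel f) (hU : Continuous dU) (y : ℝ) {i : Fin n} (hi : x t i = y) :
    Tendsto (fun s => (1 / (n : ℝ)) * (β i * ∑ k, (β k - clusterCharge β (x t) y k) *
      oddKer f (x s i - x s k)) - β i * dU (x s i)) (𝓝[<] t)
      (𝓝 (-(β i * ((1 / (n : ℝ)) * ∑ k, (b t k : ℝ) * oddKer f (x t k - y) + dU y)))) := by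
  have h1 : ∀ k, Tendsto (fun s => (β k - clusterCharge β (x t) y k) * oddKer f (x s i - x s k))
      (𝓝[<] t) (𝓝 (-(β k * oddKer f (x t k - y)))) := by
    intro k
    by_cases hk : x t k = y
    · rw [clusterCharge_of_eq hk, hk, sub_self, sub_self, oddKer_zero]
      simp
    · have h2 := ((hf.continuousAt_oddKer (sub_ne_zero.2 fun h' => hk (h'.symm.trans hi))).tendsto.comp
        ((h.cont i).sub (h.cont k))).const_mul (β k)
      rw [hi, ← neg_sub (x t k) y, oddKer_odd, mul_neg] at h2
      simp only [clusterCharge, if_neg hk, sub_zero]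
      exact h2
  have h3 := (((tendsto_finsetSum Finset.univ fun k _ => h1 k).const_mul (β i)).const_mul
    (1 / (n : ℝ))).sub (((hU.tendsto (x t i)).comp (h.cont i)).const_mul (β i))
  rw [h.sum_mul_eq fun s => oddKer f (s - y)]
  rw [hi, Finset.sum_neg_distrib] at h3
  convert h3 using 2
  · rfl
  · ring

omit h in
theorem velocity_split (c : ℝ) (β γ X : Fin n → ℝ) (i : Fin n) :
    velocity c f dU β X i = (c * (β i * ∑ k, (β k - γ k) * oddKer f (X i - X k)) - β i * dU (X i)) +
      c * (β i * ∑ k, γ k * oddKer f (X i - X k)) := by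
  simp only [velocity, sub_mul, Finset.sum_sub_distrib]
  ring

omit h in
theorem _root_.ParticleHJ.IsCluster.first_le (hc : IsCluster β (x t) y a z) : a ≤ z :=
  not_lt.1 fun hlt => hc.last_ne (hc.first z hlt)

include hc in
-- In a neutral cluster the first and the last particle are distinct and converge to the same point,
-- so the kernel at their distance eventually exceeds any prescribed `f r`.
theorem eventually_kernel_le (hf : IsKernel f) {r : ℝ} (hr : 0 < r) :
    ∀ᶠ s in 𝓝[<] t, netCharge x b t y = 0 → f r ≤ f (x s z - x s a) := by
  have hlim := (h.cont z).sub (h.cont a)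
  rw [(clusterCharge_ne_zero.1 hc.last_ne).2, (clusterCharge_ne_zero.1 hc.first_ne).2, sub_self] at hlim
  filter_upwards [hlim.eventually (gt_mem_nhds hr), h.eventually_mem] with s hs hs' hnet
  have haz : a ≠ z := by
    rintro rfl
    rcases h.net_eq_last hc with ⟨_, h2⟩ | ⟨h1, _⟩
    · exact hc.first_ne (by linarith)
    · exact hc.first_ne (by rw [← h1, hnet])
  refine hf.anti (mem_Ioi.2 (sub_pos.2 ?_)) hr hs.le
  exact h.ordered_cluster hs' y a z (lt_of_le_of_ne hc.first_le haz) hc.first_ne hc.last_ne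

include hc in
-- The outer forces converge and the force inside the cluster is bounded by `cluster_force_first`.
-- The radius `r` is free: the term with `f r` vanishes unless the cluster is neutral, and it later
-- absorbs the same term in `le_nonlocal_of_contact`.
theorem velocity_first (hf : IsKernel f) (hU : Continuous dU) {r η : ℝ} (hr : 0 < r) (hη : 0 < η) :
    ∀ᶠ s in 𝓝[<] t,
      -(β a * ((1 / (n : ℝ)) * ∑ k, (b t k : ℝ) * oddKer f (x t k - y) + dU y)) +
        (1 / (n : ℝ)) * ((1 - β a * netCharge x b t y) * f r) - η ≤
      velocity (1 / (n : ℝ)) f dU β (x s) a := by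
  have ha := clusterCharge_ne_zero.1 hc.first_ne
  have hβa := clusterCharge_of_eq (b := β) ha.2
  have hn : 0 ≤ 1 / (n : ℝ) := by positivity
  filter_upwards [(h.tendsto_outer hf hU y ha.2).eventually (lt_mem_nhds (sub_lt_self _ hη)),
    h.eventually_mem, h.eventually_kernel_le hc hf hr] with s h1 hs h2
  rw [velocity_split _ β (clusterCharge β (x t) y)]
  have h3 := cluster_force_first hf (h.charge.cluster _ _) (h.alternating y)
    (h.ordered_cluster hs y) hc.first_ne hc.first hc.last_ne hc.last
  rw [h.sum_cluster_eq, hβa] at h3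
  have h4 : (1 - β a * netCharge x b t y) * f r ≤
      (1 - β a * netCharge x b t y) * f (x s z - x s a) := by
    rcases h.net_eq_first hc with h5 | h5
    · rw [h5]; simpa using h2 h5
    · rw [h5, hβa, h.charge.mul_self ha.1]; simp
  have := mul_le_mul_of_nonneg_left (h4.trans h3) hn
  linarith

include hc in
theorem velocity_last (hf : IsKernel f) (hU : Continuous dU) {r η : ℝ} (hr : 0 < r) (hη : 0 < η) :
    ∀ᶠ s in 𝓝[<] t, velocity (1 / (n : ℝ)) f dU β (x s) z ≤
      -(β z * ((1 / (n : ℝ)) * ∑ k, (b t k : ℝ) * oddKer f (x t k - y) + dU y)) -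
        (1 / (n : ℝ)) * ((1 - β z * netCharge x b t y) * f r) + η := by
  have hz := clusterCharge_ne_zero.1 hc.last_ne
  have hβz := clusterCharge_of_eq (b := β) hz.2
  have hn : 0 ≤ 1 / (n : ℝ) := by positivity
  filter_upwards [(h.tendsto_outer hf hU y hz.2).eventually (gt_mem_nhds (lt_add_of_pos_right _ hη)),
    h.eventually_mem, h.eventually_kernel_le hc hf hr] with s h1 hs h2
  rw [velocity_split _ β (clusterCharge β (x t) y)]
  have h3 := cluster_force_last hf (h.charge.cluster _ _) (h.alternating y)
    (h.ordered_cluster hs y) hc.first_ne hc.first hc.last_ne hc.last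
  rw [h.sum_cluster_eq, hβz] at h3
  have h4 : (1 - β z * netCharge x b t y) * f r ≤
      (1 - β z * netCharge x b t y) * f (x s z - x s a) := by
    rcases h.net_eq_last hc with ⟨h5, _⟩ | ⟨h5, h6⟩
    · rw [h5]; simpa using h2 h5
    · rw [h5, ← h6, hβz, h.charge.mul_self hz.1]; simp
  have := mul_le_mul_of_nonneg_left (h3.trans (neg_le_neg h4)) hn
  linarith

theorem eventually_hasDerivAt (i : Fin n) : ∀ᶠ s in 𝓝[<] t,
    HasDerivAt (fun s => x s i) (velocity (1 / (n : ℝ)) f dU β (x s) i) s :=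
  h.eventually_mem.mono fun s hs => h.flow.ode s hs i

include hc in
/-- The first particle of a cluster approaches the cluster point at least like `(t-s)^{1/3}`. -/
theorem cube_bound (hf : IsKernel f) (hU : Continuous dU) :
    ∃ K, ∀ᶠ s in 𝓝[<] t, |x s a - y| ^ 3 ≤ K * (t - s) := by
  have ha := clusterCharge_ne_zero.1 hc.first_ne
  have hz := clusterCharge_ne_zero.1 hc.last_ne
  -- The first particle is bounded from above by its own velocity bound, and from below by that of
  -- the last particle minus the diameter of the cluster, which is at most n(Cτ)^{1/3} because each
  -- inner gap has cube at most Cτ.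
  have h1 := eventually_displacement_ge (h.eventually_hasDerivAt a) (h.cont a)
    (h.velocity_first hc hf hU one_pos one_pos)
  have h2 := eventually_displacement_ge ((h.eventually_hasDerivAt z).mono fun s hs => hs.neg)
    (h.cont z).neg ((h.velocity_last hc hf hU one_pos one_pos).mono fun s hs => neg_le_neg hs)
  set v₁ := -(β a * ((1 / (n : ℝ)) * ∑ k, (b t k : ℝ) * oddKer f (x t k - y) + dU y)) +
        (1 / (n : ℝ)) * ((1 - β a * netCharge x b t y) * f 1) - 1
  set v₂ := -(-(β z * ((1 / (n : ℝ)) * ∑ k, (b t k : ℝ) * oddKer f (x t k - y) + dU y)) -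
        (1 / (n : ℝ)) * ((1 - β z * netCharge x b t y) * f 1) + 1)
  set D := |v₁| + |v₂| with hD
  refine ⟨4 * (D ^ 3 + (n : ℝ) ^ 3 * C), ?_⟩
  filter_upwards [h1, h2, h.eventually_mem, Ioo_mem_nhdsLT (show t - 1 < t by linarith)]
    with s h1 h2 hs hs1
  simp only [Pi.neg_apply] at h2
  have hτ : 0 < t - s := sub_pos.2 hs.2
  have hτ1 : t - s ≤ 1 := by linarith [hs1.1]
  set τ := t - s with hτd
  set δ := (C * τ) ^ ((1 : ℝ) / 3) with hδ
  have hCτ : 0 ≤ C * τ := mul_nonneg h.cube_nonneg hτ.le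
  have hδ0 : 0 ≤ δ := Real.rpow_nonneg hCτ _
  have hδ3 : δ ^ 3 = C * τ := by
    rw [hδ, ← Real.rpow_natCast, ← Real.rpow_mul hCτ]
    norm_num
  have hdiam := diam_le_of_consec (b := clusterCharge β (x t) y) (x := x s) hδ0
    (fun i j hij => by
      have hi := clusterCharge_ne_zero.1 hij.2.1
      have hj := clusterCharge_ne_zero.1 hij.2.2.1
      refine le_of_pow_le_pow_left₀ (by norm_num : 3 ≠ 0) hδ0 ?_
      rw [hδ3]
      exact h.cube i j (consec_of_cluster h.mono hij) (hi.2.trans hj.2.symm) s hs)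
    a hc.first_ne z hc.last_ne hc.first_le
  have hcard : ((Finset.univ.filter fun k => a < k).card : ℝ) ≤ n := by
    have := Finset.card_filter_le (Finset.univ : Finset (Fin n)) fun k => a < k
    rw [Finset.card_univ, Fintype.card_fin] at this
    exact_mod_cast this
  have hdiam' : x s z - x s a ≤ n * δ := hdiam.trans (mul_le_mul_of_nonneg_right hcard hδ0)
  rw [ha.2] at h1
  rw [hz.2] at h2
  have h3 : -(|v₁| * τ) ≤ v₁ * τ := by
    rw [← neg_mul]; exact mul_le_mul_of_nonneg_right (neg_abs_le _) hτ.le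
  have h4 : -(|v₂| * τ) ≤ v₂ * τ := by
    rw [← neg_mul]; exact mul_le_mul_of_nonneg_right (neg_abs_le _) hτ.le
  have h5 : 0 ≤ |v₁| * τ := by positivity
  have h6 : 0 ≤ |v₂| * τ := by positivity
  have h7 : (0 : ℝ) ≤ n * δ := by positivity
  have habs : |x s a - y| ≤ D * τ + n * δ := by
    rw [abs_le, hD, add_mul]
    constructor <;> linarith
  have hD0 : 0 ≤ D * τ := by positivity
  calc |x s a - y| ^ 3 ≤ (D * τ + n * δ) ^ 3 := pow_le_pow_left₀ (abs_nonneg _) habs 3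
    _ ≤ 4 * ((D * τ) ^ 3 + (n * δ) ^ 3) := by
        have : 0 ≤ (D * τ + n * δ) * (D * τ - n * δ) ^ 2 := by positivity
        nlinarith
    _ = 4 * (D ^ 3 * τ ^ 3 + (n : ℝ) ^ 3 * (C * τ)) := by rw [mul_pow, mul_pow, hδ3]
    _ ≤ 4 * (D ^ 3 * τ + (n : ℝ) ^ 3 * (C * τ)) := by
        have h8 : τ ^ 3 ≤ τ := by
          have : τ ^ 2 ≤ 1 := pow_le_one₀ hτ.le hτ1
          nlinarith
        have h9 : 0 ≤ D ^ 3 := by positivity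
        nlinarith [mul_le_mul_of_nonneg_left h8 h9]
    _ = _ := by ring

end LeftEnd

end Local

/-! ### The step function of a particle solution is a subsolution -/

theorem isOpen_Q : IsOpen Q := isOpen_lt continuous_const continuous_fst

theorem eventually_nhds_of_lt_of_ge {p : ℝ × ℝ} {P : ℝ × ℝ → Prop}
    (h1 : ∀ᶠ q in 𝓝[{q | q.1 < p.1}] p, P q) (h2 : ∀ᶠ q in 𝓝[{q | p.1 ≤ q.1}] p, P q) :
    ∀ᶠ q in 𝓝 p, P q := by
  rw [eventually_nhdsWithin_iff] at h1 h2
  filter_upwards [h1, h2] with q h1 h2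
  exact (lt_or_ge q.1 p.1).elim h1 h2

theorem nonpos_of_le_left {ψ : ℝ → ℝ} {ψ' y : ℝ} (h : HasDerivAt ψ ψ' y)
    (hle : ∀ᶠ z in 𝓝[<] y, ψ y ≤ ψ z) : ψ' ≤ 0 := by
  refine le_of_tendsto ((hasDerivAt_iff_tendsto_slope.1 h).mono_left
    (nhdsWithin_mono y (s := Iio y) fun s hs => (show s < y from hs).ne)) ?_
  filter_upwards [hle, self_mem_nhdsWithin] with z hz hzy
  rw [slope_def_field]
  exact div_nonpos_of_nonneg_of_nonpos (sub_nonneg.2 hz) (sub_nonpos.2 (show z < y from hzy).le)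

theorem nonneg_of_le_right {ψ : ℝ → ℝ} {ψ' y : ℝ} (h : HasDerivAt ψ ψ' y)
    (hle : ∀ᶠ z in 𝓝[>] y, ψ y ≤ ψ z) : 0 ≤ ψ' := by
  refine ge_of_tendsto ((hasDerivAt_iff_tendsto_slope.1 h).mono_left
    (nhdsWithin_mono y (s := Ioi y) fun s hs => (show y < s from hs).ne')) ?_
  filter_upwards [hle, self_mem_nhdsWithin] with z hz hzy
  rw [slope_def_field]
  exact div_nonneg (sub_nonneg.2 hz) (sub_nonneg.2 (show y < z from hzy).le)

theorem staircase_mul_int {ε : ℝ} (hε : 0 < ε) (k : ℤ) :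
    staircase ε (ε * k) = ε * (k + 1 / 2) := by
  rw [staircase, mul_div_cancel_left₀ _ hε.ne', Int.floor_intCast]

section Subsolution

variable {n : ℕ} {f dU : ℝ → ℝ} {x : ℝ → Fin n → ℝ} {b : ℝ → Fin n → ℤ} {t y : ℝ}

theorem abs_stepFunction_le {X : Fin n → ℝ} {β : Fin n → ℤ}
    (h : ∀ i, β i = -1 ∨ β i = 0 ∨ β i = 1) (y : ℝ) : |stepFunction X β y| ≤ 1 := by
  have h1 : |∑ i, (β i : ℝ) * heaviside (y - X i)| ≤ n := by
    refine (Finset.abs_sum_le_sum_abs _ _).trans ?_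
    calc ∑ i, |(β i : ℝ) * heaviside (y - X i)| ≤ ∑ _i : Fin n, (1 : ℝ) := by
          refine Finset.sum_le_sum fun i _ => ?_
          unfold heaviside
          rcases h i with h | h | h <;> rw [h] <;> split_ifs <;> norm_num
      _ = n := by simp
  rw [stepFunction, abs_mul, abs_of_nonneg (by positivity), one_div]
  calc (n : ℝ)⁻¹ * |∑ i, (β i : ℝ) * heaviside (y - X i)| ≤ (n : ℝ)⁻¹ * n :=
        mul_le_mul_of_nonneg_left h1 (by positivity)
    _ ≤ 1 := by
        rw [inv_mul_eq_div]; exact div_self_le_one _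

namespace Traj

theorem abs_le (h : Traj f dU x b) {q : ℝ × ℝ} (hq : 0 ≤ q.1) : |stepEvolution x b q| ≤ 1 :=
  abs_stepFunction_le (h.mem q.1 hq).1 q.2

theorem bounded (h : Traj f dU x b) : ∃ C : ℝ, ∀ q ∈ Q, |stepEvolution x b q| ≤ C :=
  ⟨1, fun _ hq => h.abs_le (le_of_lt hq)⟩

theorem ordered (h : Traj f dU x b) (ht : 0 ≤ t) : Ordered (fun i => (b t i : ℝ)) (x t) :=
  ordered_of_mem (h.mem t ht)

theorem eventually_value_right (h : Traj f dU x b) (ht : 0 ≤ t) (y : ℝ) :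
    ∀ᶠ q in 𝓝[{q : ℝ × ℝ | t ≤ q.1}] (t, y),
      stepEvolution x b q = leftValue x b t y +
        (1 / (n : ℝ)) * ∑ i with x q.1 i ≤ q.2, clusterCharge (fun i => (b t i : ℝ)) (x t) y i := by
  obtain ⟨e, he, hb, -⟩ := h.right t ht
  have htend : Tendsto (fun q : ℝ × ℝ => q.1) (𝓝[{q | t ≤ q.1}] (t, y)) (𝓝[≥] t) :=
    tendsto_nhdsWithin_iff.2 ⟨(continuous_fst.tendsto (t, y)).mono_left nhdsWithin_le_nhds,
      self_mem_nhdsWithin⟩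
  have hcont : ∀ i, Tendsto (fun s => x s i) (𝓝[≥] t) (𝓝 (x t i)) := fun i =>
    ((tendsto_pi_nhds.1 (h.continuous t ht).tendsto) i).mono_left
      (nhdsWithin_mono _ (Ici_subset_Ici.2 ht))
  have h1 : ∀ i, Tendsto (fun q : ℝ × ℝ => q.2 - x q.1 i) (𝓝[{q | t ≤ q.1}] (t, y))
      (𝓝 (y - x t i)) := fun i =>
    ((continuous_snd.tendsto (t, y)).mono_left nhdsWithin_le_nhds).sub ((hcont i).comp htend)
  filter_upwards [eventually_sum_heaviside (fun i => (b t i : ℝ)) (x t) y h1,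
    htend.eventually (Ico_mem_nhdsGE he)] with q hq hq'
  rw [stepEvolution, stepFunction, leftValue, ← mul_add, ← sum_mul_heaviside, ← hq, hb _ hq']

theorem sum_cluster_eq (y : ℝ) :
    ∑ i, clusterCharge (fun i => (b t i : ℝ)) (x t) y i = netCharge x b t y :=
  sum_cluster _ _ _

theorem partial_sum (h : Traj f dU x b) (ht : 0 ≤ t) (y : ℝ) (p : Fin n → Prop) [DecidablePred p] :
    ∑ i with p i, clusterCharge (fun i => (b t i : ℝ)) (x t) y i = 0 ∨
      ∑ i with p i, clusterCharge (fun i => (b t i : ℝ)) (x t) y i = netCharge x b t y := by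
  rw [← sum_cluster_eq]
  set γ := clusterCharge (fun i => (b t i : ℝ)) (x t) y with hγ
  by_cases h0 : ∀ i, γ i = 0
  · exact Or.inl (Finset.sum_eq_zero fun i _ => h0 i)
  · push Not at h0
    obtain ⟨i, hi⟩ := h0
    have hone : ∀ k, k ≠ i → γ k = 0 := by
      intro k hki
      by_contra hk
      have h1 := clusterCharge_ne_zero.1 hk
      have h2 := clusterCharge_ne_zero.1 hi
      exact (h.ordered ht).ne hki h1.1 h2.1 (h1.2.trans h2.2.symm)
    rw [Finset.sum_filter, Fintype.sum_eq_single i fun k hk => by simp [hone k hk],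
      Fintype.sum_eq_single i hone]
    split_ifs
    · exact Or.inr rfl
    · exact Or.inl rfl

theorem eventually_value_slice_left (b : ℝ → Fin n → ℤ) (x : ℝ → Fin n → ℝ) (t y : ℝ) :
    ∀ᶠ z in 𝓝[<] y, stepEvolution x b (t, z) = leftValue x b t y := by
  have h1 : ∀ i, Tendsto (fun z : ℝ => z - x t i) (𝓝[<] y) (𝓝 (y - x t i)) := fun i =>
    (tendsto_id.mono_left nhdsWithin_le_nhds).sub_const _
  filter_upwards [eventually_sum_heaviside (fun i => (b t i : ℝ)) (x t) y h1, self_mem_nhdsWithin]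
    with z hz hzy
  have hzy' : z < y := hzy
  rw [stepEvolution, stepFunction, leftValue, hz, Finset.sum_eq_zero (s := Finset.univ)
    (f := fun i => clusterCharge (fun i => (b t i : ℝ)) (x t) y i * heaviside (z - x t i)), add_zero]
  intro i _
  by_cases hi : x t i = y
  · rw [heaviside_of_neg (by linarith), mul_zero]
  · rw [clusterCharge, if_neg hi, zero_mul]

theorem eventually_value_slice_right (b : ℝ → Fin n → ℤ) (x : ℝ → Fin n → ℝ) (t y : ℝ) :
    ∀ᶠ z in 𝓝[>] y, stepEvolution x b (t, z) =
      leftValue x b t y + (1 / (n : ℝ)) * netCharge x b t y := by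
  have h1 : ∀ i, Tendsto (fun z : ℝ => z - x t i) (𝓝[>] y) (𝓝 (y - x t i)) := fun i =>
    (tendsto_id.mono_left nhdsWithin_le_nhds).sub_const _
  filter_upwards [eventually_sum_heaviside (fun i => (b t i : ℝ)) (x t) y h1, self_mem_nhdsWithin]
    with z hz hzy
  have hzy' : y < z := hzy
  rw [stepEvolution, stepFunction, leftValue, hz, mul_add, ← sum_cluster_eq]
  congr 2
  refine Finset.sum_congr rfl fun i _ => ?_
  by_cases hi : x t i = y
  · rw [heaviside_of_nonneg (by linarith), mul_one]
  · rw [clusterCharge, if_neg hi, zero_mul]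

end Traj

namespace LeftEnd

variable {e d C : ℝ} {β : Fin n → ℝ} {a z : Fin n}

theorem eventually_eq (hT : Traj f dU x b) (h : LeftEnd f dU x b t e β d C)
    (h0 : ∀ i, clusterCharge β (x t) y i = 0) :
    ∀ᶠ q in 𝓝 (t, y), stepEvolution x b q = leftValue x b t y := by
  refine eventually_nhds_of_lt_of_ge ?_ ?_
  · filter_upwards [h.eventually_value y] with q hq
    rw [hq.2, Finset.sum_eq_zero fun i _ => h0 i, mul_zero, add_zero]
  · have ht : 0 ≤ t := h.nonneg.trans h.lt.le
    have hnet : netCharge x b t y = 0 := by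
      rw [← h.sum_cluster_eq, Finset.sum_eq_zero fun i _ => h0 i]
    filter_upwards [hT.eventually_value_right ht y] with q hq
    rw [hq]
    rcases hT.partial_sum ht y fun i => x q.1 i ≤ q.2 with h1 | h1 <;> rw [h1]
    · rw [mul_zero, add_zero]
    · rw [hnet, mul_zero, add_zero]

variable (hT : Traj f dU x b) (h : LeftEnd f dU x b t e β d C)
  (hc : IsCluster β (x t) y a z)
include hT h hc

/-- Before `t` the partial sums of the alternating cluster are 0 or its first charge, and from `t`
on at most one charge is left, so no other values of the step function occur near the point. -/
theorem eventually_le : ∀ᶠ q in 𝓝 (t, y), stepEvolution x b q ≤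
    leftValue x b t y + (1 / (n : ℝ)) * max 0 (clusterCharge β (x t) y a) := by
  have hn : 0 ≤ 1 / (n : ℝ) := by positivity
  refine eventually_nhds_of_lt_of_ge ?_ ?_
  · filter_upwards [h.eventually_value y] with q hq
    rw [hq.2]
    gcongr
    rcases h.partial_sum hc (fun i => x q.1 i ≤ q.2) (fun i j hij hi hj hp =>
      ((h.ordered_cluster hq.1 y) i j hij hi hj).le.trans hp) with h1 | h1 <;> rw [h1]
    · exact le_max_left _ _
    · exact le_max_right _ _
  · have ht : 0 ≤ t := h.nonneg.trans h.lt.le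
    filter_upwards [hT.eventually_value_right ht y] with q hq
    rw [hq]
    gcongr
    rcases hT.partial_sum ht y fun i => x q.1 i ≤ q.2 with h1 | h1 <;> rw [h1]
    · exact le_max_left _ _
    · rcases h.net_eq_first hc with h2 | h2 <;> rw [h2]
      · exact le_max_left _ _
      · exact le_max_right _ _

theorem upperEnvelope_le : upperEnvelope Q (stepEvolution x b) (t, y) ≤
    leftValue x b t y + (1 / (n : ℝ)) * max 0 (clusterCharge β (x t) y a) := by
  have : (𝓝[Q] (t, y)).NeBot := neBot_nhdsWithin_of_mem (h.nonneg.trans_lt h.lt)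
  exact ParticleHJ.upperEnvelope_le hT.bounded
    (nhdsWithin_le_nhds (h.eventually_le hT hc))

/-- Every particle of the cluster switches the partial sum between 0 and the first charge, so the
larger value is attained on one of its two sides, and the envelope on its curve sees both sides.
Each such curve can therefore serve to test a contact at the collision. -/
theorem eventually_le_upperEnvelope {i : Fin n} (hi : clusterCharge β (x t) y i ≠ 0) :
    ∀ᶠ s in 𝓝[<] t, leftValue x b t y + (1 / (n : ℝ)) * max 0 (clusterCharge β (x t) y a) ≤
      upperEnvelope Q (stepEvolution x b) (s, x s i) := by
  have hlim : Tendsto (fun s => (s, x s i)) (𝓝[<] t) (𝓝[{q | q.1 < t}] (t, y)) := by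
    refine tendsto_nhdsWithin_iff.2 ⟨?_, self_mem_nhdsWithin⟩
    have h1 := h.cont i
    rw [(clusterCharge_ne_zero.1 hi).2] at h1
    exact (tendsto_id.mono_left nhdsWithin_le_nhds).prodMk_nhds h1
  filter_upwards [hlim.eventually (eventually_eventually_nhdsWithin.2 (h.eventually_value y)),
    self_mem_nhdsWithin, hlim.eventually (h.eventually_value y)] with s hs hst hval
  have hst' : s < t := hst
  have hs0 : (s, x s i) ∈ Q := h.nonneg.trans_lt hval.1.1
  rcases (h.partial_sums hc hi hval.1).2 with ⟨h1, h2⟩ | ⟨h1, h2⟩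
  all_goals rcases le_total 0 (clusterCharge β (x t) y a) with h3 | h3
  · refine le_trans (le_of_eq ?_) (le_upperEnvelope hT.bounded hs0)
    rw [hval.2, h2, max_eq_right h3]
  rotate_left
  rotate_left
  · refine le_trans (le_of_eq ?_) (le_upperEnvelope hT.bounded hs0)
    rw [hval.2, h2, max_eq_left h3]
  -- In the remaining cases the larger value is taken just to the left of the particle.
  all_goals
    refine le_upperEnvelope_of_frequently hT.bounded ?_
    have htend : Tendsto (fun y' : ℝ => (s, y')) (𝓝[<] (x s i)) (𝓝[Q] (s, x s i)) :=
      tendsto_nhdsWithin_iff.2 ⟨(tendsto_const_nhds.prodMk_nhds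
        (tendsto_id.mono_left nhdsWithin_le_nhds)), Eventually.of_forall fun _ => hs0⟩
    have htend' : Tendsto (fun y' : ℝ => (s, y')) (𝓝[<] (x s i)) (𝓝[{q | q.1 < t}] (s, x s i)) :=
      tendsto_nhdsWithin_iff.2 ⟨(tendsto_const_nhds.prodMk_nhds
        (tendsto_id.mono_left nhdsWithin_le_nhds)), Eventually.of_forall fun _ => hst'⟩
    refine htend.frequently (Eventually.frequently ?_)
    have hk : ∀ k, ∀ᶠ y' in 𝓝[<] (x s i), (x s k ≤ y' ↔ x s k < x s i) := by
      intro k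
      by_cases hk : x s k < x s i
      · filter_upwards [Ioo_mem_nhdsLT hk] with y' hy'
        exact ⟨fun _ => hk, fun _ => hy'.1.le⟩
      · filter_upwards [self_mem_nhdsWithin] with y' hy'
        exact ⟨fun h => h.trans_lt hy', fun h => absurd h hk⟩
    filter_upwards [htend'.eventually hs, eventually_all.2 hk] with y' hy' hk'
    rw [hy'.2]
    simp only [hk', h1]
  · rw [max_eq_left h3]
  · rw [max_eq_right h3]

end LeftEnd

/-- Lower bound for the nonlocal operator at a contact point with a test function from above. -/
theorem le_nonlocal_of_contact {W : ℝ → ℝ} (hf : IsKernel f) (hf0 : Tendsto f atTop (𝓝 0))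
    (hW : ∀ z ≠ 0, iteratedDeriv 2 W z = -deriv f |z|) (hn : 0 < n) {ρ : ℝ} (hρ : 0 < ρ)
    {ψ v : ℝ → ℝ} (hψ : Continuous ψ) {ψ' σ : ℝ} (hψd : HasDerivAt ψ ψ' y) (hψ' : ψ' ≠ 0)
    (hv : Measurable v) (hvb : ∃ C : ℝ, ∀ y, |v y| ≤ C) {m : ℤ}
    (hle1 : ∀ z, stepEvolution x b (t, z) - (leftValue x b t y + (1 / (n : ℝ)) * m) ≤ ψ z - ψ y)
    (hle2 : ∀ z, stepEvolution x b (t, z) - (leftValue x b t y + (1 / (n : ℝ)) * m) ≤ v z - v y)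
    (hσ : σ = 1 ∧ (m : ℝ) = 1 ∨ σ = -1 ∧ (m : ℝ) = netCharge x b t y + 1) :
    ∃ r > 0, (1 / (n : ℝ)) * ∑ k, (b t k : ℝ) * oddKer f (x t k - y) -
      (1 / (n : ℝ)) * ((1 - σ * netCharge x b t y) * f r) ≤
        nonlocal (staircase (1 / (n : ℝ))) W ρ ψ v y := by
  have hε : 0 < 1 / (n : ℝ) := by positivity
  -- The point `y` is given the charge σ, and the remainder of its net charge, `netCharge x b t y -
  -- σ`, is placed at distance `r` on the side of σ as the extra charge `none`. For |z| ≥ r this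
  -- yields the correct step function relative to the contact level; the extra charge produces the
  -- error term with `f r`.
  obtain ⟨r₀, hr₀, hb⟩ := nonlocal_bounds (ι := Option (Fin n)) hf hf0 hW hε hρ hψ hψd hψ' hv hvb
  have hr : ∀ᶠ r in 𝓝[>] (0 : ℝ), ∀ i, x t i ≠ y → r ≤ |x t i - y| := by
    refine eventually_all.2 fun i => ?_
    by_cases hi : x t i = y
    · exact Eventually.of_forall fun _ h => absurd hi h
    · filter_upwards [Ioo_mem_nhdsGT (abs_pos.2 (sub_ne_zero.2 hi))] with r hr _ using hr.2.le
  obtain ⟨r, hr, hr'⟩ := (hr.and (Ioo_mem_nhdsGT hr₀)).exists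
  set N := netCharge x b t y with hN
  have hσr : |σ * r| = r := by
    rcases hσ with h | h <;> rw [h.1] <;> simp [abs_of_pos hr'.1]
  refine ⟨r, hr'.1, ?_⟩
  have key := (hb r ⟨hr'.1, hr'.2.le⟩ σ
    (fun j => j.elim (N - σ) fun i => if x t i = y then 0 else (b t i : ℝ))
    (fun j => j.elim (σ * r) fun i => x t i - y) ?_).2 ?_
  · refine le_trans (le_of_eq ?_) key
    rw [Fintype.sum_option]
    simp only [Option.elim]
    have h1 : ∑ i, (if x t i = y then 0 else (b t i : ℝ)) * oddKer f (x t i - y) =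
        ∑ k, (b t k : ℝ) * oddKer f (x t k - y) := by
      refine Finset.sum_congr rfl fun i _ => ?_
      split_ifs with hi
      · rw [hi, sub_self, oddKer_zero]; ring
      · rfl
    have h2 : (N - σ) * oddKer f (σ * r) = -((1 - σ * N) * f r) := by
      rcases hσ with h | h <;> rw [h.1]
      · rw [one_mul, oddKer_pos hr'.1]; ring
      · rw [neg_one_mul, oddKer_odd, oddKer_pos hr'.1]; ring
    rw [h1, h2]; ring
  · rintro (_ | i) hj
    · simp only [Option.elim, hσr, le_refl]
    · simp only [Option.elim] at hj ⊢
      refine hr i fun h => ?_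
      rw [if_pos h] at hj
      exact hj rfl
  · intro z hz hzd
    have hz0 : z ≠ 0 := fun h => by
      rw [h, abs_zero] at hz
      linarith [hr'.1]
    have h1 : staircase (1 / (n : ℝ)) (stepEvolution x b (t, y + z) -
        (leftValue x b t y + (1 / (n : ℝ)) * m)) ≤
        if |z| < ρ then staircase (1 / (n : ℝ)) (ψ (y + z) - ψ y)
          else staircase (1 / (n : ℝ)) (v (y + z) - v y) := by
      split_ifs
      · exact staircase_mono hε (hle1 _)
      · exact staircase_mono hε (hle2 _)
    refine le_trans (le_of_eq ?_) h1
    -- Relative to the contact level the step function is an integer multiple of `1 / n`, so the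
    -- staircase only adds one half of a step.
    set k : ℤ := ∑ i, b t i * ((if x t i ≤ y + z then 1 else 0) - (if x t i < y then 1 else 0)) - m
      with hk
    have h2 : stepEvolution x b (t, y + z) - (leftValue x b t y + (1 / (n : ℝ)) * m) =
        (1 / (n : ℝ)) * k := by
      rw [hk, stepEvolution, stepFunction, leftValue]
      push_cast
      simp only [mul_sub, Finset.sum_sub_distrib, heaviside, sub_nonneg]
      ring
    rw [h2, staircase_mul_int hε]
    congr 1
    have h3 : (k : ℝ) = ∑ i, (if x t i = y then 0 else (b t i : ℝ)) * jumpAt (x t i - y) z +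
        N * (if 0 < z then 1 else 0) - m := by
      rw [hk, hN, netCharge, Finset.sum_filter, Finset.sum_mul, ← Finset.sum_add_distrib]
      push_cast
      congr 1
      refine Finset.sum_congr rfl fun i _ => ?_
      by_cases hi : x t i = y
      · simp only [hi, if_true, lt_irrefl, if_false, zero_mul, sub_zero, zero_add]
        have : (y ≤ y + z) ↔ 0 < z := ⟨fun h => lt_of_le_of_ne (by linarith) hz0.symm,
          fun h => by linarith⟩
        simp only [this]
      · simp only [hi, if_false, zero_mul, add_zero, jumpAt]
        by_cases hbi : (b t i : ℝ) = 0
        · rw [hbi]; ring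
        · have hzi : z ≠ x t i - y := hzd (some i) (by simpa [hi] using hbi)
          have e1 : (x t i ≤ y + z) ↔ x t i - y < z :=
            ⟨fun h => lt_of_le_of_ne (by linarith) hzi.symm, fun h => by linarith⟩
          have e2 : x t i < y ↔ x t i - y < 0 := sub_neg.symm
          simp only [e1, e2]
    rw [relStep, Fintype.sum_option, h3]
    simp only [Option.elim]
    have hnone : N - σ ≠ 0 → z ≠ σ * r := fun h => hzd none h
    rcases hσ with ⟨hσ, hm⟩ | ⟨hσ, hm⟩
    · rw [hσ, one_mul] at hnone
      rw [hσ, hm, one_mul, one_mul]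
      rcases hz0.lt_or_gt with h | h
      · simp only [jumpAt, h.not_gt, (h.trans hr'.1).not_gt, hr'.1.not_gt, if_false]; ring
      · rw [abs_of_pos h] at hz
        rcases hz.eq_or_lt with h' | h'
        · have : N = 1 := by
            by_contra hN1
            exact hnone (sub_ne_zero.2 hN1) h'.symm
          rw [this]
          simp only [jumpAt, h, if_true]; ring
        · simp only [jumpAt, h, h', hr'.1.not_gt, if_true, if_false]; ring
    · rw [hσ, hm]
      have hrneg : -1 * r < 0 := by linarith [hr'.1]
      rcases hz0.lt_or_gt with h | h
      · rw [abs_of_neg h] at hz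
        have : ¬ (-1 * r < z) := by linarith
        simp only [jumpAt, h.not_gt, this, hrneg, if_true, if_false]; ring
      · have : -1 * r < z := by linarith
        simp only [jumpAt, h, this, hrneg, if_true]; ring

/-- The upper envelope of the step function of a particle solution is a subsolution. -/
theorem Traj.isSubsolution {W U : ℝ → ℝ} (hT : Traj f (deriv U) x b) (hf : IsKernel f)
    (hf0 : Tendsto f atTop (𝓝 0)) (hW : ∀ z ≠ 0, iteratedDeriv 2 W z = -deriv f |z|)
    {L : NNReal} (hL : LipschitzWith L (deriv U)) (hn : 0 < n) {ρ : ℝ} (hρ : 0 < ρ) :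
    IsSubsolution W U (1 / (n : ℝ)) ρ (upperEnvelope Q (stepEvolution x b)) := by
  have hε : 0 < 1 / (n : ℝ) := by positivity
  refine ⟨upperSemicontinuousOn_upperEnvelope hT.bounded, ⟨1, fun p hp => ?_⟩, ?_⟩
  · have := neBot_nhdsWithin_of_mem hp
    exact abs_upperEnvelope_le fun q hq => hT.abs_le (le_of_lt hq)
  rintro φ hφ ⟨t, y⟩ hp hmax
  have ht : 0 < t := hp
  have hφd : DifferentiableAt ℝ φ (t, y) :=
    (hφ.differentiableOn (by norm_num)).differentiableAt (isOpen_Q.mem_nhds hp)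
  have hle : ∀ q ∈ Q, upperEnvelope Q (stepEvolution x b) q -
      upperEnvelope Q (stepEvolution x b) (t, y) ≤ φ q - φ (t, y) := fun q hq => by
    have := hmax hq
    simp only [mem_ofPred_eq] at this
    linarith
  obtain ⟨e, β, d, C, hE⟩ := hT.exists_leftEnd hf hL ht
  rcases exists_isCluster β (x t) y with h0 | ⟨a, z, hc⟩
  -- No charge arrives at `y`: the step function is locally constant, and the contact point is a
  -- local minimum of φ.
  · have hev := hE.eventually_eq hT h0
    have hup : upperEnvelope Q (stepEvolution x b) (t, y) ≤ leftValue x b t y := by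
      have := neBot_nhdsWithin_of_mem hp
      exact ParticleHJ.upperEnvelope_le hT.bounded
        (nhdsWithin_le_nhds (hev.mono fun q hq => hq.le))
    have hmin : ∀ᶠ q in 𝓝 (t, y), φ (t, y) ≤ φ q := by
      filter_upwards [hev, isOpen_Q.mem_nhds hp] with q hq hqQ
      have := hle q hqQ
      have := le_upperEnvelope hT.bounded hqQ
      linarith
    have hdt : dt φ (t, y) = 0 := by
      refine IsLocalMin.deriv_eq_zero ?_
      exact (show Tendsto (fun s : ℝ => (s, y)) (𝓝 t) (𝓝 (t, y)) from
        (Continuous.prodMk continuous_id continuous_const).tendsto t).eventually hmin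
    have hdx : dx φ (t, y) = 0 := by
      refine IsLocalMin.deriv_eq_zero ?_
      exact (show Tendsto (fun s : ℝ => (t, s)) (𝓝 y) (𝓝 (t, y)) from
        (Continuous.prodMk continuous_const continuous_id).tendsto y).eventually hmin
    exact ⟨fun h => absurd hdx h, fun _ => hdt.le⟩
  · have hup := hE.upperEnvelope_le hT hc
    have ha := clusterCharge_ne_zero.1 hc.first_ne
    have hz := clusterCharge_ne_zero.1 hc.last_ne
    have hβa := clusterCharge_of_eq (b := β) ha.2
    have hβz := clusterCharge_of_eq (b := β) hz.2
    have hcurve : ∀ i, clusterCharge β (x t) y i ≠ 0 →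
        ∀ᶠ s in 𝓝[<] t, φ (t, y) ≤ φ (s, x s i) := by
      intro i hi
      filter_upwards [hE.eventually_le_upperEnvelope hT hc hi, hE.eventually_mem] with s hs hs'
      have := hle (s, x s i) (hE.nonneg.trans_lt hs'.1)
      linarith
    have hlim : ∀ i, clusterCharge β (x t) y i ≠ 0 →
        Tendsto (fun s => x s i) (𝓝[<] t) (𝓝 y) := fun i hi => by
      have := hE.cont i
      rwa [(clusterCharge_ne_zero.1 hi).2] at this
    have hstep : ∀ s, stepEvolution x b (t, s) ≤ upperEnvelope Q (stepEvolution x b) (t, s) :=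
      fun s => le_upperEnvelope hT.bounded (show (t, s) ∈ Q from ht)
    refine ⟨fun hdx => ?_, fun hquart => ?_⟩
    · have hψd := hasDerivAt_dx hφd
      have hψc : Continuous fun s => φ (t, s) := by
        rw [continuous_iff_continuousAt]
        intro s
        refine ContinuousAt.comp (g := φ) (f := fun s : ℝ => (t, s)) ?_
          (Continuous.prodMk continuous_const continuous_id).continuousAt
        exact (hφ.continuousOn).continuousAt (isOpen_Q.mem_nhds (show (t, s) ∈ Q from ht))
      have hvm : Measurable fun s => upperEnvelope Q (stepEvolution x b) (t, s) := by
        refine UpperSemicontinuous.measurable fun s A hA => ?_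
        have h1 := (upperSemicontinuousOn_upperEnvelope hT.bounded) (t, s) ht A hA
        rw [isOpen_Q.nhdsWithin_eq (show (t, s) ∈ Q from ht)] at h1
        exact ((Continuous.prodMk continuous_const continuous_id).tendsto s).eventually h1
      have hvb : ∃ C : ℝ, ∀ s, |upperEnvelope Q (stepEvolution x b) (t, s)| ≤ C := ⟨1, fun s => by
        have := neBot_nhdsWithin_of_mem (show (t, s) ∈ Q from ht)
        exact abs_upperEnvelope_le fun q hq => hT.abs_le (le_of_lt hq)⟩
      -- Here σ is the sign of φ_x, `i` is the end particle of the cluster with charge σ (the first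
      -- for σ = 1, the last for σ = -1), and `m` is the height of the contact above the left value.
      -- The velocity of particle `i` and the nonlocal operator are bounded with the same term in `f
      -- r`, which cancels.
      have main : ∀ (σ : ℝ) (m : ℤ) (i : Fin n), clusterCharge β (x t) y i ≠ 0 →
          0 < σ * dx φ (t, y) →
          (σ = 1 ∧ (m : ℝ) = 1 ∨ σ = -1 ∧ (m : ℝ) = netCharge x b t y + 1) →
          max 0 (clusterCharge β (x t) y a) = m →
          (∀ r > 0, ∀ η > 0, ∀ᶠ s in 𝓝[<] t,
            -((1 / (n : ℝ)) * ∑ k, (b t k : ℝ) * oddKer f (x t k - y) + deriv U y) +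
            (1 / (n : ℝ)) * ((1 - σ * netCharge x b t y) * f r) - η ≤
            σ * velocity (1 / (n : ℝ)) f (deriv U) β (x s) i) →
          dt φ (t, y) ≤ (nonlocal (staircase (1 / (n : ℝ))) W ρ (fun s => φ (t, s))
            (fun s => upperEnvelope Q (stepEvolution x b) (t, s)) y + deriv U y) * |dx φ (t, y)| := by
        intro σ m i hi hσdx hσ hm hvel
        have hσσ : σ * σ = 1 := by rcases hσ with h | h <;> rw [h.1] <;> norm_num
        have habs : |dx φ (t, y)| = σ * dx φ (t, y) := by
          rcases hσ with h | h <;> rw [h.1] at hσdx ⊢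
          · rw [one_mul] at hσdx ⊢; exact abs_of_pos hσdx
          · rw [neg_one_mul] at hσdx ⊢; exact abs_of_neg (neg_pos.1 hσdx)
        rw [hm] at hup
        obtain ⟨r, hr, hM⟩ := le_nonlocal_of_contact (b := b) (x := x) (t := t) hf hf0 hW hn hρ hψc
          hψd hdx hvm hvb (m := m) (σ := σ)
          (fun s => by have := hle (t, s) ht; have := hstep s; linarith)
          (fun s => by have := hstep s; linarith) hσ
        set M := nonlocal (staircase (1 / (n : ℝ))) W ρ (fun s => φ (t, s))
            (fun s => upperEnvelope Q (stepEvolution x b) (t, s)) y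
        refine le_of_forall_pos_le_add fun η hη => ?_
        have hA : 0 < |dx φ (t, y)| := abs_pos.2 hdx
        have hη' : 0 < η / |dx φ (t, y)| := by positivity
        have hdisp := eventually_displacement_ge
          ((hE.eventually_hasDerivAt i).mono fun s hs => hs.const_mul σ)
          ((hE.cont i).const_mul σ) (hvel r hr _ hη')
        have := dt_le_of_curve (v' := -(M + deriv U y) - η / |dx φ (t, y)|) hφd hσσ hσdx (hlim i hi)
          (hcurve i hi) (by
            filter_upwards [hdisp, self_mem_nhdsWithin] with s hs hst
            have hst' : s < t := hst
            rw [(clusterCharge_ne_zero.1 hi).2] at hs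
            refine le_trans (mul_le_mul_of_nonneg_right ?_ (sub_nonneg.2 hst'.le))
              (hs.trans (by linarith))
            linarith)
        rw [← habs] at this
        have h3 : η / |dx φ (t, y)| * |dx φ (t, y)| = η := div_mul_cancel₀ _ hA.ne'
        nlinarith
      rw [hamiltonian, upperEnvelope_staircase hε]
      rcases hdx.lt_or_gt with hneg | hpos
      -- If the maximal value were taken just to the right of `y`, contact from above would force
      -- φ_x ≥ 0. The remaining possibilities all end the cluster with a negative charge.
      · have hne : netCharge x b t y ≠ max 0 (clusterCharge β (x t) y a) := fun hnet => by
          refine absurd (nonneg_of_le_right hψd ?_) (not_le.2 hneg)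
          filter_upwards [Traj.eventually_value_slice_right b x t y] with s hs
          have := hle (t, s) ht
          have := hstep s
          rw [hnet] at hs
          linarith
        have hz1 : β z = -1 ∧ ∃ m : ℤ, (m : ℝ) = netCharge x b t y + 1 ∧
            max 0 (clusterCharge β (x t) y a) = m := by
          rw [hβa] at hne ⊢
          rcases hE.net_eq_last hc with ⟨h1, h2⟩ | ⟨h1, h2⟩ <;> rw [hβa, hβz] at h2
          · rcases hE.charge a with h3 | h3 | h3
            · rw [h1, h3] at hne; norm_num at hne
            · exact absurd h3 ha.1
            · exact ⟨by rw [h2, h3], 1, by rw [h1]; norm_num, by rw [h3]; norm_num⟩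
          · rw [hβa] at h1
            rcases hE.charge a with h3 | h3 | h3
            · exact ⟨by rw [h2, h3], 0, by rw [h1, h3]; norm_num, by rw [h3]; norm_num⟩
            · exact absurd h3 ha.1
            · rw [h1, h3] at hne; norm_num at hne
        obtain ⟨hz1, m, hm1, hm2⟩ := hz1
        refine main (-1) m z hc.last_ne (by linarith) (Or.inr ⟨rfl, hm1⟩) hm2 fun r hr η hη => ?_
        filter_upwards [hE.velocity_last hc hf hL.continuous hr hη] with s hs
        rw [hz1] at hs
        linarith
      -- If the first charge were negative, the maximal value would be taken just to the left of
      -- `y`, which forces φ_x ≤ 0.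
      · have ha1 : β a = 1 := by
          rcases hE.charge a with h3 | h3 | h3
          · refine absurd (nonpos_of_le_left hψd ?_) (not_le.2 hpos)
            filter_upwards [Traj.eventually_value_slice_left b x t y] with s hs
            have := hle (t, s) ht
            have := hstep s
            rw [hβa, h3, max_eq_left (by norm_num), mul_zero] at hup
            linarith
          · exact absurd h3 ha.1
          · exact h3
        refine main 1 1 a hc.first_ne (by linarith) (Or.inl ⟨rfl, by norm_num⟩)
          (by rw [hβa, ha1]; norm_num) fun r hr η hη => ?_
        filter_upwards [hE.velocity_first hc hf hL.continuous hr hη] with s hs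
        rw [ha1] at hs
        linarith
    · obtain ⟨θ, g, hg, hφg⟩ := hquart
      have hdt : dt φ (t, y) = deriv g t := by
        refine Filter.EventuallyEq.deriv_eq ?_
        filter_upwards [Ioi_mem_nhds ht] with s hs
        rw [hφg (s, y) hs]
        simp
      rw [hdt]
      obtain ⟨K, hK⟩ := hE.cube_bound hc hf hL.continuous
      refine deriv_nonpos_of_quartic (θ := θ)
        ((hg.differentiableOn (by norm_num)).differentiableAt (Ioi_mem_nhds ht))
        (hlim a hc.first_ne) ?_ hK
      filter_upwards [hcurve a hc.first_ne, hE.eventually_mem] with s hs hs'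
      rw [hφg _ hp, hφg (s, x s a) (hE.nonneg.trans_lt hs'.1)] at hs
      simp only [sub_self, abs_zero] at hs
      have : θ * (0 : ℝ) ^ 4 = 0 := by norm_num
      linarith

end Subsolution

/-! ### Symmetry under negation -/

/-- Negation exchanges the two envelopes of the staircase. Since `limUnder` need not commute with
negation when a limit is missing, both principal values are evaluated explicitly, and this uses φ_x
≠ 0. -/
theorem hamiltonian_neg {f W U : ℝ → ℝ} (hf : IsKernel f) (hf0 : Tendsto f atTop (𝓝 0))
    (hW : ∀ z ≠ 0, iteratedDeriv 2 W z = -deriv f |z|) {ε ρ : ℝ} (hε : 0 < ε) (hρ : 0 < ρ)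
    {ψ : ℝ × ℝ → ℝ} (v : ℝ × ℝ → ℝ) (hψ : ContDiffOn ℝ 2 ψ Q) {p : ℝ × ℝ} (hp : p ∈ Q)
    (hdx : dx ψ p ≠ 0) :
    hamiltonian (lowerEnvelope univ (staircase ε)) W U ρ ψ v p =
      -hamiltonian (upperEnvelope univ (staircase ε)) W (fun s => -U s) ρ (fun q => -ψ q)
        (fun q => -v q) p := by
  have hψd : DifferentiableAt ℝ ψ p :=
    (hψ.differentiableOn (by norm_num)).differentiableAt (isOpen_Q.mem_nhds hp)
  have hψc : Continuous fun s => -ψ (p.1, s) := by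
    rw [continuous_iff_continuousAt]
    intro s
    refine (ContinuousAt.comp (g := ψ) (f := fun s : ℝ => (p.1, s)) ?_
      (Continuous.prodMk continuous_const continuous_id).continuousAt).neg
    exact (hψ.continuousOn).continuousAt (isOpen_Q.mem_nhds (show (p.1, s) ∈ Q from hp))
  have hd := (hasDerivAt_dx hψd).neg
  have hdx' : dx (fun q => -ψ q) p = -dx ψ p := hd.deriv
  obtain ⟨r, hr, h⟩ := nonlocal_eq (v := fun y => -v (p.1, y)) hf hf0 hW hε hρ hψc hd
    (neg_ne_zero.2 hdx)
  have hr' := h r ⟨hr, le_rfl⟩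
  have key : nonlocal (lowerEnvelope univ (staircase ε)) W ρ (fun y => ψ (p.1, y))
      (fun y => v (p.1, y)) p.2 = -nonlocal (staircase ε) W ρ (fun y => -ψ (p.1, y))
      (fun y => -v (p.1, y)) p.2 := by
    rw [hr'.2.2.2, nonlocal, neg_add, ← integral_neg, ← integral_neg]
    have e1 : ∀ z, lowerEnvelope univ (staircase ε) (ψ (p.1, p.2 + z) - ψ (p.1, p.2)) *
        iteratedDeriv 2 W z = -(staircase ε (-ψ (p.1, p.2 + z) - -ψ (p.1, p.2)) *
        iteratedDeriv 2 W z) := fun z => by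
      rw [lowerEnvelope_staircase hε, neg_mul]
      congr 4
      ring
    have e2 : ∀ z, lowerEnvelope univ (staircase ε) (v (p.1, p.2 + z) - v (p.1, p.2)) *
        iteratedDeriv 2 W z = -(staircase ε (-v (p.1, p.2 + z) - -v (p.1, p.2)) *
        iteratedDeriv 2 W z) := fun z => by
      rw [lowerEnvelope_staircase hε, neg_mul]
      congr 4
      ring
    simp only [e1, e2]
    congr 1
    refine pvIntegral_eq hr hr'.1 (fun z hz hzr => ?_) fun δ hδ => Integrable.neg ?_
    · rw [hr'.2.1 z hz hzr, iteratedDeriv_two_neg hW]; ring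
    · exact ((h (min δ r) ⟨lt_min hδ hr, min_le_right _ _⟩).2.2.1).mono_set fun z hz =>
        ⟨(min_le_left _ _).trans hz.1, hz.2⟩
  rw [hamiltonian, hamiltonian, upperEnvelope_staircase hε, hdx', abs_neg, key,
    show deriv (fun s => -U s) p.2 = -deriv U p.2 from deriv.fun_neg]
  ring

theorem IsQuarticAt.neg {φ : ℝ × ℝ → ℝ} {y : ℝ} (h : IsQuarticAt φ y) :
    IsQuarticAt (fun q => -φ q) y := by
  obtain ⟨θ, g, hg, h⟩ := h
  exact ⟨-θ, fun s => -g s, hg.neg, fun p hp => by simp only [h p hp]; ring⟩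

theorem dt_neg (φ : ℝ × ℝ → ℝ) (p : ℝ × ℝ) : dt (fun q => -φ q) p = -dt φ p := deriv.fun_neg

theorem dx_neg (φ : ℝ × ℝ → ℝ) (p : ℝ × ℝ) : dx (fun q => -φ q) p = -dx φ p := deriv.fun_neg

section Negation

variable {f W U : ℝ → ℝ} {ε ρ : ℝ}

theorem IsSupersolution.neg (hf : IsKernel f) (hf0 : Tendsto f atTop (𝓝 0))
    (hW : ∀ z ≠ 0, iteratedDeriv 2 W z = -deriv f |z|) (hε : 0 < ε) (hρ : 0 < ρ)
    {v : ℝ × ℝ → ℝ} (h : IsSupersolution W U ε ρ v) :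
    IsSubsolution W (fun s => -U s) ε ρ fun q => -v q := by
  refine ⟨fun p hp A hA => ?_, ?_, fun φ hφ p hp hmax => ?_⟩
  · filter_upwards [h.lsc p hp (-A) (by linarith)] with q hq
    linarith
  · obtain ⟨C, hC⟩ := h.bounded
    exact ⟨C, fun p hp => by rw [abs_neg]; exact hC p hp⟩
  · have h1 := h.test (fun q => -φ q) hφ.neg p hp fun q hq => by
      have := hmax hq
      simp only [mem_ofPred_eq] at this ⊢
      linarith
    rw [dt_neg, dx_neg] at h1
    refine ⟨fun hdx => ?_, fun hq => by linarith [h1.2 hq.neg]⟩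
    have h2 := h1.1 (neg_ne_zero.2 hdx)
    rw [hamiltonian_neg hf hf0 hW hε hρ v hφ.neg hp (by rw [dx_neg]; exact neg_ne_zero.2 hdx)] at h2
    simp only [neg_neg] at h2
    linarith

theorem IsSubsolution.isSupersolution (hf : IsKernel f) (hf0 : Tendsto f atTop (𝓝 0))
    (hW : ∀ z ≠ 0, iteratedDeriv 2 W z = -deriv f |z|) (hε : 0 < ε) (hρ : 0 < ρ)
    {v : ℝ × ℝ → ℝ} (h : IsSubsolution W (fun s => -U s) ε ρ fun q => -v q) :
    IsSupersolution W U ε ρ v := by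
  refine ⟨fun p hp A hA => ?_, ?_, fun φ hφ p hp hmin => ?_⟩
  · filter_upwards [h.usc p hp (-A) (by linarith)] with q hq
    linarith
  · obtain ⟨C, hC⟩ := h.bounded
    exact ⟨C, fun p hp => by rw [← abs_neg]; exact hC p hp⟩
  · have h1 := h.test (fun q => -φ q) hφ.neg p hp fun q hq => by
      have := hmin hq
      simp only [mem_ofPred_eq] at this ⊢
      linarith
    rw [dt_neg, dx_neg] at h1
    refine ⟨fun hdx => ?_, fun hq => by linarith [h1.2 hq.neg]⟩
    rw [hamiltonian_neg hf hf0 hW hε hρ v hφ hp hdx]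
    linarith [h1.1 (neg_ne_zero.2 hdx)]

end Negation

/-! ### Particle solutions as viscosity solutions, and their initial envelopes -/

section Solution

variable {n : ℕ} {f dU : ℝ → ℝ} {x : ℝ → Fin n → ℝ} {b : ℝ → Fin n → ℤ} {t y : ℝ}

/-- The interaction is quadratic in the charges, so flipping all of them has to be compensated only
in the drift. -/
theorem velocity_neg {c : ℝ} (β X : Fin n → ℝ) (i : Fin n) :
    velocity c f (fun s => -dU s) (fun k => -β k) X i = velocity c f dU β X i := by
  simp only [velocity, neg_mul, Finset.sum_neg_distrib]
  ring

theorem Flow.neg {c : ℝ} {β : Fin n → ℝ} {I : Set ℝ} (h : Flow c f dU β x I) :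
    Flow c f (fun s => -dU s) (fun k => -β k) x I :=
  ⟨fun t ht i j hij hi hj => h.order t ht i j hij (neg_ne_zero.1 hi) (neg_ne_zero.1 hj),
    fun t ht i => by rw [velocity_neg]; exact h.ode t ht i⟩

theorem Traj.neg (h : Traj f dU x b) : Traj f (fun s => -dU s) x fun t i => -b t i := by
  refine ⟨h.continuous, fun t ht => ⟨fun i => ?_, fun i j hij hb => ?_⟩, fun t ht => ?_,
    fun t ht => ?_⟩
  · rcases (h.mem t ht).1 i with h | h | h <;> simp only at h ⊢ <;> rw [h] <;> simp
  · refine (h.mem t ht).2 i j hij ?_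
    simpa using hb
  · obtain ⟨e, he, h1, h2⟩ := h.right t ht
    refine ⟨e, he, fun s hs => by rw [h1 s hs], ?_⟩
    have := h2.neg
    simpa only [Int.cast_neg] using this
  · obtain ⟨e, he, β, h1, h2, h3⟩ := h.left t ht
    refine ⟨e, he, fun i => -β i, fun s hs => by rw [h1 s hs], ?_, fun y => ?_⟩
    · have := h2.neg
      simpa only [Int.cast_neg] using this
    · rw [Finset.sum_neg_distrib, Finset.sum_neg_distrib, h3]

theorem stepFunction_neg (X : Fin n → ℝ) (β : Fin n → ℤ) (y : ℝ) :
    stepFunction X (fun i => -β i) y = -stepFunction X β y := by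
  simp only [stepFunction, Int.cast_neg, neg_mul, Finset.sum_neg_distrib, mul_neg]

theorem stepEvolution_neg (x : ℝ → Fin n → ℝ) (b : ℝ → Fin n → ℤ) (q : ℝ × ℝ) :
    stepEvolution x (fun t i => -b t i) q = -stepEvolution x b q := stepFunction_neg _ _ _

theorem lowerEnvelope_stepEvolution (s : Set (ℝ × ℝ)) (p : ℝ × ℝ) :
    lowerEnvelope s (stepEvolution x b) p =
      -upperEnvelope s (stepEvolution x fun t i => -b t i) p := by
  rw [lowerEnvelope_eq_neg]
  congr 2
  ext q
  rw [stepEvolution_neg]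

theorem Traj.isViscositySolution {W U : ℝ → ℝ} (hT : Traj f (deriv U) x b) (hf : IsKernel f)
    (hf0 : Tendsto f atTop (𝓝 0)) (hW : ∀ z ≠ 0, iteratedDeriv 2 W z = -deriv f |z|)
    {L : NNReal} (hL : LipschitzWith L (deriv U)) (hn : 0 < n) {ρ : ℝ} (hρ : 0 < ρ) :
    IsViscositySolution W U (1 / (n : ℝ)) ρ (stepEvolution x b) := by
  refine ⟨hT.bounded, hT.isSubsolution hf hf0 hW hL hn hρ,
    IsSubsolution.isSupersolution hf hf0 hW (by positivity) hρ ?_⟩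
  have hU : deriv (fun s => -U s) = fun s => -deriv U s := by ext s; exact deriv.fun_neg
  have hT' : Traj f (deriv fun s => -U s) x fun t i => -b t i := by
    rw [hU]; exact hT.neg
  have h := hT'.isSubsolution (W := W) hf hf0 hW (by rw [hU]; exact hL.neg) hn hρ
  convert h using 1
  ext q
  rw [lowerEnvelope_stepEvolution, neg_neg]

/-! ### Envelopes of step functions -/

theorem eventually_uncharged (X : Fin n → ℝ) (y : ℝ) : ∀ᶠ z in 𝓝[≠] y, ∀ i, X i ≠ z := by
  have h := eventually_notMem_of_finite (finite_range X) y
  filter_upwards [nhdsWithin_le_nhds h, self_mem_nhdsWithin] with z hz hzy i hi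
  exact hz hzy ⟨i, hi⟩

theorem stepEvolution_eq_leftValue (h : ∀ i, x t i ≠ y) :
    stepEvolution x b (t, y) = leftValue x b t y := by
  rw [stepEvolution, stepFunction, leftValue]
  congr 1
  refine Finset.sum_congr rfl fun i _ => ?_
  have : (0 ≤ y - x t i) ↔ x t i < y :=
    ⟨fun h' => lt_of_le_of_ne (by linarith) (h i), fun h' => by linarith⟩
  simp only [heaviside, this]

theorem Traj.eventually_eq_right (h : Traj f dU x b) (ht : 0 ≤ t) (hy : ∀ i, x t i ≠ y) :
    ∀ᶠ q in 𝓝[{q : ℝ × ℝ | t ≤ q.1}] (t, y), stepEvolution x b q = stepEvolution x b (t, y) := by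
  filter_upwards [h.eventually_value_right ht y] with q hq
  rw [hq, stepEvolution_eq_leftValue hy, Finset.sum_eq_zero, mul_zero, add_zero]
  intro i _
  rw [clusterCharge, if_neg (hy i)]

theorem Q_subset : Q ⊆ {q : ℝ × ℝ | 0 ≤ q.1} := fun q hq => (show 0 ≤ q.1 from le_of_lt (show 0 < q.1 from hq))

theorem neBot_nhdsWithin_Q {p : ℝ × ℝ} (hp : 0 ≤ p.1) : (𝓝[Q] p).NeBot := by
  have h : Tendsto (fun s : ℝ => (s, p.2)) (𝓝[>] p.1) (𝓝[Q] p) :=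
    tendsto_nhdsWithin_iff.2 ⟨((Continuous.prodMk continuous_id continuous_const).tendsto p.1).mono_left
      nhdsWithin_le_nhds, by
        filter_upwards [self_mem_nhdsWithin] with s hs
        exact hp.trans_lt hs⟩
  exact h.neBot

/-- The envelope is taken over positive times. Near `(0, z)` with `z` not occupied by a particle the
step function keeps its initial value for a short time, and such `z` approach `y` from within `s`.
-/
theorem Traj.le_upperEnvelope_initial (h : Traj f dU x b) {s : Set ℝ} {A : ℝ} (hs : s ⊆ {y}ᶜ)
    [(𝓝[s] y).NeBot] (hA : ∀ᶠ z in 𝓝[s] y, stepEvolution x b (0, z) = A) :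
    A ≤ upperEnvelope Q (stepEvolution x b) (0, y) := by
  refine le_upperEnvelope_of_frequently h.bounded fun hcon => ?_
  rw [eventually_nhdsWithin_iff] at hcon
  have hlim : Tendsto (fun z : ℝ => ((0 : ℝ), z)) (𝓝[s] y) (𝓝 (0, y)) :=
    ((Continuous.prodMk continuous_const continuous_id).tendsto y).mono_left nhdsWithin_le_nhds
  obtain ⟨z, ⟨hz1, hz2⟩, hz3⟩ := ((hlim.eventually (eventually_eventually_nhds.2 hcon)).and hA
    |>.and (nhdsWithin_mono y hs (eventually_uncharged (x 0) y))).exists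
  have := neBot_nhdsWithin_Q (p := ((0 : ℝ), z)) le_rfl
  have h4 : ∀ᶠ q in 𝓝[Q] ((0 : ℝ), z), stepEvolution x b q = stepEvolution x b (0, z) :=
    nhdsWithin_mono _ Q_subset (h.eventually_eq_right le_rfl hz3)
  obtain ⟨q, hq1, hq2⟩ := (h4.and (eventually_nhdsWithin_iff.2 hz1)).exists
  exact hq2 (hq1.trans hz2).ge

theorem Traj.upperEnvelope_initial (h : Traj f dU x b) (y : ℝ) :
    upperEnvelope Q (stepEvolution x b) (0, y) =
      leftValue x b 0 y + (1 / (n : ℝ)) * max 0 (netCharge x b 0 y) := by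
  have hn : 0 ≤ 1 / (n : ℝ) := by positivity
  have := neBot_nhdsWithin_Q (p := ((0 : ℝ), y)) le_rfl
  refine le_antisymm (upperEnvelope_le h.bounded ?_) ?_
  · refine nhdsWithin_mono _ Q_subset ?_
    filter_upwards [h.eventually_value_right le_rfl y] with q hq
    rw [hq]
    gcongr
    rcases h.partial_sum le_rfl y fun i => x q.1 i ≤ q.2 with h1 | h1 <;> rw [h1]
    · exact le_max_left _ _
    · exact le_max_right _ _
  · rcases le_total 0 (netCharge x b 0 y) with h0 | h0
    · rw [max_eq_right h0]
      exact h.le_upperEnvelope_initial (s := Ioi y) (fun z hz => ne_of_gt hz)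
        (eventually_value_slice_right b x 0 y)
    · rw [max_eq_left h0, mul_zero, add_zero]
      exact h.le_upperEnvelope_initial (s := Iio y) (fun z hz => ne_of_lt hz)
        (eventually_value_slice_left b x 0 y)

theorem Traj.upperEnvelope_slice (h : Traj f dU x b) (ht : 0 ≤ t) (y : ℝ) :
    upperEnvelope univ (stepFunction (x t) (b t)) y =
      leftValue x b t y + (1 / (n : ℝ)) * max 0 (netCharge x b t y) := by
  have hn : 0 ≤ 1 / (n : ℝ) := by positivity
  have hb : ∃ C : ℝ, ∀ z ∈ (univ : Set ℝ), |stepFunction (x t) (b t) z| ≤ C :=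
    ⟨1, fun z _ => abs_stepFunction_le (h.mem t ht).1 z⟩
  have hne : (𝓝[univ] y).NeBot := neBot_nhdsWithin_of_mem (mem_univ y)
  refine le_antisymm (upperEnvelope_le hb ?_) ?_
  · have hlim : Tendsto (fun z : ℝ => (t, z)) (𝓝[univ] y) (𝓝[{q : ℝ × ℝ | t ≤ q.1}] (t, y)) := by
      rw [nhdsWithin_univ]
      exact tendsto_nhdsWithin_iff.2 ⟨(Continuous.prodMk continuous_const continuous_id).tendsto y,
        Eventually.of_forall fun _ => le_refl t⟩
    filter_upwards [hlim.eventually (h.eventually_value_right ht y)] with z hz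
    rw [stepEvolution] at hz
    rw [hz]
    gcongr
    rcases h.partial_sum ht y fun i => x t i ≤ z with h1 | h1 <;> rw [h1]
    · exact le_max_left _ _
    · exact le_max_right _ _
  · rcases le_total 0 (netCharge x b t y) with h0 | h0
    · rw [max_eq_right h0]
      refine le_upperEnvelope_of_frequently hb ?_
      rw [nhdsWithin_univ]
      refine Frequently.filter_mono (Eventually.frequently ?_) (nhdsWithin_le_nhds (s := Ioi y))
      exact (eventually_value_slice_right b x t y).mono fun z hz => hz.ge
    · rw [max_eq_left h0, mul_zero, add_zero]
      refine le_upperEnvelope_of_frequently hb ?_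
      rw [nhdsWithin_univ]
      refine Frequently.filter_mono (Eventually.frequently ?_) (nhdsWithin_le_nhds (s := Iio y))
      exact (eventually_value_slice_left b x t y).mono fun z hz => hz.ge

theorem Traj.hasInitialEnvelopes (h : Traj f dU x b) :
    HasInitialEnvelopes (stepEvolution x b) (stepFunction (x 0) (b 0)) := by
  intro y
  refine ⟨by rw [h.upperEnvelope_initial, h.upperEnvelope_slice le_rfl], ?_⟩
  rw [lowerEnvelope_stepEvolution, lowerEnvelope_eq_neg, h.neg.upperEnvelope_initial,
    ← h.neg.upperEnvelope_slice le_rfl]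
  congr 2
  ext z
  rw [stepFunction_neg]

end Solution

/-! ### Comparison with smooth barriers -/

theorem hasDerivAt_smoothTransition (s : ℝ) :
    HasDerivAt Real.smoothTransition (deriv Real.smoothTransition s) s :=
  ((Real.smoothTransition.contDiff (n := 1)).differentiable (by norm_num) s).hasDerivAt

theorem monotone_smoothTransition : Monotone Real.smoothTransition := Real.smoothTransition.monotone

theorem deriv_smoothTransition_nonneg (s : ℝ) : 0 ≤ deriv Real.smoothTransition s :=
  monotone_smoothTransition.deriv_nonneg

theorem deriv_smoothTransition_of_neg {s : ℝ} (hs : s < 0) : deriv Real.smoothTransition s = 0 := by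
  have : Real.smoothTransition =ᶠ[𝓝 s] fun _ => (0 : ℝ) := by
    filter_upwards [gt_mem_nhds hs] with z hz
    exact Real.smoothTransition.zero_of_nonpos (le_of_lt hz)
  rw [this.deriv_eq, deriv_const]

theorem eventually_forall_lt_of_upperEnvelope {w Φ : ℝ × ℝ → ℝ} (hwb : ∃ C : ℝ, ∀ p ∈ Q, |w p| ≤ C)
    (hΦ : Continuous Φ) {t R σ : ℝ} (h : ∀ x, upperEnvelope Q w (t, x) ≤ Φ (t, x)) (hσ : 0 < σ) :
    ∀ᶠ s in 𝓝 t, ∀ y ∈ Icc (-R) R, (s, y) ∈ Q → w (s, y) < Φ (s, y) + σ := by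
  refine isCompact_Icc.eventually_forall_of_forall_eventually fun y _ => ?_
  have h1 := eventually_lt_of_upperEnvelope_lt (A := Φ (t, y) + σ / 2) hwb
    (lt_of_le_of_lt (h y) (by linarith))
  rw [eventually_nhdsWithin_iff] at h1
  have h2 : ∀ᶠ q in 𝓝 (t, y), Φ (t, y) - σ / 2 < Φ q :=
    (hΦ.tendsto (t, y)).eventually (lt_mem_nhds (by linarith))
  filter_upwards [h1, h2] with q hq1 hq2 hq
  linarith [hq1 hq]

/-- If `w` exceeded `Φ` somewhere, then `w - Φ - P` would have an interior maximum, where the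
penalty `P` depends on time only, increases with slope at least η after an initial layer, and is
large before `t₁` and near `t₂`. At the maximum `Φ` is either a classical supersolution with nonzero
slope in space, or dominated by a quartic; in both cases the slope of `P` gives a contradiction. The
initial inequality is required for the envelope of `w`, which is what compactness needs near `t₁`.
-/
theorem IsSubsolution.le_of_barrier {W U : ℝ → ℝ} {ε ρ : ℝ} {w Φ : ℝ × ℝ → ℝ} (hε : 0 < ε)
    (hw : IsSubsolution W U ε ρ w) (hΦ : ContDiff ℝ 2 Φ) (hΦb : ∃ C : ℝ, ∀ q, |Φ q| ≤ C)
    {t₁ t₂ : ℝ} (ht₁ : 0 ≤ t₁) (hinit : ∀ x, upperEnvelope Q w (t₁, x) ≤ Φ (t₁, x))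
    (hfar : ∃ R : ℝ, ∀ p : ℝ × ℝ, t₁ < p.1 → p.1 < t₂ → R ≤ |p.2| → w p ≤ Φ p)
    (hstrict : ∀ p : ℝ × ℝ, t₁ < p.1 → p.1 < t₂ →
      (dx Φ p ≠ 0 ∧ ∀ v : ℝ → ℝ, Measurable v → (∃ C : ℝ, ∀ y, |v y| ≤ C) →
        (∀ y, v y - v p.2 ≤ Φ (p.1, y) - Φ p) →
        (nonlocal (staircase ε) W ρ (fun y => Φ (p.1, y)) v p.2 + deriv U p.2) * |dx Φ p| ≤
          dt Φ p) ∨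
      ∃ K : ℝ, ∀ q, Φ q ≤ Φ p + K * (|q.2 - p.2| ^ 4 + (q.1 - p.1) ^ 4))
    {p : ℝ × ℝ} (hp1 : t₁ < p.1) (hp2 : p.1 < t₂) : w p ≤ Φ p := by
  by_contra! hlt
  obtain ⟨B, hB⟩ := hw.bounded
  obtain ⟨B', hB'⟩ := hΦb
  obtain ⟨R, hR⟩ := hfar
  set g₀ := w p - Φ p with hg₀
  have hg₀p : 0 < g₀ := by linarith
  have hpt : 0 < p.1 - t₁ := by linarith
  obtain ⟨κ, hκ, hκ1⟩ : ∃ κ > 0, ∀ s, t₁ < s → s ≤ t₁ + 2 * κ → ∀ y ∈ Icc (-R) R,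
      w (s, y) < Φ (s, y) + g₀ / 4 := by
    obtain ⟨r, hr, h⟩ := Metric.eventually_nhds_iff.1
      (eventually_forall_lt_of_upperEnvelope (R := R) hw.bounded hΦ.continuous hinit
        (show 0 < g₀ / 4 by linarith))
    refine ⟨r / 4, by linarith, fun s hs1 hs2 y hy => h ?_ y hy (show (0:ℝ) < s by linarith)⟩
    rw [Real.dist_eq, abs_lt]; constructor <;> linarith
  set κ₂ := (t₂ - p.1) / 2 with hκ₂
  have hκ₂p : 0 < κ₂ := by linarith
  -- η is fixed by requiring that the penalty equals `g₀ / 4` at `p`. Λ lets the penalty exceed the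
  -- supremum of `w - Φ` before `t₁` and after `p.1 + κ₂`; its summand `η * t₁` compensates the
  -- negative linear part on (0,t₁).
  set η := g₀ / (4 * (p.1 - t₁)) with hη
  have hηp : 0 < η := by positivity
  set Λ := |B| + |B'| + 1 + η * t₁ with hΛ
  have hΛp : 0 < Λ := by positivity
  have hηe : η * (p.1 - t₁) = g₀ / 4 := by rw [hη]; field_simp
  set S := Real.smoothTransition with hS
  have hSc : ∀ m : ℕ∞, ContDiff ℝ m S := fun m => Real.smoothTransition.contDiff
  -- the penalty in time
  set P : ℝ → ℝ := fun s => η * (s - t₁) + Λ * S ((t₁ + κ - s) / κ) + Λ * S ((s - p.1) / κ₂) with hP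
  have hPc : ContDiff ℝ 2 P := by
    have h1 : ContDiff ℝ 2 fun s : ℝ => S ((t₁ + κ - s) / κ) :=
      (hSc 2).comp (by fun_prop)
    have h2 : ContDiff ℝ 2 fun s : ℝ => S ((s - p.1) / κ₂) :=
      (hSc 2).comp (by fun_prop)
    rw [hP]
    fun_prop
  have hPd : ∀ s, t₁ + κ < s → ∃ P', HasDerivAt P P' s ∧ η ≤ P' := by
    intro s hs
    have h1 : HasDerivAt (fun s : ℝ => (t₁ + κ - s) / κ) (-1 / κ) s := by
      simpa using ((hasDerivAt_id s).const_sub (t₁ + κ)).div_const κ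
    have h2 : HasDerivAt (fun s : ℝ => (s - p.1) / κ₂) (1 / κ₂) s := by
      simpa using ((hasDerivAt_id s).sub_const p.1).div_const κ₂
    have h3 := ((hasDerivAt_smoothTransition ((t₁ + κ - s) / κ)).comp s h1).const_mul Λ
    have h4 := ((hasDerivAt_smoothTransition ((s - p.1) / κ₂)).comp s h2).const_mul Λ
    have h5 : HasDerivAt (fun s : ℝ => η * (s - t₁)) (η * 1) s :=
      ((hasDerivAt_id s).sub_const t₁).const_mul η
    refine ⟨_, (h5.add h3).add h4, ?_⟩
    rw [deriv_smoothTransition_of_neg (div_neg_of_neg_of_pos (by linarith) hκ)]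
    have := deriv_smoothTransition_nonneg ((s - p.1) / κ₂)
    have h6 : 0 ≤ Λ * (deriv Real.smoothTransition ((s - p.1) / κ₂) * (1 / κ₂)) := by positivity
    linarith
  have hPpos : ∀ s, t₁ ≤ s → 0 ≤ P s := fun s hs => by
    have := Real.smoothTransition.nonneg ((t₁ + κ - s) / κ)
    have := Real.smoothTransition.nonneg ((s - p.1) / κ₂)
    have := sub_nonneg.2 hs
    simp only [hP]
    positivity
  have hpκ : p.1 > t₁ + 2 * κ ∨ ¬ p.2 ∈ Icc (-R) R := by
    by_contra! hcon
    have := hκ1 p.1 hp1 hcon.1 p.2 hcon.2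
    change w p < Φ p + g₀ / 4 at this
    linarith
  have hpR : p.2 ∈ Icc (-R) R := by
    rw [mem_Icc, ← abs_le]
    by_contra! hcon
    linarith [hR p hp1 hp2 hcon.le]
  have hpκ1 : t₁ + 2 * κ < p.1 := hpκ.resolve_right (not_not.2 hpR)
  have hPp : P p.1 = g₀ / 4 := by
    simp only [hP]
    rw [hηe, hS, Real.smoothTransition.zero_of_nonpos, Real.smoothTransition.zero_of_nonpos]
    · ring
    · simp
    · exact div_nonpos_of_nonpos_of_nonneg (by linarith) hκ.le
  set φ : ℝ × ℝ → ℝ := fun q => Φ q + P q.1 with hφ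
  have hφc : ContDiff ℝ 2 φ := hΦ.add (hPc.comp contDiff_fst)
  have hbad : w p - φ p = 3 * g₀ / 4 := by simp only [hφ]; rw [hPp]; linarith
  -- away from a compact set the difference is small
  set Kc : Set (ℝ × ℝ) := Icc (t₁ + κ) (p.1 + κ₂) ×ˢ Icc (-R) R with hKc
  have hKQ : Kc ⊆ Q := fun q hq => by
    have := hq.1.1
    show 0 < q.1
    linarith
  have hwB : ∀ q ∈ Q, w q - Φ q ≤ Λ - η * t₁ := fun q hq => by
    have h1 := (le_abs_self _).trans (hB q hq)
    have h2 := (neg_abs_le (Φ q))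
    have h3 := hB' q
    have h4 := le_abs_self B
    have h5 := le_abs_self B'
    linarith
  have hout : ∀ q ∈ Q, (q ∈ Kc → q.1 ≤ t₁ + 2 * κ ∨ p.1 + κ₂ ≤ q.1) → w q - φ q ≤ g₀ / 4 := by
    intro q hq hqK
    have h0 := hwB q hq
    have hn1 := Real.smoothTransition.nonneg ((t₁ + κ - q.1) / κ)
    have hn2 := Real.smoothTransition.nonneg ((q.1 - p.1) / κ₂)
    by_cases h1 : q.1 ≤ t₁
    · have h2 : S ((t₁ + κ - q.1) / κ) = 1 :=
        Real.smoothTransition.one_of_one_le ((one_le_div hκ).2 (by linarith))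
      have h3 : 0 ≤ η * q.1 := mul_nonneg hηp.le (le_of_lt (show 0 < q.1 from hq))
      have h4 : 0 ≤ Λ * S ((q.1 - p.1) / κ₂) := by positivity
      simp only [hφ, hP, h2]
      linarith
    push Not at h1
    by_cases h2 : p.1 + κ₂ ≤ q.1
    · have h3 : S ((q.1 - p.1) / κ₂) = 1 :=
        Real.smoothTransition.one_of_one_le ((one_le_div hκ₂p).2 (by linarith))
      have h4 : 0 ≤ Λ * S ((t₁ + κ - q.1) / κ) := by positivity
      have h5 : 0 ≤ η * (q.1 - t₁) := mul_nonneg hηp.le (by linarith)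
      have h6 : 0 ≤ η * t₁ := mul_nonneg hηp.le ht₁
      simp only [hφ, hP, h3]
      linarith
    push Not at h2
    have h3 := hPpos q.1 h1.le
    by_cases h4 : q.2 ∈ Icc (-R) R
    · by_cases h5 : q.1 ≤ t₁ + 2 * κ
      · have := hκ1 q.1 h1 h5 q.2 h4
        change w q < Φ q + g₀ / 4 at this
        simp only [hφ]
        linarith
      · rcases hqK ⟨⟨by linarith, h2.le⟩, h4⟩ with h | h <;> linarith
    · rw [mem_Icc, ← abs_le] at h4
      have := hR q h1 (by linarith) (le_of_lt (not_le.1 h4))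
      simp only [hφ]
      linarith
  have husc : UpperSemicontinuousOn (fun q => w q - φ q) Kc := by
    have h1 : UpperSemicontinuousOn w Kc := fun q hq A hA =>
      nhdsWithin_mono q hKQ (hw.usc q (hKQ hq) A hA)
    have h2 : UpperSemicontinuousOn (fun q => -φ q) Kc :=
      hφc.continuous.neg.upperSemicontinuous.upperSemicontinuousOn _
    simpa [sub_eq_add_neg] using h1.add h2
  have hpK : p ∈ Kc := ⟨⟨by linarith, by linarith⟩, hpR⟩
  obtain ⟨o, ho, hmax⟩ := husc.exists_isMaxOn ⟨p, hpK⟩ (isCompact_Icc.prod isCompact_Icc)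
  have hoQ := hKQ ho
  have hval : 3 * g₀ / 4 ≤ w o - φ o := by rw [← hbad]; exact hmax hpK
  have hglob : IsMaxOn (fun q => w q - φ q) Q o := fun q hq => by
    by_cases hqK : q ∈ Kc
    · exact hmax hqK
    · show w q - φ q ≤ w o - φ o
      linarith [hout q hq fun h => absurd h hqK]
  have ho12 : t₁ + 2 * κ < o.1 ∧ o.1 < p.1 + κ₂ := by
    by_contra hcon
    have := hout o hoQ fun _ => by
      by_contra! h
      exact hcon h
    linarith
  obtain ⟨P', hP', hηP⟩ := hPd o.1 (by linarith)
  have hΦd := hΦ.differentiable (by norm_num) o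
  rcases hstrict o (by linarith) (by linarith) with ⟨hdx, hH⟩ | ⟨K, hK⟩
  -- The time penalty cancels in all spatial increments, so the nonlocal operator is that of `Φ`,
  -- whereas φ_t gains at least η.
  · have hdxφ : dx φ o = dx Φ o := by
      have := (hasDerivAt_dx hΦd).add_const (P o.1)
      exact this.deriv
    have hdtφ : dt φ o = dt Φ o + P' := ((hasDerivAt_dt hΦd).add hP').deriv
    have h1 := (hw.test φ hφc.contDiffOn o hoQ hglob).1 (by rwa [hdxφ])
    rw [upperEnvelope_staircase hε, hamiltonian, hdxφ, hdtφ] at h1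
    have h2 := hH (fun y => w (o.1, y)) ?_ ⟨B, fun y => hB _ hoQ⟩ fun y => ?_
    · have h3 : nonlocal (staircase ε) W ρ (fun y => φ (o.1, y)) (fun y => w (o.1, y)) o.2 =
          nonlocal (staircase ε) W ρ (fun y => Φ (o.1, y)) (fun y => w (o.1, y)) o.2 := by
        simp only [nonlocal, hφ, add_sub_add_right_eq_sub]
      rw [h3] at h1
      linarith
    · refine UpperSemicontinuous.measurable fun y A hA => ?_
      have h3 := hw.usc (o.1, y) hoQ A hA
      rw [isOpen_Q.nhdsWithin_eq (show (o.1, y) ∈ Q from hoQ)] at h3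
      exact ((Continuous.prodMk continuous_const continuous_id).tendsto y).eventually h3
    · have h3 : w (o.1, y) - φ (o.1, y) ≤ w o - φ o := hglob (show (o.1, y) ∈ Q from hoQ)
      simp only [hφ] at h3
      show w (o.1, y) - w o ≤ _
      linarith
  -- The test function is replaced by its quartic majorant, which touches at the same point. The
  -- added term in time has zero derivative there, so only the slope of `P` remains.
  · set g : ℝ → ℝ := fun s => Φ o + K * (s - o.1) ^ 4 + P s with hg
    have hgc : ContDiff ℝ 2 g := by rw [hg]; fun_prop
    set ψ : ℝ × ℝ → ℝ := fun q => K * |q.2 - o.2| ^ 4 + g q.1 with hψ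
    have hψc : ContDiff ℝ 2 ψ := by
      have h1 : ψ = fun q => K * (q.2 - o.2) ^ 4 + g q.1 := by
        ext q; simp only [hψ]; rw [Even.pow_abs (by decide)]
      rw [h1]
      exact (by fun_prop : ContDiff ℝ 2 fun q : ℝ × ℝ => K * (q.2 - o.2) ^ 4).add
        (hgc.comp contDiff_fst)
    have hψo : ψ o = φ o := by simp [hψ, hg, hφ]
    have h1 := (hw.test ψ hψc.contDiffOn o hoQ fun q hq => ?_).2
      ⟨K, g, hgc.contDiffOn, fun q _ => rfl⟩
    · have h2 : HasDerivAt (fun s : ℝ => K * (s - o.1) ^ 4) (K * (4 * (o.1 - o.1) ^ 3 * 1)) o.1 := by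
        have := ((hasDerivAt_id o.1).sub_const o.1).pow 4
        simpa using this.const_mul K
      have h3 : HasDerivAt g (K * (4 * (o.1 - o.1) ^ 3 * 1) + P') o.1 :=
        (h2.const_add (Φ o)).add hP'
      have h4 : dt ψ o = K * (4 * (o.1 - o.1) ^ 3 * 1) + P' := (h3.const_add (K * |o.2 - o.2| ^ 4)).deriv
      rw [h4] at h1
      simp at h1
      linarith
    · have h2 : w q - φ q ≤ w o - φ o := hglob hq
      have h3 := hK q
      show w q - ψ q ≤ w o - ψ o
      rw [hψo]
      simp only [hψ, hg, hφ] at h2 ⊢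
      linarith

/-! ### The layer profile -/

theorem smoothTransition_one_sub (s : ℝ) :
    Real.smoothTransition (1 - s) = 1 - Real.smoothTransition s := by
  have h := Real.smoothTransition.pos_denom s
  unfold Real.smoothTransition
  rw [sub_sub_cancel, add_comm (expNegInvGlue (1 - s)), eq_sub_iff_add_eq, ← add_div,
    add_comm (expNegInvGlue (1 - s)), div_self h.ne']

/-- This is exp(1/s) ≥ s⁻⁴/4! for s > 0. -/
theorem expNegInvGlue_le (s : ℝ) : expNegInvGlue s ≤ 24 * s ^ 4 := by
  rcases le_or_gt s 0 with hs | hs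
  · rw [expNegInvGlue.zero_of_nonpos hs]; positivity
  · rw [expNegInvGlue, if_neg hs.not_ge, Real.exp_neg]
    have h := Real.pow_div_factorial_le_exp (s⁻¹) (by positivity) 4
    rw [show ((Nat.factorial 4 : ℕ) : ℝ) = 24 by norm_num [Nat.factorial]] at h
    refine inv_le_of_inv_le₀ (by positivity) ?_
    calc (24 * s ^ 4)⁻¹ = s⁻¹ ^ 4 / 24 := by field_simp
      _ ≤ _ := h

theorem exists_smoothTransition_le : ∃ C ≥ 0, ∀ s : ℝ, Real.smoothTransition s ≤ C * s ^ 4 := by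
  have h0 : 0 < expNegInvGlue (1 / 2) := expNegInvGlue.pos_of_pos (by norm_num)
  refine ⟨24 / expNegInvGlue (1 / 2), by positivity, fun s => ?_⟩
  have h1 : expNegInvGlue (1 / 2) ≤ expNegInvGlue s + expNegInvGlue (1 - s) := by
    rcases le_total (1 / 2) s with h | h
    · exact (expNegInvGlue.monotone h).trans (le_add_of_nonneg_right (expNegInvGlue.nonneg _))
    · exact (expNegInvGlue.monotone (by linarith)).trans
        (le_add_of_nonneg_left (expNegInvGlue.nonneg _))
  have h2 := expNegInvGlue_le s
  unfold Real.smoothTransition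
  calc expNegInvGlue s / (expNegInvGlue s + expNegInvGlue (1 - s))
      ≤ (24 * s ^ 4) / expNegInvGlue (1 / 2) := by
        gcongr
    _ = _ := by ring

theorem hasDerivAt_expNegInvGlue {s : ℝ} (hs : 0 < s) :
    ∃ d > 0, HasDerivAt expNegInvGlue d s := by
  have h : HasDerivAt (fun s : ℝ => Real.exp (-s⁻¹)) (Real.exp (-s⁻¹) * -(-(s ^ 2)⁻¹)) s :=
    ((hasDerivAt_inv hs.ne').neg).exp
  refine ⟨_, by rw [neg_neg]; positivity, h.congr_of_eventuallyEq ?_⟩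
  filter_upwards [lt_mem_nhds hs] with z hz
  rw [expNegInvGlue, if_neg hz.not_ge]

theorem deriv_smoothTransition_pos {s : ℝ} (h0 : 0 < s) (h1 : s < 1) :
    0 < deriv Real.smoothTransition s := by
  obtain ⟨d, hd, h⟩ := hasDerivAt_expNegInvGlue h0
  obtain ⟨e, he, h'⟩ := hasDerivAt_expNegInvGlue (sub_pos.2 h1)
  have h2 : HasDerivAt (fun s => expNegInvGlue (1 - s)) (e * -1) s :=
    h'.comp s (by simpa using (hasDerivAt_id s).const_sub 1)
  have hp := Real.smoothTransition.pos_denom s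
  have h3 := (h.div (h.add h2) hp.ne').deriv
  have h4 : deriv Real.smoothTransition s = (d * (expNegInvGlue s + expNegInvGlue (1 - s)) -
      expNegInvGlue s * (d + e * -1)) / (expNegInvGlue s + expNegInvGlue (1 - s)) ^ 2 := h3
  rw [h4]
  have h5 := expNegInvGlue.pos_of_pos h0
  have h6 := expNegInvGlue.pos_of_pos (sub_pos.2 h1)
  refine div_pos ?_ (by positivity)
  nlinarith [mul_pos hd h6, mul_pos he h5]

theorem deriv_smoothTransition_of_gt_one {s : ℝ} (hs : 1 < s) :
    deriv Real.smoothTransition s = 0 := by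
  have : Real.smoothTransition =ᶠ[𝓝 s] fun _ => (1 : ℝ) := by
    filter_upwards [lt_mem_nhds hs] with z hz
    exact Real.smoothTransition.one_of_one_le (le_of_lt hz)
  rw [this.deriv_eq, deriv_const]

theorem smoothTransition_lt {s r : ℝ} (h : s < r) (hr : 0 < r) (hs : s < 1) :
    Real.smoothTransition s < Real.smoothTransition r := by
  have hmono : StrictMonoOn Real.smoothTransition (Icc 0 1) :=
    strictMonoOn_of_deriv_pos (convex_Icc 0 1) Real.smoothTransition.continuous.continuousOn
      fun z hz => by
        rw [interior_Icc] at hz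
        exact deriv_smoothTransition_pos hz.1 hz.2
  rcases le_or_gt s 0 with h0 | h0
  · rw [Real.smoothTransition.zero_of_nonpos h0]
    exact Real.smoothTransition.pos_of_pos hr
  · rcases le_or_gt 1 r with h1 | h1
    · rw [Real.smoothTransition.one_of_one_le h1]
      exact Real.smoothTransition.lt_one_of_lt_one hs
    · exact hmono ⟨h0.le, hs.le⟩ ⟨hr.le, h1.le⟩ h

/-- On its plateaus the profile is flat to fourth order, with a constant uniform on the line. This
supplies quartic test functions at points outside all transition zones. -/
theorem exists_abs_smoothTransition_sub_le : ∃ C ≥ 0, ∀ s r : ℝ, (r ≤ 0 ∨ 1 ≤ r) →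
    |Real.smoothTransition s - Real.smoothTransition r| ≤ C * (s - r) ^ 4 := by
  obtain ⟨C, hC, h⟩ := exists_smoothTransition_le
  have key : ∀ s r : ℝ, r ≤ 0 →
      |Real.smoothTransition s - Real.smoothTransition r| ≤ C * (s - r) ^ 4 := by
    intro s r hr
    rw [Real.smoothTransition.zero_of_nonpos hr, sub_zero,
      abs_of_nonneg (Real.smoothTransition.nonneg s)]
    rcases le_or_gt s 0 with hs | hs
    · rw [Real.smoothTransition.zero_of_nonpos hs]; positivity
    · refine (h s).trans ?_
      gcongr
      linarith
  refine ⟨C, hC, fun s r hr => hr.elim (key s r) fun hr => ?_⟩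
  have := key (1 - s) (1 - r) (by linarith)
  rw [smoothTransition_one_sub, smoothTransition_one_sub, abs_sub_comm] at this
  calc _ = |1 - Real.smoothTransition r - (1 - Real.smoothTransition s)| := by congr 1; ring
    _ ≤ _ := this
    _ = _ := by ring

/-! ### Layers -/

/-- A smooth layer of width `δ` replacing the jump of size `β` at `y`, located on the left of `y`
for `β = 1` and on the right for `β = -1`. -/
noncomputable def layer (δ β y x : ℝ) : ℝ :=
  β * Real.smoothTransition ((x - y) / δ + (1 + β) / 2)

section Layer

variable {δ β y x s : ℝ}

theorem abs_layer_le (hβ : β = -1 ∨ β = 0 ∨ β = 1) : |layer δ β y x| ≤ 1 := by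
  have h1 := Real.smoothTransition.nonneg ((x - y) / δ + (1 + β) / 2)
  have h2 := Real.smoothTransition.le_one ((x - y) / δ + (1 + β) / 2)
  rw [layer, abs_mul, abs_of_nonneg h1]
  have : |β| ≤ 1 := by rcases hβ with h | h | h <;> simp [h]
  nlinarith [abs_nonneg β]

/-- Outside its transition zone a layer has the values of a sharp step, no matter where inside the
zone the step is put. The parameter `s` will be a common cut for all layers of a barrier. -/
theorem layer_of_plateau (hδ : 0 < δ) (hβ : β = -1 ∨ β = 0 ∨ β = 1) (hs : s ∈ Ioo (0 : ℝ) 1)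
    (hx : β ≠ 0 → ¬ (0 < β * (y - x) ∧ β * (y - x) < δ)) :
    layer δ β y x = β * if y - β * δ * s < x then 1 else 0 := by
  have hs1 : δ * s < δ := by nlinarith [hs.2]
  have hs0 : 0 < δ * s := mul_pos hδ hs.1
  rcases hβ with rfl | rfl | rfl
  · have h := hx (by norm_num)
    rw [not_and_or, not_lt, not_lt] at h
    rw [layer]
    rcases h with h | h
    · rw [if_neg (by linarith), Real.smoothTransition.zero_of_nonpos]
      have : (x - y) / δ ≤ 0 := div_nonpos_of_nonpos_of_nonneg (by linarith) hδ.le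
      linarith
    · rw [if_pos (by linarith), Real.smoothTransition.one_of_one_le]
      have : 1 ≤ (x - y) / δ := (one_le_div hδ).2 (by linarith)
      linarith
  · simp [layer]
  · have h := hx (by norm_num)
    rw [not_and_or, not_lt, not_lt] at h
    rw [layer]
    rcases h with h | h
    · rw [if_pos (by linarith), Real.smoothTransition.one_of_one_le]
      have : 0 ≤ (x - y) / δ := div_nonneg (by linarith) hδ.le
      linarith
    · rw [if_neg (by linarith), Real.smoothTransition.zero_of_nonpos]
      have : (x - y) / δ ≤ -1 := (div_le_iff₀ hδ).2 (by linarith)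
      linarith

/-- At the cut point with parameter `s` a layer of either sign has the value S(1-s) up to an
integer, with S the transition profile; this is where S(1-s) = 1 - S(s) is used. Monotonicity gives
the strict bound elsewhere, with the same excess for both signs. -/
theorem layer_lt (hδ : 0 < δ) (hβ : β = -1 ∨ β = 1) (hs : s ∈ Ioo (0 : ℝ) 1)
    (hx : x ≠ y - β * δ * s) :
    layer δ β y x < β * (if y - β * δ * s < x then 1 else 0) + Real.smoothTransition (1 - s) := by
  have hS : 0 < Real.smoothTransition (1 - s) :=
    Real.smoothTransition.pos_of_pos (by linarith [hs.2])
  have h0 := Real.smoothTransition.nonneg ((x - y) / δ + (1 + β) / 2)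
  have h1 := Real.smoothTransition.le_one ((x - y) / δ + (1 + β) / 2)
  rw [layer]
  rcases lt_or_gt_of_ne hx with h | h
  · rw [if_neg h.not_gt, mul_zero, zero_add]
    rcases hβ with rfl | rfl
    · linarith
    · rw [one_mul]
      refine smoothTransition_lt ?_ (by linarith [hs.2]) ?_
      · have : (x - y) / δ < -s := (div_lt_iff₀ hδ).2 (by linarith)
        linarith
      · have : (x - y) / δ < -s := (div_lt_iff₀ hδ).2 (by linarith)
        linarith [hs.1]
  · rw [if_pos h]
    rcases hβ with rfl | rfl
    · rw [smoothTransition_one_sub]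
      have : Real.smoothTransition s < Real.smoothTransition ((x - y) / δ + (1 + -1) / 2) := by
        have : s < (x - y) / δ := (lt_div_iff₀ hδ).2 (by linarith)
        exact smoothTransition_lt (by linarith) (by linarith [hs.1]) hs.2
      linarith
    · linarith

theorem layer_self (hδ : 0 < δ) (hβ : β = -1 ∨ β = 1) :
    layer δ β y (y - β * δ * s) = (β - 1) / 2 + Real.smoothTransition (1 - s) := by
  rw [layer]
  rcases hβ with rfl | rfl
  · rw [smoothTransition_one_sub, show (y - -1 * δ * s - y) / δ + (1 + -1) / 2 = s by
      field_simp; ring]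
    ring
  · rw [show (y - 1 * δ * s - y) / δ + (1 + 1) / 2 = 1 - s by field_simp; ring]
    ring

theorem hasDerivAt_layer_right (δ β y x : ℝ) :
    HasDerivAt (fun x => layer δ β y x)
      (β * (deriv Real.smoothTransition ((x - y) / δ + (1 + β) / 2) / δ)) x := by
  have h : HasDerivAt (fun x : ℝ => (x - y) / δ + (1 + β) / 2) (1 / δ) x := by
    simpa using (((hasDerivAt_id x).sub_const y).div_const δ).add_const ((1 + β) / 2)
  have := ((hasDerivAt_smoothTransition _).comp x h).const_mul β
  rw [mul_one_div] at this
  exact this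

theorem hasDerivAt_layer_left {Y : ℝ → ℝ} {Y' t : ℝ} (δ β x : ℝ) (hY : HasDerivAt Y Y' t) :
    HasDerivAt (fun t => layer δ β (Y t) x)
      (-(β * (deriv Real.smoothTransition ((x - Y t) / δ + (1 + β) / 2) / δ)) * Y') t := by
  have h : HasDerivAt (fun t : ℝ => (x - Y t) / δ + (1 + β) / 2) (-Y' / δ) t := by
    simpa using ((hY.const_sub x).div_const δ).add_const ((1 + β) / 2)
  refine (((hasDerivAt_smoothTransition _).comp t h).const_mul β).congr_deriv ?_
  ring

/-- For times near `p.1` the curve is Lipschitz, so the argument of the profile moves by a multiple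
of the displacement in space and time, and flatness on the plateau applies. For other times the
oscillation 2 of the layer is absorbed by `2 / r ^ 4`. -/
theorem exists_layer_quartic {Y : ℝ → ℝ} (hY : ContDiff ℝ 2 Y) (hδ : 0 < δ)
    (hβ : β = -1 ∨ β = 0 ∨ β = 1) (p : ℝ × ℝ)
    (hx : β ≠ 0 → ¬ (0 < β * (Y p.1 - p.2) ∧ β * (Y p.1 - p.2) < δ)) :
    ∃ K ≥ 0, ∀ q : ℝ × ℝ, layer δ β (Y q.1) q.2 ≤
      layer δ β (Y p.1) p.2 + K * (|q.2 - p.2| ^ 4 + (q.1 - p.1) ^ 4) := by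
  obtain ⟨C, hC, hS⟩ := exists_abs_smoothTransition_sub_le
  obtain ⟨L, U, hU, hL⟩ := (hY.of_le (by norm_num : (1 : WithTop ℕ∞) ≤ 2)).locallyLipschitz p.1
  obtain ⟨r, hr, hrU⟩ := Metric.mem_nhds_iff.1 hU
  rcases eq_or_ne β 0 with rfl | hβ0
  · exact ⟨0, le_rfl, fun q => by simp [layer]⟩
  have hplat : (p.2 - Y p.1) / δ + (1 + β) / 2 ≤ 0 ∨ 1 ≤ (p.2 - Y p.1) / δ + (1 + β) / 2 := by
    have h := hx hβ0
    rw [not_and_or, not_lt, not_lt] at h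
    rcases hβ with rfl | rfl | rfl
    · rcases h with h | h
      · left
        have : (p.2 - Y p.1) / δ ≤ 0 := div_nonpos_of_nonpos_of_nonneg (by linarith) hδ.le
        linarith
      · right
        have : 1 ≤ (p.2 - Y p.1) / δ := (one_le_div hδ).2 (by linarith)
        linarith
    · exact absurd rfl hβ0
    · rcases h with h | h
      · right
        have : 0 ≤ (p.2 - Y p.1) / δ := div_nonneg (by linarith) hδ.le
        linarith
      · left
        have : (p.2 - Y p.1) / δ ≤ -1 := (div_le_iff₀ hδ).2 (by linarith)
        linarith
  set K₁ : ℝ := C * (8 * (1 + (L : ℝ) ^ 4) / δ ^ 4) with hK₁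
  have hK₁0 : 0 ≤ K₁ := by positivity
  refine ⟨K₁ + 2 / r ^ 4, by positivity, fun q => ?_⟩
  have h4 : |q.2 - p.2| ^ 4 = (q.2 - p.2) ^ 4 := Even.pow_abs (by decide) _
  rw [h4]
  have hq2 : 0 ≤ (q.2 - p.2) ^ 4 := by positivity
  have hq1 : 0 ≤ (q.1 - p.1) ^ 4 := by positivity
  by_cases hq : |q.1 - p.1| < r
  · have hLq : |Y q.1 - Y p.1| ≤ L * |q.1 - p.1| := by
      have := hL.dist_le_mul q.1 (hrU (by rwa [Metric.mem_ball, Real.dist_eq])) p.1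
        (hrU (Metric.mem_ball_self hr))
      rwa [Real.dist_eq, Real.dist_eq] at this
    have h5 := hS ((q.2 - Y q.1) / δ + (1 + β) / 2) _ hplat
    have h6 : layer δ β (Y q.1) q.2 - layer δ β (Y p.1) p.2 ≤
        C * ((q.2 - Y q.1) / δ + (1 + β) / 2 - ((p.2 - Y p.1) / δ + (1 + β) / 2)) ^ 4 := by
      rw [layer, layer, ← mul_sub]
      refine (le_abs_self _).trans ?_
      rw [abs_mul]
      have : |β| ≤ 1 := by rcases hβ with h | h | h <;> simp [h]
      nlinarith [abs_nonneg (Real.smoothTransition ((q.2 - Y q.1) / δ + (1 + β) / 2) -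
        Real.smoothTransition ((p.2 - Y p.1) / δ + (1 + β) / 2))]
    have h7 : ((q.2 - Y q.1) / δ + (1 + β) / 2 - ((p.2 - Y p.1) / δ + (1 + β) / 2)) ^ 4 =
        ((q.2 - p.2) + -(Y q.1 - Y p.1)) ^ 4 / δ ^ 4 := by
      rw [← div_pow]; congr 1; ring
    have h8 : ((q.2 - p.2) + -(Y q.1 - Y p.1)) ^ 4 ≤
        8 * ((q.2 - p.2) ^ 4 + (Y q.1 - Y p.1) ^ 4) := by
      generalize q.2 - p.2 = a, Y q.1 - Y p.1 = b
      nlinarith [sq_nonneg (a + b), sq_nonneg (a ^ 2 - b ^ 2), sq_nonneg (a * (a + b)),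
        sq_nonneg (b * (a + b)), sq_nonneg (a - b), sq_nonneg (a ^ 2 + b ^ 2 + 2 * a * b),
        sq_nonneg ((a + b) * (a - b)), sq_nonneg ((a + b) ^ 2)]
    have h9 : (Y q.1 - Y p.1) ^ 4 ≤ (L : ℝ) ^ 4 * (q.1 - p.1) ^ 4 := by
      calc (Y q.1 - Y p.1) ^ 4 = |Y q.1 - Y p.1| ^ 4 := (Even.pow_abs (by decide) _).symm
        _ ≤ (L * |q.1 - p.1|) ^ 4 := by gcongr
        _ = _ := by rw [mul_pow, Even.pow_abs (by decide)]
    have h10 : ((q.2 - p.2) + -(Y q.1 - Y p.1)) ^ 4 ≤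
        8 * (1 + (L : ℝ) ^ 4) * ((q.2 - p.2) ^ 4 + (q.1 - p.1) ^ 4) := by
      have : 0 ≤ (L : ℝ) ^ 4 := by positivity
      nlinarith [mul_nonneg this hq2]
    have h11 : C * (((q.2 - p.2) + -(Y q.1 - Y p.1)) ^ 4 / δ ^ 4) ≤
        K₁ * ((q.2 - p.2) ^ 4 + (q.1 - p.1) ^ 4) := by
      calc C * (((q.2 - p.2) + -(Y q.1 - Y p.1)) ^ 4 / δ ^ 4) ≤
          C * (8 * (1 + (L : ℝ) ^ 4) * ((q.2 - p.2) ^ 4 + (q.1 - p.1) ^ 4) / δ ^ 4) := by gcongr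
        _ = _ := by rw [hK₁]; ring
    have h12 : 0 ≤ 2 / r ^ 4 * ((q.2 - p.2) ^ 4 + (q.1 - p.1) ^ 4) := by positivity
    rw [h7] at h6
    linarith
  · push Not at hq
    have h5 := abs_le.1 (abs_layer_le (δ := δ) (y := Y q.1) (x := q.2) hβ)
    have h6 := abs_le.1 (abs_layer_le (δ := δ) (y := Y p.1) (x := p.2) hβ)
    have h7 : r ^ 4 ≤ (q.1 - p.1) ^ 4 := by
      rw [← Even.pow_abs (by decide : Even 4) (q.1 - p.1)]; gcongr
    have h8 : 2 ≤ 2 / r ^ 4 * (q.1 - p.1) ^ 4 := by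
      rw [div_mul_eq_mul_div, le_div_iff₀ (by positivity)]; linarith
    have h9 : 0 ≤ K₁ * ((q.2 - p.2) ^ 4 + (q.1 - p.1) ^ 4) := by positivity
    have h10 : 0 ≤ 2 / r ^ 4 * (q.2 - p.2) ^ 4 := by positivity
    linarith

end Layer

/-! ### Barriers made of layers -/

section Barrier

variable {ι : Type*} [Fintype ι]

/-- A superposition of layers moving along the curves `Y i`. -/
noncomputable def layered (c m δ : ℝ) (β : ι → ℝ) (Y : ι → ℝ → ℝ) (q : ℝ × ℝ) : ℝ :=
  m + c * ∑ i, layer δ (β i) (Y i q.1) q.2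

variable {c m δ : ℝ} {β : ι → ℝ} {Y : ι → ℝ → ℝ}

theorem contDiff_layered (hY : ∀ i, ContDiff ℝ 2 (Y i)) : ContDiff ℝ 2 (layered c m δ β Y) := by
  have h : ∀ i, ContDiff ℝ 2 fun q : ℝ × ℝ => layer δ (β i) (Y i q.1) q.2 := fun i => by
    have h1 : ContDiff ℝ 2 fun q : ℝ × ℝ => (q.2 - Y i q.1) / δ + (1 + β i) / 2 := by
      have := (hY i).comp (contDiff_fst (E := ℝ) (F := ℝ))
      exact ((contDiff_snd.sub this).div_const δ).add contDiff_const
    exact contDiff_const.mul ((Real.smoothTransition.contDiff (n := 2)).comp h1)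
  unfold layered
  exact contDiff_const.add (contDiff_const.mul (ContDiff.sum fun i _ => h i))

theorem abs_layered_le (hβ : IsCharge β) (q : ℝ × ℝ) :
    |layered c m δ β Y q| ≤ |m| + |c| * Fintype.card ι := by
  refine (abs_add_le _ _).trans ?_
  rw [abs_mul]
  gcongr
  refine (Finset.abs_sum_le_sum_abs _ _).trans ((Finset.sum_le_sum fun i _ =>
    abs_layer_le (hβ i)).trans ?_)
  simp

theorem dx_layered (q : ℝ × ℝ) : dx (layered c m δ β Y) q =
    c * ∑ i, β i * (deriv Real.smoothTransition ((q.2 - Y i q.1) / δ + (1 + β i) / 2) / δ) := by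
  have h := ((HasDerivAt.fun_sum fun i (_ : i ∈ Finset.univ) =>
    hasDerivAt_layer_right δ (β i) (Y i q.1) q.2).const_mul c).const_add m
  exact h.deriv

theorem dt_layered (hY : ∀ i, ContDiff ℝ 2 (Y i)) (q : ℝ × ℝ) : dt (layered c m δ β Y) q =
    c * ∑ i, -(β i * (deriv Real.smoothTransition ((q.2 - Y i q.1) / δ + (1 + β i) / 2) / δ)) *
      deriv (Y i) q.1 := by
  have h := ((HasDerivAt.fun_sum fun i (_ : i ∈ Finset.univ) =>
    hasDerivAt_layer_left δ (β i) q.2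
      ((hY i).differentiable (by norm_num) q.1).hasDerivAt).const_mul c).const_add m
  exact h.deriv

/-- The separation leaves at most one layer in transition at any point. Replacing every layer by the
sharp step at its cut point costs exactly S(1-s) at `x` and strictly less than S(1-s) extra at `x'`;
the common amount cancels in the difference. -/
theorem layered_sub_lt (hδ : 0 < δ) (hβ : IsCharge β) {t x x' s : ℝ}
    (hsep : ∀ i j, i ≠ j → β i ≠ 0 → β j ≠ 0 → 2 * δ < |Y i t - Y j t|) {i : ι} (hi : β i ≠ 0)
    (hs : s ∈ Ioo (0 : ℝ) 1) (hx : x = Y i t - β i * δ * s)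
    (hx' : ∀ j, β j ≠ 0 → x' ≠ Y j t - β j * δ * s) [DecidableEq ι] :
    ∑ j, layer δ (β j) (Y j t) x' - ∑ j, layer δ (β j) (Y j t) x <
      β i * (if 0 < x' - x then 1 else 0) - (β i - 1) / 2 +
        ∑ j, (if j = i then 0 else β j) * jumpAt (Y j t - β j * δ * s - x) (x' - x) := by
  set S₀ := Real.smoothTransition (1 - s) with hS₀
  have hS : 0 < S₀ := Real.smoothTransition.pos_of_pos (by linarith [hs.2])
  have hpm : ∀ j, β j ≠ 0 → β j = -1 ∨ β j = 1 := fun j hj => by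
    rcases hβ j with h | h | h
    · exact Or.inl h
    · exact absurd h hj
    · exact Or.inr h
  have hδs : δ * s < δ := by nlinarith [hs.2]
  have hδs0 : 0 < δ * s := mul_pos hδ hs.1
  have htr : ∀ j k u, j ≠ k → β k ≠ 0 → (0 < β k * (Y k t - u) ∧ β k * (Y k t - u) < δ) →
      β j ≠ 0 → ¬(0 < β j * (Y j t - u) ∧ β j * (Y j t - u) < δ) := by
    intro j k u hjk hk hu hj hu'
    have h1 := hsep j k hjk hj hk
    have h2 : |Y k t - u| < δ := by
      rw [abs_lt]
      rcases hpm k hk with h | h <;> rw [h] at hu <;> constructor <;> linarith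
    have h3 : |Y j t - u| < δ := by
      rw [abs_lt]
      rcases hpm j hj with h | h <;> rw [h] at hu' <;> constructor <;> linarith
    rw [abs_lt] at h2 h3
    rcases lt_abs.1 h1 with h | h <;> linarith
  -- the value at `x`
  have hxi : 0 < β i * (Y i t - x) ∧ β i * (Y i t - x) < δ := by
    rw [hx]
    rcases hpm i hi with h | h <;> rw [h] <;> constructor <;> linarith
  have hval : ∑ j, layer δ (β j) (Y j t) x = (β i - 1) / 2 + S₀ +
      ∑ j, (if j = i then 0 else β j * if Y j t - β j * δ * s < x then 1 else 0) := by
    rw [← Finset.add_sum_erase _ _ (Finset.mem_univ i)]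
    conv_rhs => rw [← Finset.add_sum_erase _ _ (Finset.mem_univ i)]
    rw [if_pos rfl, zero_add]
    congr 1
    · rw [hx]; exact layer_self hδ (hpm i hi)
    · refine Finset.sum_congr rfl fun j hj => ?_
      rw [if_neg (Finset.ne_of_mem_erase hj)]
      exact layer_of_plateau hδ (hβ j) hs (htr j i x (Finset.ne_of_mem_erase hj) hi hxi)
  have hval' : ∑ j, layer δ (β j) (Y j t) x' <
      ∑ j, (β j * if Y j t - β j * δ * s < x' then 1 else 0) + S₀ := by
    by_cases hk : ∃ k, β k ≠ 0 ∧ (0 < β k * (Y k t - x') ∧ β k * (Y k t - x') < δ)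
    · obtain ⟨k, hk0, hk⟩ := hk
      rw [← Finset.add_sum_erase _ _ (Finset.mem_univ k)]
      conv_rhs => rw [← Finset.add_sum_erase _ _ (Finset.mem_univ k)]
      have h1 := layer_lt hδ (hpm k hk0) hs (hx' k hk0)
      have h2 : ∑ j ∈ Finset.univ.erase k, layer δ (β j) (Y j t) x' =
          ∑ j ∈ Finset.univ.erase k, (β j * if Y j t - β j * δ * s < x' then 1 else 0) :=
        Finset.sum_congr rfl fun j hj =>
          layer_of_plateau hδ (hβ j) hs (htr j k x' (Finset.ne_of_mem_erase hj) hk0 hk)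
      rw [h2]
      linarith
    · push Not at hk
      have h2 : ∑ j, layer δ (β j) (Y j t) x' =
          ∑ j, (β j * if Y j t - β j * δ * s < x' then 1 else 0) :=
        Finset.sum_congr rfl fun j hj =>
          layer_of_plateau hδ (hβ j) hs fun hj0 h => not_lt.2 (hk j hj0 h.1) h.2
      rw [h2]
      linarith
  have hsum : ∑ j, (β j * if Y j t - β j * δ * s < x' then 1 else 0) -
      ∑ j, (if j = i then 0 else β j * if Y j t - β j * δ * s < x then 1 else 0) =
      β i * (if 0 < x' - x then 1 else 0) +
        ∑ j, (if j = i then 0 else β j) * jumpAt (Y j t - β j * δ * s - x) (x' - x) := by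
    rw [← Finset.sum_sub_distrib, ← Finset.add_sum_erase _ _ (Finset.mem_univ i)]
    conv_rhs => rw [← Finset.add_sum_erase _ _ (Finset.mem_univ i)]
    rw [if_pos rfl, if_pos rfl, zero_mul, zero_add, sub_zero, ← hx]
    simp only [sub_pos]
    congr 1
    refine Finset.sum_congr rfl fun j hj => ?_
    rw [if_neg (Finset.ne_of_mem_erase hj), if_neg (Finset.ne_of_mem_erase hj), jumpAt]
    simp only [sub_lt_sub_iff_right, sub_neg]
    ring
  linarith

/-- Outside all transition zones the barrier has a quartic majorant. Inside the zone of layer `i`,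
at cut parameter `s`, its increments are strictly below those of sharp steps at the cut points, so
the nonlocal operator is at most the force of point charges there. The hypothesis `hode` is the
resulting supersolution inequality, required for every `s` because all levels of the layer move with
the same velocity. -/
theorem IsSubsolution.le_layered {f W U : ℝ → ℝ} (hf : IsKernel f) (hf0 : Tendsto f atTop (𝓝 0))
    (hW : ∀ z ≠ 0, iteratedDeriv 2 W z = -deriv f |z|) {ρ : ℝ} (hc : 0 < c) (hρ : 0 < ρ)
    {w : ℝ × ℝ → ℝ} (hw : IsSubsolution W U c ρ w) (hδ : 0 < δ) (hβ : IsCharge β)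
    (hY : ∀ i, ContDiff ℝ 2 (Y i)) {t₁ t₂ : ℝ} (ht₁ : 0 ≤ t₁)
    (hsep : ∀ t ∈ Ioo t₁ t₂, ∀ i j, i ≠ j → β i ≠ 0 → β j ≠ 0 → 2 * δ < |Y i t - Y j t|)
    (hode : ∀ t ∈ Ioo t₁ t₂, ∀ s ∈ Ioo (0 : ℝ) 1, ∀ i, β i ≠ 0 →
      c * ∑ j, β j * oddKer f ((Y j t - β j * δ * s) - (Y i t - β i * δ * s)) +
        deriv U (Y i t - β i * δ * s) ≤ -β i * deriv (Y i) t)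
    (hinit : ∀ x, upperEnvelope Q w (t₁, x) ≤ layered c m δ β Y (t₁, x))
    (hfar : ∃ R : ℝ, ∀ p : ℝ × ℝ, t₁ < p.1 → p.1 < t₂ → R ≤ |p.2| → w p ≤ layered c m δ β Y p)
    {p : ℝ × ℝ} (hp : p.1 ∈ Ioo t₁ t₂) : w p ≤ layered c m δ β Y p := by
  classical
  refine hw.le_of_barrier hc (contDiff_layered hY) ⟨_, abs_layered_le hβ⟩ ht₁ hinit hfar ?_ hp.1 hp.2
  intro o ho1 ho2
  have ho : o.1 ∈ Ioo t₁ t₂ := ⟨ho1, ho2⟩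
  have hpm : ∀ j, β j ≠ 0 → β j = -1 ∨ β j = 1 := fun j hj => by
    rcases hβ j with h | h | h
    · exact Or.inl h
    · exact absurd h hj
    · exact Or.inr h
  by_cases hi : ∃ i, β i ≠ 0 ∧ (0 < β i * (Y i o.1 - o.2) ∧ β i * (Y i o.1 - o.2) < δ)
  swap
  · right
    push Not at hi
    choose K hK hq using fun i => exists_layer_quartic (hY i) hδ (hβ i) o
      fun h0 h => not_lt.2 (hi i h0 h.1) h.2
    refine ⟨c * ∑ i, K i, fun q => ?_⟩
    rw [layered, layered]
    calc m + c * ∑ i, layer δ (β i) (Y i q.1) q.2 ≤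
        m + c * ∑ i, (layer δ (β i) (Y i o.1) o.2 +
          K i * (|q.2 - o.2| ^ 4 + (q.1 - o.1) ^ 4)) := by
          gcongr with i
          exact hq i q
      _ = _ := by rw [Finset.sum_add_distrib, ← Finset.sum_mul]; ring
  left
  obtain ⟨i, hi0, hi⟩ := hi
  -- The parameter for which the contact point is the cut point of layer `i`.
  set s := β i * (Y i o.1 - o.2) / δ with hs
  have hsm : s ∈ Ioo (0 : ℝ) 1 := ⟨div_pos hi.1 hδ, (div_lt_one hδ).2 hi.2⟩
  have hδs : δ * s = β i * (Y i o.1 - o.2) := by rw [hs]; field_simp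
  have hδ1 : δ * s < δ := by nlinarith [hsm.2]
  have hδ0 : 0 < δ * s := mul_pos hδ hsm.1
  have hx : o.2 = Y i o.1 - β i * δ * s := by
    rw [mul_assoc, hδs]
    rcases hpm i hi0 with h | h <;> rw [h] <;> ring
  have hother : ∀ j, j ≠ i → β j ≠ 0 → δ < |Y j o.1 - o.2| ∧ Y j o.1 - β j * δ * s ≠ o.2 := by
    intro j hji hj0
    have h1 := hsep o.1 ho j i hji hj0 hi0
    have h2 : |Y i o.1 - o.2| < δ := by
      rw [abs_lt]
      rcases hpm i hi0 with h | h <;> rw [h] at hi <;> constructor <;> linarith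
    have h3 : |Y j o.1 - Y i o.1| ≤ |Y j o.1 - o.2| + |Y i o.1 - o.2| := by
      rw [abs_sub_comm (Y i o.1)]; exact abs_sub_le _ _ _
    have h4 : δ < |Y j o.1 - o.2| := by linarith
    refine ⟨h4, fun h => ?_⟩
    rw [← h, sub_sub_cancel] at h4
    have : |β j * δ * s| = δ * s := by
      rw [mul_assoc, abs_mul, abs_of_pos hδ0]
      rcases hpm j hj0 with h | h <;> rw [h] <;> norm_num
    linarith
  have hderiv : ∀ j, j ≠ i →
      β j * (deriv Real.smoothTransition ((o.2 - Y j o.1) / δ + (1 + β j) / 2) / δ) = 0 := by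
    intro j hji
    by_cases hj0 : β j = 0
    · rw [hj0, zero_mul]
    · have h1 := (hother j hji hj0).1
      suffices deriv Real.smoothTransition ((o.2 - Y j o.1) / δ + (1 + β j) / 2) = 0 by
        rw [this]; simp
      rcases lt_abs.1 h1 with h | h
      · have h2 : (o.2 - Y j o.1) / δ < -1 := (div_lt_iff₀ hδ).2 (by linarith)
        refine deriv_smoothTransition_of_neg ?_
        rcases hpm j hj0 with h | h <;> rw [h] <;> linarith
      · have h2 : 1 < (o.2 - Y j o.1) / δ := (lt_div_iff₀ hδ).2 (by linarith)
        refine deriv_smoothTransition_of_gt_one ?_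
        rcases hpm j hj0 with h | h <;> rw [h] <;> linarith
  set S' := deriv Real.smoothTransition ((o.2 - Y i o.1) / δ + (1 + β i) / 2) / δ with hS'
  have hS'pos : 0 < S' := by
    refine div_pos (deriv_smoothTransition_pos ?_ ?_) hδ
    · have h1 : (o.2 - Y i o.1) / δ = -(β i * s) := by
        rw [hx]; field_simp; ring
      rw [h1]
      rcases hpm i hi0 with h | h <;> rw [h] <;> linarith [hsm.1, hsm.2]
    · have h1 : (o.2 - Y i o.1) / δ = -(β i * s) := by
        rw [hx]; field_simp; ring
      rw [h1]
      rcases hpm i hi0 with h | h <;> rw [h] <;> linarith [hsm.1, hsm.2]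
  have hdx : dx (layered c m δ β Y) o = c * (β i * S') := by
    rw [dx_layered, Finset.sum_eq_single i (fun j _ hj => hderiv j hj) (by simp)]
  have hdt : dt (layered c m δ β Y) o = c * (-(β i * S') * deriv (Y i) o.1) := by
    rw [dt_layered hY, Finset.sum_eq_single i (fun j _ hj => by rw [hderiv j hj]; ring) (by simp)]
  have hdx0 : dx (layered c m δ β Y) o ≠ 0 := by
    rw [hdx]; exact mul_ne_zero hc.ne' (mul_ne_zero hi0 hS'pos.ne')
  refine ⟨hdx0, fun v hv hvb hvle => ?_⟩
  have hΦd := (contDiff_layered (c := c) (m := m) (δ := δ) (β := β) hY).differentiable (by norm_num) o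
  have hΦc : Continuous fun y => layered c m δ β Y (o.1, y) :=
    (contDiff_layered hY).continuous.comp (Continuous.prodMk continuous_const continuous_id)
  obtain ⟨r₀, hr₀, hbound⟩ := nonlocal_bounds (ι := ι) hf hf0 hW hc hρ hΦc (hasDerivAt_dx hΦd) hdx0
    hv hvb
  set d : ι → ℝ := fun j => Y j o.1 - β j * δ * s - o.2 with hd
  set ω : ι → ℝ := fun j => if j = i then 0 else β j with hω
  have hd0 : ∀ j, ω j ≠ 0 → d j ≠ 0 := by
    intro j hj
    have hji : j ≠ i := fun h => hj (by simp [hω, h])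
    have hj0 : β j ≠ 0 := fun h => hj (by simp [hω, h])
    exact sub_ne_zero.2 (hother j hji hj0).2
  obtain ⟨r, hr, hrd⟩ : ∃ r ∈ Ioc 0 r₀, ∀ j, ω j ≠ 0 → r ≤ |d j| := by
    have : ∀ j, ∀ᶠ r in 𝓝[>] (0 : ℝ), ω j ≠ 0 → r ≤ |d j| := fun j => by
      by_cases hj : ω j = 0
      · exact Eventually.of_forall fun _ h => absurd hj h
      · filter_upwards [Ioo_mem_nhdsGT (abs_pos.2 (hd0 j hj))] with r hr _
        exact hr.2.le
    obtain ⟨r, hr1, hr2⟩ := ((eventually_all.2 this).and (Ioc_mem_nhdsGT hr₀)).exists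
    exact ⟨r, hr2, hr1⟩
  have hnl := (hbound r hr (β i) ω d hrd).1 ?_
  · have hforce := hode o.1 ho s hsm i hi0
    have hsumeq : ∑ j, ω j * oddKer f (d j) =
        ∑ j, β j * oddKer f ((Y j o.1 - β j * δ * s) - (Y i o.1 - β i * δ * s)) := by
      refine Finset.sum_congr rfl fun j _ => ?_
      rw [hω, hd, ← hx]
      by_cases hji : j = i
      · subst hji
        simp [← hx, oddKer]
      · simp [hji]
    rw [← hsumeq, ← hx] at hforce
    have habs : |dx (layered c m δ β Y) o| = c * S' := by
      rw [hdx, abs_mul, abs_mul, abs_of_pos hc, abs_of_pos hS'pos]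
      rcases hpm i hi0 with h | h <;> rw [h] <;> norm_num
    rw [habs, hdt]
    have hcS : 0 < c * S' := mul_pos hc hS'pos
    calc _ ≤ (-β i * deriv (Y i) o.1) * (c * S') := by
          refine mul_le_mul_of_nonneg_right ?_ hcS.le
          linarith
      _ = _ := by ring
  · intro z hz hzd
    have hz0 : z ≠ 0 := fun h => by
      rw [h, abs_zero] at hz
      linarith [hr.1]
    have hmain : layered c m δ β Y (o.1, o.2 + z) - layered c m δ β Y (o.1, o.2) <
        c * (β i * (if 0 < z then 1 else 0) - (β i - 1) / 2 + ∑ j, ω j * jumpAt (d j) z) := by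
      have h1 := layered_sub_lt (x' := o.2 + z) hδ hβ (hsep o.1 ho) hi0 hsm hx fun j hj0 h => by
        by_cases hji : j = i
        · rw [hji, ← hx] at h
          exact hz0 (by linarith)
        · exact hzd j (by simp [hω, hji, hj0]) (by simp only [hd]; linarith)
      rw [add_sub_cancel_left] at h1
      have h2 := mul_lt_mul_of_pos_left h1 hc
      simp only [layered]
      linarith
    obtain ⟨N, hN⟩ : ∃ N : ℤ, β i * (if 0 < z then 1 else 0) - (β i - 1) / 2 +
        ∑ j, ω j * jumpAt (d j) z = N := by
      have h1 : ∀ j, ∃ k : ℤ, ω j * jumpAt (d j) z = k := fun j => by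
        have : ∃ k : ℤ, jumpAt (d j) z = k := by
          unfold jumpAt
          exact ⟨(if d j < z then 1 else 0) - (if d j < 0 then 1 else 0), by push_cast; rfl⟩
        obtain ⟨k, hk⟩ := this
        have : ∃ k : ℤ, ω j = k := by
          simp only [hω]
          split_ifs
          · exact ⟨0, by simp⟩
          · rcases hβ j with h | h | h
            · exact ⟨-1, by simp [h]⟩
            · exact ⟨0, by simp [h]⟩
            · exact ⟨1, by simp [h]⟩
        obtain ⟨l, hl⟩ := this
        exact ⟨l * k, by rw [hk, hl]; push_cast; rfl⟩
      choose k hk using h1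
      have h2 : ∃ l : ℤ, β i * (if 0 < z then (1 : ℝ) else 0) - (β i - 1) / 2 = l := by
        rcases hpm i hi0 with h | h <;> rw [h] <;> split_ifs
        · exact ⟨0, by norm_num⟩
        · exact ⟨1, by norm_num⟩
        · exact ⟨1, by norm_num⟩
        · exact ⟨0, by norm_num⟩
      obtain ⟨l, hl⟩ := h2
      exact ⟨l + ∑ j, k j, by rw [hl]; push_cast; simp only [hk]⟩
    have hrel : c * relStep (β i) ω d z = c * ((N : ℝ) - 1 / 2) := by
      rw [relStep, ← hN]; ring
    rw [hN] at hmain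
    -- Strictness lowers the floor to at most `N - 1`, and `N - 1 / 2` is the value of the
    -- comparison step function.
    have hstair : ∀ γ, γ < c * N → staircase c γ ≤ c * relStep (β i) ω d z := fun γ hγ => by
      rw [hrel, staircase]
      have h1 : ⌊γ / c⌋ < N := Int.floor_lt.2 ((div_lt_iff₀ hc).2 (by linarith))
      have h2 : ((⌊γ / c⌋ : ℤ) : ℝ) ≤ N - 1 := by
        have : ⌊γ / c⌋ ≤ N - 1 := by omega
        exact_mod_cast this
      gcongr
      linarith
    split_ifs
    · exact hstair _ hmain
    · refine hstair _ (lt_of_le_of_lt ?_ hmain)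
      exact hvle (o.2 + z)

end Barrier

/-! ### Finite speed of propagation -/

section Layer

variable {δ β y x s : ℝ}

theorem layer_bounds (hβ : β = -1 ∨ β = 1) :
    (β - 1) / 2 ≤ layer δ β y x ∧ layer δ β y x ≤ (β + 1) / 2 := by
  have h0 := Real.smoothTransition.nonneg ((x - y) / δ + (1 + β) / 2)
  have h1 := Real.smoothTransition.le_one ((x - y) / δ + (1 + β) / 2)
  rw [layer]
  rcases hβ with rfl | rfl <;> constructor <;> linarith

theorem layer_of_nonpos (hδ : 0 < δ) (hβ : β = -1 ∨ β = 1) (h : β * (y - x) ≤ 0) :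
    layer δ β y x = (β + 1) / 2 := by
  rw [layer]
  rcases hβ with rfl | rfl
  · rw [Real.smoothTransition.zero_of_nonpos]
    · norm_num
    · have : (x - y) / δ ≤ 0 := div_nonpos_of_nonpos_of_nonneg (by linarith) hδ.le
      linarith
  · rw [Real.smoothTransition.one_of_one_le]
    · norm_num
    · have : 0 ≤ (x - y) / δ := div_nonneg (by linarith) hδ.le
      linarith

theorem layer_of_ge (hδ : 0 < δ) (hβ : β = -1 ∨ β = 1) (h : δ ≤ β * (y - x)) :
    layer δ β y x = (β - 1) / 2 := by
  rw [layer]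
  rcases hβ with rfl | rfl
  · rw [Real.smoothTransition.one_of_one_le]
    · norm_num
    · have : 1 ≤ (x - y) / δ := (one_le_div hδ).2 (by linarith)
      linarith
  · rw [Real.smoothTransition.zero_of_nonpos]
    · norm_num
    · have : (x - y) / δ ≤ -1 := (div_le_iff₀ hδ).2 (by linarith)
      linarith

end Layer

/-- The sign `1` or `-1`. -/
def sgn (σ : Bool) : ℝ := if σ then 1 else -1

theorem sgn_eq (σ : Bool) : sgn σ = -1 ∨ sgn σ = 1 := by cases σ <;> simp [sgn]

/-- The barrier is `A` on the ball of radius `R` and rises by `c` across each of `N` layers on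
either side, so that `2 * B ≤ c * N` puts it above `w` outside radius `2 * R`. The layers move
inwards at speed `V`, which dominates the interaction of `2 * N` charges at mutual distance at least
`g / 2` and the drift; up to time κ they advance by at most `R / 4` and do not reach the inner ball.
-/
theorem IsSubsolution.le_of_finite_speed {f W U : ℝ → ℝ} (hf : IsKernel f)
    (hf0 : Tendsto f atTop (𝓝 0)) (hW : ∀ z ≠ 0, iteratedDeriv 2 W z = -deriv f |z|)
    {c ρ : ℝ} (hc : 0 < c) (hρ : 0 < ρ) {w : ℝ × ℝ → ℝ} (hw : IsSubsolution W U c ρ w)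
    {B : ℝ} (hB : ∀ p ∈ Q, |w p| ≤ B) {N : ℕ} (hN : 2 * B ≤ c * N) {x₀ R M V : ℝ} (hR : 0 < R)
    (hM : ∀ z, |z - x₀| ≤ 2 * R → |deriv U z| ≤ M)
    (hV : c * (2 * N) * f (R / (4 * (N + 1))) + M ≤ V) {t₁ κ : ℝ} (ht₁ : 0 ≤ t₁)
    (hκ : κ * V ≤ R / 4) {A : ℝ} (hA : -B ≤ A)
    (h : ∀ x, |x - x₀| < 2 * R → upperEnvelope Q w (t₁, x) ≤ A) {p : ℝ × ℝ}
    (hp : p.1 ∈ Ioo t₁ (t₁ + κ)) (hpx : |p.2 - x₀| < R) : w p ≤ A := by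
  -- The spacing of the layers; the `N` layers of one side fit into a strip of width `R / 2`.
  set g := R / (2 * ((N : ℝ) + 1)) with hg
  have hg0 : 0 < g := by positivity
  have hgN : ((N : ℝ) + 1) * g = R / 2 := by rw [hg]; field_simp
  have hgR : g ≤ R / 2 := by nlinarith [Nat.cast_nonneg (α := ℝ) N]
  set δ := g / 4 with hδ
  have hδ0 : 0 < δ := by positivity
  have hfg : f (R / (4 * (N + 1))) = f (g / 2) := by congr 1; rw [hg]; field_simp; ring
  rw [hfg] at hV
  have hM0 : 0 ≤ M := (abs_nonneg _).trans (hM x₀ (by simp; linarith))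
  have hfn := hf.nonneg (g / 2) (by positivity)
  have hV0 : 0 ≤ V := by
    have : 0 ≤ c * (2 * N) * f (g / 2) := by positivity
    linarith
  let β : Fin N × Bool → ℝ := fun i => sgn i.2
  let Y : Fin N × Bool → ℝ → ℝ := fun i t =>
    x₀ + sgn i.2 * (2 * R - ((i.1 : ℝ) + 1) * g - V * (t - t₁))
  have hβ : IsCharge β := fun i => (sgn_eq i.2).elim Or.inl fun h => Or.inr (Or.inr h)
  have hYd : ∀ i t, HasDerivAt (Y i) (-(sgn i.2 * V)) t := fun i t => by
    have h1 : HasDerivAt (fun t : ℝ => V * (t - t₁)) V t := by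
      simpa using ((hasDerivAt_id t).sub_const t₁).const_mul V
    have h2 := ((h1.const_sub (2 * R - ((i.1 : ℝ) + 1) * g)).const_mul (sgn i.2)).const_add x₀
    exact h2.congr_deriv (by ring)
  have hY : ∀ i, ContDiff ℝ 2 (Y i) := fun i => by simp only [Y]; fun_prop
  -- the distance of the layers to the centre
  have hk : ∀ k : Fin N, 0 < ((k : ℝ) + 1) * g ∧ ((k : ℝ) + 1) * g ≤ R / 2 := fun k => by
    have : (k : ℝ) + 1 ≤ N := by exact_mod_cast k.2
    constructor
    · positivity
    · nlinarith
  have hdrift : ∀ t ∈ Ioo t₁ (t₁ + κ), 0 ≤ V * (t - t₁) ∧ V * (t - t₁) ≤ R / 4 := fun t ht => by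
    have := ht.1; have := ht.2
    constructor
    · exact mul_nonneg hV0 (by linarith)
    · nlinarith
  have hsep : ∀ t ∈ Ioo t₁ (t₁ + κ), ∀ i j, i ≠ j → g ≤ |Y i t - Y j t| := by
    rintro t ht ⟨k, σ⟩ ⟨l, τ⟩ hij
    have h1 := hdrift t ht
    have h2 := hk k
    have h3 := hk l
    have key : ∀ e : ℝ, e = (k : ℝ) - l → (k ≠ l) → g ≤ |e * g| := by
      intro e he hkl
      rw [abs_mul, abs_of_pos hg0, he]
      have : (1 : ℝ) ≤ |(k : ℝ) - l| := by
        have h4 : (k : ℤ) - (l : ℤ) ≠ 0 := sub_ne_zero.2 (by exact_mod_cast Fin.val_ne_of_ne hkl)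
        exact_mod_cast Int.one_le_abs h4
      nlinarith
    cases σ <;> cases τ
    · have hkl : k ≠ l := fun h => hij (by rw [h])
      have := key _ rfl hkl
      simp only [Y, sgn]
      convert this using 2
      norm_num
      ring
    · simp only [Y, sgn]
      rw [le_abs]; right; norm_num; linarith
    · simp only [Y, sgn]
      rw [le_abs]; left; norm_num; linarith
    · have hkl : k ≠ l := fun h => hij (by rw [h])
      have := key _ rfl hkl
      rw [← abs_neg] at this
      simp only [Y, sgn]
      convert this using 2
      norm_num
      ring
  have hzbound : ∀ t ∈ Ioo t₁ (t₁ + κ), ∀ s ∈ Ioo (0 : ℝ) 1, ∀ i,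
      |Y i t - β i * δ * s - x₀| ≤ 2 * R := by
    rintro t ht s hs ⟨k, σ⟩
    have h1 := hdrift t ht
    have h2 := hk k
    have h3 : 0 < δ * s := mul_pos hδ0 hs.1
    have h4 : δ * s < δ := by nlinarith [hs.2]
    rw [abs_le]
    cases σ <;> simp only [Y, β, sgn] <;> norm_num <;> constructor <;> linarith
  -- The base level `A + c * N` compensates the `N` negative layers on the left, each of which is -1
  -- at the centre.
  have hlay : ∀ q : ℝ × ℝ, layered c (A + c * N) δ β Y q = A + c * ∑ k : Fin N,
      (layer δ 1 (Y (k, true) q.1) q.2 + (1 + layer δ (-1) (Y (k, false) q.1) q.2)) := fun q => by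
    simp only [layered, Fintype.sum_prod_type, Fintype.sum_bool, β, sgn, if_true,
      Finset.sum_add_distrib, Finset.sum_const, Finset.card_univ, Fintype.card_fin, nsmul_eq_mul,
      Bool.false_eq_true, if_false]
    ring
  have hge : ∀ q : ℝ × ℝ, A ≤ layered c (A + c * N) δ β Y q := fun q => by
    rw [hlay]
    refine le_add_of_nonneg_right (mul_nonneg hc.le (Finset.sum_nonneg fun k _ => ?_))
    have h1 := (layer_bounds (δ := δ) (y := Y (k, true) q.1) (x := q.2) (Or.inr rfl)).1
    have h2 := (layer_bounds (δ := δ) (y := Y (k, false) q.1) (x := q.2) (Or.inl rfl)).1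
    linarith
  have hout : ∀ q : ℝ × ℝ, (q.1 = t₁ ∨ q.1 ∈ Ioo t₁ (t₁ + κ)) → 2 * R ≤ |q.2 - x₀| →
      B ≤ layered c (A + c * N) δ β Y q := by
    intro q hq hq2
    have hd : 0 ≤ V * (q.1 - t₁) := by
      rcases hq with h | h
      · simp [h]
      · exact (hdrift _ h).1
    rw [hlay]
    have hsum : (N : ℝ) ≤ ∑ k : Fin N,
        (layer δ 1 (Y (k, true) q.1) q.2 + (1 + layer δ (-1) (Y (k, false) q.1) q.2)) := by
      rw [show (N : ℝ) = ∑ k : Fin N, (1 : ℝ) by simp]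
      refine Finset.sum_le_sum fun k _ => ?_
      have h2 := hk k
      have h3 := (layer_bounds (δ := δ) (y := Y (k, true) q.1) (x := q.2) (Or.inr rfl)).1
      have h4 := (layer_bounds (δ := δ) (y := Y (k, false) q.1) (x := q.2) (Or.inl rfl)).1
      rcases le_abs.1 hq2 with h | h
      · rw [layer_of_nonpos hδ0 (Or.inr rfl)]
        · linarith
        · simp only [Y, sgn, if_true]; linarith
      · rw [layer_of_nonpos (β := -1) hδ0 (Or.inl rfl)]
        · linarith
        · simp only [Y, sgn, Bool.false_eq_true, if_false]; linarith
    have := mul_le_mul_of_nonneg_left hsum hc.le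
    linarith
  have hmain := hw.le_layered hf hf0 hW (m := A + c * N) hc hρ hδ0 hβ hY (t₂ := t₁ + κ) ht₁ ?_ ?_ ?_ ?_ hp
  · refine hmain.trans ?_
    rw [hlay]
    have hzero : ∀ k : Fin N,
        layer δ 1 (Y (k, true) p.1) p.2 + (1 + layer δ (-1) (Y (k, false) p.1) p.2) = 0 := fun k => by
      have h1 := hdrift p.1 hp
      have h2 := hk k
      rw [abs_lt] at hpx
      rw [layer_of_ge hδ0 (Or.inr rfl), layer_of_ge (β := -1) hδ0 (Or.inl rfl)]
      · norm_num
      · simp only [Y, sgn, Bool.false_eq_true, if_false]; linarith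
      · simp only [Y, sgn, if_true]; linarith
    simp [hzero]
  · intro t ht i j hij _ _
    linarith [hsep t ht i j hij]
  · intro t ht s hs i _
    rw [(hYd i t).deriv]
    have h1 : -β i * -(sgn i.2 * V) = V := by
      simp only [β]
      rcases sgn_eq i.2 with h | h <;> rw [h] <;> ring
    rw [h1]
    refine le_trans ?_ hV
    refine add_le_add ?_ ((le_abs_self _).trans (hM _ (hzbound t ht s hs i)))
    rw [mul_assoc c (2 * (N : ℝ))]
    refine mul_le_mul_of_nonneg_left ?_ hc.le
    have h2 : ∀ j, β j * oddKer f (Y j t - β j * δ * s - (Y i t - β i * δ * s)) ≤ f (g / 2) := by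
      intro j
      by_cases hij : j = i
      · subst hij
        simpa [oddKer] using hfn
      have h3 : g / 2 ≤ |Y j t - β j * δ * s - (Y i t - β i * δ * s)| := by
        have h4 := hsep t ht j i hij
        have h5 : |Y j t - Y i t| ≤ |Y j t - β j * δ * s - (Y i t - β i * δ * s)| +
            |(β j - β i) * (δ * s)| := by
          refine le_trans (le_of_eq ?_) (abs_add_le _ _)
          congr 1; ring
        have h6 : |(β j - β i) * (δ * s)| ≤ g / 2 := by
          have h7 : 0 < δ * s := mul_pos hδ0 hs.1
          have h8 : δ * s < δ := by nlinarith [hs.2]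
          rw [abs_mul, abs_of_pos h7]
          have h9 : |β j - β i| ≤ 2 := by
            simp only [β]
            rcases sgn_eq i.2 with h | h <;> rcases sgn_eq j.2 with h' | h' <;> rw [h, h'] <;>
              norm_num
          nlinarith
        linarith
      refine (le_abs_self _).trans ?_
      rw [abs_mul]
      have h4 := hf.abs_oddKer_le (by positivity) h3
      have h5 : |β j| = 1 := by
        simp only [β]; rcases sgn_eq j.2 with h | h <;> rw [h] <;> norm_num
      rw [h5, one_mul]
      exact h4
    refine (Finset.sum_le_sum fun j _ => h2 j).trans (le_of_eq ?_)
    rw [Finset.sum_const, Finset.card_univ, Fintype.card_prod, Fintype.card_fin, Fintype.card_bool,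
      nsmul_eq_mul]
    push_cast
    ring
  · intro x
    by_cases hx : |x - x₀| < 2 * R
    · exact (h x hx).trans (hge _)
    · have := neBot_nhdsWithin_Q (p := (t₁, x)) ht₁
      exact ((le_abs_self _).trans (abs_upperEnvelope_le hB)).trans
        (hout _ (Or.inl rfl) (not_lt.1 hx))
  · refine ⟨|x₀| + 2 * R, fun q hq1 hq2 hq3 => ?_⟩
    have h1 : 2 * R ≤ |q.2 - x₀| := by
      have := abs_sub_abs_le_abs_sub q.2 x₀
      linarith
    exact ((le_abs_self _).trans (hB q (ht₁.trans_lt hq1))).trans (hout q (Or.inr ⟨hq1, hq2⟩) h1)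

/-- Local propagation of upper bounds, with a time of validity that is uniform in time and in the
values of the bound. -/
theorem IsSubsolution.exists_propagation {f W U : ℝ → ℝ} (hf : IsKernel f)
    (hf0 : Tendsto f atTop (𝓝 0)) (hW : ∀ z ≠ 0, iteratedDeriv 2 W z = -deriv f |z|)
    {L : NNReal} (hL : LipschitzWith L (deriv U))
    {c ρ : ℝ} (hc : 0 < c) (hρ : 0 < ρ) {w : ℝ × ℝ → ℝ} (hw : IsSubsolution W U c ρ w)
    {B : ℝ} (hB : ∀ p ∈ Q, |w p| ≤ B) (x₀ : ℝ) {R : ℝ} (hR : 0 < R) :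
    ∃ κ > 0, ∀ t₁ ≥ 0, ∀ A ≥ -B, (∀ x, |x - x₀| < 2 * R → upperEnvelope Q w (t₁, x) ≤ A) →
      ∀ p : ℝ × ℝ, p.1 ∈ Ioo t₁ (t₁ + κ) → |p.2 - x₀| < R → w p ≤ A := by
  obtain ⟨N, hN⟩ := exists_nat_ge (2 * B / c)
  have hN' : 2 * B ≤ c * N := by rw [div_le_iff₀ hc] at hN; linarith
  set M := |deriv U x₀| + L * (2 * R) with hM
  have hM' : ∀ z, |z - x₀| ≤ 2 * R → |deriv U z| ≤ M := fun z hz => by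
    have h1 := hL.dist_le_mul z x₀
    rw [Real.dist_eq, Real.dist_eq] at h1
    have h2 := abs_sub_abs_le_abs_sub (deriv U z) (deriv U x₀)
    have h3 : (L : ℝ) * |z - x₀| ≤ L * (2 * R) := by gcongr
    linarith
  have hfn := hf.nonneg (R / (4 * (N + 1))) (by positivity)
  set V := c * (2 * N) * f (R / (4 * (N + 1))) + M + 1 with hV
  have hV0 : 0 < V := by positivity
  refine ⟨R / 4 / V, by positivity, fun t₁ ht₁ A hA h p hp hpx =>
    hw.le_of_finite_speed hf hf0 hW hc hρ hB hN' hR hM' (V := V) (by linarith) ht₁ ?_ hA h hp hpx⟩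
  rw [div_mul_cancel₀ _ hV0.ne']

/-- Propagation of upper bounds near infinity. -/
theorem IsSubsolution.exists_propagation_infinity {f W U : ℝ → ℝ} (hf : IsKernel f)
    (hf0 : Tendsto f atTop (𝓝 0)) (hW : ∀ z ≠ 0, iteratedDeriv 2 W z = -deriv f |z|)
    {L : NNReal} (hL : LipschitzWith L (deriv U))
    {c ρ : ℝ} (hc : 0 < c) (hρ : 0 < ρ) {w : ℝ × ℝ → ℝ} (hw : IsSubsolution W U c ρ w)
    {B : ℝ} (hB : ∀ p ∈ Q, |w p| ≤ B) :
    ∃ κ > 0, ∃ R₀ : ℝ, ∀ t₁ ≥ 0, ∀ A ≥ -B, ∀ p : ℝ × ℝ, p.1 ∈ Ioo t₁ (t₁ + κ) → R₀ ≤ |p.2| →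
      (∀ x, |x - p.2| < |p.2| / 2 → upperEnvelope Q w (t₁, x) ≤ A) → w p ≤ A := by
  obtain ⟨N, hN⟩ := exists_nat_ge (2 * B / c)
  have hN' : 2 * B ≤ c * N := by rw [div_le_iff₀ hc] at hN; linarith
  have hf1 := hf.nonneg 1 one_pos
  set C := c * (2 * N) * f 1 + |deriv U 0| with hC
  have hC0 : 0 ≤ C := by positivity
  refine ⟨1 / (16 * (C + 2 * L + 1)), by positivity, 16 * (N + 1), fun t₁ ht₁ A hA p hp hpR h => ?_⟩
  have hN0 : (0 : ℝ) ≤ N := Nat.cast_nonneg N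
  have hp1 : 1 ≤ |p.2| := by linarith
  -- The drift near `p.2` grows at most linearly in `|p.2|`, and so does the radius of the ball;
  -- their ratio gives a uniform time.
  refine hw.le_of_finite_speed hf hf0 hW hc hρ hB hN' (R := |p.2| / 4) (x₀ := p.2)
    (M := |deriv U 0| + L * (2 * |p.2|)) (V := C + L * (2 * |p.2|)) (by linarith) ?_ ?_ ht₁ ?_ hA
    (fun x hx => h x (by linarith)) hp (by rw [sub_self, abs_zero]; linarith)
  · intro z hz
    have h1 := hL.dist_le_mul z 0
    rw [Real.dist_eq, Real.dist_eq, sub_zero] at h1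
    have h2 := abs_sub_abs_le_abs_sub (deriv U z) (deriv U 0)
    have h3 : |z| ≤ 2 * |p.2| := by
      have := abs_sub_abs_le_abs_sub z p.2
      linarith
    have h4 : (L : ℝ) * |z| ≤ L * (2 * |p.2|) := by gcongr
    linarith
  · have h1 : f (|p.2| / 4 / (4 * (N + 1))) ≤ f 1 := by
      refine hf.anti (mem_Ioi.2 one_pos) (mem_Ioi.2 (by positivity)) ?_
      rw [le_div_iff₀ (by positivity)]
      linarith
    have h2 : c * (2 * N) * f (|p.2| / 4 / (4 * (N + 1))) ≤ c * (2 * N) * f 1 := by gcongr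
    linarith
  · rw [div_mul_eq_mul_div, one_mul, div_le_div_iff₀ (by positivity) (by norm_num)]
    have hL0 : (0 : ℝ) ≤ L := L.2
    nlinarith [mul_nonneg hC0 (sub_nonneg.2 hp1), mul_nonneg hL0 (sub_nonneg.2 hp1)]

/-! ### Force estimates for perturbed configurations -/

/-- The two conditions keep both arguments on the same side of 0 and at distance at least `l` from
it. -/
theorem IsKernel.exists_oddKer_lipschitz {f : ℝ → ℝ} (hf : IsKernel f) {l : ℝ} (hl : 0 < l) :
    ∃ Λ ≥ 0, ∀ s s' : ℝ, 2 * l ≤ |s| → |s' - s| ≤ l →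
      |oddKer f s' - oddKer f s| ≤ Λ * |s' - s| := by
  obtain ⟨Λ, hΛ⟩ := hf.lipschitz hl
  refine ⟨Λ, Λ.2, fun s s' hs hs' => ?_⟩
  rw [abs_le] at hs'
  rcases le_abs.1 hs with h | h
  · rw [oddKer_pos (by linarith), oddKer_pos (by linarith)]
    have := hΛ.dist_le_mul s' (show l ≤ s' by linarith) s (show l ≤ s by linarith)
    rwa [Real.dist_eq, Real.dist_eq] at this
  · rw [oddKer_neg (by linarith), oddKer_neg (by linarith)]
    have := hΛ.dist_le_mul (-s) (show l ≤ -s by linarith) (-s') (show l ≤ -s' by linarith)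
    rw [Real.dist_eq, Real.dist_eq] at this
    calc |(-f (-s')) - -f (-s)| = |f (-s) - f (-s')| := by congr 1; ring
      _ ≤ _ := this
      _ = _ := by congr 2; ring

/-- Barrier curves have to be C², while trajectories are only known to be C¹. The velocity is
approximated by a polynomial, which is then integrated. -/
theorem exists_smooth_approx {X v : ℝ → ℝ} {a b η : ℝ} (hab : a < b) (hη : 0 < η)
    (hX : ContinuousOn X (Icc a b)) (hv : ContinuousOn v (Icc a b))
    (hXv : ∀ t ∈ Ioo a b, HasDerivAt X (v t) t) :
    ∃ Z : ℝ → ℝ, ContDiff ℝ 2 Z ∧ ∀ t ∈ Icc a b, |Z t - X t| ≤ η ∧ |deriv Z t - v t| ≤ η := by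
  set η' := η / (1 + (b - a)) with hη'
  have hba : 0 < b - a := sub_pos.2 hab
  have hη'0 : 0 < η' := by positivity
  have hη'1 : η' ≤ η := div_le_self hη.le (by linarith)
  have hη'2 : η' * (b - a) ≤ η := by
    rw [hη', div_mul_eq_mul_div, div_le_iff₀ (by linarith)]
    nlinarith
  obtain ⟨P, hP⟩ := exists_polynomial_near_of_continuousOn a b v hv η' hη'0
  have hPc : Continuous fun t => P.eval t := P.continuous
  set Z : ℝ → ℝ := fun t => X a + ∫ s in a..t, P.eval s with hZ
  have hZd : ∀ t, HasDerivAt Z (P.eval t) t := fun t =>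
    (intervalIntegral.integral_hasDerivAt_right (hPc.intervalIntegrable _ _)
      (hPc.stronglyMeasurableAtFilter _ _) hPc.continuousAt).const_add (X a)
  have hZ2 : ContDiff ℝ 2 Z := by
    have h1 : deriv Z = fun t => P.eval t := funext fun t => (hZd t).deriv
    rw [show (2 : WithTop ℕ∞) = 1 + 1 by norm_num, contDiff_succ_iff_deriv]
    refine ⟨fun t => (hZd t).differentiableAt, by simp, ?_⟩
    rw [h1]
    simpa using P.contDiff_aeval (𝕜 := ℝ) (n := 1)
  refine ⟨Z, hZ2, fun t ht => ⟨?_, ?_⟩⟩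
  · rcases eq_or_lt_of_le ht.1 with rfl | hat
    · simpa [hZ] using hη.le
    · obtain ⟨ξ, hξ, h⟩ := exists_hasDerivAt_eq_slope (fun t => Z t - X t) (fun t => P.eval t - v t)
        hat (hZ2.continuous.continuousOn.sub (hX.mono (Icc_subset_Icc_right ht.2)))
        fun s hs => (hZd s).sub (hXv s ⟨hs.1, hs.2.trans_le ht.2⟩)
      have hZa : Z a - X a = 0 := by simp [hZ]
      rw [hZa, sub_zero, eq_div_iff (by linarith)] at h
      rw [← h, abs_mul, abs_of_pos (sub_pos.2 hat)]
      have h2 := hP ξ ⟨hξ.1.le, hξ.2.le.trans ht.2⟩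
      calc _ ≤ η' * (b - a) := by
            gcongr
            exact ht.2
        _ ≤ η := hη'2
  · rw [(hZd t).deriv]
    exact (hP t ht).le.trans hη'1

section Force

variable {n : ℕ} {f dU : ℝ → ℝ} {L : NNReal} {β X z : Fin n → ℝ} {Y : Finset ℝ} {p m : ℝ → ℝ}
  {c d δ Λ : ℝ}

/-- The force on a charged particle changes little if all positions are perturbed, and narrow
dipoles are inserted. -/
theorem force_particle_le (hc : 0 ≤ c) (hL : LipschitzWith L dU) (hβ : IsCharge β)
    (hδ : 0 < δ) (hδd : 100 * δ ≤ d) (hΛ : 0 ≤ Λ)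
    (hlip : ∀ s s' : ℝ, 2 * (d / 4) ≤ |s| → |s' - s| ≤ d / 4 →
      |oddKer f s' - oddKer f s| ≤ Λ * |s' - s|)
    (hz : ∀ i, |z i - X i| ≤ 5 * δ)
    (hm : ∀ y ∈ Y, |m y - y| ≤ 10 * δ) (hpm : ∀ y ∈ Y, |p y - m y| ≤ 12 * δ)
    (hX : ∀ i j, i ≠ j → β i ≠ 0 → β j ≠ 0 → d ≤ |X i - X j|)
    (hY : ∀ i, β i ≠ 0 → ∀ y ∈ Y, d ≤ |y - X i|) {i : Fin n} (hi : β i ≠ 0) :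
    c * (∑ j, β j * oddKer f (z j - z i) + ∑ y ∈ Y, (oddKer f (p y - z i) - oddKer f (m y - z i))) +
      dU (z i) ≤ c * ∑ j, β j * oddKer f (X j - X i) + dU (X i) +
        (c * (n * (Λ * (10 * δ)) + Y.card * (Λ * (12 * δ))) + L * (5 * δ)) := by
  have h1 : ∀ j, β j * oddKer f (z j - z i) ≤ β j * oddKer f (X j - X i) + Λ * (10 * δ) := by
    intro j
    have h0 : 0 ≤ Λ * (10 * δ) := by positivity
    by_cases hji : j = i
    · subst hji; simpa using h0
    by_cases hj : β j = 0
    · rw [hj]; simpa using h0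
    have h2 : |z j - z i - (X j - X i)| ≤ 10 * δ := by
      have := abs_sub (z j - X j) (z i - X i)
      rw [show z j - z i - (X j - X i) = z j - X j - (z i - X i) by ring]
      linarith [hz i, hz j]
    have h3 := hlip (X j - X i) (z j - z i) (by linarith [hX j i hji hj hi]) (by linarith)
    have h4 : Λ * |z j - z i - (X j - X i)| ≤ Λ * (10 * δ) := by gcongr
    have h5 := abs_le.1 (h3.trans h4)
    rcases hβ j with h | h | h
    · rw [h]; linarith
    · exact absurd h hj
    · rw [h]; linarith
  have h2 : ∀ y ∈ Y, oddKer f (p y - z i) - oddKer f (m y - z i) ≤ Λ * (12 * δ) := by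
    intro y hy
    have h3 : |p y - z i - (m y - z i)| ≤ 12 * δ := by
      rw [sub_sub_sub_cancel_right]; exact hpm y hy
    have h4 : 2 * (d / 4) ≤ |m y - z i| := by
      have h5 := hY i hi y hy
      have h6 : |y - X i| ≤ |m y - z i| + |m y - y| + |z i - X i| := by
        have := abs_add_three (m y - z i) (-(m y - y)) (z i - X i)
        rw [abs_neg] at this
        refine le_trans (le_of_eq ?_) this
        congr 1; ring
      linarith [hm y hy, hz i]
    have h5 := hlip _ (p y - z i) h4 (by linarith)
    have h6 : Λ * |p y - z i - (m y - z i)| ≤ Λ * (12 * δ) := by gcongr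
    exact (le_abs_self _).trans (h5.trans h6)
  have h3 : dU (z i) ≤ dU (X i) + L * (5 * δ) := by
    have h4 := hL.dist_le_mul (z i) (X i)
    rw [Real.dist_eq, Real.dist_eq] at h4
    have h5 : (L : ℝ) * |z i - X i| ≤ L * (5 * δ) := by gcongr; exact hz i
    linarith [le_abs_self (dU (z i) - dU (X i))]
  have h4 := Finset.sum_le_sum fun j (_ : j ∈ Finset.univ) => h1 j
  have h5 := Finset.sum_le_sum h2
  rw [Finset.sum_add_distrib] at h4
  simp only [Finset.sum_const, Finset.card_univ, Fintype.card_fin, nsmul_eq_mul] at h4 h5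
  have h6 := mul_le_mul_of_nonneg_left (add_le_add h4 h5) hc
  linarith

/-- The force between the two charges of a narrow dipole dominates all other forces. -/
theorem force_dipole_le (hf : IsKernel f) (hc : 0 ≤ c) (hL : LipschitzWith L dU) (hβ : IsCharge β)
    (hδ : 0 < δ) (hδd : 100 * δ ≤ d) {M : ℝ} (hM : ∀ y ∈ Y, |dU y| ≤ M)
    (hz : ∀ i, |z i - X i| ≤ 5 * δ) (hp : ∀ y ∈ Y, |p y - y| ≤ 10 * δ)
    (hm : ∀ y ∈ Y, |m y - y| ≤ 10 * δ) (hpm : ∀ y ∈ Y, 0 < m y - p y ∧ m y - p y ≤ 12 * δ)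
    (hY : ∀ i, β i ≠ 0 → ∀ y ∈ Y, d ≤ |y - X i|) (hYY : ∀ y ∈ Y, ∀ y' ∈ Y, y ≠ y' → d ≤ |y - y'|)
    {y₀ z₀ : ℝ} (hy₀ : y₀ ∈ Y) (hz₀ : z₀ = p y₀ ∨ z₀ = m y₀) :
    c * (∑ j, β j * oddKer f (z j - z₀) + ∑ y ∈ Y, (oddKer f (p y - z₀) - oddKer f (m y - z₀))) +
      dU z₀ ≤ c * (n * f (d / 2) + Y.card * (2 * f (d / 2))) + (M + L * (10 * δ)) -
        c * f (12 * δ) := by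
  have hd : 0 < d / 2 := by linarith
  have hfd := hf.nonneg _ hd
  have hz₀y : |z₀ - y₀| ≤ 10 * δ := by
    rcases hz₀ with h | h <;> rw [h]
    · exact hp _ hy₀
    · exact hm _ hy₀
  have h1 : ∀ j, β j * oddKer f (z j - z₀) ≤ f (d / 2) := by
    intro j
    by_cases hj : β j = 0
    · rw [hj, zero_mul]; exact hfd
    have h2 : d / 2 ≤ |z j - z₀| := by
      have h5 := hY j hj _ hy₀
      have h6 : |y₀ - X j| ≤ |z j - z₀| + |z₀ - y₀| + |z j - X j| := by
        have := abs_add_three (-(z j - z₀)) (-(z₀ - y₀)) (z j - X j)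
        rw [abs_neg, abs_neg] at this
        refine le_trans (le_of_eq ?_) this
        congr 1; ring
      linarith [hz j]
    have h3 := abs_le.1 (hf.abs_oddKer_le hd h2)
    rcases hβ j with h | h | h
    · rw [h]; linarith
    · exact absurd h hj
    · rw [h]; linarith
  have hfar : ∀ y ∈ Y, y ≠ y₀ → ∀ q, |q - y| ≤ 10 * δ → |oddKer f (q - z₀)| ≤ f (d / 2) := by
    intro y hy hne q hq
    refine hf.abs_oddKer_le hd ?_
    have h5 := hYY y hy y₀ hy₀ hne
    have h6 : |y - y₀| ≤ |q - z₀| + |q - y| + |z₀ - y₀| := by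
      have := abs_add_three (q - z₀) (-(q - y)) (z₀ - y₀)
      rw [abs_neg] at this
      refine le_trans (le_of_eq ?_) this
      congr 1; ring
    linarith
  have h2 : ∀ y ∈ Y, oddKer f (p y - z₀) - oddKer f (m y - z₀) ≤
      2 * f (d / 2) + if y = y₀ then -f (12 * δ) else 0 := by
    intro y hy
    split_ifs with h
    · subst h
      obtain ⟨h3, h4⟩ := hpm y hy
      have h5 : f (12 * δ) ≤ f (m y - p y) :=
        hf.anti (mem_Ioi.2 h3) (mem_Ioi.2 (by linarith)) h4
      rcases hz₀ with h | h <;> rw [h, sub_self]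
      · rw [oddKer_pos h3]; simp [oddKer]; linarith
      · rw [oddKer_neg (by linarith), neg_sub]; simp [oddKer]; linarith
    · have h3 := abs_le.1 (hfar y hy h _ (hp y hy))
      have h4 := abs_le.1 (hfar y hy h _ (hm y hy))
      linarith
  have h3 : dU z₀ ≤ M + L * (10 * δ) := by
    have h4 := hL.dist_le_mul z₀ y₀
    rw [Real.dist_eq, Real.dist_eq] at h4
    have h5 : (L : ℝ) * |z₀ - y₀| ≤ L * (10 * δ) := by gcongr
    linarith [le_abs_self (dU z₀ - dU y₀), le_abs_self (dU y₀), hM y₀ hy₀]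
  have h4 := Finset.sum_le_sum fun j (_ : j ∈ Finset.univ) => h1 j
  have h5 := Finset.sum_le_sum h2
  rw [Finset.sum_add_distrib, Finset.sum_ite_eq' Y y₀, if_pos hy₀] at h5
  simp only [Finset.sum_const, Finset.card_univ, Fintype.card_fin, nsmul_eq_mul] at h4 h5
  have h6 := mul_le_mul_of_nonneg_left (add_le_add h4 h5) hc
  linarith

end Force

/-! ### Values of the upper envelope at a fixed time -/

section Values

variable {n : ℕ} {f dU : ℝ → ℝ} {x : ℝ → Fin n → ℝ} {b : ℝ → Fin n → ℤ} {t y : ℝ}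

/-- The upper bound for the envelope of `u_n` at a positive time, in which all points where
particles have annihilated count as possible spikes. -/
theorem Traj.upperEnvelope_le_spike (h : Traj f dU x b) (hf : IsKernel f) {L : NNReal}
    (hL : LipschitzWith L dU) (ht : 0 ≤ t) (y : ℝ) :
    upperEnvelope Q (stepEvolution x b) (t, y) ≤ leftValue x b t y + (1 / (n : ℝ)) *
      (max 0 (netCharge x b t y) + if netCharge x b t y = 0 ∧ ∃ i, x t i = y then 1 else 0) := by
  have hn : 0 ≤ 1 / (n : ℝ) := by positivity
  have hite : (0 : ℝ) ≤ if netCharge x b t y = 0 ∧ ∃ i, x t i = y then 1 else 0 := by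
    split_ifs <;> norm_num
  rcases ht.eq_or_lt with rfl | ht
  · rw [h.upperEnvelope_initial]
    gcongr
    linarith
  obtain ⟨e, β, d, C, hE⟩ := h.exists_leftEnd hf hL ht
  rcases exists_isCluster β (x t) y with h0 | ⟨a, z, hc⟩
  · have := neBot_nhdsWithin_of_mem (show (t, y) ∈ Q from ht)
    refine (upperEnvelope_le (A := leftValue x b t y) h.bounded (nhdsWithin_le_nhds
      ((hE.eventually_eq h h0).mono fun q hq => hq.le))).trans ?_
    refine le_add_of_nonneg_right (mul_nonneg hn (add_nonneg (le_max_left _ _) hite))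
  · refine (hE.upperEnvelope_le h hc).trans ?_
    gcongr
    rcases hE.net_eq_first hc with h1 | h1
    · have ha : ∃ i, x t i = y := ⟨a, (clusterCharge_ne_zero.1 hc.first_ne).2⟩
      rw [if_pos ⟨h1, ha⟩, h1, max_self, zero_add]
      refine max_le zero_le_one ?_
      rcases hE.charge.cluster (x t) y a with h | h | h <;> rw [h] <;> norm_num
    · rw [← h1]
      linarith

theorem Traj.le_upperEnvelope_slice (h : Traj f dU x b) (ht : 0 < t) (y : ℝ) :
    leftValue x b t y + (1 / (n : ℝ)) * max 0 (netCharge x b t y) ≤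
      upperEnvelope Q (stepEvolution x b) (t, y) := by
  rw [← h.upperEnvelope_slice ht.le]
  have hb : ∃ C : ℝ, ∀ z ∈ (univ : Set ℝ), |stepFunction (x t) (b t) z| ≤ C :=
    ⟨1, fun z _ => abs_stepFunction_le (h.mem t ht.le).1 z⟩
  have hne : (𝓝[univ] y).NeBot := neBot_nhdsWithin_of_mem (mem_univ y)
  refine le_of_forall_gt fun A hA => ?_
  obtain ⟨A', hA', hA'A⟩ := exists_between hA
  refine lt_of_le_of_lt (upperEnvelope_le hb ?_) hA'A
  have h1 := eventually_lt_of_upperEnvelope_lt h.bounded hA'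
  rw [isOpen_Q.nhdsWithin_eq (show (t, y) ∈ Q from ht)] at h1
  rw [nhdsWithin_univ]
  filter_upwards [((Continuous.prodMk continuous_const continuous_id).tendsto y).eventually h1]
    with z hz
  exact hz.le

/-- At most one charge sits at `y`, so the positive part may be taken particle by particle. The left
side is the form in which layers are summed. -/
theorem Traj.sum_max_eq (h : Traj f dU x b) (ht : 0 ≤ t) (y : ℝ) :
    ∑ i, max 0 (b t i : ℝ) * (if x t i = y then 1 else 0) = max 0 (netCharge x b t y) := by
  by_cases hex : ∃ i, x t i = y ∧ (b t i : ℝ) ≠ 0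
  · obtain ⟨i, hi, hi0⟩ := hex
    have huniq : ∀ j, j ≠ i → x t j = y → (b t j : ℝ) = 0 := fun j hji hj => by
      by_contra hj0
      exact (h.ordered ht).ne hji hj0 hi0 (hj.trans hi.symm)
    have h1 : netCharge x b t y = b t i := by
      rw [netCharge]
      exact Finset.sum_eq_single_of_mem i (by simp [hi]) fun j hj hji =>
        huniq j hji (Finset.mem_filter.1 hj).2
    rw [h1, Finset.sum_eq_single i]
    · rw [if_pos hi, mul_one]
    · intro j _ hji
      by_cases hj : x t j = y
      · rw [huniq j hji hj, max_self, zero_mul]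
      · rw [if_neg hj, mul_zero]
    · simp
  · push Not at hex
    have h1 : netCharge x b t y = 0 := Finset.sum_eq_zero fun j hj =>
      hex j (Finset.mem_filter.1 hj).2
    rw [h1, max_self]
    refine Finset.sum_eq_zero fun j _ => ?_
    by_cases hj : x t j = y
    · rw [hex j hj, max_self, zero_mul]
    · rw [if_neg hj, mul_zero]

end Values

/-! ### Comparison on a short time interval -/

theorem sum_sum_prod_bool {α : Type*} [Fintype α] (Y : Finset ℝ) (F : α ⊕ (Y × Bool) → ℝ)
    (G : ℝ → Bool → ℝ) (hG : ∀ y σ, F (Sum.inr (y, σ)) = G y σ) :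
    ∑ j, F j = ∑ i, F (Sum.inl i) + ∑ y ∈ Y, (G y true + G y false) := by
  rw [Fintype.sum_sum_type, Fintype.sum_prod_type]
  simp only [Fintype.sum_bool, hG]
  rw [Finset.sum_coe_sort Y fun y => G y true + G y false]

section Layer

variable {δ β y x : ℝ}

theorem layer_of_add_le (hδ : 0 < δ) (hβ : β = -1 ∨ β = 0 ∨ β = 1) (h : x + δ ≤ y) :
    layer δ β y x = 0 := by
  rcases hβ with rfl | rfl | rfl
  · rw [layer_of_nonpos hδ (Or.inl rfl) (by linarith)]; norm_num
  · simp [layer]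
  · rw [layer_of_ge hδ (Or.inr rfl) (by linarith)]; norm_num

theorem layer_of_le_sub (hδ : 0 < δ) (hβ : β = -1 ∨ β = 0 ∨ β = 1) (h : y ≤ x - δ) :
    layer δ β y x = β := by
  rcases hβ with rfl | rfl | rfl
  · rw [layer_of_ge hδ (Or.inl rfl) (by linarith)]; norm_num
  · simp [layer]
  · rw [layer_of_nonpos hδ (Or.inr rfl) (by linarith)]; norm_num

theorem dipole_nonneg {y' : ℝ} (hδ : 0 < δ) (hy : y ≤ y') :
    0 ≤ layer δ 1 y x + layer δ (-1) y' x := by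
  have h1 := (layer_bounds (δ := δ) (y := y) (x := x) (Or.inr rfl)).1
  have h2 := (layer_bounds (δ := δ) (y := y') (x := x) (Or.inl rfl)).1
  rcases le_total x y' with h | h
  · rw [layer_of_nonpos (β := -1) hδ (Or.inl rfl) (by linarith)]; linarith
  · rw [layer_of_nonpos (β := 1) hδ (Or.inr rfl) (by linarith)]; linarith

end Layer

/-- The curves along which the two layers of a dipole at `y` move. -/
noncomputable def dipoleCurve (t δ y : ℝ) (σ : Bool) (s : ℝ) : ℝ :=
  if σ then y + 4 * δ - 6 * δ * Real.exp (-(s - t) / (2 * δ)) else y + 8 * δ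

section Dipole

variable {t δ y s : ℝ}

theorem contDiff_dipoleCurve (σ : Bool) : ContDiff ℝ 2 (dipoleCurve t δ y σ) := by
  cases σ
  · exact contDiff_const
  · show ContDiff ℝ 2 fun s => y + 4 * δ - 6 * δ * Real.exp (-(s - t) / (2 * δ))
    fun_prop

/-- The positive charge of a dipole relaxes from `y - 2 * δ` to `y + 4 * δ` on the time scale δ,
while the negative one rests at `y + 8 * δ`. Thus `y` is covered at time `t` and uncovered after a
time of order δ, yet the speed stays below 3 independently of δ. The singular attraction within the
dipole pays for this speed. -/
theorem deriv_dipoleCurve_true (hδ : 0 < δ) (hs : t ≤ s) :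
    0 ≤ deriv (dipoleCurve t δ y true) s ∧ deriv (dipoleCurve t δ y true) s ≤ 3 := by
  have h1 : HasDerivAt (fun s : ℝ => -(s - t) / (2 * δ)) (-1 / (2 * δ)) s := by
    simpa using (((hasDerivAt_id s).sub_const t).neg).div_const (2 * δ)
  have h2 : HasDerivAt (dipoleCurve t δ y true)
      (-(6 * δ * (Real.exp (-(s - t) / (2 * δ)) * (-1 / (2 * δ))))) s :=
    ((h1.exp).const_mul (6 * δ)).const_sub (y + 4 * δ)
  have h3 : -(6 * δ * (Real.exp (-(s - t) / (2 * δ)) * (-1 / (2 * δ)))) =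
      3 * Real.exp (-(s - t) / (2 * δ)) := by field_simp; ring
  have h4 : Real.exp (-(s - t) / (2 * δ)) ≤ 1 :=
    Real.exp_le_one_iff.2 (div_nonpos_of_nonpos_of_nonneg (by linarith) (by linarith))
  rw [h2.deriv, h3]
  constructor
  · positivity
  · linarith

theorem deriv_dipoleCurve_false : deriv (dipoleCurve t δ y false) s = 0 := by
  show deriv (fun _ => y + 8 * δ) s = 0
  simp

theorem dipoleCurve_true_mem (hδ : 0 < δ) (hs : t ≤ s) :
    y - 2 * δ ≤ dipoleCurve t δ y true s ∧ dipoleCurve t δ y true s ≤ y + 4 * δ := by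
  have h4 : Real.exp (-(s - t) / (2 * δ)) ≤ 1 :=
    Real.exp_le_one_iff.2 (div_nonpos_of_nonpos_of_nonneg (by linarith) (by linarith))
  have h5 := Real.exp_pos (-(s - t) / (2 * δ))
  have h6 : dipoleCurve t δ y true s = y + 4 * δ - 6 * δ * Real.exp (-(s - t) / (2 * δ)) := rfl
  rw [h6]
  constructor <;> nlinarith

end Dipole

/-! ### Short time intervals without collisions -/

section Window

variable {n : ℕ} {f dU : ℝ → ℝ} {x : ℝ → Fin n → ℝ} {b : ℝ → Fin n → ℤ} {t : ℝ}

/-- Uniform control of a particle solution on a short time interval. -/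
structure Window (f dU : ℝ → ℝ) (x : ℝ → Fin n → ℝ) (b : ℝ → Fin n → ℤ) (t : ℝ) (Y : Finset ℝ)
    (κ d R : ℝ) : Prop where
  b_eq : ∀ s ∈ Icc t (t + κ), b s = b t
  cont : ∀ i, ContinuousOn (fun s => x s i) (Icc t (t + κ))
  cont_velocity : ∀ i, ContinuousOn
    (fun s => velocity (1 / (n : ℝ)) f dU (fun k => (b t k : ℝ)) (x s) i) (Icc t (t + κ))
  ode : ∀ s ∈ Ioo t (t + κ), ∀ i, HasDerivAt (fun s => x s i)
    (velocity (1 / (n : ℝ)) f dU (fun k => (b t k : ℝ)) (x s) i) s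
  gap : ∀ s ∈ Icc t (t + κ), ∀ i j, i ≠ j → (b t i : ℝ) ≠ 0 → (b t j : ℝ) ≠ 0 →
    d ≤ |x s i - x s j|
  spike : ∀ s ∈ Icc t (t + κ), ∀ i, (b t i : ℝ) ≠ 0 → ∀ y ∈ Y, d ≤ |y - x s i|
  spikes : ∀ y ∈ Y, ∀ y' ∈ Y, y ≠ y' → d ≤ |y - y'|
  bound : ∀ s ∈ Icc t (t + κ), ∀ i, |x s i| ≤ R
  bound_spike : ∀ y ∈ Y, |y| ≤ R

theorem Window.mono {Y : Finset ℝ} {κ κ' d R : ℝ} (h : Window f dU x b t Y κ d R) (hκ : κ' ≤ κ) :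
    Window f dU x b t Y κ' d R := by
  have hI : Icc t (t + κ') ⊆ Icc t (t + κ) := Icc_subset_Icc_right (by linarith)
  exact ⟨fun s hs => h.b_eq s (hI hs), fun i => (h.cont i).mono hI,
    fun i => (h.cont_velocity i).mono hI,
    fun s hs => h.ode s ⟨hs.1, hs.2.trans_le (by linarith)⟩, fun s hs => h.gap s (hI hs),
    fun s hs => h.spike s (hI hs), h.spikes, fun s hs => h.bound s (hI hs), h.bound_spike⟩

/-- All distances concerned are larger than `2 * d` at time `t`, which by continuity leaves `d` for
a short time. -/
theorem Traj.exists_window (h : Traj f dU x b) (hf : IsKernel f) (hU : Continuous dU) (ht : 0 ≤ t)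
    {Y : Finset ℝ} (hY : ∀ i, (b t i : ℝ) ≠ 0 → x t i ∉ Y) :
    ∃ κ > 0, ∃ d > 0, ∃ R, Window f dU x b t Y κ d R := by
  obtain ⟨e, he, hb, hflow⟩ := h.right t ht
  have hord := h.ordered ht
  have hxc : ∀ i, ContinuousOn (fun s => x s i) (Ici 0) := fun i s hs =>
    (continuous_apply i).continuousAt.comp_continuousWithinAt (h.continuous s hs)
  -- positive lower bounds at time `t`
  have hpos : ∀ r : ℝ, r ≠ 0 → ∀ᶠ d in 𝓝[>] (0 : ℝ), 2 * d < |r| := fun r hr => by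
    filter_upwards [Ioo_mem_nhdsGT (half_pos (abs_pos.2 hr))] with d hd
    linarith [hd.2]
  have h1 : ∀ᶠ d in 𝓝[>] (0 : ℝ), ∀ i j, i ≠ j → (b t i : ℝ) ≠ 0 → (b t j : ℝ) ≠ 0 →
      2 * d < |x t i - x t j| := by
    refine eventually_all.2 fun i => eventually_all.2 fun j => ?_
    by_cases hij : i ≠ j ∧ (b t i : ℝ) ≠ 0 ∧ (b t j : ℝ) ≠ 0
    · filter_upwards [hpos _ (sub_ne_zero.2 (hord.ne hij.1 hij.2.1 hij.2.2))] with d hd _ _ _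
      exact hd
    · exact Eventually.of_forall fun d h1 h2 h3 => absurd ⟨h1, h2, h3⟩ hij
  have h2 : ∀ᶠ d in 𝓝[>] (0 : ℝ), ∀ i, (b t i : ℝ) ≠ 0 → ∀ y ∈ Y, 2 * d < |y - x t i| := by
    refine eventually_all.2 fun i => ?_
    by_cases hi : (b t i : ℝ) ≠ 0
    · have := (Finset.eventually_all Y).2 fun y hy => hpos (y - x t i)
        (sub_ne_zero.2 fun h => hY i hi (h ▸ hy))
      filter_upwards [this] with d hd _ using hd
    · exact Eventually.of_forall fun d h1 => absurd h1 hi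
  have h3 : ∀ᶠ d in 𝓝[>] (0 : ℝ), ∀ y ∈ Y, ∀ y' ∈ Y, y ≠ y' → 2 * d < |y - y'| := by
    refine (Finset.eventually_all Y).2 fun y _ => (Finset.eventually_all Y).2 fun y' _ => ?_
    by_cases hyy : y = y'
    · exact Eventually.of_forall fun d h1 => absurd hyy h1
    · filter_upwards [hpos _ (sub_ne_zero.2 hyy)] with d hd _ using hd
  obtain ⟨d, ⟨⟨hd1, hd2⟩, hd3⟩, hd0⟩ := (((h1.and h2).and h3).and self_mem_nhdsWithin).exists
  have hd0' : 0 < d := hd0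
  obtain ⟨R, hR1, hR2⟩ : ∃ R : ℝ, (∀ i, |x t i| < R) ∧ ∀ y ∈ Y, |y| ≤ R := by
    have h4 : ∀ᶠ R in atTop, ∀ i, |x t i| < R := eventually_all.2 fun i => eventually_gt_atTop _
    have h5 : ∀ᶠ R in atTop, ∀ y ∈ Y, |y| ≤ R :=
      (Finset.eventually_all Y).2 fun y _ => eventually_ge_atTop _
    exact (h4.and h5).exists
  have htend : ∀ i, Tendsto (fun s => x s i) (𝓝[≥] t) (𝓝 (x t i)) := fun i =>
    (hxc i t ht).mono_left (nhdsWithin_mono t (Ici_subset_Ici.2 ht))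
  have h4 : ∀ᶠ s in 𝓝[≥] t, ∀ i j, i ≠ j → (b t i : ℝ) ≠ 0 → (b t j : ℝ) ≠ 0 →
      d < |x s i - x s j| := by
    refine eventually_all.2 fun i => eventually_all.2 fun j => ?_
    by_cases hij : i ≠ j ∧ (b t i : ℝ) ≠ 0 ∧ (b t j : ℝ) ≠ 0
    · have := hd1 i j hij.1 hij.2.1 hij.2.2
      filter_upwards [((htend i).sub (htend j)).abs.eventually
        (lt_mem_nhds (show d < |x t i - x t j| by linarith))] with s hs _ _ _ using hs
    · exact Eventually.of_forall fun d h1 h2 h3 => absurd ⟨h1, h2, h3⟩ hij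
  have h5 : ∀ᶠ s in 𝓝[≥] t, ∀ i, (b t i : ℝ) ≠ 0 → ∀ y ∈ Y, d < |y - x s i| := by
    refine eventually_all.2 fun i => ?_
    by_cases hi : (b t i : ℝ) ≠ 0
    · have := (Finset.eventually_all Y).2 fun y hy => ((htend i).const_sub y).abs.eventually
        (lt_mem_nhds (show d < |y - x t i| by linarith [hd2 i hi y hy]))
      filter_upwards [this] with s hs _ using hs
    · exact Eventually.of_forall fun d h1 => absurd h1 hi
  have h6 : ∀ᶠ s in 𝓝[≥] t, ∀ i, |x s i| < R :=
    eventually_all.2 fun i => (htend i).abs.eventually (gt_mem_nhds (hR1 i))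
  obtain ⟨e', he', hsub⟩ := mem_nhdsGE_iff_exists_Icc_subset.1
    ((h4.and h5).and (h6.and (Ico_mem_nhdsGE he)))
  have hte : t < e' := he'
  obtain ⟨κ, rfl⟩ : ∃ κ, e' = t + κ := ⟨e' - t, by ring⟩
  refine ⟨κ, by linarith, d, hd0', R, ?_⟩
  have hIci : Icc t (t + κ) ⊆ Ici 0 := fun s hs => ht.trans hs.1
  have hbs : ∀ s ∈ Icc t (t + κ), b s = b t := fun s hs => hb s (hsub hs).2.2
  refine ⟨hbs, fun i => (hxc i).mono hIci, fun i s hs => ?_,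
    fun s hs i => hflow.ode s ⟨hs.1, (hsub ⟨hs.1.le, hs.2.le⟩).2.2.2⟩ i,
    fun s hs i j hij hi hj => ((hsub hs).1.1 i j hij hi hj).le,
    fun s hs i hi y hy => ((hsub hs).1.2 i hi y hy).le,
    fun y hy y' hy' hne => by linarith [hd3 y hy y' hy' hne],
    fun s hs i => ((hsub hs).2.1 i).le, hR2⟩
  have hos : Ordered (fun k => (b t k : ℝ)) (x s) := by
    have := h.ordered (hIci hs)
    rwa [hbs s hs] at this
  exact (hos.continuousAt_velocity hf hU i).comp_continuousWithinAt
    ((h.continuous s (hIci hs)).mono hIci)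

end Window

/-! ### The barrier of shifted particles and dipoles -/

section Barrier

variable {n : ℕ} {f W U : ℝ → ℝ} {x : ℝ → Fin n → ℝ} {b : ℝ → Fin n → ℤ} {t : ℝ}

/-- The configuration of layers used as a barrier: perturbed particles and dipoles. -/
noncomputable def barrierCharge (b : ℝ → Fin n → ℤ) (t : ℝ) (Y : Finset ℝ) :
    Fin n ⊕ (Y × Bool) → ℝ :=
  Sum.elim (fun i => (b t i : ℝ)) fun v => sgn v.2

noncomputable def barrierCurve (Z : Fin n → ℝ → ℝ) (t δ : ℝ) (Y : Finset ℝ) :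
    Fin n ⊕ (Y × Bool) → ℝ → ℝ :=
  Sum.elim Z fun v => dipoleCurve t δ v.1 v.2

theorem layered_barrier (c δ : ℝ) (Z : Fin n → ℝ → ℝ) (Y : Finset ℝ) (p : ℝ × ℝ) :
    layered c 0 δ (barrierCharge b t Y) (barrierCurve Z t δ Y) p =
      c * (∑ i, layer δ (b t i) (Z i p.1) p.2 +
        ∑ y ∈ Y, (layer δ 1 (dipoleCurve t δ y true p.1) p.2 +
          layer δ (-1) (dipoleCurve t δ y false p.1) p.2)) := by
  rw [layered, zero_add, sum_sum_prod_bool Y _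
    (fun y σ => layer δ (sgn σ) (dipoleCurve t δ y σ p.1) p.2) fun _ _ => rfl]
  rfl

/-- For the particle layers the trajectories are smoothed, shifted and cut, which perturbs the
forces by O(δ); the shift has an extra velocity `δ * K` that exceeds this error. For dipole layers
`hδf` says that the inner attraction beats all other forces with a margin 3, the largest speed of a
dipole curve. The length κ of the interval is restricted by `K` but not by δ. -/
theorem Window.le_layered {Y : Finset ℝ} {κ d R : ℝ} (hwin : Window f (deriv U) x b t Y κ d R)
    (hf : IsKernel f) (hf0 : Tendsto f atTop (𝓝 0))
    (hW : ∀ z ≠ 0, iteratedDeriv 2 W z = -deriv f |z|)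
    {L : NNReal} (hL : LipschitzWith L (deriv U)) (hn : 0 < n) {ρ : ℝ} (hρ : 0 < ρ)
    {w : ℝ × ℝ → ℝ} (hw : IsSubsolution W U (1 / (n : ℝ)) ρ w) (ht : 0 ≤ t)
    (hb : IsCharge fun i => (b t i : ℝ))
    (hinit : ∀ y, upperEnvelope Q w (t, y) ≤ leftValue x b t y + (1 / (n : ℝ)) *
      (∑ i, max 0 (b t i : ℝ) * (if x t i = y then 1 else 0) + if y ∈ Y then 1 else 0))
    {R' : ℝ} (hleft : ∀ p : ℝ × ℝ, p.1 ∈ Ioo t (t + κ) → p.2 ≤ -R' → w p ≤ 0)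
    (hright : ∀ p : ℝ × ℝ, p.1 ∈ Ioo t (t + κ) → R' ≤ p.2 → w p ≤ (1 / (n : ℝ)) * ∑ i, (b t i : ℝ))
    {δ Λ K M : ℝ} (hδ : 0 < δ) (hδ1 : δ ≤ 1) (hδd : 100 * δ ≤ d) (hΛ : 0 ≤ Λ)
    (hlip : ∀ s s' : ℝ, 2 * (d / 4) ≤ |s| → |s' - s| ≤ d / 4 →
      |oddKer f s' - oddKer f s| ≤ Λ * |s' - s|)
    (hK : (1 / (n : ℝ)) * (n * (Λ * 10) + Y.card * (Λ * 12)) + L * 5 + 1 ≤ K) (hKκ : K * κ ≤ 1)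
    (hκ : 0 < κ) (hM : ∀ y ∈ Y, |deriv U y| ≤ M)
    (hδf : (1 / (n : ℝ)) * (n * f (d / 2) + Y.card * (2 * f (d / 2))) + (M + L * (10 * δ)) + 3 ≤
      (1 / (n : ℝ)) * f (12 * δ)) :
    ∃ Z : Fin n → ℝ → ℝ, (∀ s ∈ Icc t (t + κ), ∀ i, |Z i s - x s i| ≤ 4 * δ) ∧
      ∀ p : ℝ × ℝ, p.1 ∈ Ioo t (t + κ) →
        w p ≤ layered (1 / (n : ℝ)) 0 δ (barrierCharge b t Y) (barrierCurve Z t δ Y) p := by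
  have hc : 0 < 1 / (n : ℝ) := by positivity
  set c := 1 / (n : ℝ) with hcdef
  set v : Fin n → ℝ → ℝ := fun i s => velocity c f (deriv U) (fun k => (b t k : ℝ)) (x s) i with hv
  choose X hX2 hX using fun i => exists_smooth_approx (show t < t + κ by linarith) hδ (hwin.cont i)
    (hwin.cont_velocity i) fun s hs => hwin.ode s hs i
  -- Each particle is shifted against its charge, which raises the barrier. The initial shift `2 *
  -- δ` exceeds the smoothing error δ, and the growth `δ * K` absorbs the force errors; `K * κ ≤ 1`
  -- keeps the shift below `3 * δ`.
  set q : ℝ → ℝ := fun s => δ * (2 + K * (s - t)) with hq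
  have hK0 : 0 ≤ K := by
    have : 0 ≤ c * (n * (Λ * 10) + Y.card * (Λ * 12)) + L * 5 + 1 := by positivity
    linarith
  have hqb : ∀ s ∈ Icc t (t + κ), 2 * δ ≤ q s ∧ q s ≤ 3 * δ := fun s hs => by
    have h1 : 0 ≤ K * (s - t) := mul_nonneg hK0 (by linarith [hs.1])
    have h2 : K * (s - t) ≤ 1 := by nlinarith [hs.2]
    simp only [hq]
    constructor <;> nlinarith
  set Z : Fin n → ℝ → ℝ := fun i s => X i s - (b t i : ℝ) * q s with hZ
  have hb' : ∀ i, (b t i : ℝ) = -1 ∨ (b t i : ℝ) = 0 ∨ (b t i : ℝ) = 1 := hb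
  have hbabs : ∀ i, |(b t i : ℝ)| ≤ 1 := fun i => by
    rcases hb' i with h | h | h <;> rw [h] <;> norm_num
  have hZx : ∀ s ∈ Icc t (t + κ), ∀ i, |Z i s - x s i| ≤ 4 * δ := fun s hs i => by
    have h1 := (hX i s hs).1
    have h2 := hqb s hs
    have h3 : |(b t i : ℝ) * q s| ≤ 3 * δ := by
      rw [abs_mul, abs_of_nonneg (by linarith : 0 ≤ q s)]
      nlinarith [hbabs i, abs_nonneg (b t i : ℝ)]
    have h4 := abs_sub (X i s - x s i) ((b t i : ℝ) * q s)
    rw [show Z i s - x s i = X i s - x s i - (b t i : ℝ) * q s by simp only [hZ]; ring]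
    linarith
  have hZc : ∀ i, ContDiff ℝ 2 (Z i) := fun i => by
    have := hX2 i
    simp only [hZ, hq]
    fun_prop
  have hZd : ∀ i s, deriv (Z i) s = deriv (X i) s - (b t i : ℝ) * (δ * K) := fun i s => by
    have h1 : HasDerivAt q (δ * K) s := by
      have := ((((hasDerivAt_id s).sub_const t).const_mul K).const_add 2).const_mul δ
      simpa [hq] using this
    exact (((hX2 i).differentiable (by norm_num) s).hasDerivAt.sub (h1.const_mul _)).deriv
  refine ⟨Z, hZx, fun p hp => ?_⟩
  have hβ : IsCharge (barrierCharge b t Y) := by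
    rintro (i | v)
    · exact hb i
    · exact (sgn_eq v.2).elim Or.inl fun h => Or.inr (Or.inr h)
  have hY2 : ∀ j, ContDiff ℝ 2 (barrierCurve Z t δ Y j) := by
    rintro (i | v)
    · exact hZc i
    · exact contDiff_dipoleCurve v.2
  -- positions of the dipoles
  have hdip : ∀ s ∈ Icc t (t + κ), ∀ y : ℝ, ∀ σ, |dipoleCurve t δ y σ s - y| ≤ 8 * δ := by
    intro s hs y σ
    cases σ
    · simp only [dipoleCurve, Bool.false_eq_true, if_false]
      rw [add_sub_cancel_left, abs_of_pos (by linarith)]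
    · have := dipoleCurve_true_mem (y := y) hδ hs.1
      rw [abs_le]; constructor <;> linarith
  refine hw.le_layered hf hf0 hW hc hρ hδ hβ hY2 ht ?_ ?_ ?_ ?_ hp
  · -- separation
    intro s hs j k hjk hj hk
    have hs' : s ∈ Icc t (t + κ) := ⟨hs.1.le, hs.2.le⟩
    rcases j with i | ⟨⟨y, hy⟩, σ⟩ <;> rcases k with j | ⟨⟨y', hy'⟩, τ⟩
    · have h1 := hwin.gap s hs' i j (fun h => hjk (by rw [h])) hj hk
      have h2 := hZx s hs' i
      have h3 := hZx s hs' j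
      have h4 : |x s i - x s j| ≤ |Z i s - Z j s| + |Z i s - x s i| + |Z j s - x s j| := by
        have := abs_add_three (Z i s - Z j s) (-(Z i s - x s i)) (Z j s - x s j)
        rw [abs_neg] at this
        refine le_trans (le_of_eq ?_) this
        congr 1; ring
      show 2 * δ < |Z i s - Z j s|
      linarith
    · have h1 := hwin.spike s hs' i hj y' hy'
      have h2 := hZx s hs' i
      have h3 := hdip s hs' y' τ
      have h4 : |y' - x s i| ≤ |Z i s - dipoleCurve t δ y' τ s| + |Z i s - x s i| +
          |dipoleCurve t δ y' τ s - y'| := by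
        have := abs_add_three (-(Z i s - dipoleCurve t δ y' τ s)) (Z i s - x s i)
          (-(dipoleCurve t δ y' τ s - y'))
        rw [abs_neg, abs_neg] at this
        refine le_trans (le_of_eq ?_) this
        congr 1; ring
      show 2 * δ < |Z i s - dipoleCurve t δ y' τ s|
      linarith
    · have h1 := hwin.spike s hs' j hk y hy
      have h2 := hZx s hs' j
      have h3 := hdip s hs' y σ
      have h4 : |y - x s j| ≤ |dipoleCurve t δ y σ s - Z j s| + |Z j s - x s j| +
          |dipoleCurve t δ y σ s - y| := by
        have := abs_add_three (dipoleCurve t δ y σ s - Z j s) (Z j s - x s j)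
          (-(dipoleCurve t δ y σ s - y))
        rw [abs_neg] at this
        refine le_trans (le_of_eq ?_) this
        congr 1; ring
      show 2 * δ < |dipoleCurve t δ y σ s - Z j s|
      linarith
    · show 2 * δ < |dipoleCurve t δ y σ s - dipoleCurve t δ y' τ s|
      by_cases hyy : y = y'
      · subst hyy
        have h1 := dipoleCurve_true_mem (y := y) hδ hs'.1
        have h2 : dipoleCurve t δ y false s = y + 8 * δ := rfl
        cases σ <;> cases τ
        · exact absurd rfl hjk
        · rw [lt_abs]; left; linarith
        · rw [lt_abs]; right; linarith
        · exact absurd rfl hjk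
      · have h1 := hwin.spikes y hy y' hy' hyy
        have h2 := hdip s hs' y σ
        have h3 := hdip s hs' y' τ
        have h4 : |y - y'| ≤ |dipoleCurve t δ y σ s - dipoleCurve t δ y' τ s| +
            |dipoleCurve t δ y σ s - y| + |dipoleCurve t δ y' τ s - y'| := by
          have := abs_add_three (dipoleCurve t δ y σ s - dipoleCurve t δ y' τ s)
            (-(dipoleCurve t δ y σ s - y)) (dipoleCurve t δ y' τ s - y')
          rw [abs_neg] at this
          refine le_trans (le_of_eq ?_) this
          congr 1; ring
        linarith
  · -- the differential inequalities
    intro s hs r hr j hj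
    have hs' : s ∈ Icc t (t + κ) := ⟨hs.1.le, hs.2.le⟩
    have hr0 : 0 < δ * r := mul_pos hδ hr.1
    have hr1 : δ * r < δ := by nlinarith [hr.2]
    set z : Fin n → ℝ := fun i => Z i s - (b t i : ℝ) * δ * r with hz
    set P : ℝ → ℝ := fun y => dipoleCurve t δ y true s - 1 * δ * r with hP
    set m : ℝ → ℝ := fun y => dipoleCurve t δ y false s - (-1) * δ * r with hm
    have hsum : ∀ z₀, ∑ k, barrierCharge b t Y k *
        oddKer f (barrierCurve Z t δ Y k s - barrierCharge b t Y k * δ * r - z₀) =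
        ∑ i, (b t i : ℝ) * oddKer f (z i - z₀) +
          ∑ y ∈ Y, (oddKer f (P y - z₀) - oddKer f (m y - z₀)) := fun z₀ => by
      rw [sum_sum_prod_bool Y _ (fun y σ => sgn σ *
        oddKer f (dipoleCurve t δ y σ s - sgn σ * δ * r - z₀)) fun _ _ => rfl]
      simp only [sgn, if_true, Bool.false_eq_true, if_false, one_mul, neg_one_mul, ← sub_eq_add_neg]
      simp only [hP, hm, one_mul, neg_mul]
      rfl
    rw [hsum]
    have hzx : ∀ i, |z i - x s i| ≤ 5 * δ := fun i => by
      have h1 := hZx s hs' i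
      have h2 : |(b t i : ℝ) * δ * r| ≤ δ := by
        rw [mul_assoc, abs_mul, abs_of_pos hr0]
        nlinarith [hbabs i, abs_nonneg (b t i : ℝ)]
      have h3 := abs_sub (Z i s - x s i) ((b t i : ℝ) * δ * r)
      rw [show z i - x s i = Z i s - x s i - (b t i : ℝ) * δ * r by simp only [hz]; ring]
      linarith
    have hPm : ∀ y, dipoleCurve t δ y true s - 1 * δ * r = P y := fun y => rfl
    have hPy : ∀ y, y - 3 * δ ≤ P y ∧ P y ≤ y + 4 * δ := fun y => by
      have h1 := dipoleCurve_true_mem (y := y) hδ hs'.1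
      simp only [hP]
      constructor <;> linarith
    have hmy : ∀ y, m y = y + 8 * δ + δ * r := fun y => by
      simp only [hm, dipoleCurve, Bool.false_eq_true, if_false]; ring
    have hP10 : ∀ y ∈ Y, |P y - y| ≤ 10 * δ := fun y _ => by
      have := hPy y
      rw [abs_le]; constructor <;> linarith
    have hm10 : ∀ y ∈ Y, |m y - y| ≤ 10 * δ := fun y _ => by
      have := hmy y
      rw [abs_le]; constructor <;> linarith
    have hmP : ∀ y ∈ Y, 0 < m y - P y ∧ m y - P y ≤ 12 * δ := fun y _ => by
      have := hPy y; have := hmy y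
      constructor <;> linarith
    have hdip' : ∀ y ∈ Y, ∀ z₀, (z₀ = P y ∨ z₀ = m y) →
        c * (∑ i, (b t i : ℝ) * oddKer f (z i - z₀) +
          ∑ y ∈ Y, (oddKer f (P y - z₀) - oddKer f (m y - z₀))) + deriv U z₀ ≤ -3 := by
      intro y hy z₀ hz₀
      have := force_dipole_le hf hc.le hL hb hδ hδd hM hzx hP10 hm10 hmP (hwin.spike s hs')
        hwin.spikes hy hz₀
      linarith
    rcases j with i | ⟨⟨y, hy⟩, σ⟩
    · have hbi : (b t i : ℝ) ≠ 0 := hj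
      have h1 := force_particle_le hc.le hL hb hδ hδd hΛ hlip hzx hm10
        (fun y hy => by rw [abs_sub_comm, abs_of_pos (hmP y hy).1]; exact (hmP y hy).2)
        (hwin.gap s hs') (hwin.spike s hs') hbi
      refine h1.trans ?_
      show _ ≤ -(b t i : ℝ) * deriv (Z i) s
      have hsq : (b t i : ℝ) * (b t i : ℝ) = 1 := by
        rcases hb' i with h | h | h
        · rw [h]; norm_num
        · exact absurd h hbi
        · rw [h]; norm_num
      have h2 : c * ∑ j, (b t j : ℝ) * oddKer f (x s j - x s i) + deriv U (x s i) =
          -(b t i : ℝ) * v i s := by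
        simp only [hv, velocity]
        have h3 : ∑ j, (b t j : ℝ) * oddKer f (x s j - x s i) =
            -∑ j, (b t j : ℝ) * oddKer f (x s i - x s j) := by
          rw [← Finset.sum_neg_distrib]
          refine Finset.sum_congr rfl fun j _ => ?_
          rw [show x s j - x s i = -(x s i - x s j) by ring, oddKer_odd]
          ring
        rw [h3]
        linear_combination (c * ∑ j, (b t j : ℝ) * oddKer f (x s i - x s j) -
          deriv U (x s i)) * hsq
      have h3 := (hX i s hs').2
      have h4 : -(b t i : ℝ) * deriv (Z i) s = -(b t i : ℝ) * v i s -
          (b t i : ℝ) * (deriv (X i) s - v i s) + δ * K := by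
        rw [hZd]
        linear_combination (δ * K) * hsq
      have h5 : |(b t i : ℝ) * (deriv (X i) s - v i s)| ≤ δ := by
        rw [abs_mul]
        have : |deriv (X i) s - v i s| ≤ δ := h3
        nlinarith [hbabs i, abs_nonneg (b t i : ℝ), abs_nonneg (deriv (X i) s - v i s)]
      have h6 := (abs_le.1 h5).2
      have h7 := mul_le_mul_of_nonneg_left hK hδ.le
      rw [h2, h4]
      linarith
    · cases σ
      · show _ ≤ -(-1) * deriv (dipoleCurve t δ y false) s
        rw [deriv_dipoleCurve_false]
        have := hdip' y hy (m y) (Or.inr rfl)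
        simp only [mul_zero]
        refine le_trans this (by norm_num)
      · show _ ≤ -1 * deriv (dipoleCurve t δ y true) s
        have h1 := deriv_dipoleCurve_true (y := y) hδ hs'.1
        refine (hdip' y hy (P y) (Or.inl rfl)).trans ?_
        linarith
  · -- initial values
    intro y
    refine (hinit y).trans ?_
    have ht' : t ∈ Icc t (t + κ) := ⟨le_rfl, by linarith⟩
    rw [layered_barrier, leftValue, ← mul_add]
    refine mul_le_mul_of_nonneg_left ?_ hc.le
    rw [← add_assoc, ← Finset.sum_add_distrib]
    refine add_le_add (Finset.sum_le_sum fun i _ => ?_) ?_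
    · have hZi : Z i t = X i t - (b t i : ℝ) * q t := rfl
      have h1 := (abs_le.1 (hX i t ht').1)
      have h2 := hqb t ht'
      show _ ≤ layer δ (b t i) (Z i t) y
      rcases hb' i with h | h | h
      · rw [h] at hZi ⊢
        have h3 := (layer_bounds (δ := δ) (y := Z i t) (x := y) (Or.inl rfl : (-1 : ℝ) = -1 ∨ _)).1
        by_cases hy : x t i < y
        · rw [if_pos hy, max_eq_left (by norm_num)]; linarith
        · rw [if_neg hy, layer_of_nonpos hδ (Or.inl rfl) (by linarith), max_eq_left (by norm_num)]
          norm_num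
      · rw [h]; simp [layer]
      · rw [h] at hZi ⊢
        have h3 := (layer_bounds (δ := δ) (y := Z i t) (x := y) (Or.inr rfl : (1 : ℝ) = -1 ∨ _)).1
        rcases lt_trichotomy (x t i) y with hy | hy | hy
        · rw [if_pos hy, if_neg hy.ne, layer_of_nonpos hδ (Or.inr rfl) (by linarith)]; norm_num
        · rw [if_neg hy.not_lt, if_pos hy, layer_of_nonpos hδ (Or.inr rfl) (by linarith)]; norm_num
        · rw [if_neg hy.not_gt, if_neg hy.ne']
          linarith
    · have hnn : ∀ y' ∈ Y, 0 ≤ layer δ 1 (dipoleCurve t δ y' true t) y +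
          layer δ (-1) (dipoleCurve t δ y' false t) y := fun y' _ => by
        refine dipole_nonneg hδ ?_
        have h1 := dipoleCurve_true_mem (y := y') hδ (le_refl t)
        have h2 : dipoleCurve t δ y' false t = y' + 8 * δ := rfl
        linarith
      split_ifs with hy
      · refine le_trans ?_ (Finset.single_le_sum hnn hy)
        have h1 : dipoleCurve t δ y true t = y - 2 * δ := by
          simp [dipoleCurve]; ring
        have h2 : dipoleCurve t δ y false t = y + 8 * δ := rfl
        rw [h1, h2, layer_of_nonpos (β := 1) hδ (Or.inr rfl) (by linarith),
          layer_of_nonpos (β := -1) hδ (Or.inl rfl) (by linarith)]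
        norm_num
      · exact Finset.sum_nonneg hnn
  · -- behaviour near infinity
    refine ⟨max R' (R + 20), fun p hp1 hp2 hpR => ?_⟩
    have hpI : p.1 ∈ Icc t (t + κ) := ⟨hp1.le, hp2.le⟩
    have hZR : ∀ i, |Z i p.1| ≤ R + 4 := fun i => by
      have h1 := hZx p.1 hpI i
      have h2 := hwin.bound p.1 hpI i
      have h3 := abs_sub_abs_le_abs_sub (Z i p.1) (x p.1 i)
      linarith
    have hDR : ∀ y ∈ Y, ∀ σ, |dipoleCurve t δ y σ p.1| ≤ R + 8 := fun y hy σ => by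
      have h1 := hdip p.1 hpI y σ
      have h2 := hwin.bound_spike y hy
      have h3 := abs_sub_abs_le_abs_sub (dipoleCurve t δ y σ p.1) y
      linarith
    rw [layered_barrier]
    rcases le_abs.1 hpR with h | h
    · have h1 : R + 20 ≤ p.2 := (le_max_right _ _).trans h
      refine (hright p ⟨hp1, hp2⟩ ((le_max_left _ _).trans h)).trans (le_of_eq ?_)
      congr 1
      rw [Finset.sum_eq_zero (s := Y), add_zero]
      · refine Finset.sum_congr rfl fun i _ => ?_
        rw [layer_of_le_sub hδ (hb i)]
        linarith [le_abs_self (Z i p.1), hZR i]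
      · intro y hy
        rw [layer_of_le_sub hδ (Or.inr (Or.inr rfl)), layer_of_le_sub hδ (Or.inl rfl)]
        · norm_num
        · linarith [le_abs_self (dipoleCurve t δ y false p.1), hDR y hy false]
        · linarith [le_abs_self (dipoleCurve t δ y true p.1), hDR y hy true]
    · have h1 : R + 20 ≤ -p.2 := (le_max_right _ _).trans h
      have h2 : R' ≤ -p.2 := (le_max_left _ _).trans h
      refine (hleft p ⟨hp1, hp2⟩ (by linarith)).trans (le_of_eq ?_)
      rw [Finset.sum_eq_zero, Finset.sum_eq_zero, add_zero, mul_zero]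
      · intro y hy
        rw [layer_of_add_le hδ (Or.inr (Or.inr rfl)), layer_of_add_le hδ (Or.inl rfl), add_zero]
        · linarith [neg_abs_le (dipoleCurve t δ y false p.1), hDR y hy false]
        · linarith [neg_abs_le (dipoleCurve t δ y true p.1), hDR y hy true]
      · intro i _
        rw [layer_of_add_le hδ (hb i)]
        linarith [neg_abs_le (Z i p.1), hZR i]

end Barrier

/-! ### Comparison of subsolutions with particle solutions -/

section Comparison

variable {n : ℕ} {f W U : ℝ → ℝ} {x : ℝ → Fin n → ℝ} {b : ℝ → Fin n → ℤ} {t : ℝ}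

theorem Traj.netCharge_eq {dU : ℝ → ℝ} (h : Traj f dU x b) (ht : 0 ≤ t) {i : Fin n}
    (hi : (b t i : ℝ) ≠ 0) : netCharge x b t (x t i) = b t i := by
  rw [netCharge]
  refine Finset.sum_eq_single_of_mem i (by simp) fun j hj hji => ?_
  by_contra hj0
  exact (h.ordered ht).ne hji hj0 hi (Finset.mem_filter.1 hj).2

theorem eventually_layer_le {β X y : ℝ} (hβ : β = -1 ∨ β = 0 ∨ β = 1) :
    ∀ᶠ δ in 𝓝[>] (0 : ℝ), ∀ A, |A - X| ≤ 4 * δ → layer δ β A y ≤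
      β * (if X < y then 1 else 0) + max 0 β * (if X = y then 1 else 0) := by
  rcases lt_trichotomy X y with h | h | h
  · filter_upwards [Ioo_mem_nhdsGT (show 0 < (y - X) / 5 by linarith)] with δ hδ A hA
    have h2 := (_root_.abs_le.1 hA).2
    rw [layer_of_le_sub hδ.1 hβ (by linarith [hδ.2]), if_pos h, if_neg h.ne]
    simp
  · filter_upwards [self_mem_nhdsWithin] with δ hδ A hA
    rw [if_neg h.not_lt, if_pos h, mul_zero, zero_add, mul_one]
    rcases hβ with rfl | rfl | rfl
    · exact le_max_of_le_left
        ((layer_bounds (δ := δ) (y := A) (x := y) (Or.inl rfl)).2.trans (by norm_num))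
    · simp [layer]
    · exact le_max_of_le_right
        ((layer_bounds (δ := δ) (y := A) (x := y) (Or.inr rfl)).2.trans (by norm_num))
  · filter_upwards [Ioo_mem_nhdsGT (show 0 < (X - y) / 5 by linarith)] with δ hδ A hA
    have h2 := (_root_.abs_le.1 hA).1
    rw [layer_of_add_le hδ.1 hβ (by linarith [hδ.2]), if_neg h.not_gt, if_neg h.ne']
    simp

/-- For `z ≤ y` and small δ the exponential is below 1/2, which puts the positive layer beyond `y +
δ`, so both layers still vanish at `z`. For `z > y` the negative layer is completed at `z` and
cancels whatever the positive one contributes. -/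
theorem eventually_dipole_le {y z s : ℝ} (hs : t < s) :
    ∀ᶠ δ in 𝓝[>] (0 : ℝ), layer δ 1 (dipoleCurve t δ y true s) z +
      layer δ (-1) (dipoleCurve t δ y false s) z ≤ 0 := by
  rcases le_or_gt z y with h | h
  · have h1 : Tendsto (fun δ : ℝ => Real.exp (-(s - t) / (2 * δ))) (𝓝[>] 0) (𝓝 0) := by
      refine Real.tendsto_exp_atBot.comp ?_
      have h2 : Tendsto (fun δ : ℝ => (s - t) / 2 * δ⁻¹) (𝓝[>] 0) atTop :=
        tendsto_inv_nhdsGT_zero.const_mul_atTop (by linarith)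
      refine (tendsto_neg_atTop_atBot.comp h2).congr' ?_
      filter_upwards [self_mem_nhdsWithin] with δ hδ
      have : δ ≠ 0 := ne_of_gt hδ
      simp only [Function.comp]
      field_simp
    filter_upwards [h1.eventually (gt_mem_nhds (show (0 : ℝ) < 1 / 2 by norm_num)),
      self_mem_nhdsWithin] with δ hE hδ
    have hδ' : 0 < δ := hδ
    have h3 : dipoleCurve t δ y true s = y + 4 * δ - 6 * δ * Real.exp (-(s - t) / (2 * δ)) := rfl
    have h4 : dipoleCurve t δ y false s = y + 8 * δ := rfl
    rw [layer_of_add_le hδ' (Or.inr (Or.inr rfl)) (by rw [h3]; nlinarith),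
      layer_of_add_le hδ' (Or.inl rfl) (by rw [h4]; linarith), add_zero]
  · filter_upwards [Ioo_mem_nhdsGT (show 0 < (z - y) / 9 by linarith)] with δ hδ
    have h4 : dipoleCurve t δ y false s = y + 8 * δ := rfl
    have h5 := (layer_bounds (δ := δ) (y := dipoleCurve t δ y true s) (x := z) (Or.inr rfl)).2
    rw [layer_of_le_sub (β := -1) hδ.1 (Or.inl rfl) (by rw [h4]; linarith [hδ.2])]
    linarith

/-- At time `t` the envelope of the particle solution may carry spikes at points of zero net charge
where a particle sits; dipoles at these points put the barrier above `w`. The barrier then dominates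
`w` for a time independent of δ, and as δ → 0 it falls, at each later point, to a value below the
envelope of the particle solution. -/
theorem Traj.exists_forward (hT : Traj f (deriv U) x b) (hf : IsKernel f)
    (hf0 : Tendsto f atTop (𝓝 0)) (hW : ∀ z ≠ 0, iteratedDeriv 2 W z = -deriv f |z|)
    {L : NNReal} (hL : LipschitzWith L (deriv U)) (hn : 0 < n) {ρ : ℝ} (hρ : 0 < ρ)
    {w : ℝ × ℝ → ℝ} (hw : IsSubsolution W U (1 / (n : ℝ)) ρ w) (ht : 0 ≤ t)
    (hgood : ∀ y, upperEnvelope Q w (t, y) ≤ upperEnvelope Q (stepEvolution x b) (t, y)) :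
    ∃ κ > 0, ∀ p : ℝ × ℝ, p.1 ∈ Ioo t (t + κ) → w p ≤ upperEnvelope Q (stepEvolution x b) p := by
  have hc : 0 < 1 / (n : ℝ) := by positivity
  have hb : IsCharge fun i => (b t i : ℝ) := isCharge_cast (h := (hT.mem t ht).1)
  have hb' : ∀ i, (b t i : ℝ) = -1 ∨ (b t i : ℝ) = 0 ∨ (b t i : ℝ) = 1 := hb
  set Y : Finset ℝ := (Finset.univ.filter fun i => netCharge x b t (x t i) = 0).image (x t) with hY
  have hmemY : ∀ y, y ∈ Y ↔ netCharge x b t y = 0 ∧ ∃ i, x t i = y := by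
    intro y
    simp only [hY, Finset.mem_image, Finset.mem_filter, Finset.mem_univ, true_and]
    constructor
    · rintro ⟨i, hi, rfl⟩; exact ⟨hi, i, rfl⟩
    · rintro ⟨hi, i, rfl⟩; exact ⟨i, hi, rfl⟩
  obtain ⟨κ₀, hκ₀, d, hd, R, hwin⟩ := hT.exists_window hf hL.continuous ht (Y := Y)
    fun i hi hmem => hi (by rw [← hT.netCharge_eq ht hi]; exact ((hmemY _).1 hmem).1)
  obtain ⟨B, hB⟩ := hw.bounded
  have hB1 : ∀ p ∈ Q, |w p| ≤ max B 1 := fun p hp => (hB p hp).trans (le_max_left _ _)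
  obtain ⟨κ₁, hκ₁, R₀, hprop⟩ := hw.exists_propagation_infinity hf hf0 hW hL hc hρ hB1
  obtain ⟨Λ, hΛ, hlip⟩ := hf.exists_oddKer_lipschitz (show 0 < d / 4 by positivity)
  set K := (1 / (n : ℝ)) * (n * (Λ * 10) + Y.card * (Λ * 12)) + L * 5 + 1 with hK
  have hK0 : 0 < K := by positivity
  obtain ⟨M, hM⟩ : ∃ M, ∀ y ∈ Y, |deriv U y| ≤ M :=
    ((Finset.eventually_all Y).2 fun y _ => eventually_ge_atTop |deriv U y|).exists (f := atTop)
  -- κ is chosen before δ, so that δ can be taken small depending on the point `p`.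
  set κ := min κ₀ (min κ₁ (1 / K)) with hκdef
  have hκ : 0 < κ := lt_min hκ₀ (lt_min hκ₁ (by positivity))
  have hκ1 : κ ≤ κ₁ := (min_le_right _ _).trans (min_le_left _ _)
  have hKκ : K * κ ≤ 1 := by
    have : κ ≤ 1 / K := (min_le_right _ _).trans (min_le_right _ _)
    calc K * κ ≤ K * (1 / K) := by gcongr
      _ = 1 := by field_simp
  have hwin' := hwin.mono (min_le_left _ _ : κ ≤ κ₀)
  have hinit : ∀ y, upperEnvelope Q w (t, y) ≤ leftValue x b t y + (1 / (n : ℝ)) *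
      (∑ i, max 0 (b t i : ℝ) * (if x t i = y then 1 else 0) + if y ∈ Y then 1 else 0) := by
    intro y
    refine ((hgood y).trans (hT.upperEnvelope_le_spike hf hL ht y)).trans (le_of_eq ?_)
    rw [hT.sum_max_eq ht]
    simp only [hmemY]
  have htt : t ∈ Icc t (t + κ₀) := ⟨le_rfl, by linarith⟩
  have hfar : ∀ y, R < |y| → upperEnvelope Q w (t, y) ≤ leftValue x b t y := by
    intro y hy
    refine (hinit y).trans (le_of_eq ?_)
    have h1 : ∀ i, x t i ≠ y := fun i h => by
      have := hwin.bound t htt i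
      rw [h] at this
      linarith
    rw [if_neg fun h => absurd (hwin.bound_spike y h) (not_le.2 hy), Finset.sum_eq_zero]
    · ring
    · intro i _
      rw [if_neg (h1 i), mul_zero]
  have hsum1 : |(1 / (n : ℝ)) * ∑ i, (b t i : ℝ)| ≤ 1 := by
    rw [abs_mul, abs_of_pos hc]
    have h1 : |∑ i, (b t i : ℝ)| ≤ n := by
      refine (Finset.abs_sum_le_sum_abs _ _).trans ((Finset.sum_le_sum (g := fun _ => (1 : ℝ))
        fun i _ => ?_).trans (by simp))
      rcases hb' i with h | h | h <;> rw [h] <;> norm_num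
    calc _ ≤ 1 / (n : ℝ) * n := by gcongr
      _ = 1 := by field_simp
  set R' := max R₀ (2 * (|R| + 1)) with hR'
  have hleft : ∀ p : ℝ × ℝ, p.1 ∈ Ioo t (t + κ) → p.2 ≤ -R' → w p ≤ 0 := by
    intro p hp hp2
    have h1 : R₀ ≤ R' := le_max_left _ _
    have h2 : 2 * (|R| + 1) ≤ R' := le_max_right _ _
    have h0 := abs_nonneg R
    have h3 : |p.2| = -p.2 := abs_of_nonpos (by linarith)
    refine hprop t ht 0 (show -max B 1 ≤ 0 by linarith [le_max_right B 1]) p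
      ⟨hp.1, by linarith [hp.2]⟩ (by linarith) fun y hy => ?_
    rw [h3, abs_lt] at hy
    have h4 : R < |y| := by linarith [neg_abs_le y, le_abs_self R]
    refine (hfar y h4).trans (le_of_eq ?_)
    rw [leftValue, Finset.sum_eq_zero, mul_zero]
    intro i _
    rw [if_neg, mul_zero]
    have := (_root_.abs_le.1 (hwin.bound t htt i)).1
    linarith [le_abs_self R]
  have hright : ∀ p : ℝ × ℝ, p.1 ∈ Ioo t (t + κ) → R' ≤ p.2 →
      w p ≤ (1 / (n : ℝ)) * ∑ i, (b t i : ℝ) := by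
    intro p hp hp2
    have h1 : R₀ ≤ R' := le_max_left _ _
    have h2 : 2 * (|R| + 1) ≤ R' := le_max_right _ _
    have h0 := abs_nonneg R
    have h3 : |p.2| = p.2 := abs_of_nonneg (by linarith)
    refine hprop t ht _ ?_ p ⟨hp.1, by linarith [hp.2]⟩ (by linarith) fun y hy => ?_
    · have := le_max_right B 1
      have := (_root_.abs_le.1 hsum1).1
      linarith
    rw [h3, abs_lt] at hy
    have h4 : R < |y| := by linarith [le_abs_self y, le_abs_self R]
    refine (hfar y h4).trans (le_of_eq ?_)
    rw [leftValue]
    congr 1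
    refine Finset.sum_congr rfl fun i _ => ?_
    rw [if_pos, mul_one]
    have := (_root_.abs_le.1 (hwin.bound t htt i)).2
    linarith [le_abs_self R]
  refine ⟨κ, hκ, fun p hp => ?_⟩
  have hpI : p.1 ∈ Icc t (t + κ) := ⟨hp.1.le, hp.2.le⟩
  have hp0 : 0 < p.1 := ht.trans_lt hp.1
  have hsing : ∀ᶠ δ in 𝓝[>] (0 : ℝ),
      (1 / (n : ℝ)) * (n * f (d / 2) + Y.card * (2 * f (d / 2))) + (M + L * 10) + 3 ≤
        (1 / (n : ℝ)) * f (12 * δ) := by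
    have h1 : Tendsto (fun δ : ℝ => 12 * δ) (𝓝[>] 0) (𝓝[>] 0) := by
      refine tendsto_nhdsWithin_iff.2 ⟨?_, ?_⟩
      · have : Tendsto (fun δ : ℝ => 12 * δ) (𝓝 0) (𝓝 (12 * 0)) := (continuous_const_mul 12).tendsto 0
        rw [mul_zero] at this
        exact this.mono_left nhdsWithin_le_nhds
      · filter_upwards [self_mem_nhdsWithin] with δ hδ
        have hδ' : 0 < δ := hδ
        exact mem_Ioi.2 (by linarith)
    exact ((hf.singular.comp h1).const_mul_atTop hc).eventually_ge_atTop _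
  have hlayers : ∀ᶠ δ in 𝓝[>] (0 : ℝ), ∀ i, ∀ A, |A - x p.1 i| ≤ 4 * δ → layer δ (b t i) A p.2 ≤
      (b t i : ℝ) * (if x p.1 i < p.2 then 1 else 0) +
        max 0 (b t i : ℝ) * (if x p.1 i = p.2 then 1 else 0) :=
    eventually_all.2 fun i => eventually_layer_le (hb' i)
  have hdip : ∀ᶠ δ in 𝓝[>] (0 : ℝ), ∀ y ∈ Y, layer δ 1 (dipoleCurve t δ y true p.1) p.2 +
      layer δ (-1) (dipoleCurve t δ y false p.1) p.2 ≤ 0 :=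
    (Finset.eventually_all Y).2 fun y _ => eventually_dipole_le hp.1
  obtain ⟨δ, ⟨⟨h1, h2⟩, h3⟩, h4⟩ := (((hsing.and hlayers).and hdip).and
    (Ioo_mem_nhdsGT (show 0 < min 1 (d / 100) by positivity))).exists
  have hδ1 : δ ≤ 1 := h4.2.le.trans (min_le_left _ _)
  have hδd : 100 * δ ≤ d := by
    have := h4.2.le.trans (min_le_right _ _)
    linarith
  obtain ⟨Z, hZ, hle⟩ := hwin'.le_layered hf hf0 hW hL hn hρ hw ht hb hinit hleft hright h4.1 hδ1 hδd
    hΛ hlip (le_refl K) hKκ hκ hM (le_trans (by gcongr; linarith) h1)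
  refine (hle p hp).trans ?_
  rw [layered_barrier]
  refine le_trans ?_ (hT.le_upperEnvelope_slice hp0 p.2)
  rw [leftValue, ← mul_add, ← hT.sum_max_eq hp0.le, hwin'.b_eq p.1 hpI, ← Finset.sum_add_distrib]
  refine mul_le_mul_of_nonneg_left ?_ hc.le
  have h5 := Finset.sum_le_sum fun i (_ : i ∈ Finset.univ) => h2 i (Z i p.1) (hZ p.1 hpI i)
  have h6 := Finset.sum_nonpos h3
  linarith

/-- A bound `A` slightly above the envelope at `(t, y)` holds nearby by upper semicontinuity, hence
for `w` at times just before `t`. The propagation time κ depends neither on the starting time nor on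
`A`, so starting at `t₁ > t - κ` carries the bound across `t`. -/
theorem Traj.le_at_of_lt (hT : Traj f (deriv U) x b) (hf : IsKernel f)
    (hf0 : Tendsto f atTop (𝓝 0)) (hW : ∀ z ≠ 0, iteratedDeriv 2 W z = -deriv f |z|)
    {L : NNReal} (hL : LipschitzWith L (deriv U)) (hn : 0 < n) {ρ : ℝ} (hρ : 0 < ρ)
    {w : ℝ × ℝ → ℝ} (hw : IsSubsolution W U (1 / (n : ℝ)) ρ w) (ht : 0 < t)
    (hgood : ∀ p ∈ Q, p.1 < t → w p ≤ upperEnvelope Q (stepEvolution x b) p) (y : ℝ) :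
    w (t, y) ≤ upperEnvelope Q (stepEvolution x b) (t, y) := by
  have hc : 0 < 1 / (n : ℝ) := by positivity
  by_contra! hcon
  obtain ⟨A, hA1, hA2⟩ := exists_between hcon
  have htQ : (t, y) ∈ Q := ht
  have hev := eventually_upperEnvelope_lt hT.bounded hA1
  rw [isOpen_Q.nhdsWithin_eq htQ] at hev
  obtain ⟨r, hr, hbox⟩ := Metric.eventually_nhds_iff.1 hev
  obtain ⟨B, hB⟩ := hw.bounded
  have hB1 : ∀ p ∈ Q, |w p| ≤ max B 1 := fun p hp => (hB p hp).trans (le_max_left _ _)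
  obtain ⟨κ, hκ, hprop⟩ := hw.exists_propagation hf hf0 hW hL hc hρ hB1 y (half_pos hr)
  obtain ⟨t₁, ht₁, ht₁'⟩ := exists_between (show max 0 (max (t - r) (t - κ)) < t from
    max_lt ht (max_lt (by linarith) (by linarith)))
  have h1 : 0 < t₁ := (le_max_left _ _).trans_lt ht₁
  have h2 : t - r < t₁ := ((le_max_left _ _).trans (le_max_right _ _)).trans_lt ht₁
  have h3 : t - κ < t₁ := ((le_max_right _ _).trans (le_max_right _ _)).trans_lt ht₁
  have hA : A ≥ -max B 1 := by
    have := neBot_nhdsWithin_of_mem htQ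
    have h4 := abs_upperEnvelope_le (s := Q) (p := (t, y)) (f := stepEvolution x b) (C := 1)
      fun q hq => hT.abs_le (le_of_lt (show 0 < q.1 from hq))
    have := (_root_.abs_le.1 h4).1
    have := le_max_right B 1
    linarith
  have := hprop t₁ h1.le A hA (fun z hz => ?_) (t, y) ⟨ht₁', by linarith⟩ (by simpa using half_pos hr)
  · linarith
  · have hzQ : (t₁, z) ∈ Q := h1
    rw [hw.usc.upperEnvelope_eq hw.bounded hzQ]
    refine (hgood _ hzQ ht₁').trans (le_of_lt (hbox ?_))
    rw [Prod.dist_eq, max_lt_iff, Real.dist_eq, Real.dist_eq]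
    refine ⟨?_, by linarith⟩
    rw [abs_lt]; constructor <;> linarith

/-- Continuation in time: at the infimum `T` of the times of violation the inequality still holds,
and `Traj.exists_forward` extends it beyond `T`. -/
theorem Traj.le_of_isSubsolution (hT : Traj f (deriv U) x b) (hf : IsKernel f)
    (hf0 : Tendsto f atTop (𝓝 0)) (hW : ∀ z ≠ 0, iteratedDeriv 2 W z = -deriv f |z|)
    {L : NNReal} (hL : LipschitzWith L (deriv U)) (hn : 0 < n) {ρ : ℝ} (hρ : 0 < ρ)
    {w : ℝ × ℝ → ℝ} (hw : IsSubsolution W U (1 / (n : ℝ)) ρ w)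
    (hinit : ∀ y, upperEnvelope Q w (0, y) ≤ upperEnvelope Q (stepEvolution x b) (0, y))
    {p : ℝ × ℝ} (hp : p ∈ Q) : w p ≤ upperEnvelope Q (stepEvolution x b) p := by
  by_contra! hcon
  set S : Set ℝ := {s | 0 < s ∧ ∃ y, upperEnvelope Q (stepEvolution x b) (s, y) < w (s, y)} with hS
  have hpS : p.1 ∈ S := ⟨hp, p.2, hcon⟩
  have hbdd : BddBelow S := ⟨0, fun s hs => hs.1.le⟩
  set T := sInf S with hTdef
  have hT0 : 0 ≤ T := le_csInf ⟨_, hpS⟩ fun s hs => hs.1.le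
  have hbefore : ∀ q ∈ Q, q.1 < T → w q ≤ upperEnvelope Q (stepEvolution x b) q := by
    intro q hq hqT
    by_contra! h
    exact absurd (csInf_le hbdd (show q.1 ∈ S from ⟨hq, q.2, h⟩)) (not_le.2 hqT)
  have hat : ∀ y, upperEnvelope Q w (T, y) ≤ upperEnvelope Q (stepEvolution x b) (T, y) := by
    intro y
    rcases hT0.eq_or_lt with h | h
    · rw [← h]; exact hinit y
    · rw [hw.usc.upperEnvelope_eq hw.bounded (show (T, y) ∈ Q from h)]
      exact hT.le_at_of_lt hf hf0 hW hL hn hρ hw h hbefore y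
  obtain ⟨κ, hκ, hfwd⟩ := hT.exists_forward hf hf0 hW hL hn hρ hw hT0 hat
  have : T + κ ≤ T := by
    refine le_csInf ⟨_, hpS⟩ fun s hs => ?_
    by_contra! hsκ
    obtain ⟨hs0, y, hy⟩ := hs
    rcases (csInf_le hbdd (show s ∈ S from ⟨hs0, y, hy⟩)).eq_or_lt with h | h
    · have h1 := hat y
      rw [show T = s from h, hw.usc.upperEnvelope_eq hw.bounded (show (s, y) ∈ Q from hs0)] at h1
      linarith
    · linarith [hfwd (s, y) ⟨h, hsκ⟩]
  linarith

/-! ### Uniqueness of the envelopes -/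

theorem stepEvolution_eventually_right (x : ℝ → Fin n → ℝ) (b : ℝ → Fin n → ℤ) (q : ℝ × ℝ) :
    ∀ᶠ η in 𝓝[>] (0 : ℝ), stepEvolution x b (q.1, q.2 + η) = stepEvolution x b q ∧
      ∀ i, x q.1 i ≠ q.2 + η := by
  have h1 : ∀ i, ∀ᶠ η in 𝓝[>] (0 : ℝ), heaviside (q.2 + η - x q.1 i) = heaviside (q.2 - x q.1 i) ∧
      x q.1 i ≠ q.2 + η := fun i => by
    rcases le_or_gt (x q.1 i) q.2 with h | h
    · filter_upwards [self_mem_nhdsWithin] with η hη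
      have hη' : 0 < η := hη
      rw [heaviside_of_nonneg (by linarith), heaviside_of_nonneg (by linarith)]
      exact ⟨rfl, fun h' => by linarith⟩
    · filter_upwards [Ioo_mem_nhdsGT (sub_pos.2 h)] with η hη
      have := hη.2
      rw [heaviside_of_neg (by linarith), heaviside_of_neg (by linarith)]
      exact ⟨rfl, fun h' => by linarith⟩
  filter_upwards [eventually_all.2 h1] with η hη
  refine ⟨?_, fun i => (hη i).2⟩
  rw [stepEvolution, stepEvolution, stepFunction, stepFunction]
  congr 1
  exact Finset.sum_congr rfl fun i _ => by rw [(hη i).1]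

theorem Traj.upperEnvelope_eq_of_uncharged {dU : ℝ → ℝ} (hT : Traj f dU x b) (hf : IsKernel f)
    {L : NNReal} (hL : LipschitzWith L dU) (ht : 0 < t) {y : ℝ} (hy : ∀ i, x t i ≠ y) :
    upperEnvelope Q (stepEvolution x b) (t, y) ≤ stepEvolution x b (t, y) := by
  obtain ⟨e, β, d, C, hE⟩ := hT.exists_leftEnd hf hL ht
  have := neBot_nhdsWithin_of_mem (show (t, y) ∈ Q from ht)
  have h1 := hE.eventually_eq hT (y := y) fun i => by rw [clusterCharge, if_neg (hy i)]
  refine upperEnvelope_le hT.bounded (nhdsWithin_le_nhds ?_)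
  filter_upwards [h1] with q hq
  rw [hq, h1.self_of_nhds]

/-- Upper semicontinuity absorbs a small displacement to the right. It is used with a step function
that is right-continuous in space, so that comparison is needed only at points not occupied by
particles. -/
theorem upperEnvelope_mono_right {u w : ℝ × ℝ → ℝ} (hu : ∃ C : ℝ, ∀ p ∈ Q, |u p| ≤ C)
    (hw : ∃ C : ℝ, ∀ p ∈ Q, |w p| ≤ C)
    (h : ∀ q ∈ Q, ∀ᶠ η in 𝓝[>] (0 : ℝ), u q ≤ upperEnvelope Q w (q.1, q.2 + η)) {p : ℝ × ℝ}
    (hp : p ∈ Q) : upperEnvelope Q u p ≤ upperEnvelope Q w p := by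
  refine le_of_forall_gt fun A hA => ?_
  obtain ⟨A', hA', hA'A⟩ := exists_between hA
  have := neBot_nhdsWithin_of_mem hp
  refine lt_of_le_of_lt (upperEnvelope_le hu ?_) hA'A
  have h1 := eventually_upperEnvelope_lt hw hA'
  rw [isOpen_Q.nhdsWithin_eq hp] at h1 ⊢
  filter_upwards [eventually_eventually_nhds.2 h1, isOpen_Q.mem_nhds hp] with q hq hqQ
  have h2 : Tendsto (fun η : ℝ => (q.1, q.2 + η)) (𝓝[>] 0) (𝓝 q) := by
    have : Tendsto (fun η : ℝ => (q.1, q.2 + η)) (𝓝 0) (𝓝 (q.1, q.2 + 0)) :=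
      (by fun_prop : Continuous fun η : ℝ => (q.1, q.2 + η)).tendsto 0
    rw [add_zero] at this
    exact this.mono_left nhdsWithin_le_nhds
  obtain ⟨η, h3, h4⟩ := ((h2.eventually hq).and (h q hqQ)).exists
  exact h4.trans h3.le

/-- One inequality is comparison for the upper envelope of `w`. For the other, comparison of the
negated problem puts the lower envelope of `w` above that of the step function u. At a point without
particles u is locally constant, so its value there lies below `w` and thus below the upper
envelope; moving slightly to the right reaches such points without changing the value of u. -/
theorem Traj.upperEnvelope_unique (hT : Traj f (deriv U) x b) (hf : IsKernel f)
    (hf0 : Tendsto f atTop (𝓝 0)) (hW : ∀ z ≠ 0, iteratedDeriv 2 W z = -deriv f |z|)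
    {L : NNReal} (hL : LipschitzWith L (deriv U)) (hn : 0 < n) {ρ : ℝ} (hρ : 0 < ρ)
    {w : ℝ × ℝ → ℝ} (hwb : ∃ C : ℝ, ∀ p ∈ Q, |w p| ≤ C)
    (hsub : IsSubsolution W U (1 / (n : ℝ)) ρ (upperEnvelope Q w))
    (hsuper : IsSupersolution W U (1 / (n : ℝ)) ρ (lowerEnvelope Q w))
    (hinit : HasInitialEnvelopes w (stepFunction (x 0) (b 0))) {p : ℝ × ℝ} (hp : p ∈ Q) :
    upperEnvelope Q w p = upperEnvelope Q (stepEvolution x b) p := by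
  have hc : 0 < 1 / (n : ℝ) := by positivity
  have hwb' : ∃ C : ℝ, ∀ p ∈ Q, |-w p| ≤ C := by simpa only [abs_neg] using hwb
  have hidem : ∀ (g : ℝ × ℝ → ℝ), (∃ C : ℝ, ∀ p ∈ Q, |g p| ≤ C) → ∀ y,
      upperEnvelope Q (upperEnvelope Q g) (0, y) ≤ upperEnvelope Q g (0, y) := by
    intro g hg y
    refine le_of_forall_gt fun A hA => ?_
    obtain ⟨A', hA', hA'A⟩ := exists_between hA
    have := neBot_nhdsWithin_Q (p := ((0 : ℝ), y)) le_rfl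
    obtain ⟨C, hC⟩ := hg
    refine lt_of_le_of_lt (upperEnvelope_le ⟨C, fun q hq => ?_⟩
      ((eventually_upperEnvelope_lt ⟨C, hC⟩ hA').mono fun q hq => hq.le)) hA'A
    have := neBot_nhdsWithin_of_mem hq
    exact abs_upperEnvelope_le hC
  have hTi := hT.hasInitialEnvelopes
  refine le_antisymm (hT.le_of_isSubsolution hf hf0 hW hL hn hρ hsub (fun y => ?_) hp)
    (upperEnvelope_mono_right hT.bounded hwb (fun q hq => ?_) hp)
  · refine (hidem w hwb y).trans (le_of_eq ?_)
    rw [(hinit y).1, (hTi y).1]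
  · -- the lower envelope dominates `u` where `u` is locally constant
    have hdU : (deriv fun s => -U s) = fun s => -deriv U s := funext fun s => deriv.fun_neg
    have hT' : Traj f (deriv fun s => -U s) x fun t i => -b t i := by rw [hdU]; exact hT.neg
    have hL' : LipschitzWith L (deriv fun s => -U s) := by
      rw [hdU]
      exact fun s s' => by rw [edist_neg_neg]; exact hL s s'
    have hsub' := hsuper.neg hf hf0 hW hc hρ
    have hneg : (fun q => -lowerEnvelope Q w q) = upperEnvelope Q fun q => -w q := by
      ext q; rw [lowerEnvelope_eq_neg, neg_neg]
    rw [hneg] at hsub'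
    have hle : ∀ q ∈ Q, upperEnvelope Q (fun q => -w q) q ≤
        upperEnvelope Q (stepEvolution x fun t i => -b t i) q := fun q hq =>
      hT'.le_of_isSubsolution hf hf0 hW hL' hn hρ hsub' (fun y => by
        refine (hidem _ hwb' y).trans (le_of_eq ?_)
        have h1 := (hinit y).2
        have h2 := (hTi y).2
        rw [lowerEnvelope_eq_neg Q] at h1
        rw [lowerEnvelope_stepEvolution] at h2
        linarith) hq
    filter_upwards [stepEvolution_eventually_right x b q] with η hη
    have hq' : (q.1, q.2 + η) ∈ Q := hq
    have h1 := hle _ hq'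
    have h2 := hT'.upperEnvelope_eq_of_uncharged hf hL' hq hη.2
    rw [stepEvolution_neg, hη.1] at h2
    have h3 := le_upperEnvelope hwb hq'
    have h4 := le_upperEnvelope hwb' hq'
    linarith

/-- The lower envelope is the upper envelope of the problem with charges, drift and `w` negated. -/
theorem Traj.sameEnvelopes (hT : Traj f (deriv U) x b) (hf : IsKernel f)
    (hf0 : Tendsto f atTop (𝓝 0)) (hW : ∀ z ≠ 0, iteratedDeriv 2 W z = -deriv f |z|)
    {L : NNReal} (hL : LipschitzWith L (deriv U)) (hn : 0 < n) {ρ : ℝ} (hρ : 0 < ρ)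
    {w : ℝ × ℝ → ℝ} (hw : IsViscositySolution W U (1 / (n : ℝ)) ρ w)
    (hinit : HasInitialEnvelopes w (stepFunction (x 0) (b 0))) :
    SameEnvelopes w (stepEvolution x b) := by
  intro p hp
  have hc : 0 < 1 / (n : ℝ) := by positivity
  refine ⟨hT.upperEnvelope_unique hf hf0 hW hL hn hρ hw.bounded hw.sub hw.super hinit hp, ?_⟩
  have hdU : (deriv fun s => -U s) = fun s => -deriv U s := funext fun s => deriv.fun_neg
  have hT' : Traj f (deriv fun s => -U s) x fun t i => -b t i := by rw [hdU]; exact hT.neg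
  have hL' : LipschitzWith L (deriv fun s => -U s) := by
    rw [hdU]
    exact fun s s' => by rw [edist_neg_neg]; exact hL s s'
  have hneg : (fun q => -lowerEnvelope Q w q) = upperEnvelope Q fun q => -w q := by
    ext q; rw [lowerEnvelope_eq_neg, neg_neg]
  have hneg' : (fun q => -upperEnvelope Q w q) = lowerEnvelope Q fun q => -w q := by
    ext q; rw [lowerEnvelope_eq_neg]; simp only [neg_neg]
  have hsub := hw.super.neg hf hf0 hW hc hρ
  rw [hneg] at hsub
  have hsuper : IsSupersolution W (fun s => -U s) (1 / (n : ℝ)) ρ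
      (lowerEnvelope Q fun q => -w q) := by
    rw [← hneg']
    refine IsSubsolution.isSupersolution hf hf0 hW hc hρ ?_
    simp only [neg_neg]
    exact hw.sub
  have h := hT'.upperEnvelope_unique hf hf0 hW hL' hn hρ
    (by simpa only [abs_neg] using hw.bounded) hsub hsuper (fun y => ?_) hp
  · rw [lowerEnvelope_eq_neg, h, lowerEnvelope_stepEvolution]
  · have h1 := hinit y
    have h2 : stepFunction (x 0) (fun i => -b 0 i) = fun y => -stepFunction (x 0) (b 0) y :=
      funext fun y => stepFunction_neg _ _ y
    rw [h2]
    rw [lowerEnvelope_eq_neg, lowerEnvelope_eq_neg univ] at h1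
    refine ⟨by linarith [h1.2], ?_⟩
    rw [lowerEnvelope_eq_neg, lowerEnvelope_eq_neg univ]
    simp only [neg_neg]
    have := h1.1
    exact congrArg Neg.neg this

end Comparison

/-! ### From the assumptions on the potential to the kernel -/

/-- The function h - (A/k)x⁻ᵏ is increasing near 0, hence bounded above there. -/
theorem eventually_le_div_pow {h : ℝ → ℝ} {A : ℝ} {k : ℕ} (hk : k ≠ 0)
    (hd : DifferentiableOn ℝ h (Ioi 0))
    (hA : ∀ᶠ x in 𝓝[>] (0 : ℝ), -deriv h x ≤ A / x ^ (k + 1)) :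
    ∃ C, ∀ᶠ x in 𝓝[>] (0 : ℝ), h x ≤ C / x ^ k := by
  obtain ⟨δ, hδ, hsub⟩ := mem_nhdsGT_iff_exists_Ioc_subset.1 (hA.and (Ioc_mem_nhdsGT one_pos))
  have hδ0 : 0 < δ := hδ
  have hδ1 : δ ≤ 1 := (hsub ⟨hδ0, le_rfl⟩).2.2
  have hk0 : (0 : ℝ) < k := by exact_mod_cast Nat.pos_of_ne_zero hk
  set F : ℝ → ℝ := fun x => h x - A / k * (x ^ k)⁻¹ with hF
  have hFd : ∀ x ∈ Ioi (0 : ℝ), HasDerivAt F (deriv h x + A / x ^ (k + 1)) x := by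
    intro x hx
    have hx0 : (x : ℝ) ≠ 0 := ne_of_gt hx
    have h1 := ((hasDerivAt_pow k x).fun_inv (pow_ne_zero k hx0)).const_mul (A / k)
    have h2 := ((hd x hx).differentiableAt (Ioi_mem_nhds hx)).hasDerivAt.fun_sub h1
    refine h2.congr_deriv ?_
    obtain ⟨m, rfl⟩ := Nat.exists_eq_succ_of_ne_zero hk
    simp only [Nat.succ_eq_add_one, Nat.add_sub_cancel] at hk0 ⊢
    field_simp
    ring
  have hmono : MonotoneOn F (Ioc 0 δ) := by
    refine monotoneOn_of_deriv_nonneg (convex_Ioc 0 δ)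
      (fun x hx => (hFd x hx.1).continuousAt.continuousWithinAt)
      (fun x hx => (hFd x (interior_subset hx).1).differentiableAt.differentiableWithinAt)
      fun x hx => ?_
    have hx' := interior_subset hx
    rw [(hFd x hx'.1).deriv]
    have := (hsub hx').1
    linarith
  refine ⟨|F δ| + A / k, ?_⟩
  filter_upwards [Ioc_mem_nhdsGT hδ0] with x hx
  have h1 := hmono hx ⟨hδ0, le_rfl⟩ hx.2
  have h2 : F x = h x - A / k * (x ^ k)⁻¹ := rfl
  have h3 : 1 ≤ (x ^ k)⁻¹ :=
    (one_le_inv₀ (pow_pos hx.1 k)).2 (pow_le_one₀ hx.1.le (hx.2.trans hδ1))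
  rw [div_eq_mul_inv, add_mul]
  have h4 : |F δ| ≤ |F δ| * (x ^ k)⁻¹ := le_mul_of_one_le_right (abs_nonneg _) h3
  linarith [le_abs_self (F δ)]

section Potential

variable {V U : ℝ → ℝ}

theorem WellPosednessAssumption.contDiffOn_deriv (h : WellPosednessAssumption V U) :
    ContDiffOn ℝ 2 (deriv V) (Ioi 0) :=
  h.regular.deriv_of_isOpen isOpen_Ioi (by norm_num)

theorem WellPosednessAssumption.contDiffOn_deriv_two (h : WellPosednessAssumption V U) :
    ContDiffOn ℝ 1 (iteratedDeriv 2 V) (Ioi 0) := by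
  rw [iteratedDeriv_succ, iteratedDeriv_one]
  exact h.contDiffOn_deriv.deriv_of_isOpen isOpen_Ioi (by norm_num)

theorem deriv_neg_deriv (V : ℝ → ℝ) :
    deriv (fun x => -deriv V x) = fun x => -iteratedDeriv 2 V x := by
  ext x
  rw [deriv.fun_neg, iteratedDeriv_succ, iteratedDeriv_one]

theorem deriv_iteratedDeriv_two (V : ℝ → ℝ) : deriv (iteratedDeriv 2 V) = iteratedDeriv 3 V :=
  (iteratedDeriv_succ (n := 2)).symm

theorem WellPosednessAssumption.antitoneOn_deriv_two (h : WellPosednessAssumption V U) :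
    AntitoneOn (iteratedDeriv 2 V) (Ioi 0) := by
  refine antitoneOn_of_deriv_nonpos (convex_Ioi 0) h.contDiffOn_deriv_two.continuousOn ?_ ?_
  · rw [interior_Ioi]
    exact h.contDiffOn_deriv_two.differentiableOn (by norm_num)
  · rw [interior_Ioi]
    intro x hx
    rw [deriv_iteratedDeriv_two]
    exact h.third_deriv_nonpos x hx

/-- The supremum at t is at least |V'''(y)| for all t < y; integrating t³ times this bound over
(y/4, y/2) gives at least (y/4)⁴|V'''(y)|, whence the constant 256. -/
theorem eventually_deriv_three_of_lintegral {I : ℝ≥0∞} (hI : I ≠ ∞)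
    (h : ∫⁻ x in Ioo (0 : ℝ) 1, ENNReal.ofReal (x ^ 3) * derivSup V 3 (Iio 1) x ≤ I) :
    ∀ y ∈ Ioo (0 : ℝ) 1, |iteratedDeriv 3 V y| ≤ 256 * I.toReal / y ^ 4 := by
  intro y hy
  set x := y / 2 with hx
  have hx0 : 0 < x := by linarith [hy.1]
  have h1 : ENNReal.ofReal (x / 2) * (ENNReal.ofReal ((x / 2) ^ 3) *
      ENNReal.ofReal |iteratedDeriv 3 V y|) ≤ I := by
    refine le_trans ?_ h
    have hsub : Ioo (x / 2) x ⊆ Ioo (0 : ℝ) 1 :=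
      Ioo_subset_Ioo (by linarith) (by linarith [hy.2])
    refine le_trans ?_ (lintegral_mono_set hsub)
    have h2 : ∫⁻ _ in Ioo (x / 2) x, (ENNReal.ofReal ((x / 2) ^ 3) *
        ENNReal.ofReal |iteratedDeriv 3 V y|) = ENNReal.ofReal (x / 2) *
        (ENNReal.ofReal ((x / 2) ^ 3) * ENNReal.ofReal |iteratedDeriv 3 V y|) := by
      rw [setLIntegral_const, Real.volume_Ioo, mul_comm, show x - x / 2 = x / 2 by ring]
    rw [← h2]
    refine setLIntegral_mono' measurableSet_Ioo fun t ht => ?_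
    have ht0 : 0 < t := by linarith [ht.1]
    have h3 : ENNReal.ofReal |iteratedDeriv 3 V y| ≤ derivSup V 3 (Iio 1) t := by
      unfold derivSup
      exact le_biSup (fun y => ENNReal.ofReal |iteratedDeriv 3 V y|)
        (show y ∈ Iio (1 : ℝ) ∩ Ioi t from ⟨hy.2, mem_Ioi.2 (by linarith [ht.2])⟩)
    gcongr
    exact ht.1.le
  rw [← ENNReal.ofReal_mul (by positivity), ← ENNReal.ofReal_mul (by positivity),
    ENNReal.ofReal_le_iff_le_toReal hI] at h1
  rw [le_div_iff₀ (by have := hy.1; positivity)]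
  have h4 : x / 2 * ((x / 2) ^ 3 * |iteratedDeriv 3 V y|) = |iteratedDeriv 3 V y| * y ^ 4 / 256 := by
    rw [hx]; ring
  linarith

/-- V'' is decreasing, so over (x/2, x) the integral of t²V''(t) is at least x³V''(x)/8. -/
theorem deriv_two_le_of_integrable (hV : WellPosednessAssumption V U)
    (h : IntegrableOn (fun x => x ^ 2 * iteratedDeriv 2 V x) (Ioo 0 1)) :
    ∀ x ∈ Ioo (0 : ℝ) 1, iteratedDeriv 2 V x ≤
      8 * (∫ x in Ioo (0 : ℝ) 1, x ^ 2 * iteratedDeriv 2 V x) / x ^ 3 := by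
  intro x hx
  have hx0 := hx.1
  have hsub : Ioo (x / 2) x ⊆ Ioo (0 : ℝ) 1 := Ioo_subset_Ioo (by linarith) hx.2.le
  have h1 : ∫ t in Ioo (x / 2) x, t ^ 2 * iteratedDeriv 2 V t ≤
      ∫ t in Ioo (0 : ℝ) 1, t ^ 2 * iteratedDeriv 2 V t := by
    refine setIntegral_mono_set h ?_ (LE.le.eventuallyLE hsub)
    filter_upwards [ae_restrict_mem measurableSet_Ioo] with t ht
    exact mul_nonneg (sq_nonneg t) (hV.second_deriv_nonneg t ht.1)
  have h2 : ∫ _ in Ioo (x / 2) x, (x / 2) ^ 2 * iteratedDeriv 2 V x ≤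
      ∫ t in Ioo (x / 2) x, t ^ 2 * iteratedDeriv 2 V t := by
    refine setIntegral_mono_on (integrableOn_const (by simp)) (h.mono_set hsub) measurableSet_Ioo
      fun t ht => ?_
    have ht0 : 0 < t := by linarith [ht.1]
    have h3 := hV.antitoneOn_deriv_two (mem_Ioi.2 ht0) (mem_Ioi.2 hx0) ht.2.le
    have h4 := hV.second_deriv_nonneg x hx0
    gcongr
    exact ht.1.le
  rw [setIntegral_const, Measure.real, Real.volume_Ioo,
    ENNReal.toReal_ofReal (by linarith), smul_eq_mul] at h2
  rw [le_div_iff₀ (by positivity)]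
  have h5 : (x - x / 2) * ((x / 2) ^ 2 * iteratedDeriv 2 V x) = iteratedDeriv 2 V x * x ^ 3 / 8 := by
    ring
  linarith

/-- In the first two regimes V''' = O(x⁻⁴), by integrability of the monotone supremum or by
assumption; in the third V'' = O(x⁻³). Integrating twice, respectively once, gives the bound of
order x⁻² which the cubic gap estimate needs. -/
theorem WellPosednessAssumption.eventually_bound (hV : WellPosednessAssumption V U)
    (h : Regime1 V ∨ Regime2 V ∨ Regime3 V) :
    ∃ C, ∀ᶠ x in 𝓝[>] (0 : ℝ), -deriv V x ≤ C / x ^ 2 := by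
  have key : (∃ A, ∀ᶠ x in 𝓝[>] (0 : ℝ), iteratedDeriv 2 V x ≤ A / x ^ 3) →
      ∃ C, ∀ᶠ x in 𝓝[>] (0 : ℝ), -deriv V x ≤ C / x ^ 2 := by
    rintro ⟨A, hA⟩
    refine eventually_le_div_pow (A := A) (by norm_num)
      (hV.contDiffOn_deriv.differentiableOn (by norm_num)).neg ?_
    rw [deriv_neg_deriv]
    simpa using hA
  have key' : (∃ A, ∀ᶠ x in 𝓝[>] (0 : ℝ), |iteratedDeriv 3 V x| ≤ A / x ^ 4) →
      ∃ C, ∀ᶠ x in 𝓝[>] (0 : ℝ), -deriv V x ≤ C / x ^ 2 := by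
    rintro ⟨A, hA⟩
    refine key (eventually_le_div_pow (A := A) (by norm_num)
      (hV.contDiffOn_deriv_two.differentiableOn (by norm_num)) ?_)
    rw [deriv_iteratedDeriv_two]
    exact hA.mono fun x hx => (neg_le_abs _).trans hx
  rcases h with h | h | h
  · refine key' ⟨256 * (∫⁻ x in Ioo (0 : ℝ) 1, ENNReal.ofReal (x ^ 3) * derivSup V 3 (Iio 1) x).toReal, ?_⟩
    filter_upwards [Ioo_mem_nhdsGT one_pos] with x hx
    exact eventually_deriv_three_of_lintegral h.2.ne le_rfl x hx
  · refine key' ⟨1, ?_⟩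
    filter_upwards [(h.2.2.2.abs).eventually (gt_mem_nhds (show |(0 : ℝ)| < 1 by simp)),
      self_mem_nhdsWithin] with x hx hx0
    have hx0' : 0 < x := hx0
    rw [le_div_iff₀ (by positivity)]
    rw [abs_mul, abs_of_pos (by positivity : 0 < x ^ 4)] at hx
    linarith
  · refine key ⟨8 * ∫ x in Ioo (0 : ℝ) 1, x ^ 2 * iteratedDeriv 2 V x, ?_⟩
    filter_upwards [Ioo_mem_nhdsGT one_pos] with x hx
    exact deriv_two_le_of_integrable hV h.2.2.1 x hx

theorem WellPosednessAssumption.isKernel (hV : WellPosednessAssumption V U)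
    (h : Regime1 V ∨ Regime2 V ∨ Regime3 V) : IsKernel fun x => -deriv V x := by
  have hcont : ContinuousOn (fun x => -deriv V x) (Ioi 0) := hV.contDiffOn_deriv.continuousOn.neg
  have hdiff : DifferentiableOn ℝ (fun x => -deriv V x) (Ioi 0) :=
    (hV.contDiffOn_deriv.differentiableOn (by norm_num)).neg
  have hanti : AntitoneOn (fun x => -deriv V x) (Ioi 0) := by
    refine antitoneOn_of_deriv_nonpos (convex_Ioi 0) hcont (by rwa [interior_Ioi]) fun x hx => ?_
    rw [interior_Ioi] at hx
    rw [deriv_neg_deriv]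
    simpa using hV.second_deriv_nonneg x hx
  refine ⟨fun x hx => by simpa using hV.deriv_nonpos x hx, hanti, ?_,
    (hV.contDiffOn_deriv.of_le (by norm_num)).neg, ?_, ?_⟩
  · refine MonotoneOn.convexOn_of_deriv (convex_Ioi 0) hcont (by rwa [interior_Ioi]) ?_
    rw [interior_Ioi, deriv_neg_deriv]
    exact fun x hx y hy hxy => neg_le_neg (hV.antitoneOn_deriv_two hx hy hxy)
  -- Near 0 one has xV''(x) ≥ 1, so -V' + log is decreasing there and -V' grows at least like -log
  -- x.
  · obtain ⟨δ, hδ, hsub⟩ := mem_nhdsGT_iff_exists_Ioc_subset.1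
      (hV.singularity_lower.eventually_ge_atTop 1)
    have hδ0 : 0 < δ := hδ
    have hFd : ∀ x ∈ Ioi (0 : ℝ), HasDerivAt (fun x => -deriv V x + Real.log x)
        (-iteratedDeriv 2 V x + x⁻¹) x := by
      intro x hx
      have h1 := ((hdiff x hx).differentiableAt (Ioi_mem_nhds hx)).hasDerivAt
      rw [deriv_neg_deriv] at h1
      exact h1.add (Real.hasDerivAt_log (ne_of_gt hx))
    have hF : AntitoneOn (fun x => -deriv V x + Real.log x) (Ioc 0 δ) := by
      refine antitoneOn_of_deriv_nonpos (convex_Ioc 0 δ)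
        (fun x hx => (hFd x hx.1).continuousAt.continuousWithinAt)
        (fun x hx => (hFd x (interior_subset hx).1).differentiableAt.differentiableWithinAt)
        fun x hx => ?_
      have hx' := interior_subset hx
      rw [(hFd x hx'.1).deriv]
      have h1 : 1 ≤ x * iteratedDeriv 2 V x := hsub hx'
      have h2 : x⁻¹ ≤ iteratedDeriv 2 V x := by
        rw [inv_le_iff_one_le_mul₀ hx'.1, mul_comm]; exact h1
      linarith
    have hlog : Tendsto (fun x => (-deriv V δ + Real.log δ) + -Real.log x) (𝓝[>] 0) atTop :=
      tendsto_atTop_add_const_left _ _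
        (tendsto_neg_atBot_atTop.comp Real.tendsto_log_nhdsGT_zero)
    refine tendsto_atTop_mono' _ ?_ hlog
    filter_upwards [Ioc_mem_nhdsGT hδ0] with x hx
    have := hF hx ⟨hδ0, le_rfl⟩ hx.2
    simp only at this
    linarith
  · obtain ⟨C, hC⟩ := hV.eventually_bound h
    obtain ⟨δ, hδ, hsub⟩ := mem_nhdsGT_iff_exists_Ioc_subset.1 hC
    have hδ0 : 0 < δ := hδ
    refine ⟨|C| + |deriv V δ| + 1, by positivity, fun x hx => ?_⟩
    have hx2 : 0 < x ^ 2 := pow_pos hx.1 2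
    have hx21 : x ^ 2 ≤ 1 := pow_le_one₀ hx.1.le hx.2.le
    rw [le_div_iff₀ hx2]
    rcases le_or_gt x δ with hxδ | hxδ
    · have h1 : -deriv V x ≤ C / x ^ 2 := hsub ⟨hx.1, hxδ⟩
      rw [le_div_iff₀ hx2] at h1
      linarith [le_abs_self C, abs_nonneg (deriv V δ)]
    · have h1 := hanti (mem_Ioi.2 hδ0) (mem_Ioi.2 hx.1) hxδ.le
      simp only at h1
      have h2 := hV.deriv_nonpos x hx.1
      have h3 : -deriv V x * x ^ 2 ≤ -deriv V x := by nlinarith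
      linarith [neg_le_abs (deriv V δ), abs_nonneg C]

end Potential

/-! ### Rescaling kernels and removing the force at infinity -/

theorem IsKernel.comp_mul {f : ℝ → ℝ} (hf : IsKernel f) {k a : ℝ} (hk : 0 < k) (ha : 0 < a) :
    IsKernel fun x => k * f (a * x) := by
  have hmaps : MapsTo (fun x : ℝ => a * x) (Ioi 0) (Ioi 0) := fun x hx => mul_pos ha hx
  refine ⟨fun x hx => mul_nonneg hk.le (hf.nonneg _ (mul_pos ha hx)), fun x hx y hy hxy => ?_,
    ⟨convex_Ioi 0, fun x hx y hy s t hs ht hst => ?_⟩, ?_, ?_, ?_⟩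
  · exact mul_le_mul_of_nonneg_left (hf.anti (hmaps hx) (hmaps hy)
      (mul_le_mul_of_nonneg_left hxy ha.le)) hk.le
  · have := hf.convex.2 (hmaps hx) (hmaps hy) hs ht hst
    simp only [smul_eq_mul] at this ⊢
    rw [show a * (s * x + t * y) = s * (a * x) + t * (a * y) by ring]
    calc _ ≤ k * (s * f (a * x) + t * f (a * y)) := by gcongr
      _ = _ := by ring
  · exact contDiffOn_const.mul (hf.regular.comp (contDiff_const.mul contDiff_id).contDiffOn hmaps)
  · have h1 : Tendsto (fun x : ℝ => a * x) (𝓝[>] 0) (𝓝[>] 0) := by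
      refine tendsto_nhdsWithin_iff.2 ⟨?_, ?_⟩
      · have : Tendsto (fun x : ℝ => a * x) (𝓝 0) (𝓝 (a * 0)) := (continuous_const_mul a).tendsto 0
        rw [mul_zero] at this
        exact this.mono_left nhdsWithin_le_nhds
      · filter_upwards [self_mem_nhdsWithin] with x hx
        exact hmaps hx
    exact (hf.singular.comp h1).const_mul_atTop hk
  · obtain ⟨C, hC, h⟩ := hf.bound
    have hf1 := hf.nonneg 1 one_pos
    refine ⟨k * (C / a ^ 2 + f 1), by positivity, fun x hx => ?_⟩
    have hx2 : 0 < x ^ 2 := pow_pos hx.1 2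
    rw [mul_div_assoc]
    refine mul_le_mul_of_nonneg_left ?_ hk.le
    rw [le_div_iff₀ hx2]
    have hx0 := hx.1
    rcases lt_or_ge (a * x) 1 with h1 | h1
    · have h2 := h (a * x) ⟨by positivity, h1⟩
      rw [mul_pow, ← div_div, le_div_iff₀ hx2] at h2
      linarith
    · have h2 := hf.anti (mem_Ioi.2 one_pos) (mem_Ioi.2 (by positivity)) h1
      have h3 : x ^ 2 ≤ 1 := pow_le_one₀ hx.1.le hx.2.le
      have h4 : f (a * x) * x ^ 2 ≤ f 1 * 1 := by
        gcongr
      have h5 : 0 < C / a ^ 2 := by positivity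
      linarith

/-- The limit is a constant force between distant particles; subtracting it keeps the kernel
nonnegative and produces the decay that the nonlocal operator requires. -/
theorem IsKernel.exists_limit {f : ℝ → ℝ} (hf : IsKernel f) :
    ∃ ℓ, Tendsto f atTop (𝓝 ℓ) ∧ ∀ x > 0, ℓ ≤ f x := by
  have hanti : Antitone fun x => f (max x 1) := fun x y hxy =>
    hf.anti (mem_Ioi.2 (by positivity)) (mem_Ioi.2 (by positivity)) (max_le_max_right 1 hxy)
  have hbdd : BddBelow (range fun x => f (max x 1)) :=
    ⟨0, by rintro _ ⟨x, rfl⟩; exact hf.nonneg _ (by positivity)⟩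
  have hlim : Tendsto f atTop (𝓝 (⨅ x, f (max x 1))) := by
    refine (tendsto_atTop_ciInf hanti hbdd).congr' ?_
    filter_upwards [eventually_ge_atTop 1] with x hx
    rw [max_eq_left hx]
  refine ⟨_, hlim, fun x hx => le_of_tendsto hlim ?_⟩
  filter_upwards [eventually_ge_atTop x] with y hy
  exact hf.anti hx (hx.trans_le hy) hy

theorem IsKernel.sub_const {f : ℝ → ℝ} (hf : IsKernel f) {ℓ : ℝ} (hℓ : ∀ x > 0, ℓ ≤ f x) :
    IsKernel fun x => f x - ℓ := by
  refine ⟨fun x hx => sub_nonneg.2 (hℓ x hx), fun x hx y hy hxy => sub_le_sub_right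
    (hf.anti hx hy hxy) ℓ, ?_, hf.regular.sub contDiffOn_const, ?_, ?_⟩
  · have : (fun x => f x - ℓ) = f + fun _ => -ℓ := by ext; simp [sub_eq_add_neg]
    rw [this]
    exact hf.convex.add_const (-ℓ)
  · simpa [sub_eq_add_neg] using tendsto_atTop_add_const_right _ (-ℓ) hf.singular
  · obtain ⟨C, hC, h⟩ := hf.bound
    refine ⟨C + |ℓ|, by positivity, fun x hx => ?_⟩
    have hx2 : 0 < x ^ 2 := pow_pos hx.1 2
    have h1 := h x hx
    rw [le_div_iff₀ hx2] at h1 ⊢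
    have h3 : x ^ 2 ≤ 1 := pow_le_one₀ hx.1.le hx.2.le
    have h4 : -ℓ * x ^ 2 ≤ |ℓ| := by
      calc -ℓ * x ^ 2 ≤ |ℓ| * 1 := by
            gcongr
            exact neg_le_abs ℓ
        _ = _ := mul_one _
    linarith

/-! ### Even potentials and their kernels -/

theorem deriv_neg_of_even {W : ℝ → ℝ} (hW : ∀ x, W (-x) = W x) (x : ℝ) :
    deriv W (-x) = -deriv W x := by
  have h1 : deriv (fun x => W (-x)) x = -deriv W (-x) := deriv_comp_neg W x
  simp only [hW] at h1
  linarith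

theorem iteratedDeriv_two_of_even {W : ℝ → ℝ} (hW : ∀ x, W (-x) = W x) (x : ℝ) :
    iteratedDeriv 2 W (-x) = iteratedDeriv 2 W x := by
  rw [iteratedDeriv_succ, iteratedDeriv_one]
  have h1 : deriv (fun x => deriv W (-x)) x = -deriv (deriv W) (-x) := deriv_comp_neg (deriv W) x
  simp only [deriv_neg_of_even hW] at h1
  rw [deriv.fun_neg] at h1
  linarith

theorem deriv_eq_neg_oddKer {W : ℝ → ℝ} (hW : ∀ x, W (-x) = W x) {s : ℝ} (hs : s ≠ 0) :
    deriv W s = -oddKer (fun x => -deriv W x) s := by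
  rcases hs.lt_or_gt with h | h
  · rw [oddKer_neg h, neg_neg, deriv_neg_of_even hW, neg_neg]
  · rw [oddKer_pos h, neg_neg]

theorem iteratedDeriv_two_eq {W : ℝ → ℝ} (hW : ∀ x, W (-x) = W x) {ℓ : ℝ} (z : ℝ) :
    iteratedDeriv 2 W z = -deriv (fun x => -deriv W x - ℓ) |z| := by
  have h1 : iteratedDeriv 2 W z = iteratedDeriv 2 W |z| := by
    rcases abs_choice z with h | h <;> rw [h]
    rw [iteratedDeriv_two_of_even hW]
  rw [h1, deriv_sub_const, deriv_neg_deriv, neg_neg]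

theorem oddKer_congr {f g : ℝ → ℝ} (h : ∀ x > 0, f x = g x) (s : ℝ) : oddKer f s = oddKer g s := by
  rcases lt_trichotomy s 0 with hs | rfl | hs
  · rw [oddKer_neg hs, oddKer_neg hs, h _ (neg_pos.2 hs)]
  · simp [oddKer]
  · rw [oddKer_pos hs, oddKer_pos hs, h s hs]

/-- Adding ℓ|x| to the potential subtracts ℓ from the kernel and leaves the second derivative
unchanged off 0. The particle system changes, the equation does not. -/
theorem deriv_add_const_mul_abs {W : ℝ → ℝ} (hW : ∀ x, W (-x) = W x)
    (hd : ∀ x > 0, DifferentiableAt ℝ W x) (ℓ : ℝ) {s : ℝ} (hs : s ≠ 0) :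
    deriv (fun x => W x + ℓ * |x|) s = -oddKer (fun x => -deriv W x - ℓ) s := by
  rw [deriv_eq_neg_oddKer (W := fun x => W x + ℓ * |x|) (fun x => by rw [hW, abs_neg]) hs]
  congr 1
  refine oddKer_congr (fun x hx => ?_) s
  have h1 := (hd x hx).hasDerivAt.add ((hasDerivAt_abs_pos hx).const_mul ℓ)
  have h2 : deriv (fun x => W x + ℓ * |x|) x = deriv W x + ℓ * 1 := h1.deriv
  rw [h2]
  ring

theorem exists_isParticleSolution {n : ℕ} {f W U : ℝ → ℝ} (hf : IsKernel f)
    (hW : ∀ s ≠ 0, deriv W s = -oddKer f s) {L : NNReal} (hL : LipschitzWith L (deriv U))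
    {x₀ : Fin n → ℝ} {b₀ : Fin n → ℤ} (h₀ : (x₀, b₀) ∈ stateSpace n) :
    ∃ x b, IsParticleSolution W U x₀ b₀ x b := by
  obtain ⟨x, b, S, h⟩ := exists_isGlobalSolution hf (c := 1 / (n : ℝ)) (by positivity) hL _ x₀ b₀
    h₀ le_rfl
  exact ⟨x, b, h.isParticleSolution hf hW hL.continuous⟩

theorem scaledPotential_even {V : ℝ → ℝ} (hV : ∀ x, V (-x) = V x) (α x : ℝ) :
    scaledPotential V α (-x) = scaledPotential V α x := by
  rw [scaledPotential, scaledPotential, mul_neg, hV]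

theorem neg_deriv_scaledPotential (V : ℝ → ℝ) (α : ℝ) :
    (fun x => -deriv (scaledPotential V α) x) = fun x => α ^ 2 * -deriv V (α * x) := by
  ext x
  have h : deriv (scaledPotential V α) x = α * deriv (fun x => V (α * x)) x :=
    deriv_const_mul_field α
  rw [h, deriv_comp_mul_left, smul_eq_mul]
  ring

end ParticleHJ

/-! ### Proof of the proposition -/

open ParticleHJ

theorem proposition5p5 (V U : ℝ → ℝ) (hVU : WellPosednessAssumption V U)
    (hV : Regime1 V ∨ Regime2 V ∨ Regime3 V)
    (n : ℕ) (hn : 2 ≤ n) (α : ℝ) (hα : 0 < α)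
    (x₀ : Fin n → ℝ) (b₀ : Fin n → ℤ) (h₀ : (x₀, b₀) ∈ stateSpace n) :
    ∃ v : ℝ × ℝ → ℝ,
      -- `v` is a viscosity solution with the required initial envelopes
      (∀ ρ > 0, IsViscositySolution (scaledPotential V α) U (1 / (n : ℝ)) ρ v) ∧
      HasInitialEnvelopes v (stepFunction x₀ b₀) ∧
      -- it is the only one
      (∀ ρ > 0, ∀ w : ℝ × ℝ → ℝ,
        IsViscositySolution (scaledPotential V α) U (1 / (n : ℝ)) ρ w →
        HasInitialEnvelopes w (stepFunction x₀ b₀) → SameEnvelopes w v) ∧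
      -- the particle system is solvable, and its solutions are characterized by `v`
      (∃ (x : ℝ → Fin n → ℝ) (b : ℝ → Fin n → ℤ),
        IsParticleSolution (scaledPotential V α) U x₀ b₀ x b) ∧
      (Tendsto (deriv V) atTop (𝓝 0) →
        ∀ (x : ℝ → Fin n → ℝ) (b : ℝ → Fin n → ℤ),
          IsParticleSolution (scaledPotential V α) U x₀ b₀ x b →
          (∀ ρ > 0, IsViscositySolution (scaledPotential V α) U (1 / (n : ℝ)) ρ
            (stepEvolution x b)) ∧
          HasInitialEnvelopes (stepEvolution x b) (stepFunction x₀ b₀) ∧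
          SameEnvelopes (stepEvolution x b) v) := by
  have hn0 : 0 < n := by omega
  obtain ⟨L, hL⟩ := hVU.external_lipschitz
  have heven := scaledPotential_even hVU.even α
  have hf : IsKernel fun x => -deriv (scaledPotential V α) x := by
    rw [neg_deriv_scaledPotential]
    exact (hVU.isKernel hV).comp_mul (by positivity) hα
  have hdiff : ∀ x > 0, DifferentiableAt ℝ (scaledPotential V α) x := fun x hx => by
    have hx' : 0 < α * x := mul_pos hα hx
    have h1 : DifferentiableAt ℝ V (α * x) :=
      (hVU.regular.differentiableOn (by norm_num)).differentiableAt (Ioi_mem_nhds hx')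
    exact (h1.comp x (differentiableAt_id.const_mul α)).const_mul α
  obtain ⟨ℓ, hℓ, hℓf⟩ := hf.exists_limit
  have hf' := hf.sub_const hℓf
  have hf0 : Tendsto (fun x => -deriv (scaledPotential V α) x - ℓ) atTop (𝓝 0) := by
    simpa using hℓ.sub_const ℓ
  have hker : ∀ z ≠ 0, iteratedDeriv 2 (scaledPotential V α) z =
      -deriv (fun x => -deriv (scaledPotential V α) x - ℓ) |z| :=
    fun z _ => iteratedDeriv_two_eq heven z
  -- a constant force at infinity is invisible to the equation, so it is removed first
  obtain ⟨y, d, hyd⟩ := exists_isParticleSolution (x₀ := x₀) (b₀ := b₀) hf'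
    (fun s hs => deriv_add_const_mul_abs heven hdiff ℓ hs) hL h₀
  have hT := hyd.traj fun s hs => deriv_add_const_mul_abs heven hdiff ℓ hs
  obtain ⟨hy0, hd0⟩ := hyd.initial
  have huniq : ∀ ρ > 0, ∀ w : ℝ × ℝ → ℝ,
      IsViscositySolution (scaledPotential V α) U (1 / (n : ℝ)) ρ w →
      HasInitialEnvelopes w (stepFunction x₀ b₀) → SameEnvelopes w (stepEvolution y d) :=
    fun ρ hρ w hw hi => hT.sameEnvelopes hf' hf0 hker hL hn0 hρ hw (by rwa [hy0, hd0])
  -- The candidate comes from the system with the reduced kernel; solvability of the original system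
  -- is obtained separately with the full kernel, which needs no decay.
  refine ⟨stepEvolution y d, fun ρ hρ => hT.isViscositySolution hf' hf0 hker hL hn0 hρ, ?_, huniq,
    exists_isParticleSolution hf (fun s hs => deriv_eq_neg_oddKer heven hs) hL h₀,
    fun hV0 x b hxb => ?_⟩
  · rw [← hy0, ← hd0]
    exact hT.hasInitialEnvelopes
  have hfz : Tendsto (fun x => -deriv (scaledPotential V α) x) atTop (𝓝 0) := by
    rw [neg_deriv_scaledPotential]
    simpa using ((hV0.comp (tendsto_id.const_mul_atTop hα)).neg).const_mul (α ^ 2)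
  -- When V' vanishes at infinity nothing has been removed, so every original particle solution
  -- solves the equation, and uniqueness identifies its envelopes with those of the candidate.
  obtain rfl : ℓ = 0 := tendsto_nhds_unique hℓ hfz
  simp only [sub_zero] at hker
  have hTx := hxb.traj fun s hs => deriv_eq_neg_oddKer heven hs
  obtain ⟨hx0, hb0⟩ := hxb.initial
  have hsol : ∀ ρ > 0, IsViscositySolution (scaledPotential V α) U (1 / (n : ℝ)) ρ
      (stepEvolution x b) := fun ρ hρ => hTx.isViscositySolution hf hfz hker hL hn0 hρ
  have hinit : HasInitialEnvelopes (stepEvolution x b) (stepFunction x₀ b₀) := by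
    rw [← hx0, ← hb0]
    exact hTx.hasInitialEnvelopes
  exact ⟨hsol, hinit, huniq 1 one_pos _ (hsol 1 one_pos) hinit⟩
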